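/- **Setting.** Let $F$ be a totally real number field with ring of integers $\mathcal O$, different $\mathfrak d$ and finite adeles $\widehat F$. For $\xi\in F^\times$ let $\chi^\xi$ be the character of the idele class group of $F$ attached to $F(\sqrt\xi)/F$ (regarded as a character of $\widehat F^\times$), with conductor $\mathfrak f_\xi$ and induced character $\chi^\xi_*$ on ideals prime to $\mathfrak f_\xi$. A pair $(\xi,\mathfrak a)$, with $\mathfrak a$ a fractional ideal, is a *fundamental discriminant* if either $\xi$ is not a square and there is $\omega\in F(\sqrt\xi)$ with $(\omega-\bar\omega)^2=\xi$ such that $\mathcal O\oplus\mathfrak a\omega$ is the maximal order, or $\xi=m^2$ and $\mathfrak a=m^{-1}\mathcal O$. Let $B/F$ be a totally definite quaternion algebra with reduced norm $\mathcal N$, $W=B/F$, $\Delta(x)=\operatorname{trd}(x)^2-4\mathcal N(x)$ on $W$, and let $R\subset B$ be an order of reduced discriminant $\mathfrak N$ whose Eichler invariant at every $\mathfrak p\mid\mathfrak N$ is nonzero. Put $L=R/\mathcal O\subset W$, $\widehat R_x=x^{-1}\widehat Rx$, $R_x=B\cap\widehat R_x$ for $x\in\widehat B^\times$, let $N(\widehat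 R)$ be the normalizer of $\widehat R$ in $\widehat B^\times$, and $\operatorname{Bil}(R)=\widehat R^\times\backslash N(\widehat R)/\widehat F^\times$. Let $\mathbf k=(k_\tau)$ be a family of non-negative integers indexed by the real embeddings of $F$, and let $V_{\mathbf k}$ be the space of complex polynomials on $W$ homogeneous of degree $\mathbf k$ and harmonic with respect to $\Delta$, with the right action $(P\cdot\gamma)(y)=P(\gamma y\gamma^{-1})$ of $B^\times$ and a $B^\times$-invariant inner product $\langle\cdot,\cdot\rangle$, linear in the first variable. Let $\mathcal M_{\mathbf k}(R)$ be the space of $\varphi:\widehat B^\times\to V_{\mathbf k}$ with $\varphi(ux\gamma)=\varphi(x)\cdot\gamma$ for $u\in\widehat R^\times,\gamma\in B^\times$; put $(\varphi\cdot z)(x)=\varphi(zx)$ for $z\in N(\widehat R)$; let $\mathcal M_{\mathbf k}(R,\mathbb 1)$ be the subspace fixed by $\widehat F^\times$, and for a character $\delta$ of $\operatorname{Bil}(R)$ let $\mathcal M_{\mathbf k}(R,\mathbb 1)^\delta$ be the subspace of those $\varphi$ with $\varphi\cdot z=\delta(z)\varphi$ for all $z$. For $x\in\widehat B^\times$, $P\in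 V_{\mathbf k}$ let $$\varphi_{x,P}(y)=\sum_{\gamma\in(B^\times\cap x^{-1}\widehat R^\times y)/\mathcal O^\times}P\cdot\gamma .$$ Let $l,D\in F^\times$ with $\Delta=lD$ totally negative, $\mathfrak f_l$ prime to $2\mathfrak d\mathfrak N$, and $\mathfrak f_l$ prime to $\mathfrak f_D$. Let $(l,\mathfrak b)$ and $(D,\mathfrak a)$ be fundamental discriminants, $\mathfrak c=\mathfrak a\mathfrak b$, $K=F(\sqrt\Delta)$, and let $\omega\in K$ satisfy $(\omega-\bar\omega)^2=\Delta$ with $\mathcal O\oplus\mathfrak c\omega$ an order. Assume that an embedding $K\hookrightarrow B$ is given which maps the maximal order $\mathcal O_K$ into $R$. For each prime $\mathfrak p\mid\mathfrak f_l$ let $w_{\mathfrak p}:L_{\mathfrak p}/\pi_{\mathfrak p}L_{\mathfrak p}\to\{0,1,-1\}$ be a nonzero function such that $w_{\mathfrak p}(x)=0$ if $\Delta(x)\notin\pi_{\mathfrak p}\mathcal O_{\mathfrak p}$; $w_{\mathfrak p}(\zeta x)=\chi^l_{\mathfrak p}(\zeta)w_{\mathfrak p}(x)$ for $\zeta\in\mathcal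 O_{\mathfrak p}^\times$; and $w_{\mathfrak p}(y^{-1}xy)=\chi^l_{\mathfrak p}(\mathcal N y)w_{\mathfrak p}(x)$ for $y\in B_{\mathfrak p}^\times$ with $y^{-1}L_{\mathfrak p}y=L_{\mathfrak p}$. Let $w(x)=\prod_{\mathfrak p\mid\mathfrak f_l}w_{\mathfrak p}(x_{\mathfrak p})$ for $x\in\widehat L$ and $w(x)=0$ for $x \in \widehat W\setminus\widehat L$; put $w_x(y)=\chi^l(\mathcal N x)\,w(xyx^{-1})$ and $w_x(y;\mathfrak c)=\chi^l(\xi)\,w_x(\xi y)$, where $\xi\in\widehat F^\times$ generates $\mathfrak c$; write $w(\cdot\,;\mathfrak c)=w_1(\cdot\,;\mathfrak c)$. Let $P_\Delta\in V_{\mathbf k}$ be characterized by $w(\omega;\mathfrak c)P(\omega)=\langle P,P_\Delta\rangle$ for all $P\in V_{\mathbf k}$. Let $X_\Delta=\widehat R^\times\backslash\{x\in\widehat B^\times:\mathcal O\oplus\mathfrak c\omega\subseteq R_x\}/K^\times$, $\operatorname{Cl}(K)=\widehat{\mathcal O}_K^\times\backslash\widehat K^\times/K^\times$, $t_K=[\mathcal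 O_K^\times:\mathcal O^\times]$, $\mathcal O_x=R_x\cap K$, let $\Xi(a)=\chi^l(\mathcal N_{K/F}a)$ be the genus character of $K$ attached to $(l,D)$, and put $$\eta^l_D=\frac1{w(\omega;\mathfrak c)}\sum_{x\in X_\Delta}\frac{w_x(\omega;\mathfrak c)}{[\mathcal O_x^\times:\mathcal O^\times]}\,\varphi_{x,P_\Delta},\qquad \psi^l_D=\frac1{t_K}\sum_{a\in\operatorname{Cl}(K)}\Xi(a)\,\varphi_{a,P_\Delta}.$$ Let $\delta^l$ be the character $\delta^l(z)=\chi^l_*(\mathcal N z)$ of $\operatorname{Bil}(R)$, where each class is represented by a $z$ such that $\mathcal N z$ is a unit at the primes dividing $\mathfrak f_l$. **Proposition 5.3.** Assume that $\mathfrak f_\Delta$ is prime to $\mathfrak N$. Then $\operatorname{Bil}(R)$, $\operatorname{Cl}(K)$ and $X_\Delta$ are finite, $$\eta^l_D=\sum_{z\in\operatorname{Bil}(R)}\delta^l(z)\,\psi^l_D\cdot z,$$ and $\eta^l_D\in\mathcal M_{\mathbf k}(R,\mathbb 1)^{\delta^l}$. -/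

import Mathlib

open NumberField IsDedekindDomain
open scoped nonZeroDivisors

noncomputable section

namespace QForms

/-! ### Quaternion algebras and their adelizations -/

/-- For an `F`-algebra `A`, the `A`-algebra `B ⊗_F A`, where `B` is the quaternion algebra
over `F` with basis `1, i, j, k = ij` and relations `i² = α`, `j² = β`, `ji = -ij`.
Thus `B = Quat F α β`, its completion at `v` is `Quat F_v α β`, and its ring of finite adeles
is `Quat 𝔸_f α β`. -/
abbrev Quat {F : Type*} (A : Type*) [Field F] [CommRing A] [Algebra F A] (α β : F) : Type _ :=
  QuaternionAlgebra A (algebraMap F A α) 0 (algebraMap F A β)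

section Quaternion

variable {F : Type*} [Field F] {A A' : Type*} [CommRing A] [Algebra F A] [CommRing A']
  [Algebra F A'] (α β : F)

/-- Base change `B ⊗ A → B ⊗ A'` along a homomorphism of `F`-algebras `A → A'`. -/
def baseChange (f : A →ₐ[F] A') : Quat A α β →+* Quat A' α β where
  toFun x := ⟨f x.re, f x.imI, f x.imJ, f x.imK⟩
  map_one' := by ext <;> simp
  map_zero' := by ext <;> simp
  map_mul' x y := by ext <;> simp
  map_add' x y := by ext <;> simp

variable {α β}

/-- The reduced norm `x ↦ x * x̄`. -/
def nrd : Quat A α β →* A where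
  toFun x := (x * star x).re
  map_one' := by simp
  map_mul' x y := by simp; ring

/-- The reduced trace `x ↦ x + x̄`. -/
def trd (x : Quat A α β) : A := (x + star x).re

/-- The quadratic form `Δ(x) = trd(x)² - 4 nrd(x)`. It only depends on `x` modulo `A`, so it
is a quadratic form on `W ⊗ A`, where `W = B / F`. -/
def Disc (x : Quat A α β) : A := trd x ^ 2 - 4 * nrd x

end Quaternion

variable {F : Type*} [Field F] [NumberField F]

/-- The ring of finite adeles of `F`. -/
abbrev FinAdele (F : Type*) [Field F] [NumberField F] : Type _ := FiniteAdeleRing (𝓞 F) F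

/-- The finite places of `F`. -/
abbrev FinPlace (F : Type*) [Field F] [NumberField F] : Type _ := HeightOneSpectrum (𝓞 F)

/-- The projection of the finite adeles onto the completion at `v`. -/
def adeleEval (v : FinPlace F) : FinAdele F →ₐ[F] v.adicCompletion F where
  toFun x := x v
  map_one' := rfl
  map_mul' _ _ := rfl
  map_zero' := rfl
  map_add' _ _ := rfl
  commutes' _ := rfl

variable {α β : F}

/-- The component at `v` of an element of `B ⊗ 𝔸_f`. -/
def comp (v : FinPlace F) : Quat (FinAdele F) α β →+* Quat (v.adicCompletion F) α β :=
  baseChange α β (adeleEval v)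

/-- The embedding of `B` in `B_v`. -/
def toLocal (v : FinPlace F) : Quat F α β →+* Quat (v.adicCompletion F) α β :=
  baseChange α β (Algebra.ofId F _)

/-- The diagonal embedding of `B` in `B ⊗ 𝔸_f`. -/
def toAdele : Quat F α β →+* Quat (FinAdele F) α β :=
  baseChange α β (Algebra.ofId F _)

/-- The unit group of `B ⊗ 𝔸_f`. -/
abbrev AdeleUnits (α β : F) : Type _ := (Quat (FinAdele F) α β)ˣ

/-- The diagonal embedding of `B^×` in the unit group of `B ⊗ 𝔸_f`. -/
def globalUnit : (Quat F α β)ˣ →* AdeleUnits α β := Units.map toAdele.toMonoidHom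

/-- The embedding of the finite ideles in the unit group of `B ⊗ 𝔸_f`. -/
def scalarUnit : (FinAdele F)ˣ →* AdeleUnits α β :=
  Units.map (algebraMap (FinAdele F) (Quat (FinAdele F) α β)).toMonoidHom

/-! ### Orders -/

/-- `R` is an order of `B`: a subring that is a finitely generated `𝓞 F`-module spanning `B`. -/
def IsOrder (R : Subalgebra (𝓞 F) (Quat F α β)) : Prop :=
  (Subalgebra.toSubmodule R).FG ∧ Submodule.span F (R : Set (Quat F α β)) = ⊤

/-- The ideal generated by the determinants `det (trd (x_i x_j))` with `x_0, …, x_3 ∈ R`. It is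
the square of the (reduced) discriminant of the order `R`. -/
def discIdeal (R : Subalgebra (𝓞 F) (Quat F α β)) : Ideal (𝓞 F) :=
  Ideal.span {d | ∃ x : Fin 4 → Quat F α β, (∀ i, x i ∈ R) ∧
    (d : F) = (Matrix.of fun i j => trd (x i * x j)).det}

/-- The `𝓞_v`-subalgebra of `B_v` generated by a subset `S` of `B`. When `S` is an
`𝓞 F`-subalgebra of `B` this is its completion `S_v`. -/
def localize (v : FinPlace F) (S : Set (Quat F α β)) :
    Subalgebra (v.adicCompletionIntegers F) (Quat (v.adicCompletion F) α β) :=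
  Algebra.adjoin _ (toLocal v '' S)

/-- The subring `∏_v S_v` of `B ⊗ 𝔸_f`. -/
def hat (S : Set (Quat F α β)) : Subring (Quat (FinAdele F) α β) :=
  ⨅ v : FinPlace F, (localize v S).toSubring.comap (comp v)

/-- The Eichler invariant of `R_v` is `1` or `-1`: the quotient of `R_v` by its Jacobson radical
is the product of two copies of the residue field of `v`, or it is a field strictly larger than
that residue field. (When `v` divides the discriminant of `R`, the only other possibility is that
this quotient is the residue field, and then the Eichler invariant is `0`.) -/
def EichlerInvariantNeZero (v : FinPlace F) (R : Subalgebra (𝓞 F) (Quat F α β)) : Prop :=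
  let Rv := localize v (R : Set (Quat F α β))
  let k := IsLocalRing.ResidueField (v.adicCompletionIntegers F)
  Nonempty ((Rv ⧸ Ring.jacobson Rv) ≃+* k × k) ∨
    (IsField (Rv ⧸ Ring.jacobson Rv) ∧
      ¬ Function.Surjective fun c : v.adicCompletionIntegers F =>
        Ideal.Quotient.mk (Ring.jacobson Rv) (algebraMap _ Rv c))

/-- The group of units of `∏_v R_v`. -/
def hatUnits (R : Subalgebra (𝓞 F) (Quat F α β)) : Subgroup (AdeleUnits α β) :=
  (hat (R : Set (Quat F α β))).toSubmonoid.units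

/-- The normalizer `N(R̂)` of `R̂` in the unit group of `B ⊗ 𝔸_f`. -/
def normalizer (R : Subalgebra (𝓞 F) (Quat F α β)) : Set (AdeleUnits α β) :=
  {z | ∀ r : Quat (FinAdele F) α β, r ∈ hat (R : Set (Quat F α β)) ↔
    ((z⁻¹ : AdeleUnits α β) : Quat (FinAdele F) α β) * r * z ∈ hat (R : Set (Quat F α β))}

/-- The order `R_x = B ∩ x⁻¹ R̂ x`. -/
def conjOrder (R : Subalgebra (𝓞 F) (Quat F α β)) (x : AdeleUnits α β) :
    Subring (Quat F α β) where
  carrier := {b | (x : Quat (FinAdele F) α β) * toAdele b *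
    ((x⁻¹ : AdeleUnits α β) : Quat (FinAdele F) α β) ∈ hat (R : Set (Quat F α β))}
  mul_mem' {b c} hb hc := by
    have h := (hat (R : Set (Quat F α β))).mul_mem hb hc
    have e : (x : Quat (FinAdele F) α β) * toAdele (b * c) *
        ((x⁻¹ : AdeleUnits α β) : Quat (FinAdele F) α β) =
        (x * toAdele b * ((x⁻¹ : AdeleUnits α β) : Quat (FinAdele F) α β)) *
        (x * toAdele c * ((x⁻¹ : AdeleUnits α β) : Quat (FinAdele F) α β)) := by
      simp [mul_assoc]
    simpa only [Set.mem_ofPred_eq, e] using h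
  one_mem' := by simp [one_mem]
  add_mem' {b c} hb hc := by
    have h := (hat (R : Set (Quat F α β))).add_mem hb hc
    simpa only [Set.mem_ofPred_eq, map_add, mul_add, add_mul] using h
  zero_mem' := by simp [zero_mem]
  neg_mem' {b} hb := by
    have h := (hat (R : Set (Quat F α β))).neg_mem hb
    simpa only [Set.mem_ofPred_eq, map_neg, mul_neg, neg_mul] using h

/-- `Bil(R) = R̂^× \ N(R̂) / 𝔸_f^×`, as a subset of `R̂^× \ B̂^× / 𝔸_f^×`. -/
def Bil (R : Subalgebra (𝓞 F) (Quat F α β)) :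
    Set (DoubleCoset.Quotient (hatUnits R : Set (AdeleUnits α β))
      (scalarUnit (α := α) (β := β)).range) :=
  DoubleCoset.mk _ _ '' normalizer R

/-! ### The quadratic character attached to `F(√ξ)/F` -/

/-- `x` is a norm from `F_v(√ξ)`. -/
def IsLocalNorm (v : FinPlace F) (ξ : F) (x : v.adicCompletion F) : Prop :=
  ∃ s t : v.adicCompletion F, x = s ^ 2 - algebraMap F _ ξ * t ^ 2

open Classical in
/-- The finite idele which is `x` at `v` and `1` elsewhere. -/
def localIdele (v : FinPlace F) (x : (v.adicCompletion F)ˣ) : (FinAdele F)ˣ where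
  val := RestrictedProduct.mulSingle _ v (x : v.adicCompletion F)
  inv := RestrictedProduct.mulSingle _ v ((x⁻¹ : (v.adicCompletion F)ˣ) : v.adicCompletion F)
  val_inv := (RestrictedProduct.mulSingle_mul _ v _ _).symm.trans (by simp; rfl)
  inv_val := (RestrictedProduct.mulSingle_mul _ v _ _).symm.trans (by simp; rfl)

/-- The embedding of the finite adeles in the adeles, with component `1` at infinity. -/
def finiteToAdele : FinAdele F →* AdeleRing (𝓞 F) F where
  toFun x := (1, x)
  map_one' := rfl
  map_mul' _ _ := Prod.ext (mul_one (1 : InfiniteAdeleRing F)).symm rfl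

/-- `χ` is the character of the idele class group of `F` that class field theory attaches to
`F(√ξ)/F`: it is a continuous character of the group of ideles, it is trivial on `F^×`, and for
every finite place `v` its component at `v` is the norm residue symbol of `F_v(√ξ)/F_v`.
(By weak approximation there is at most one such `χ`.) -/
def IsQuadraticHeckeCharacter (ξ : F) (χ : (AdeleRing (𝓞 F) F)ˣ →* ℤˣ) : Prop :=
  Continuous χ ∧
  (∀ x : Fˣ, χ (Units.map (algebraMap F (AdeleRing (𝓞 F) F)).toMonoidHom x) = 1) ∧
  ∀ (v : FinPlace F) (x : (v.adicCompletion F)ˣ),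
    χ (Units.map finiteToAdele (localIdele v x)) = 1 ↔ IsLocalNorm v ξ x

open Classical in
/-- The quadratic Hecke character of `F(√ξ)/F`. It exists by Artin reciprocity. -/
def heckeChar (ξ : F) : (AdeleRing (𝓞 F) F)ˣ →* ℤˣ :=
  if h : ∃ χ, IsQuadraticHeckeCharacter ξ χ then h.choose else 1

/-- The restriction `χ^ξ` of the quadratic Hecke character of `F(√ξ)/F` to the finite ideles. -/
def quadChar (ξ : F) : (FinAdele F)ˣ →* ℤˣ :=
  (heckeChar ξ).comp (Units.map finiteToAdele)

/-- The component at `v` of `χ^ξ`. -/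
def quadCharAt (v : FinPlace F) (ξ : F) (x : (v.adicCompletion F)ˣ) : ℤˣ :=
  quadChar ξ (localIdele v x)

/-- The exponent at `v` of the conductor of `F(√ξ)/F`: the least `n` such that every unit of
`𝓞_v` congruent to `1` modulo the `n`-th power of the maximal ideal is a norm from `F_v(√ξ)`. -/
def condExponent (v : FinPlace F) (ξ : F) : ℕ :=
  sInf {n | ∀ u : (v.adicCompletionIntegers F)ˣ,
    (u : v.adicCompletionIntegers F) - 1 ∈
      IsLocalRing.maximalIdeal (v.adicCompletionIntegers F) ^ n →
    IsLocalNorm v ξ ((u : v.adicCompletionIntegers F) : v.adicCompletion F)}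

/-- The conductor of the quadratic character of `F(√ξ)/F`. -/
def quadConductor (ξ : F) : Ideal (𝓞 F) := ∏ᶠ v : FinPlace F, v.asIdeal ^ condExponent v ξ

open Classical in
/-- The finite adele which is `1` at the places dividing `f` and agrees with `x` elsewhere. -/
def awayAdele (f : Ideal (𝓞 F)) (x : FinAdele F) : FinAdele F :=
  ⟨fun v => if v.asIdeal ∣ f then 1 else x v, by
    filter_upwards [x.2] with v hv
    split_ifs
    · exact one_mem _
    · exact hv⟩

open Classical in
/-- The finite idele which is `1` at the places dividing `f` and agrees with `x` elsewhere. -/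
def awayIdele (f : Ideal (𝓞 F)) (x : (FinAdele F)ˣ) : (FinAdele F)ˣ where
  val := awayAdele f x
  inv := awayAdele f (x⁻¹ : (FinAdele F)ˣ)
  val_inv := by
    refine FiniteAdeleRing.ext _ fun v => ?_
    have h : ((x : FinAdele F) * (x⁻¹ : (FinAdele F)ˣ)) v = (1 : FinAdele F) v := by simp
    change (if v.asIdeal ∣ f then 1 else (x : FinAdele F) v) *
      (if v.asIdeal ∣ f then 1 else ((x⁻¹ : (FinAdele F)ˣ) : FinAdele F) v) = 1
    split_ifs
    · exact mul_one 1
    · exact h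
  inv_val := by
    refine FiniteAdeleRing.ext _ fun v => ?_
    have h : (((x⁻¹ : (FinAdele F)ˣ) : FinAdele F) * x) v = (1 : FinAdele F) v := by simp
    change (if v.asIdeal ∣ f then 1 else ((x⁻¹ : (FinAdele F)ˣ) : FinAdele F) v) *
      (if v.asIdeal ∣ f then 1 else (x : FinAdele F) v) = 1
    split_ifs
    · exact mul_one 1
    · exact h

/-- The character `δ^l(z) = χ^l_*(nrd z)` of `Bil(R)`, where `χ^l_*` is the character on ideals
prime to `quadConductor l` induced by `χ^l`. The value of `χ^l_*` at the ideal of a finite idele `x`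
that is a unit at the places dividing `quadConductor l` is `χ^l(x')`, where `x'` is obtained from `x` by
replacing by `1` its components at those places. -/
def delta (l : F) (z : AdeleUnits α β) : ℤˣ :=
  quadChar l (awayIdele (quadConductor l) (Units.map nrd z))

/-! ### Discriminants -/

/-- The quadratic algebra `F(√ξ)`, i.e. `F[X]/(X² - ξ)`. -/
abbrev QuadExt (ξ : F) : Type _ := QuadraticAlgebra F ξ 0

/-- The lattice `𝓞 F + 𝔞 ω` in `F(√ξ)`. -/
def quadLattice {ξ : F} (𝔞 : FractionalIdeal (𝓞 F)⁰ F) (ω : QuadExt ξ) : Set (QuadExt ξ) :=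
  {x | ∃ s : 𝓞 F, ∃ t ∈ 𝔞, x = algebraMap (𝓞 F) (QuadExt ξ) s + t • ω}

/-- The element `ω` of `F(√ξ)` satisfies `(ω - ω̄)² = ξ`, and `𝓞 F + 𝔞 ω` is an order. -/
def GeneratesOrder {ξ : F} (𝔞 : FractionalIdeal (𝓞 F)⁰ F) (ω : QuadExt ξ) : Prop :=
  (ω - star ω) ^ 2 = algebraMap F (QuadExt ξ) ξ ∧
    ∃ S : Subalgebra (𝓞 F) (QuadExt ξ), (S : Set (QuadExt ξ)) = quadLattice 𝔞 ω

/-- `(ξ, 𝔞)` is a fundamental discriminant: `ξ` is not a square and for some `ω` in `F(√ξ)` with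
`(ω - ω̄)² = ξ` the lattice `𝓞 F + 𝔞 ω` is the maximal order, or `ξ = m²` and `𝔞 = m⁻¹ 𝓞 F`. -/
def IsFundamentalDiscriminant (ξ : F) (𝔞 : FractionalIdeal (𝓞 F)⁰ F) : Prop :=
  (¬ IsSquare ξ ∧ ∃ ω : QuadExt ξ, (ω - star ω) ^ 2 = algebraMap F (QuadExt ξ) ξ ∧
    (integralClosure (𝓞 F) (QuadExt ξ) : Set (QuadExt ξ)) = quadLattice 𝔞 ω) ∨
  ∃ m : F, m ≠ 0 ∧ ξ = m ^ 2 ∧ 𝔞 = FractionalIdeal.spanSingleton (𝓞 F)⁰ m⁻¹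

/-- The finite idele `x` generates the fractional ideal `𝔠`, i.e. `x Ô ∩ F = 𝔠`. -/
def IdeleGenerates (x : (FinAdele F)ˣ) (𝔠 : FractionalIdeal (𝓞 F)⁰ F) : Prop :=
  ∀ t : F, t ∈ 𝔠 ↔ ∀ v : FinPlace F,
    Valued.v (algebraMap F (v.adicCompletion F) t) ≤ Valued.v ((x : FinAdele F) v)

/-! ### Weight functions

Functions on `W ⊗ A = (B ⊗ A) / A` are regarded as functions on `B ⊗ A` that are invariant under
translation by `A`, and subsets of `W ⊗ A` are replaced by their preimages in `B ⊗ A`. -/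

/-- The preimage in `B_v` of the lattice `L_v = R_v / 𝓞_v` of `W_v = B_v / F_v`. -/
def localLattice (v : FinPlace F) (R : Subalgebra (𝓞 F) (Quat F α β)) :
    Set (Quat (v.adicCompletion F) α β) :=
  {x | ∃ r ∈ localize v (R : Set (Quat F α β)), ∃ c : v.adicCompletion F,
    x = r + algebraMap _ _ c}

/-- The preimage in `B ⊗ 𝔸_f` of the lattice `L̂ = R̂ / Ô` of `W ⊗ 𝔸_f`. -/
def adelicLattice (R : Subalgebra (𝓞 F) (Quat F α β)) : Set (Quat (FinAdele F) α β) :=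
  {x | ∃ r ∈ hat (R : Set (Quat F α β)), ∃ c : FinAdele F, x = r + algebraMap _ _ c}

/-- `w` is a nonzero local weight function on `L_v = R_v / 𝓞_v`, with respect to `χ^l`. Only the
values of `w` on `L_v` are relevant. -/
structure IsLocalWeight (v : FinPlace F) (R : Subalgebra (𝓞 F) (Quat F α β)) (l : F)
    (w : Quat (v.adicCompletion F) α β → ℤ) : Prop where
  /-- `w` is a function on `W_v = B_v / F_v` -/
  translate : ∀ x, ∀ c : v.adicCompletion F, w (x + algebraMap _ _ c) = w x
  values : ∀ x ∈ localLattice v R, w x = 0 ∨ w x = 1 ∨ w x = -1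
  /-- on `L_v`, it factors through `L_v / π L_v` -/
  periodic : ∀ x ∈ localLattice v R, ∀ y ∈ localLattice v R,
    ∀ c ∈ IsLocalRing.maximalIdeal (v.adicCompletionIntegers F),
      w (x + (c : v.adicCompletion F) • y) = w x
  normal : ∀ x ∈ localLattice v R, ¬ Valued.v (Disc x) < 1 → w x = 0
  homog : ∀ x ∈ localLattice v R, ∀ c : (v.adicCompletion F)ˣ,
    Valued.v (c : v.adicCompletion F) = 1 →
      w ((c : v.adicCompletion F) • x) = quadCharAt v l c * w x
  transp : ∀ x ∈ localLattice v R, ∀ y : (Quat (v.adicCompletion F) α β)ˣ,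
    (∀ t, t ∈ localLattice v R ↔
      ((y⁻¹ : (Quat (v.adicCompletion F) α β)ˣ) : Quat (v.adicCompletion F) α β) * t * y ∈
        localLattice v R) →
    w (((y⁻¹ : (Quat (v.adicCompletion F) α β)ˣ) : Quat (v.adicCompletion F) α β) * x * y) =
      quadCharAt v l (Units.map nrd y) * w x
  nonzero : ∃ x ∈ localLattice v R, w x ≠ 0

open Classical in
/-- The weight function on `L̂` defined by the local weight functions at the places dividing
`quadConductor l`. -/
def adelicWeight (R : Subalgebra (𝓞 F) (Quat F α β)) (l : F)
    (w : ∀ v : FinPlace F, Quat (v.adicCompletion F) α β → ℤ)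
    (y : Quat (FinAdele F) α β) : ℤ :=
  if y ∈ adelicLattice R then
    ∏ᶠ (v : FinPlace F) (_ : v.asIdeal ∣ quadConductor l), w v (comp v y)
  else 0

/-- The weight function `w_x(y) = χ^l(nrd x) w(x y x⁻¹)` on `L̂_x`. -/
def conjWeight (R : Subalgebra (𝓞 F) (Quat F α β)) (l : F)
    (w : ∀ v : FinPlace F, Quat (v.adicCompletion F) α β → ℤ) (x : AdeleUnits α β)
    (y : Quat (FinAdele F) α β) : ℤ :=
  quadChar l (Units.map nrd x) *
    adelicWeight R l w (x * y * ((x⁻¹ : AdeleUnits α β) : Quat (FinAdele F) α β))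

/-- The weight function `w_x(y; 𝔠) = χ^l(ξ) w_x(ξ y)` on `𝔠⁻¹ L̂_x`, where `ξ` is a finite idele
generating the fractional ideal `𝔠`. -/
def idealWeight (R : Subalgebra (𝓞 F) (Quat F α β)) (l : F)
    (w : ∀ v : FinPlace F, Quat (v.adicCompletion F) α β → ℤ) (ξ : (FinAdele F)ˣ)
    (x : AdeleUnits α β) (y : Quat (FinAdele F) α β) : ℤ :=
  quadChar l ξ * conjWeight R l w x ((ξ : FinAdele F) • y)

/-! ### Harmonic polynomials -/

/-- The coordinates on `W = B / F` with respect to the basis given by `i, j, k`. -/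
def coord (y : Quat F α β) : Fin 3 → F := ![y.imI, y.imJ, y.imK]

/-- The Laplacian at the real embedding `τ` for the quadratic form
`Δ(x₁ i + x₂ j + x₃ k) / 4 = α x₁² + β x₂² - α β x₃²` on `W`. -/
def laplacian (α β : F) (τ : F →+* ℝ) (p : MvPolynomial ((F →+* ℝ) × Fin 3) ℂ) :
    MvPolynomial ((F →+* ℝ) × Fin 3) ℂ :=
  ((τ α)⁻¹ : ℂ) • MvPolynomial.pderiv (τ, 0) (MvPolynomial.pderiv (τ, 0) p) +
  ((τ β)⁻¹ : ℂ) • MvPolynomial.pderiv (τ, 1) (MvPolynomial.pderiv (τ, 1) p) -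
  ((τ (α * β))⁻¹ : ℂ) • MvPolynomial.pderiv (τ, 2) (MvPolynomial.pderiv (τ, 2) p)

open Classical in
/-- The polynomials in the coordinates of `W ⊗_τ ℝ`, for all `τ`, that are homogeneous of degree
`k τ` in the coordinates at `τ` and harmonic at `τ`, for every `τ`. -/
def harmonicPoly (α β : F) (k : (F →+* ℝ) → ℕ) :
    Submodule ℂ (MvPolynomial ((F →+* ℝ) × Fin 3) ℂ) where
  carrier := {p | MvPolynomial.IsWeightedHomogeneous
    (fun s : (F →+* ℝ) × Fin 3 => (Pi.single s.1 1 : (F →+* ℝ) → ℕ)) p k ∧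
    ∀ τ, laplacian α β τ p = 0}
  add_mem' {p q} hp hq := by
    refine ⟨hp.1.add hq.1, fun τ => ?_⟩
    have h : laplacian α β τ p + laplacian α β τ q = 0 := by rw [hp.2 τ, hq.2 τ, add_zero]
    rw [← h]
    simp only [laplacian, map_add, smul_add]
    abel
  zero_mem' := ⟨MvPolynomial.isWeightedHomogeneous_zero _ _ _, fun τ => by simp [laplacian]⟩
  smul_mem' c p hp := by
    refine ⟨(MvPolynomial.weightedHomogeneousSubmodule ℂ _ k).smul_mem c hp.1, fun τ => ?_⟩
    have h : c • laplacian α β τ p = 0 := by rw [hp.2 τ, smul_zero]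
    rw [← h]
    simp only [laplacian, Derivation.map_smul, smul_add, smul_sub, smul_comm c]

/-- Evaluation of polynomials at the points of `W`, as functions on `B`. -/
def evalPoly (α β : F) :
    MvPolynomial ((F →+* ℝ) × Fin 3) ℂ →ₗ[ℂ] (Quat F α β → ℂ) :=
  LinearMap.pi fun y => (MvPolynomial.aeval fun s : (F →+* ℝ) × Fin 3 =>
    ((s.1 (coord y s.2) : ℝ) : ℂ)).toLinearMap

/-- The space `V_k` of homogeneous polynomial functions on `W` of degree `k` that are harmonic with
respect to `Δ`. -/
def harmonicForms (α β : F) (k : (F →+* ℝ) → ℕ) : Submodule ℂ (Quat F α β → ℂ) :=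
  (harmonicPoly α β k).map (evalPoly α β)

/-- The right action of `B^×` on functions on `W`: `(P · γ)(y) = P(γ y γ⁻¹)`. -/
def act (P : Quat F α β → ℂ) (γ : (Quat F α β)ˣ) : Quat F α β → ℂ :=
  fun y => P (γ * y * ((γ⁻¹ : (Quat F α β)ˣ) : Quat F α β))

/-- The inner product on `V_k` is invariant under `B^×`, i.e. `V_k` is a unitary representation. -/
def IsInvariantInner {k : (F →+* ℝ) → ℕ} (ip : InnerProductSpace.Core ℂ (harmonicForms α β k)) :
    Prop :=
  ∀ (γ : (Quat F α β)ˣ) (P Q P' Q' : harmonicForms α β k),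
    (P' : Quat F α β → ℂ) = act P γ → (Q' : Quat F α β → ℂ) = act Q γ →
      ip.inner P' Q' = ip.inner P Q

open Classical in
/-- The element `Q` of `V_k` characterized by `⟨P, Q⟩ = c P(y)` for every `P` in `V_k`, where
`⟨·, ·⟩` is linear in the first variable (in `ip.inner` it is the second variable that is linear).
It exists and is unique, because `V_k` is finite dimensional. -/
def rieszPoly {k : (F →+* ℝ) → ℕ} (ip : InnerProductSpace.Core ℂ (harmonicForms α β k)) (c : ℂ)
    (y : Quat F α β) : Quat F α β → ℂ :=
  if h : ∃ Q : harmonicForms α β k, ∀ P : harmonicForms α β k, ip.inner Q P = c * (P : Quat F α β → ℂ) y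
  then (h.choose : Quat F α β → ℂ) else 0

/-! ### Quaternionic modular forms -/

/-- The space `M_k(R)` of quaternionic modular forms. -/
def modularForms (R : Subalgebra (𝓞 F) (Quat F α β)) (k : (F →+* ℝ) → ℕ) :
    Submodule ℂ (AdeleUnits α β → Quat F α β → ℂ) where
  carrier := {φ | (∀ x, φ x ∈ harmonicForms α β k) ∧
    ∀ u ∈ hatUnits R, ∀ x, ∀ γ, φ (u * x * globalUnit γ) = act (φ x) γ}
  add_mem' {φ ψ} hφ hψ := by
    refine ⟨fun x => add_mem (hφ.1 x) (hψ.1 x), fun u hu x γ => ?_⟩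
    simp only [Pi.add_apply, hφ.2 u hu x γ, hψ.2 u hu x γ]
    rfl
  zero_mem' := ⟨fun x => zero_mem _, fun u hu x γ => rfl⟩
  smul_mem' c φ hφ := by
    refine ⟨fun x => Submodule.smul_mem _ c (hφ.1 x), fun u hu x γ => ?_⟩
    simp only [Pi.smul_apply, hφ.2 u hu x γ]
    rfl

/-- The action `(φ · z)(x) = φ(z x)`. -/
def translateForm (φ : AdeleUnits α β → Quat F α β → ℂ) (z : AdeleUnits α β) :
    AdeleUnits α β → Quat F α β → ℂ :=
  fun x => φ (z * x)

/-- The subspace `M_k(R, 1)` of forms that are fixed by the action of `Cl(F)`. -/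
def modularFormsOne (R : Subalgebra (𝓞 F) (Quat F α β)) (k : (F →+* ℝ) → ℕ) :
    Submodule ℂ (AdeleUnits α β → Quat F α β → ℂ) where
  carrier := {φ | φ ∈ modularForms R k ∧ ∀ ζ, translateForm φ (scalarUnit ζ) = φ}
  add_mem' hφ hψ :=
    ⟨add_mem hφ.1 hψ.1, fun ζ => congrArg₂ (· + ·) (hφ.2 ζ) (hψ.2 ζ)⟩
  zero_mem' := ⟨zero_mem _, fun _ => rfl⟩
  smul_mem' c _ hφ := ⟨Submodule.smul_mem _ c hφ.1, fun ζ => congrArg (c • ·) (hφ.2 ζ)⟩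

/-- The subspace `M_k(R, 1)^δ` of forms on which `Bil(R)` acts through `δ`. -/
def eigenForms (R : Subalgebra (𝓞 F) (Quat F α β)) (k : (F →+* ℝ) → ℕ)
    (δ : AdeleUnits α β → ℤˣ) : Submodule ℂ (AdeleUnits α β → Quat F α β → ℂ) where
  carrier := {φ | φ ∈ modularFormsOne R k ∧
    ∀ z ∈ normalizer R, translateForm φ z = ((δ z : ℤ) : ℂ) • φ}
  add_mem' {φ ψ} hφ hψ := by
    refine ⟨add_mem hφ.1 hψ.1, fun z hz => ?_⟩
    rw [smul_add, ← hφ.2 z hz, ← hψ.2 z hz]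
    rfl
  zero_mem' := ⟨zero_mem _, fun z hz => by rw [smul_zero]; rfl⟩
  smul_mem' c φ hφ := by
    refine ⟨Submodule.smul_mem _ c hφ.1, fun z hz => ?_⟩
    rw [smul_comm, ← hφ.2 z hz]
    rfl

/-- The image of `𝓞_F^×` in `B^×`. -/
def baseUnits (α β : F) : Subgroup (Quat F α β)ˣ :=
  (Units.map (algebraMap (𝓞 F) (Quat F α β)).toMonoidHom).range

/-- The set `Γ_{x,y} = (B^× ∩ x⁻¹ R̂^× y) / 𝓞_F^×`. It is finite when `B` is totally definite. -/
def Gam (R : Subalgebra (𝓞 F) (Quat F α β)) (x y : AdeleUnits α β) :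
    Set ((Quat F α β)ˣ ⧸ baseUnits α β) :=
  QuotientGroup.mk '' {γ | x * globalUnit γ * y⁻¹ ∈ hatUnits R}

/-- The form `φ_{x,P}(y) = ∑_{γ ∈ Γ_{x,y}} P · γ`. -/
def minimalForm (R : Subalgebra (𝓞 F) (Quat F α β)) (x : AdeleUnits α β)
    (P : Quat F α β → ℂ) : AdeleUnits α β → Quat F α β → ℂ :=
  fun y => ∑ᶠ γ ∈ Gam R x y, act P γ.out

/-! ### Special points

Here `Δ ∈ F`, `K = F(√Δ)` and `ι : K → B` is an embedding. -/

section SpecialPoints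

variable {Δ : F} (R : Subalgebra (𝓞 F) (Quat F α β)) (ι : QuadExt Δ →ₐ[F] Quat F α β)

/-- `K^×` as a subgroup of the unit group of `B ⊗ 𝔸_f`. -/
def globalK : Subgroup (AdeleUnits α β) :=
  (globalUnit.comp (Units.map ι.toRingHom.toMonoidHom)).range

/-- The unit group of `K ⊗ 𝔸_f`, as a subgroup of the unit group of `B ⊗ 𝔸_f`. -/
def hatK : Subgroup (AdeleUnits α β) :=
  (Algebra.adjoin (FinAdele F)
    (Set.range fun a => toAdele (ι a)) : Subalgebra (FinAdele F) _).toSubmonoid.units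

/-- The unit group of `∏_v 𝓞_{K,v}`, as a subgroup of the unit group of `B ⊗ 𝔸_f`. -/
def hatOK : Subgroup (AdeleUnits α β) :=
  (hat (ι '' (integralClosure (𝓞 F) (QuadExt Δ) : Set (QuadExt Δ)))).toSubmonoid.units

/-- `Cl(K) = Ô_K^× \ K̂^× / K^×`, as a subset of `Ô_K^× \ B̂^× / K^×`. -/
def ClK : Set (DoubleCoset.Quotient (hatOK ι : Set (AdeleUnits α β)) (globalK ι)) :=
  DoubleCoset.mk _ _ '' (hatK ι : Set (AdeleUnits α β))

/-- The set of special points `X = R̂^× \ {x ∈ B̂^× : 𝓞 F + 𝔠 ω ⊆ R_x} / K^×`, as a subset of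
`R̂^× \ B̂^× / K^×`. -/
def specialPoints (𝔠 : FractionalIdeal (𝓞 F)⁰ F) (ω : QuadExt Δ) :
    Set (DoubleCoset.Quotient (hatUnits R : Set (AdeleUnits α β)) (globalK ι)) :=
  DoubleCoset.mk _ _ '' {x | ∀ y ∈ quadLattice 𝔠 ω, ι y ∈ conjOrder R x}

/-- The index `[𝓞_x^× : 𝓞_F^×]`, where `𝓞_x = R_x ∩ K`. -/
def unitIndex (x : AdeleUnits α β) : ℕ :=
  (Units.map (algebraMap (𝓞 F) (QuadExt Δ)).toMonoidHom).range.relIndex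
    ((conjOrder R x).comap ι.toRingHom).toSubmonoid.units

/-- `t_K = [𝓞_K^× : 𝓞_F^×]`. -/
def tK (Δ : F) : ℕ :=
  (Units.map (algebraMap (𝓞 F) (integralClosure (𝓞 F) (QuadExt Δ))).toMonoidHom).range.index

/-- The polynomial `P_Δ` in `V_k` such that `w(ω; 𝔠) P(ω) = ⟨P, P_Δ⟩` for every `P` in `V_k`. Here
`ξ` is a finite idele generating `𝔠`. -/
def PDelta (l : F) (w : ∀ v : FinPlace F, Quat (v.adicCompletion F) α β → ℤ)
    (ξ : (FinAdele F)ˣ) {k : (F →+* ℝ) → ℕ} (ip : InnerProductSpace.Core ℂ (harmonicForms α β k))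
    (ω : QuadExt Δ) : Quat F α β → ℂ :=
  rieszPoly ip (idealWeight R l w ξ 1 (toAdele (ι ω)) : ℂ) (ι ω)

/-- The form `η`, the sum over the special points `x` of
`w_x(ω; 𝔠) / (w(ω; 𝔠) [𝓞_x^× : 𝓞_F^×]) φ_{x, P_Δ}`. -/
def eta (l : F) (w : ∀ v : FinPlace F, Quat (v.adicCompletion F) α β → ℤ)
    (𝔠 : FractionalIdeal (𝓞 F)⁰ F) (ξ : (FinAdele F)ˣ)
    {k : (F →+* ℝ) → ℕ} (ip : InnerProductSpace.Core ℂ (harmonicForms α β k)) (ω : QuadExt Δ) :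
    AdeleUnits α β → Quat F α β → ℂ :=
  (idealWeight R l w ξ 1 (toAdele (ι ω)) : ℂ)⁻¹ •
    ∑ᶠ q ∈ specialPoints R ι 𝔠 ω,
      ((idealWeight R l w ξ q.out (toAdele (ι ω)) : ℂ) / (unitIndex R ι q.out : ℂ)) •
        minimalForm R q.out (PDelta R ι l w ξ ip ω)

/-- The form `ψ_{Ξ,P} = (1 / t_K) ∑_{a ∈ Cl(K)} Ξ(a) φ_{a,P}`, where `Ξ(a) = χ^l(N a)` is the genus
character of `K`. The reduced norm of `B` restricts to the norm of `K/F`. -/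
def psi (l : F) (P : Quat F α β → ℂ) : AdeleUnits α β → Quat F α β → ℂ :=
  ((tK Δ : ℂ))⁻¹ • ∑ᶠ q ∈ ClK ι,
    ((quadChar l (Units.map nrd q.out) : ℤ) : ℂ) • minimalForm R q.out P

end SpecialPoints

end QForms

end

open NumberField IsDedekindDomain QForms
open scoped nonZeroDivisors

open NumberField IsDedekindDomain
open scoped nonZeroDivisors

noncomputable section

set_option linter.unusedSectionVars false

namespace QForms

open scoped WithZero

/-! ### Quaternion identities -/

section Identities

variable {F : Type*} [Field F] {A : Type*} [CommRing A] [Algebra F A] {α β : F}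

/-! The key fact is a description of the special points. The elements `x` with `𝓞 F + 𝔠 ω ⊆ R_x` are
exactly the products `z a` with `z ∈ N(R̂)` and `a ∈ K̂^×` (`forall_mem_conjOrder_iff`). Moreover
`N(R̂) ∩ K̂^×` lies in `F̂^× R̂^×` (`exists_scalarUnit_mul_of_mem_hatK`), and `R̂^× ∩ K̂^×` is
`Ô_K^×` (`hatOK_eq`). Pure group theory (`IsTorusConfiguration.bijOn`) then shows that `(z, a) ↦ z⁻¹
a` induces a bijection from `Bil(R) × Cl(K)` onto `X_Δ`.

Along this bijection every term of `η` factors. The weight at `z⁻¹ a` is `δ(z) Ξ(a)` times the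
weight at `1` (`idealWeight_inv_mul`, `idealWeight_mul_hatK`), the unit index is always `t_K`, and
`φ_{z⁻¹ a, P} = φ_{a, P} · z` (`translateForm_minimalForm`). Summing over `a` gives `δ(z) ψ · z`.
The eigenvalue property holds because left multiplication by an element of the normalizer permutes
`X_Δ` and changes the weights by `δ`. The sums do not depend on representatives because `χ^l` is
trivial on the totally positive norms from `K^×` and because `P_Δ`, which represents evaluation at
`ω`, is fixed by `K^×`.

The description of the special points is a local question. At `v` the lattice contains an element
`θ` whose discriminant is a product of two local fundamental discriminants, one of them a unit, so
`θ` generates a maximal order (`exists_isAdmissible`). If `Disc θ` is a unit, the order is `S + S j`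
with `S = 𝓞_v[θ]` and `j θ = θ̄ j`; an element of `R_v` with the characteristic polynomial of `θ` is
conjugate to `θ` by a unit or by a unit times `j`. If `Disc θ` is not a unit, then `v` does not
divide `𝔑`, so `R_v` is unimodular for the trace form, and the conjugates of `θ` in `R_v` are
conjugate to it by units. In both cases an element of `F_v(θ)^×` that normalizes `R_v` is a scalar
times a unit.

Coprimality is assumed for conductors but is needed for discriminants. The bridge is
`IsLocalDisc.eq_one`: if the local discriminant is not a unit, the norm form comes from an
Eisenstein polynomial and misses a unit (`exists_unit_not_norm`), so the conductor is not trivial.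

For the finiteness of `Bil(R)`, a class is determined by the set of places where it is not a scalar
times a unit, and these places divide `𝔑`. The finiteness of `Cl(K)` comes from the ideal class
group. -/

theorem trd_add (x y : Quat A α β) : trd (x + y) = trd x + trd y := by
  simp only [trd, star_add, QuaternionAlgebra.re_add]; ring

theorem trd_sub (x y : Quat A α β) : trd (x - y) = trd x - trd y := by
  simp only [trd, star_sub, QuaternionAlgebra.re_add, QuaternionAlgebra.re_sub]; ring

theorem trd_neg (x : Quat A α β) : trd (-x) = -trd x := by simp [trd]

theorem trd_smul (c : A) (x : Quat A α β) : trd (c • x) = c * trd x := by simp [trd, mul_add]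

theorem trd_zero : trd (0 : Quat A α β) = 0 := by simp [trd]

theorem trd_mul_comm (x y : Quat A α β) : trd (x * y) = trd (y * x) := by simp [trd]; ring

theorem trd_algebraMap (c : A) : trd (algebraMap A (Quat A α β) c) = 2 * c := by
  simp [trd]; ring

theorem trd_star (x : Quat A α β) : trd (star x) = trd x := by simp [trd, add_comm]

theorem nrd_star (x : Quat A α β) : nrd (star x) = nrd x := by simp [nrd]

theorem nrd_smul (c : A) (x : Quat A α β) : nrd (c • x) = c ^ 2 * nrd x := by simp [nrd]; ring

theorem nrd_algebraMap (c : A) : nrd (algebraMap A (Quat A α β) c) = c ^ 2 := by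
  simp [nrd]; ring

theorem nrd_add (x y : Quat A α β) : nrd (x + y) = nrd x + nrd y + trd (x * star y) := by
  simp [nrd, trd]; ring

theorem nrd_neg (x : Quat A α β) : nrd (-x) = nrd x := by simp [nrd]

theorem nrd_zero : nrd (0 : Quat A α β) = 0 := by simp [nrd]

theorem star_eq_sub (x : Quat A α β) : star x = algebraMap A _ (trd x) - x := by
  ext <;> simp [trd]

theorem mul_star_eq (x : Quat A α β) : x * star x = algebraMap A _ (nrd x) := by
  ext <;> simp [nrd] <;> ring

theorem star_mul_eq (x : Quat A α β) : star x * x = algebraMap A _ (nrd x) := by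
  ext <;> simp [nrd] <;> ring

theorem mul_self_eq (x : Quat A α β) : x * x = trd x • x - algebraMap A _ (nrd x) := by
  ext <;> simp [nrd, trd] <;> ring

/-- For elements of a quaternion algebra, `x r x = trd(x r) x - nrd(x) r̄`. -/
theorem mul_mul_self (x r : Quat A α β) :
    x * r * x = trd (x * r) • x - nrd x • star r := by
  have h : x * r = algebraMap A _ (trd (x * r)) - star r * star x := by
    rw [← star_mul, star_eq_sub (x * r)]; abel
  calc x * r * x = (algebraMap A _ (trd (x * r)) - star r * star x) * x := by rw [← h]
    _ = _ := by
      rw [sub_mul, mul_assoc, star_mul_eq, ← Algebra.commutes, ← Algebra.smul_def,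
        ← Algebra.smul_def]

theorem scalar_comm (c : A) (x : Quat A α β) :
    algebraMap A (Quat A α β) c * x = x * algebraMap A _ c := Algebra.commutes c x

theorem Disc_eq (x : Quat A α β) : Disc x = trd x ^ 2 - 4 * nrd x := rfl

/-- The square of `x - x̄` is the discriminant. -/
theorem sub_star_mul_self (x : Quat A α β) :
    (x - star x) * (x - star x) = algebraMap A _ (Disc x) := by
  have h1 : trd (x - star x) = 0 := by rw [trd_sub, trd_star, sub_self]
  have h2 : nrd (x - star x) = -Disc x := by simp [Disc, nrd, trd]; ring
  rw [mul_self_eq, h1, h2, zero_smul, map_neg, zero_sub, neg_neg]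

theorem Disc_add_algebraMap (x : Quat A α β) (c : A) :
    Disc (x + algebraMap A _ c) = Disc x := by
  simp [Disc, nrd, trd]; ring

end Identities

/-! ### Inverses and centralizers in quaternion algebras over a field -/

section Units

variable {F : Type*} [Field F] {A : Type*} [Field A] [Algebra F A] {α β : F}

/-- An element with nonzero reduced norm is a unit. -/
def unitOfNrd (x : Quat A α β) (h : nrd x ≠ 0) : (Quat A α β)ˣ where
  val := x
  inv := (nrd x)⁻¹ • star x
  val_inv := by
    rw [mul_smul_comm, mul_star_eq, Algebra.smul_def, ← map_mul, inv_mul_cancel₀ h, map_one]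
  inv_val := by
    rw [smul_mul_assoc, star_mul_eq, Algebra.smul_def, ← map_mul, inv_mul_cancel₀ h, map_one]

@[simp] theorem unitOfNrd_val (x : Quat A α β) (h : nrd x ≠ 0) : (unitOfNrd x h : Quat A α β) = x :=
  rfl

theorem nrd_unit_ne_zero (x : (Quat A α β)ˣ) : nrd (x : Quat A α β) ≠ 0 := fun h => by
  have : nrd (x : Quat A α β) * nrd ((x⁻¹ : (Quat A α β)ˣ) : Quat A α β) = 1 := by
    rw [← map_mul, Units.mul_inv, map_one]
  rw [h, zero_mul] at this
  exact zero_ne_one this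

theorem inv_val_eq (x : (Quat A α β)ˣ) :
    ((x⁻¹ : (Quat A α β)ˣ) : Quat A α β) = (nrd (x : Quat A α β))⁻¹ • star (x : Quat A α β) := by
  have h := nrd_unit_ne_zero x
  have : x = unitOfNrd (x : Quat A α β) h := Units.ext rfl
  conv_lhs => rw [this]
  rfl

theorem trd_conj (x : (Quat A α β)ˣ) (y : Quat A α β) :
    trd ((x : Quat A α β) * y * ((x⁻¹ : (Quat A α β)ˣ) : Quat A α β)) = trd y := by
  rw [trd_mul_comm, ← mul_assoc, Units.inv_mul, one_mul]

theorem nrd_conj (x : (Quat A α β)ˣ) (y : Quat A α β) :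
    nrd ((x : Quat A α β) * y * ((x⁻¹ : (Quat A α β)ˣ) : Quat A α β)) = nrd y := by
  rw [map_mul, map_mul, mul_right_comm, ← map_mul, Units.mul_inv, map_one, one_mul]

/-- An element commuting with `θ` is a combination of `1` and `θ`, with coefficients given by
traces. -/
theorem eq_of_commute {θ k : Quat A α β} (hθ : Disc θ ≠ 0) (hk : k * θ = θ * k) :
    k = algebraMap A _ (((trd θ ^ 2 - 2 * nrd θ) * trd k - trd θ * trd (k * θ)) / Disc θ) +
      ((2 * trd (k * θ) - trd θ * trd k) / Disc θ) • θ := by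
  set a := ((trd θ ^ 2 - 2 * nrd θ) * trd k - trd θ * trd (k * θ)) / Disc θ with ha
  set b := (2 * trd (k * θ) - trd θ * trd k) / Disc θ with hb
  -- The coefficients solve the trace equations, so the remainder `y` has `trd y = trd (y θ) = 0`.
  -- Since `y` commutes with `θ`, this gives `(θ - θ̄) y = 0`, and `(θ - θ̄)²` is the nonzero scalar
  -- `Disc θ`.
  set y := k - algebraMap A _ a - b • θ with hy
  have hθθ : trd (θ * θ) = trd θ ^ 2 - 2 * nrd θ := by
    rw [mul_self_eq, trd_sub, trd_smul, trd_algebraMap]; ring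
  have h1 : trd y = 0 := by
    rw [hy, trd_sub, trd_sub, trd_smul, trd_algebraMap, ha, hb]
    field_simp
    rw [Disc_eq]; ring
  have h2 : trd (y * θ) = 0 := by
    rw [hy, sub_mul, sub_mul, trd_sub, trd_sub, smul_mul_assoc, trd_smul, hθθ, ← Algebra.smul_def,
      trd_smul, ha, hb]
    field_simp
    rw [Disc_eq]; ring
  have hc : y * θ = θ * y := by
    rw [hy, sub_mul, sub_mul, mul_sub, mul_sub, hk, scalar_comm, smul_mul_assoc, mul_smul_comm]
  have hs : star y = -y := by rw [star_eq_sub, h1, map_zero, zero_sub]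
  have h3 : y * θ + star θ * star y = 0 := by
    rw [← star_mul, star_eq_sub (y * θ), h2, map_zero]; abel
  have h4 : (θ - star θ) * y = 0 := by
    rw [sub_mul, ← hc, ← h3, hs]; simp [sub_eq_add_neg]
  have h5 : y = 0 := by
    have : (Disc θ) • y = 0 := by
      rw [Algebra.smul_def, ← sub_star_mul_self, mul_assoc, h4, mul_zero]
    exact (smul_eq_zero.mp this).resolve_left hθ
  rw [hy, sub_sub] at h5
  exact sub_eq_zero.mp h5

/-- An element with `r θ = θ̄ r` has trace zero. -/
theorem trd_eq_zero_of_anticommute {θ r : Quat A α β} (hθ : Disc θ ≠ 0) (hr : r * θ = star θ * r) :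
    trd r = 0 := by
  have h1 : star θ * star r = star r * θ := by
    rw [← star_mul, hr, star_mul, star_star]
  rw [star_eq_sub r, mul_sub, sub_mul, ← hr, ← scalar_comm, sub_left_inj, ← sub_eq_zero,
    ← mul_sub] at h1
  have h2 : trd r • (star θ - θ) = 0 := by rw [Algebra.smul_def]; exact h1
  rcases smul_eq_zero.mp h2 with h | h
  · exact h
  · exfalso
    apply hθ
    have h3 := sub_star_mul_self θ
    rw [show θ - star θ = 0 by rw [← neg_sub, h, neg_zero], mul_zero] at h3
    exact (FaithfulSMul.algebraMap_eq_zero_iff A (Quat A α β)).mp h3.symm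

end Units

/-! ### Orders in quaternion algebras over a discretely valued field -/

section LocalOrder

variable {F : Type*} [Field F] {A : Type*} [Field A] [Algebra F A] {α β : F}
  (V : Valuation A ℤᵐ⁰) (R : Subring (Quat A α β))

/-- `R` contains the valuation ring of `A`, and its elements have integral reduced trace and
norm. -/
structure IsIntegralOrder : Prop where
  scalar : ∀ c : A, V c ≤ 1 → algebraMap A _ c ∈ R
  trd_le : ∀ r ∈ R, V (trd r) ≤ 1
  nrd_le : ∀ r ∈ R, V (nrd r) ≤ 1

/-- Conjugation by `z` preserves `R`. -/
def Normalizes (z : (Quat A α β)ˣ) : Prop :=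
  ∀ r, r ∈ R ↔ ((z⁻¹ : (Quat A α β)ˣ) : Quat A α β) * r * z ∈ R

/-- `R` is unimodular for the trace form. -/
def IsUnimodular : Prop :=
  ∀ r ∈ R, (∀ s ∈ R, V (trd (r * s)) < 1) → ∃ c : A, V c < 1 ∧ ∃ r' ∈ R, r = c • r'

/-- The units of `R`. -/
def unitsOf : Subgroup (Quat A α β)ˣ := R.toSubmonoid.units

variable {V R}

theorem mem_unitsOf {u : (Quat A α β)ˣ} :
    u ∈ unitsOf R ↔ (u : Quat A α β) ∈ R ∧ ((u⁻¹ : (Quat A α β)ˣ) : Quat A α β) ∈ R := by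
  rw [unitsOf, Submonoid.mem_units_iff]
  rfl

theorem Normalizes.mul {y z : (Quat A α β)ˣ} (hy : Normalizes R y) (hz : Normalizes R z) :
    Normalizes R (y * z) := fun r => by
  rw [hy r, hz]
  simp only [mul_inv_rev, Units.val_mul, mul_assoc]

theorem Normalizes.inv {z : (Quat A α β)ˣ} (hz : Normalizes R z) : Normalizes R z⁻¹ := fun r => by
  rw [hz (((z⁻¹)⁻¹ : (Quat A α β)ˣ) * r * ((z⁻¹ : (Quat A α β)ˣ) : Quat A α β))]
  simp [mul_assoc]

theorem normalizes_of_forall {z : (Quat A α β)ˣ}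
    (h1 : ∀ r ∈ R, (z : Quat A α β) * r * ((z⁻¹ : (Quat A α β)ˣ) : Quat A α β) ∈ R)
    (h2 : ∀ r ∈ R, ((z⁻¹ : (Quat A α β)ˣ) : Quat A α β) * r * z ∈ R) : Normalizes R z := by
  refine fun r => ⟨h2 r, fun h => ?_⟩
  have := h1 _ h
  simpa [mul_assoc] using this

theorem Normalizes.conj_mem {z : (Quat A α β)ˣ} (hz : Normalizes R z) {r : Quat A α β}
    (hr : r ∈ R) : (z : Quat A α β) * r * ((z⁻¹ : (Quat A α β)ˣ) : Quat A α β) ∈ R := by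
  rw [hz]
  simpa [mul_assoc] using hr

theorem normalizes_of_mem {u : (Quat A α β)ˣ} (hu : u ∈ unitsOf R) : Normalizes R u := by
  rw [mem_unitsOf] at hu
  exact normalizes_of_forall (fun r hr => mul_mem (mul_mem hu.1 hr) hu.2)
    fun r hr => mul_mem (mul_mem hu.2 hr) hu.1

/-- The unit given by a nonzero scalar. -/
def scalarOf (α β : F) (c : Aˣ) : (Quat A α β)ˣ := Units.map (algebraMap A _).toMonoidHom c

@[simp] theorem scalarOf_val (c : Aˣ) :
    (scalarOf α β c : Quat A α β) = algebraMap A _ (c : A) := rfl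

theorem scalarOf_comm (c : Aˣ) (x : (Quat A α β)ˣ) : scalarOf α β c * x = x * scalarOf α β c :=
  Units.ext (scalar_comm _ _)

theorem normalizes_scalarOf (c : Aˣ) : Normalizes R (scalarOf α β c) := fun r => by
  rw [mul_assoc, scalarOf_val, ← scalar_comm, ← scalarOf_val, ← mul_assoc, Units.inv_mul, one_mul]

namespace IsIntegralOrder

variable (hR : IsIntegralOrder V R)
include hR

theorem smul_mem {c : A} (hc : V c ≤ 1) {r : Quat A α β} (hr : r ∈ R) : c • r ∈ R := by
  rw [Algebra.smul_def]
  exact mul_mem (hR.scalar c hc) hr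

theorem star_mem {r : Quat A α β} (hr : r ∈ R) : star r ∈ R := by
  rw [star_eq_sub]
  exact sub_mem (hR.scalar _ (hR.trd_le r hr)) hr

theorem unit_mem {u : (Quat A α β)ˣ} (hu : (u : Quat A α β) ∈ R) (h : V (nrd (u : Quat A α β)) = 1) :
    u ∈ unitsOf R := by
  refine mem_unitsOf.mpr ⟨hu, ?_⟩
  rw [inv_val_eq]
  exact hR.smul_mem (by rw [map_inv₀, h, inv_one]) (hR.star_mem hu)

theorem Disc_le {r : Quat A α β} (hr : r ∈ R) : V (Disc r) ≤ 1 := by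
  have h : Disc r = trd r * trd r - (nrd r + nrd r + nrd r + nrd r) := by rw [Disc_eq]; ring
  rw [h]
  have h1 := hR.trd_le r hr
  have h2 := hR.nrd_le r hr
  exact V.map_sub_le (by rw [map_mul]; exact mul_le_one' h1 h1)
    (V.map_add_le (V.map_add_le (V.map_add_le h2 h2) h2) h2)

end IsIntegralOrder

theorem val_two_le (V : Valuation A ℤᵐ⁰) : V 2 ≤ 1 := by
  rw [← one_add_one_eq_two]
  exact V.map_add_le V.map_one.le V.map_one.le

theorem val_mul_le {a b : A} (ha : V a ≤ 1) (hb : V b ≤ 1) : V (a * b) ≤ 1 := by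
  rw [map_mul]; exact mul_le_one' ha hb

theorem val_mul_lt {a b : A} (ha : V a < 1) (hb : V b ≤ 1) : V (a * b) < 1 := by
  rw [map_mul]; exact mul_lt_one_of_lt_of_le ha hb

theorem val_mul_lt' {a b : A} (ha : V a ≤ 1) (hb : V b < 1) : V (a * b) < 1 := by
  rw [mul_comm]; exact val_mul_lt hb ha

theorem val_inv_of_eq_one {a : A} (ha : V a = 1) : V a⁻¹ = 1 := by rw [map_inv₀, ha, inv_one]

/-- When the discriminant of `θ` is a unit, the ring generated by `θ` is self-dual. -/
theorem exists_integral_coords {θ k : Quat A α β} (ht : V (trd θ) ≤ 1) (hn : V (nrd θ) ≤ 1)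
    (hd : V (Disc θ) = 1) (hk : k * θ = θ * k) (h1 : V (trd k) ≤ 1) (h2 : V (trd (k * θ)) ≤ 1) :
    ∃ a b : A, V a ≤ 1 ∧ V b ≤ 1 ∧ k = algebraMap A _ a + b • θ := by
  have hd0 : Disc θ ≠ 0 := fun h => by simp [h] at hd
  refine ⟨_, _, ?_, ?_, eq_of_commute hd0 hk⟩
  · rw [map_div₀, hd, div_one]
    refine V.map_sub_le (val_mul_le ?_ h1) (val_mul_le ht h2)
    rw [pow_two]
    exact V.map_sub_le (val_mul_le ht ht) (val_mul_le (val_two_le V) hn)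
  · rw [map_div₀, hd, div_one]
    exact V.map_sub_le (val_mul_le (val_two_le V) h2) (val_mul_le ht h1)

/-! ### Orders containing an element of unit discriminant -/

section Unramified

variable {θ u : Quat A α β} (hR : IsIntegralOrder V R) (hθ : θ ∈ R) (hd : V (Disc θ) = 1)
  (hu : u ∈ R) (hu0 : nrd u ≠ 0) (huθ : u * θ = star θ * u)

theorem anticomm_mul {θ r : Quat A α β} (hr : r * θ = star θ * r) :
    (θ * r) * θ = star θ * (θ * r) := by
  rw [mul_assoc, hr, ← mul_assoc, ← mul_assoc, mul_star_eq, star_mul_eq]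

theorem anticomm_star {θ r : Quat A α β} (hr : r * θ = star θ * r) : r * star θ = θ * r := by
  rw [star_eq_sub, mul_sub, hr, ← scalar_comm, ← sub_mul, star_eq_sub, sub_sub_cancel]

include hR hθ hd hu hu0 huθ in
/-- An order containing an element `θ` of unit discriminant is `S + S j`, where `S` is generated by
`θ` and `j θ = θ̄ j`. -/
theorem exists_anticomm_generator :
    ∃ j : (Quat A α β)ˣ, (j : Quat A α β) ∈ R ∧ (j : Quat A α β) * θ = star θ * j ∧
      ∀ r ∈ R, ∃ a b c d : A, V a ≤ 1 ∧ V b ≤ 1 ∧ V c ≤ 1 ∧ V d ≤ 1 ∧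
        r = algebraMap A _ a + b • θ + (algebraMap A _ c + d • θ) * j := by
  have hd0 : Disc θ ≠ 0 := fun h => by simp [h] at hd
  -- choose `j` with reduced norm of maximal absolute value
  obtain ⟨j, ⟨hj, hjθ, hj0⟩, hmax⟩ : ∃ j, (j ∈ R ∧ j * θ = star θ * j ∧ nrd j ≠ 0) ∧
      ∀ r, r ∈ R → r * θ = star θ * r → V (nrd r) ≤ V (nrd j) := by
    -- Reduced norms of elements of `R` have valuation `exp (-n)` with `n` natural, so the largest
    -- valuation corresponds to the least `n`.
    let s : Set ℕ := {n | ∃ j, (j ∈ R ∧ j * θ = star θ * j ∧ nrd j ≠ 0) ∧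
      V (nrd j) = WithZero.exp (-(n : ℤ))}
    have key : ∀ r, r ∈ R → nrd r ≠ 0 → ∃ n : ℕ, V (nrd r) = WithZero.exp (-(n : ℤ)) := by
      intro r hr h0
      have h1 := hR.nrd_le r hr
      have h2 : V (nrd r) ≠ 0 := (V.ne_zero_iff).mpr h0
      have h3 := WithZero.exp_log h2
      rw [← h3, ← WithZero.exp_zero, WithZero.exp_le_exp] at h1
      refine ⟨(-(V (nrd r)).log).toNat, ?_⟩
      rw [Int.toNat_of_nonneg (by omega), neg_neg, h3]
    have hs : s.Nonempty := by
      obtain ⟨n, hn⟩ := key u hu hu0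
      exact ⟨n, u, ⟨hu, huθ, hu0⟩, hn⟩
    obtain ⟨j, hj, hjn⟩ := Nat.sInf_mem hs
    refine ⟨j, hj, fun r hr hrθ => ?_⟩
    by_cases h0 : nrd r = 0
    · rw [h0, map_zero]; exact zero_le
    obtain ⟨n, hn⟩ := key r hr h0
    rw [hjn, hn, WithZero.exp_le_exp]
    have : sInf s ≤ n := Nat.sInf_le ⟨r, ⟨hr, hrθ, h0⟩, hn⟩
    omega
  refine ⟨unitOfNrd j hj0, hj, hjθ, ?_⟩
  have hcoord : ∀ r ∈ R, r * θ = star θ * r → ∃ c d : A, V c ≤ 1 ∧ V d ≤ 1 ∧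
      r = (algebraMap A _ c + d • θ) * j := by
    intro r hr hrθ
    -- Polarization: the trace is `nrd (r + j) - nrd r - nrd j`, and all three norms are bounded by
    -- that of `j` because it is maximal.
    have hpol : ∀ r ∈ R, r * θ = star θ * r → V (trd (r * star j)) ≤ V (nrd j) := by
      intro r hr hrθ
      have h := nrd_add r j
      have h' : trd (r * star j) = nrd (r + j) - nrd r - nrd j := by rw [h]; ring
      rw [h']
      refine V.map_sub_le (V.map_sub_le (hmax _ (add_mem hr hj) ?_) (hmax r hr hrθ)) le_rfl
      rw [add_mul, mul_add, hrθ, hjθ]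
    have hVj : V (nrd j) ≠ 0 := V.ne_zero_iff.mpr hj0
    -- This is `r j⁻¹`. It commutes with `θ` because both `r` and `j` intertwine `θ` with its
    -- conjugate, and `hpol` makes its traces against `1` and `θ` integral.
    set k := (nrd j)⁻¹ • (r * star j) with hk
    have hsj : star j * θ = star θ * star j := by
      have h0 := trd_eq_zero_of_anticommute hd0 hjθ
      rw [star_eq_sub j, h0, map_zero, zero_sub, neg_mul, mul_neg, hjθ]
    have hkθ : k * θ = θ * k := by
      rw [hk, smul_mul_assoc, mul_smul_comm, mul_assoc, hsj, ← mul_assoc, anticomm_star hrθ,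
        mul_assoc]
    have hk1 : V (trd k) ≤ 1 := by
      rw [hk, trd_smul, map_mul, map_inv₀]
      calc _ ≤ (V (nrd j))⁻¹ * V (nrd j) := by gcongr; exact hpol r hr hrθ
        _ = 1 := inv_mul_cancel₀ hVj
    have hk2 : V (trd (k * θ)) ≤ 1 := by
      rw [hkθ, hk, mul_smul_comm, trd_smul, map_mul, map_inv₀, ← mul_assoc]
      calc _ ≤ (V (nrd j))⁻¹ * V (nrd j) := by
            gcongr; exact hpol _ (mul_mem hθ hr) (anticomm_mul hrθ)
        _ = 1 := inv_mul_cancel₀ hVj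
    obtain ⟨c, d, hc, hd', h⟩ :=
      exists_integral_coords (hR.trd_le θ hθ) (hR.nrd_le θ hθ) hd hkθ hk1 hk2
    refine ⟨c, d, hc, hd', ?_⟩
    rw [← h, hk, smul_mul_assoc, mul_assoc, star_mul_eq, ← Algebra.commutes, ← Algebra.smul_def,
      smul_smul, inv_mul_cancel₀ hj0, one_smul]
  intro r hr
  set g := θ - star θ with hg
  have hgR : g ∈ R := sub_mem hθ (hR.star_mem hθ)
  have hgg : g * g = algebraMap A _ (Disc θ) := sub_star_mul_self θ
  have hgθ : g * θ = θ * g := by rw [hg, sub_mul, mul_sub, star_mul_eq, mul_star_eq]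
  -- The commutator with `θ` intertwines `θ` and `θ̄`, and `rm = (θ - θ̄)⁻¹ m` is the part of `r`
  -- that does so. It stays in `R` because `Disc θ` is a unit; the rest, `r - rm`, commutes with
  -- `θ`.
  set m := θ * r - r * θ with hm
  have hmθ : m * θ = star θ * m := by
    rw [hm, sub_mul, mul_sub, ← mul_assoc (star θ) θ, star_mul_eq, mul_assoc r θ θ, mul_self_eq,
      star_eq_sub, sub_mul, mul_sub, mul_smul_comm, ← scalar_comm _ r, ← Algebra.smul_def (trd θ),
      mul_assoc]
    abel
  set rm := (Disc θ)⁻¹ • (g * m) with hrm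
  have hrmR : rm ∈ R := hR.smul_mem (val_inv_of_eq_one hd).le
    (mul_mem hgR (sub_mem (mul_mem hθ hr) (mul_mem hr hθ)))
  have hgs : g * star θ = star θ * g := by rw [hg, sub_mul, mul_sub, star_mul_eq, mul_star_eq]
  have hrmθ : rm * θ = star θ * rm := by
    rw [hrm, smul_mul_assoc, mul_smul_comm, mul_assoc, hmθ, ← mul_assoc, hgs, mul_assoc]
  have hrp : (r - rm) * θ = θ * (r - rm) := by
    have h1 : θ * rm - rm * θ = m := by
      rw [hrmθ, ← sub_mul, ← hg, hrm, mul_smul_comm, ← mul_assoc, hgg, ← Algebra.smul_def,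
        smul_smul, inv_mul_cancel₀ hd0, one_smul]
    rw [sub_mul, mul_sub, ← sub_eq_zero]
    calc r * θ - rm * θ - (θ * r - θ * rm) = (θ * rm - rm * θ) - m := by rw [hm]; abel
      _ = 0 := by rw [h1, sub_self]
  obtain ⟨a, b, ha, hb, h⟩ := exists_integral_coords (hR.trd_le θ hθ) (hR.nrd_le θ hθ) hd hrp
    (hR.trd_le _ (sub_mem hr hrmR)) (hR.trd_le _ (mul_mem (sub_mem hr hrmR) hθ))
  obtain ⟨c, d, hc, hd', h'⟩ := hcoord rm hrmR hrmθ
  exact ⟨a, b, c, d, ha, hb, hc, hd', by rw [← h, unitOfNrd_val, ← h', sub_add_cancel]⟩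

-- Conjugation by `j` fixes `j` and exchanges `θ` with `θ̄`, so it preserves the decomposition `S +
-- S j`, in either direction.
include hR hθ in
theorem normalizes_of_generator {j : (Quat A α β)ˣ} (hj : (j : Quat A α β) ∈ R)
    (hjθ : (j : Quat A α β) * θ = star θ * j)
    (h : ∀ r ∈ R, ∃ a b c d : A, V a ≤ 1 ∧ V b ≤ 1 ∧ V c ≤ 1 ∧ V d ≤ 1 ∧
        r = algebraMap A _ a + b • θ + (algebraMap A _ c + d • θ) * j) : Normalizes R j := by
  have e1 : (j : Quat A α β) * θ * ((j⁻¹ : (Quat A α β)ˣ) : Quat A α β) = star θ := by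
    rw [hjθ, mul_assoc, Units.mul_inv, mul_one]
  have e2 : ((j⁻¹ : (Quat A α β)ˣ) : Quat A α β) * θ * j = star θ := by
    rw [mul_assoc, ← anticomm_star hjθ, ← mul_assoc, Units.inv_mul, one_mul]
  have hs : ∀ a b, V a ≤ 1 → V b ≤ 1 → algebraMap A _ a + b • star θ ∈ R := fun a b ha hb =>
    add_mem (hR.scalar a ha) (hR.smul_mem hb (hR.star_mem hθ))
  refine normalizes_of_forall (fun r hr => ?_) fun r hr => ?_ <;>
    obtain ⟨a, b, c, d, ha, hb, hc, hd', rfl⟩ := h r hr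
  · have : (j : Quat A α β) * (algebraMap A _ a + b • θ + (algebraMap A _ c + d • θ) * j) *
        ((j⁻¹ : (Quat A α β)ˣ) : Quat A α β) =
        algebraMap A _ a + b • star θ + (algebraMap A _ c + d • star θ) * j := by
      rw [mul_add, mul_add, add_mul, add_mul, ← scalar_comm, mul_assoc _ (j : Quat A α β),
        Units.mul_inv, mul_one, mul_smul_comm, smul_mul_assoc, e1, mul_assoc (j : Quat A α β),
        mul_assoc _ (j : Quat A α β), Units.mul_inv, mul_one, mul_add, ← scalar_comm, mul_smul_comm,
        hjθ, add_mul, smul_mul_assoc]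
    rw [this]
    exact add_mem (hs a b ha hb) (mul_mem (hs c d hc hd') hj)
  · have : ((j⁻¹ : (Quat A α β)ˣ) : Quat A α β) *
        (algebraMap A _ a + b • θ + (algebraMap A _ c + d • θ) * j) * (j : Quat A α β) =
        algebraMap A _ a + b • star θ + (algebraMap A _ c + d • star θ) * j := by
      rw [mul_add, mul_add, add_mul, add_mul, ← scalar_comm, mul_assoc _ _ (j : Quat A α β),
        Units.inv_mul, mul_one, mul_smul_comm, smul_mul_assoc, e2, ← mul_assoc _ _ (j : Quat A α β),
        mul_add, add_mul, ← scalar_comm, mul_assoc _ _ (j : Quat A α β), Units.inv_mul, mul_one,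
        mul_smul_comm, smul_mul_assoc, e2]
    rw [this]
    exact add_mem (hs a b ha hb) (mul_mem (hs c d hc hd') hj)

include hR hθ hd in
/-- Elements of `R` with the same characteristic polynomial as `θ` are conjugate to `θ` under the
group generated by the units of `R` and `j`. -/
theorem exists_conj_of_unramified {j : (Quat A α β)ˣ}
    (hjθ : (j : Quat A α β) * θ = star θ * j) {θ' : Quat A α β} (hθ' : θ' ∈ R)
    (ht : trd θ' = trd θ) (hn : nrd θ' = nrd θ) :
    ∃ y ∈ unitsOf R, (y : Quat A α β) * θ = θ' * y ∨
      ((y * j : (Quat A α β)ˣ) : Quat A α β) * θ = θ' * (y * j : (Quat A α β)ˣ) := by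
  have hsq : θ' * θ' = trd θ • θ' - algebraMap A _ (nrd θ) := by rw [mul_self_eq, ht, hn]
  -- Both `θ` and `θ'` are roots of the same quadratic polynomial, so `θ' - θ̄` carries `θ` to `θ'`
  -- and `θ' - θ` carries `θ̄` to `θ'`. Their norms add up to the unit `-Disc θ`, so at least one of
  -- the two is invertible in `R`; the second needs the extra factor `j`.
  have i1 : (θ' - star θ) * θ = θ' * (θ' - star θ) := by
    rw [star_eq_sub, sub_mul, mul_sub, sub_mul, mul_sub, hsq, mul_self_eq, Algebra.smul_def,
      Algebra.smul_def, ← scalar_comm _ θ']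
    abel
  have i2 : (θ' - θ) * star θ = θ' * (θ' - θ) := by
    rw [star_eq_sub, sub_mul, mul_sub, mul_sub, mul_sub, hsq, mul_self_eq, Algebra.smul_def,
      Algebra.smul_def, ← scalar_comm _ θ', ← scalar_comm _ θ]
    abel
  have hsum : nrd (θ' - star θ) + nrd (θ' - θ) = -Disc θ := by
    have h1 : nrd (θ' - star θ) = 2 * nrd θ - trd (θ' * θ) := by
      rw [sub_eq_add_neg, nrd_add, nrd_neg, nrd_star, hn, star_neg, star_star, mul_neg, trd_neg]
      ring
    have h2 : nrd (θ' - θ) = 2 * nrd θ - trd (θ' * star θ) := by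
      rw [sub_eq_add_neg, nrd_add, nrd_neg, hn, star_neg, mul_neg, trd_neg]
      ring
    have h3 : trd (θ' * star θ) = trd θ ^ 2 - trd (θ' * θ) := by
      rw [star_eq_sub, mul_sub, trd_sub, ← scalar_comm, ← Algebra.smul_def, trd_smul, ht]
      ring
    rw [h1, h2, h3, Disc_eq]; ring
  have hm1 := sub_mem hθ' (hR.star_mem hθ)
  have hm2 := sub_mem hθ' hθ
  rcases (hR.nrd_le _ hm1).lt_or_eq with h | h
  · have h2 : V (nrd (θ' - θ)) = 1 := by
      refine (hR.nrd_le _ hm2).antisymm ?_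
      by_contra! h'
      have := V.map_add_lt h h'
      rw [hsum, Valuation.map_neg, hd] at this
      exact this.false
    have h0 : nrd (θ' - θ) ≠ 0 := fun h => by simp [h] at h2
    refine ⟨unitOfNrd _ h0, hR.unit_mem hm2 h2, Or.inr ?_⟩
    rw [Units.val_mul, mul_assoc, hjθ, ← mul_assoc, unitOfNrd_val, i2, mul_assoc]
  · have h0 : nrd (θ' - star θ) ≠ 0 := fun h' => by simp [h'] at h
    exact ⟨unitOfNrd _ h0, hR.unit_mem hm1 h, Or.inl i1⟩

end Unramified

end LocalOrder

/-! ### Elements of the torus normalizing the order, unramified case -/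

section LocalConjugacy

variable {F : Type*} [Field F] {A : Type*} [Field A] [Algebra F A] {α β : F}
  {V : Valuation A ℤᵐ⁰} {R : Subring (Quat A α β)}

theorem star_scalar (a : A) :
    star (algebraMap A (Quat A α β) a) = algebraMap A _ a := by
  ext <;> simp

theorem star_smul_eq (a : A) (x : Quat A α β) : star (a • x) = a • star x := by
  rw [Algebra.smul_def, star_mul, star_scalar, ← Algebra.commutes, ← Algebra.smul_def]

/-- Such a `p` is killed by `θ - θ̄`, whose square is a nonzero scalar. -/
theorem eq_zero_of_comm_of_anticomm {θ p : Quat A α β} (hd : Disc θ ≠ 0) (h1 : p * θ = θ * p)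
    (h2 : p * θ = star θ * p) : p = 0 := by
  have : Disc θ • p = 0 := by
    rw [Algebra.smul_def, ← sub_star_mul_self, mul_assoc, sub_mul _ _ p, ← h1, h2, sub_self, mul_zero]
  exact (smul_eq_zero.mp this).resolve_left hd

/-- Otherwise `θ` would be a scalar, and scalars have discriminant zero. -/
theorem coords_unique {θ : Quat A α β} (hθ : Disc θ ≠ 0) {a b a' b' : A}
    (h : algebraMap A _ a + b • θ = algebraMap A _ a' + b' • θ) : a = a' ∧ b = b' := by
  have key : (b - b') • θ = algebraMap A _ (a' - a) := by
    rw [sub_smul, map_sub]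
    rw [sub_eq_sub_iff_add_eq_add, add_comm, h]
  by_cases hb : b - b' = 0
  · rw [hb, zero_smul, eq_comm, FaithfulSMul.algebraMap_eq_zero_iff] at key
    exact ⟨(sub_eq_zero.mp key).symm, sub_eq_zero.mp hb⟩
  · exfalso
    apply hθ
    have : θ = 0 + algebraMap A _ ((b - b')⁻¹ * (a' - a)) := by
      rw [map_mul, ← key, ← Algebra.smul_def, smul_smul, inv_mul_cancel₀ hb, one_smul, zero_add]
    rw [this, Disc_add_algebraMap, Disc_eq, trd_zero, nrd_zero]
    ring

/-- A nonzero combination of `1` and `θ` has a scalar multiple which is primitive. -/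
theorem exists_primitive (θ : Quat A α β) {a b : A} (hab : a ≠ 0 ∨ b ≠ 0) :
    ∃ (c : Aˣ) (a' b' : A), V a' ≤ 1 ∧ V b' ≤ 1 ∧ (V a' = 1 ∨ V b' = 1) ∧
      algebraMap A _ a + b • θ = (c : A) • (algebraMap A _ a' + b' • θ) := by
  have aux : ∀ c : A, c ≠ 0 → algebraMap A (Quat A α β) a + b • θ =
      c • (algebraMap A _ (c⁻¹ * a) + (c⁻¹ * b) • θ) := fun c hc => by
    rw [smul_add, smul_smul, mul_inv_cancel_left₀ hc, Algebra.smul_def c, ← map_mul,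
      mul_inv_cancel_left₀ hc]
  rcases le_total (V a) (V b) with h | h
  · have hb : b ≠ 0 := by
      rintro rfl
      rw [map_zero, le_zero_iff, map_eq_zero] at h
      simp [h] at hab
    have hV : V b ≠ 0 := V.ne_zero_iff.mpr hb
    refine ⟨Units.mk0 b hb, b⁻¹ * a, b⁻¹ * b, ?_, ?_, Or.inr ?_, aux b hb⟩
    · rw [map_mul, map_inv₀]
      calc _ ≤ (V b)⁻¹ * V b := by gcongr
        _ = 1 := inv_mul_cancel₀ hV
    · rw [inv_mul_cancel₀ hb, map_one]
    · rw [inv_mul_cancel₀ hb, map_one]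
  · have ha : a ≠ 0 := by
      rintro rfl
      rw [map_zero, le_zero_iff, map_eq_zero] at h
      simp [h] at hab
    have hV : V a ≠ 0 := V.ne_zero_iff.mpr ha
    refine ⟨Units.mk0 a ha, a⁻¹ * a, a⁻¹ * b, ?_, ?_, Or.inl ?_, aux a ha⟩
    · rw [inv_mul_cancel₀ ha, map_one]
    · rw [map_mul, map_inv₀]
      calc _ ≤ (V a)⁻¹ * V a := by gcongr
        _ = 1 := inv_mul_cancel₀ hV
    · rw [inv_mul_cancel₀ ha, map_one]

theorem lt_one_of_sq {a : A} (h : V (a * a) < 1) : V a < 1 := by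
  by_contra! h'
  rw [map_mul] at h
  exact absurd h (not_lt.mpr (one_le_mul h' h'))

/-- An element of `A[θ]` all of whose primitive multiples that normalize `R` have unit norm is
a scalar times a unit of `R`. -/
theorem exists_scalar_mul_unit (hR : IsIntegralOrder V R) {θ : Quat A α β} (hθ : θ ∈ R)
    (hd : Disc θ ≠ 0) {k : (Quat A α β)ˣ} (hk : (k : Quat A α β) * θ = θ * k)
    (hN : Normalizes R k)
    (key : ∀ (s : (Quat A α β)ˣ) (a b : A), V a ≤ 1 → V b ≤ 1 → (V a = 1 ∨ V b = 1) →
      (s : Quat A α β) = algebraMap A _ a + b • θ → Normalizes R s →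
      (s : Quat A α β) ∈ R → (s : Quat A α β) * θ = θ * s → ¬ V (nrd (s : Quat A α β)) < 1) :
    ∃ (c : Aˣ), ∃ s ∈ unitsOf R, k = scalarOf α β c * s := by
  have h := eq_of_commute hd hk
  generalize ((trd θ ^ 2 - 2 * nrd θ) * trd (k : Quat A α β) - trd θ * trd ((k : Quat A α β) * θ)) /
    Disc θ = a at h
  generalize (2 * trd ((k : Quat A α β) * θ) - trd θ * trd (k : Quat A α β)) / Disc θ = b at h
  have hab : a ≠ 0 ∨ b ≠ 0 := by
    by_contra! h'
    rw [h'.1, h'.2, map_zero, zero_smul, add_zero] at h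
    exact k.ne_zero h
  obtain ⟨c, a', b', ha, hb, hab', h'⟩ := exists_primitive (V := V) θ hab
  have hks : k = scalarOf α β c * (scalarOf α β c⁻¹ * k) := by
    rw [← mul_assoc, scalarOf, scalarOf, ← map_mul, mul_inv_cancel, map_one, one_mul]
  set s := scalarOf α β c⁻¹ * k with hs
  have hsv : (s : Quat A α β) = algebraMap A _ a' + b' • θ := by
    rw [hs, Units.val_mul, h, h', scalarOf_val, ← Algebra.smul_def, smul_smul, Units.inv_mul,
      one_smul]
  have hsR : (s : Quat A α β) ∈ R := by
    rw [hsv]; exact add_mem (hR.scalar _ ha) (hR.smul_mem hb hθ)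
  have hsN : Normalizes R s := (normalizes_scalarOf _).mul hN
  have hsθ : (s : Quat A α β) * θ = θ * s := by
    rw [hsv, add_mul, mul_add, scalar_comm, smul_mul_assoc, mul_smul_comm]
  exact ⟨c, s, hR.unit_mem hsR ((hR.nrd_le _ hsR).antisymm
    (not_lt.mp (key s a' b' ha hb hab' hsv hsN hsR hsθ))), hks⟩

/-- Let `s` be the primitive multiple of `k`, and suppose that its norm is not a unit. Comparing `s
j s⁻¹ ∈ R` with `S + S j` gives `s j s⁻¹ = q j` with `q ∈ S`, and `j s̄ = s j` turns this into `s² =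
nrd(s) q`. Hence the squares of `trd s` and `trd (s θ)` are multiples of `nrd s`. Because `Disc θ`
is a unit, these two traces determine the coordinates of `s` integrally, so both coordinates are
non-units and `s` is not primitive. -/
theorem exists_scalar_mul_unit_of_unramified (hR : IsIntegralOrder V R) {θ : Quat A α β}
    (hθ : θ ∈ R) (hd : V (Disc θ) = 1) {j : (Quat A α β)ˣ} (hj : (j : Quat A α β) ∈ R)
    (hjθ : (j : Quat A α β) * θ = star θ * j)
    (h : ∀ r ∈ R, ∃ a b c d : A, V a ≤ 1 ∧ V b ≤ 1 ∧ V c ≤ 1 ∧ V d ≤ 1 ∧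
        r = algebraMap A _ a + b • θ + (algebraMap A _ c + d • θ) * j)
    {k : (Quat A α β)ˣ} (hk : (k : Quat A α β) * θ = θ * k) (hN : Normalizes R k) :
    ∃ (c : Aˣ), ∃ s ∈ unitsOf R, k = scalarOf α β c * s := by
  have hd0 : Disc θ ≠ 0 := fun h => by simp [h] at hd
  refine exists_scalar_mul_unit hR hθ hd0 hk hN fun s a b ha hb hab hs hsN hsR hsθ hlt => ?_
  have hjs : (j : Quat A α β) * star (s : Quat A α β) = s * j := by
    rw [hs, star_add, star_scalar, star_smul_eq, mul_add, add_mul, mul_smul_comm, smul_mul_assoc,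
      anticomm_star hjθ, ← scalar_comm]
  -- `s j s⁻¹ = q j` with `q` integral
  obtain ⟨q, hqR, hqθ, hq⟩ : ∃ q ∈ R, q * θ = θ * q ∧
      (s : Quat A α β) * j * ((s⁻¹ : (Quat A α β)ˣ) : Quat A α β) = q * j := by
    obtain ⟨a, b, c, d, ha, hb, hc, hd', h'⟩ := h _ (hsN.conj_mem hj)
    refine ⟨algebraMap A _ c + d • θ, add_mem (hR.scalar _ hc) (hR.smul_mem hd' hθ), by
      rw [add_mul, mul_add, scalar_comm, smul_mul_assoc, mul_smul_comm], ?_⟩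
    rw [h']
    set p := algebraMap A (Quat A α β) a + b • θ with hp
    have e1 : ((s : Quat A α β) * j * ((s⁻¹ : (Quat A α β)ˣ) : Quat A α β)) * θ =
        star θ * ((s : Quat A α β) * j * ((s⁻¹ : (Quat A α β)ˣ) : Quat A α β)) := by
      have e2 : ((s⁻¹ : (Quat A α β)ˣ) : Quat A α β) * θ =
          θ * ((s⁻¹ : (Quat A α β)ˣ) : Quat A α β) := by
        rw [Units.inv_mul_eq_iff_eq_mul, ← mul_assoc, hsθ, mul_assoc, Units.mul_inv, mul_one]
      have e3 : (s : Quat A α β) * star θ = star θ * s := by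
        rw [star_eq_sub, mul_sub, sub_mul, hsθ, scalar_comm]
      rw [mul_assoc, e2, ← mul_assoc, mul_assoc (s : Quat A α β), hjθ, ← mul_assoc, e3]
      simp only [mul_assoc]
    have e4 : ((algebraMap A _ c + d • θ) * (j : Quat A α β)) * θ =
        star θ * ((algebraMap A _ c + d • θ) * (j : Quat A α β)) := by
      have e3 : (algebraMap A _ c + d • θ) * star θ = star θ * (algebraMap A _ c + d • θ) := by
        rw [add_mul, mul_add, scalar_comm, smul_mul_assoc, mul_smul_comm, mul_star_eq, star_mul_eq]
      rw [mul_assoc, hjθ, ← mul_assoc, e3, mul_assoc]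
    have e5 : p * θ = star θ * p := by
      rw [h', add_mul, mul_add, e4] at e1
      exact add_right_cancel e1
    have e6 : p * θ = θ * p := by
      rw [hp, add_mul, mul_add, scalar_comm, smul_mul_assoc, mul_smul_comm]
    have e7 : p = 0 := eq_zero_of_comm_of_anticomm hd0 e6 e5
    rw [e7, zero_add]
  have hqs : (s : Quat A α β) * s = nrd (s : Quat A α β) • q := by
    have e1 : (s : Quat A α β) * j = q * j * s := by
      rw [← hq, mul_assoc _ _ (s : Quat A α β), Units.inv_mul, mul_one]
    have e2 : (s : Quat A α β) * s * j = nrd (s : Quat A α β) • q * j := by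
      rw [mul_assoc, ← hjs, ← mul_assoc, e1, mul_assoc, mul_star_eq, ← Algebra.commutes,
        ← Algebra.smul_def, smul_mul_assoc]
    have := congrArg (· * ((j⁻¹ : (Quat A α β)ˣ) : Quat A α β)) e2
    simpa [mul_assoc] using this
  have h1 : V (trd (s : Quat A α β)) < 1 := by
    apply lt_one_of_sq
    have e : trd (s : Quat A α β) * trd (s : Quat A α β) =
        nrd (s : Quat A α β) * (trd q + 2) := by
      have := congrArg trd hqs
      rw [mul_self_eq, trd_sub, trd_smul, trd_smul, trd_algebraMap] at this
      linear_combination this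
    rw [e]
    exact val_mul_lt hlt (V.map_add_le (hR.trd_le _ hqR) (val_two_le V))
  have h2 : V (trd ((s : Quat A α β) * θ)) < 1 := by
    apply lt_one_of_sq
    have e : trd ((s : Quat A α β) * θ) * trd ((s : Quat A α β) * θ) =
        nrd (s : Quat A α β) * (trd (q * θ * θ) + trd (star θ * θ)) := by
      -- Expand the trace as `s θ + θ̄ s̄`, multiply by `s` and use `s² = nrd(s) q`. Multiplying the
      -- result by `θ` and taking traces gives `e`.
      have e1 : trd ((s : Quat A α β) * θ) • (s : Quat A α β) =
          nrd (s : Quat A α β) • (q * θ + star θ) := by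
        rw [Algebra.smul_def, Algebra.commutes]
        have : algebraMap A _ (trd ((s : Quat A α β) * θ)) =
            (s : Quat A α β) * θ + star θ * star (s : Quat A α β) := by
          rw [← star_mul, star_eq_sub (_ * _)]; abel
        have e3 : (s : Quat A α β) * star θ = star θ * s := by
          rw [star_eq_sub, mul_sub, sub_mul, hsθ, scalar_comm]
        rw [this, mul_add, ← mul_assoc, hqs, ← mul_assoc, e3, mul_assoc, mul_star_eq,
          ← Algebra.commutes, ← Algebra.smul_def, smul_add, smul_mul_assoc]
      have := congrArg (fun x => trd (x * θ)) e1
      simp only [smul_mul_assoc, trd_smul, add_mul, trd_add] at this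
      exact this
    rw [e]
    exact val_mul_lt hlt (V.map_add_le (hR.trd_le _ (mul_mem (mul_mem hqR hθ) hθ))
      (hR.trd_le _ (mul_mem (hR.star_mem hθ) hθ)))
  have hc := coords_unique hd0 (hs.symm.trans (eq_of_commute hd0 hsθ))
  have ht := hR.trd_le θ hθ
  have hn := hR.nrd_le θ hθ
  rcases hab with h' | h'
  · rw [hc.1, map_div₀, hd, div_one] at h'
    refine (V.map_sub_lt (val_mul_lt' ?_ h1) (val_mul_lt' ht h2)).ne h'
    rw [pow_two]
    exact V.map_sub_le (val_mul_le ht ht) (val_mul_le (val_two_le V) hn)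
  · rw [hc.2, map_div₀, hd, div_one] at h'
    exact (V.map_sub_lt (val_mul_lt' (val_two_le V) h2) (val_mul_lt' ht h1)).ne h'

/-- When `R` is unimodular, the generator `j` is a unit. -/
theorem generator_mem_units (hR : IsIntegralOrder V R) {θ : Quat A α β}
    (hθ : θ ∈ R) (hd : V (Disc θ) = 1) {j : (Quat A α β)ˣ} (hj : (j : Quat A α β) ∈ R)
    (hjθ : (j : Quat A α β) * θ = star θ * j)
    (h : ∀ r ∈ R, ∃ a b c d : A, V a ≤ 1 ∧ V b ≤ 1 ∧ V c ≤ 1 ∧ V d ≤ 1 ∧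
        r = algebraMap A _ a + b • θ + (algebraMap A _ c + d • θ) * j)
    (hU : IsUnimodular V R) : j ∈ unitsOf R := by
  have hd0 : Disc θ ≠ 0 := fun h => by simp [h] at hd
  refine hR.unit_mem hj ((hR.nrd_le _ hj).antisymm (not_lt.mp fun hlt => ?_))
  have hj0 := trd_eq_zero_of_anticommute hd0 hjθ
  have hjj : (j : Quat A α β) * j = -algebraMap A _ (nrd (j : Quat A α β)) := by
    rw [mul_self_eq, hj0, zero_smul, zero_sub]
  have hjθ0 : trd ((j : Quat A α β) * θ) = 0 := by
    refine trd_eq_zero_of_anticommute hd0 ?_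
    rw [hjθ, mul_assoc, hjθ]
  -- The part `S` of `R` is orthogonal to `j` for the trace form, and `S j` pairs with `j` into the
  -- multiples of `nrd j`. If `nrd j` is not a unit, `j` is therefore in the radical, and
  -- unimodularity divides it by a non-unit `c`.
  obtain ⟨c, hc, r', hr', hjr⟩ := hU j hj fun r hr => by
    obtain ⟨a, b, c, d, ha, hb, hc, hd', rfl⟩ := h r hr
    have e : trd ((j : Quat A α β) * (algebraMap A _ a + b • θ + (algebraMap A _ c + d • θ) * (j : Quat A α β))) =
        -(nrd (j : Quat A α β)) * (2 * c + d * trd θ) := by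
      rw [mul_add, mul_add, trd_add, trd_add, mul_smul_comm, trd_smul, hjθ0, ← scalar_comm,
        ← Algebra.smul_def, trd_smul, hj0, trd_mul_comm, mul_assoc _ (j : Quat A α β), hjj, mul_neg,
        trd_neg,        ← scalar_comm, ← Algebra.smul_def, trd_smul, trd_add, trd_smul, trd_algebraMap]
      ring
    rw [e]
    exact val_mul_lt (by rwa [Valuation.map_neg]) (V.map_add_le (val_mul_le (val_two_le V) hc)
      (val_mul_le hd' (hR.trd_le _ hθ)))
  -- compare norms: `r'` is a multiple of `j`
  obtain ⟨a, b, p, q, ha, hb, hp, hq, h'⟩ := h r' hr'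
  have hc0 : c ≠ 0 := by
    rintro rfl
    exact j.ne_zero (by rw [hjr, zero_smul])
  have e1 : (1 - c • (algebraMap A _ p + q • θ)) * (j : Quat A α β) =
      c • (algebraMap A _ a + b • θ) := by
    rw [sub_mul, one_mul, smul_mul_assoc]
    nth_rw 1 [hjr]
    rw [h', smul_add, add_sub_cancel_right]
  -- Comparing components in `S + S j`: `P` lies in `S`, hence commutes with `θ`, and lies in `S j`,
  -- hence intertwines `θ` and `θ̄`. So `P = 0`, and `1` would be `c` times an element of `S`.
  set P := (1 - c • (algebraMap A _ p + q • θ)) * (j : Quat A α β) with hP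
  have e2 : P * θ = θ * P := by
    rw [e1, smul_mul_assoc, mul_smul_comm, add_mul, mul_add, scalar_comm, smul_mul_assoc,
      mul_smul_comm]
  have e3 : P * θ = star θ * P := by
    have : (1 - c • (algebraMap A _ p + q • θ)) * star θ =
        star θ * (1 - c • (algebraMap A _ p + q • θ)) := by
      rw [sub_mul, mul_sub, smul_mul_assoc, mul_smul_comm, add_mul, mul_add, scalar_comm,
        smul_mul_assoc, mul_smul_comm, mul_star_eq, star_mul_eq, one_mul, mul_one]
    rw [hP, mul_assoc, hjθ, ← mul_assoc, this, mul_assoc]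
  have e4 : P = 0 := eq_zero_of_comm_of_anticomm hd0 e2 e3
  have e5 : (1 : Quat A α β) = c • (algebraMap A _ p + q • θ) := by
    rw [hP, Units.mul_left_eq_zero, sub_eq_zero] at e4
    exact e4
  have e6 : algebraMap A (Quat A α β) 1 + (0 : A) • θ =
      algebraMap A _ (c * p) + (c * q) • θ := by
    rw [map_one, zero_smul, add_zero, e5, smul_add, smul_smul, map_mul, ← Algebra.smul_def]
  have := (coords_unique hd0 e6).1
  have h1 : V (c * p) < 1 := val_mul_lt hc hp
  rw [← this, map_one] at h1
  exact h1.false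

end LocalConjugacy

/-! ### Unimodular orders and elements that are nilpotent modulo the maximal ideal -/

section Ramified

variable {F : Type*} [Field F] {A : Type*} [Field A] [Algebra F A] {α β : F}
  {V : Valuation A ℤᵐ⁰} {R : Subring (Quat A α β)}

variable (V) in
/-- The integral elements commuting with `θ` are the integral combinations of `1` and `θ`. -/
def IsMaximalAt (θ : Quat A α β) : Prop :=
  ∀ k : Quat A α β, k * θ = θ * k → V (trd k) ≤ 1 → V (nrd k) ≤ 1 →
    ∃ a b : A, V a ≤ 1 ∧ V b ≤ 1 ∧ k = algebraMap A _ a + b • θ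

/-- `θ` is not divisible by a non-unit scalar. -/
theorem IsMaximalAt.not_divisible {θ : Quat A α β} (hm : IsMaximalAt V θ) (hd : Disc θ ≠ 0)
    {c : A} (hc : V c < 1) {r : Quat A α β} (h1 : V (trd r) ≤ 1) (h2 : V (nrd r) ≤ 1) {a b : A}
    (hab : V a = 1 ∨ V b = 1) : algebraMap A _ a + b • θ ≠ c • r := by
  intro h
  have hc0 : c ≠ 0 := by
    rintro rfl
    have := coords_unique (a' := 0) (b' := 0) hd (by rw [h]; simp)
    simp [this.1, this.2] at hab
  have hr : r = c⁻¹ • (algebraMap A _ a + b • θ) := by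
    rw [h, smul_smul, inv_mul_cancel₀ hc0, one_smul]
  obtain ⟨a', b', ha, hb, h'⟩ := hm r (by
    rw [hr, smul_mul_assoc, mul_smul_comm, add_mul, mul_add, scalar_comm, smul_mul_assoc,
      mul_smul_comm]) h1 h2
  have e : algebraMap A _ a + b • θ = algebraMap A _ (c * a') + (c * b') • θ := by
    rw [h, h', smul_add, smul_smul, map_mul, ← Algebra.smul_def]
  obtain ⟨rfl, rfl⟩ := coords_unique hd e
  rcases hab with h | h
  · exact (val_mul_lt hc ha).ne h
  · exact (val_mul_lt hc hb).ne h

/-- Suppose that the primitive multiple `s = a + b θ` of `k` has non-unit norm. That norm is `a²` up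
to non-units, so `a` and `trd s` are non-units. As `s` normalizes `R`, the element `s r̄ s⁻¹` is
integral, and the identity `trd(s r) s = trd(s) s r - nrd(s) r + nrd(s) s r̄ s⁻¹` shows that `trd(s
r)²` is a non-unit for every `r` in `R`. By unimodularity `s` is then divisible by a non-unit,
against the maximality of `𝓞[θ]`. -/
theorem exists_scalar_mul_unit_of_ramified (hR : IsIntegralOrder V R) (hU : IsUnimodular V R)
    {θ : Quat A α β} (hθ : θ ∈ R) (hd : Disc θ ≠ 0) (hm : IsMaximalAt V θ) (ht : V (trd θ) < 1)
    (hn : V (nrd θ) < 1) {k : (Quat A α β)ˣ} (hk : (k : Quat A α β) * θ = θ * k)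
    (hN : Normalizes R k) : ∃ (c : Aˣ), ∃ s ∈ unitsOf R, k = scalarOf α β c * s := by
  refine exists_scalar_mul_unit hR hθ hd hk hN fun s a b ha hb hab hs hsN hsR hsθ hlt => ?_
  have e1 : nrd (s : Quat A α β) = a * a + b * (a * trd θ + b * nrd θ) := by
    rw [hs, nrd_add, nrd_algebraMap, nrd_smul, star_smul_eq, mul_smul_comm, trd_smul,
      ← Algebra.smul_def, trd_smul, trd_star]; ring
  have h1 : V (b * (a * trd θ + b * nrd θ)) < 1 :=
    val_mul_lt' hb (V.map_add_lt (val_mul_lt' ha ht) (val_mul_lt' hb hn))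
  have ha' : V a < 1 := lt_one_of_sq (by
    rw [← sub_eq_iff_eq_add.mpr e1]; exact V.map_sub_lt hlt h1)
  have hts : V (trd (s : Quat A α β)) < 1 := by
    rw [hs, trd_add, trd_smul, trd_algebraMap]
    exact V.map_add_lt (val_mul_lt' (val_two_le V) ha') (val_mul_lt' hb ht)
  obtain ⟨c, hc, r, hr, h⟩ := hU s hsR fun r hr => by
    have e2 : trd ((s : Quat A α β) * r) • (s : Quat A α β) = trd (s : Quat A α β) • (s * r) -
        nrd (s : Quat A α β) • r + nrd (s : Quat A α β) •
          ((s : Quat A α β) * star r * ((s⁻¹ : (Quat A α β)ˣ) : Quat A α β)) := by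
      have h2 : algebraMap A _ (trd ((s : Quat A α β) * r)) =
          (s : Quat A α β) * r + star r * star (s : Quat A α β) := by
        rw [← star_mul, star_eq_sub (_ * _)]; abel
      have h3 : (s : Quat A α β) * (star r * star (s : Quat A α β)) = nrd (s : Quat A α β) •
          ((s : Quat A α β) * star r * ((s⁻¹ : (Quat A α β)ˣ) : Quat A α β)) := by
        rw [inv_val_eq, mul_smul_comm, smul_smul, mul_inv_cancel₀ (nrd_unit_ne_zero s), one_smul,
          mul_assoc]
      rw [Algebra.smul_def, Algebra.commutes, h2, mul_add, h3, ← mul_assoc, mul_self_eq, sub_mul,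
        smul_mul_assoc, ← Algebra.smul_def]
    apply lt_one_of_sq
    have e3 := congrArg (fun x => trd (x * r)) e2
    simp only [smul_mul_assoc, trd_smul, add_mul, sub_mul, trd_add, trd_sub] at e3
    rw [e3]
    exact V.map_add_lt (V.map_sub_lt (val_mul_lt hts (hR.trd_le _ (mul_mem (mul_mem hsR hr) hr)))
      (val_mul_lt hlt (hR.trd_le _ (mul_mem hr hr))))
      (val_mul_lt hlt (hR.trd_le _ (mul_mem (hsN.conj_mem (hR.star_mem hr)) hr)))
  exact hm.not_divisible hd hc (hR.trd_le r hr) (hR.nrd_le r hr) hab (hs.symm.trans h)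

/-- The elements whose trace pairing with `R` is topologically nilpotent. -/
def traceRadical (V : Valuation A ℤᵐ⁰) (R : Subring (Quat A α β)) : Ideal R where
  carrier := {r | ∀ s ∈ R, V (trd ((r : Quat A α β) * s)) < 1}
  add_mem' {x y} hx hy s hs := by
    rw [Subring.coe_add, add_mul, trd_add]
    exact V.map_add_lt (hx s hs) (hy s hs)
  zero_mem' s hs := by simp [trd_zero]
  smul_mem' a x hx s hs := by
    rw [smul_eq_mul, Subring.coe_mul, mul_assoc, trd_mul_comm, mul_assoc]
    exact hx _ (mul_mem hs a.2)

instance : (traceRadical V R).IsTwoSided where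
  mul_mem_of_left {x} a hx s hs := by
    rw [Subring.coe_mul, mul_assoc]
    exact hx _ (mul_mem a.2 hs)

theorem mk_eq_of_sub {x y : R}
    (h : ∀ s ∈ R, V (trd (((x : Quat A α β) - (y : Quat A α β)) * s)) < 1) :
    Ideal.Quotient.mk (traceRadical V R) x = Ideal.Quotient.mk (traceRadical V R) y :=
  Ideal.Quotient.eq.mpr h

set_option maxHeartbeats 400000 in
/-- If `θ` and `θ'` are nilpotent modulo the radical and `trd(θ'θ)` is in the maximal ideal, then
`θ'θ` vanishes modulo the radical. -/
theorem trd_mul_mul_lt (hR : IsIntegralOrder V R) {θ θ' c : Quat A α β} (hθ : θ ∈ R)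
    (hθ' : θ' ∈ R) (hc : c ∈ R) (ht : V (trd θ) < 1) (hn : V (nrd θ) < 1) (ht' : V (trd θ') < 1)
    (hn' : V (nrd θ') < 1) (hθc : trd (θ * c) = 1) (h0 : V (trd (θ * θ')) < 1) :
    ∀ s ∈ R, V (trd (θ' * θ * s)) < 1 := by
  let q := Ideal.Quotient.mk (traceRadical V R)
  let a : R := ⟨θ, hθ⟩
  let a' : R := ⟨θ', hθ'⟩
  let k : R := ⟨c, hc⟩
  have small : ∀ {x : A} {r s : Quat A α β}, V x < 1 → r ∈ R → s ∈ R →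
      V (trd (x • r * s)) < 1 := fun hx hr hs => by
    rw [smul_mul_assoc, trd_smul]; exact val_mul_lt hx (hR.trd_le _ (mul_mem hr hs))
  have nil : ∀ {x : Quat A α β} (hx : x ∈ R), V (trd x) < 1 → V (nrd x) < 1 →
      q ⟨x, hx⟩ * q ⟨x, hx⟩ = 0 := fun {x} hx h1 h2 => by
    rw [← map_mul, ← map_zero q]
    refine mk_eq_of_sub fun s hs => ?_
    have : ((⟨x, hx⟩ * ⟨x, hx⟩ : R) : Quat A α β) - (0 : R) = trd x • x - nrd x • 1 := by
      rw [← Algebra.algebraMap_eq_smul_one, ← mul_self_eq]; simp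
    rw [this, sub_mul, trd_sub]
    exact V.map_sub_lt (small h1 hx hs) (small h2 (one_mem _) hs)
  -- An element of non-unit norm behaves like a matrix of rank one: by `mul_mul_self`, `x r x ≡
  -- trd(x r) x` modulo the radical.
  have mms : ∀ {x r : Quat A α β} (hx : x ∈ R) (hr : r ∈ R), V (nrd x) < 1 →
      q ⟨x, hx⟩ * q ⟨r, hr⟩ * q ⟨x, hx⟩ =
        q ⟨trd (x * r) • x, hR.smul_mem (hR.trd_le _ (mul_mem hx hr)) hx⟩ := fun {x r} hx hr h => by
    rw [← map_mul, ← map_mul]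
    refine mk_eq_of_sub fun s hs => ?_
    have : ((⟨x, hx⟩ * ⟨r, hr⟩ * ⟨x, hx⟩ : R) : Quat A α β) - trd (x * r) • x =
        -(nrd x • star r) := by
      simp only [Subring.coe_mul]
      rw [mul_mul_self]; abel
    rw [this, neg_mul, trd_neg, Valuation.map_neg]
    exact small h (hR.star_mem hr) hs
  have h1 : q a * q a = 0 := nil hθ ht hn
  have h2 : q a' * q a' = 0 := nil hθ' ht' hn'
  have h3 : q a * q k * q a = q a := by
    rw [mms hθ hc hn]
    congr 2
    rw [hθc, one_smul]
  have h4 : q a * q a' * q a = 0 := by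
    rw [mms hθ hθ' hn, ← map_zero q]
    refine mk_eq_of_sub fun s hs => ?_
    simp only [Subring.coe_zero, sub_zero]
    exact small h0 hθ hs
  -- Since `trd (θ c) = 1`, the elements `e` and `1 - e` are complementary idempotents of rank one
  -- modulo the radical, as in a ring of two by two matrices.
  set e := θ * c with he
  have heR : e ∈ R := mul_mem hθ hc
  have hne : V (nrd e) < 1 := by rw [he, map_mul]; exact val_mul_lt hn (hR.nrd_le _ hc)
  have hqe : q ⟨e, heR⟩ = q a * q k := by rw [← map_mul]; rfl
  have hfR : 1 - e ∈ R := sub_mem (one_mem _) heR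
  have hqf : q ⟨1 - e, hfR⟩ = 1 - q a * q k := by rw [← hqe, ← map_one q, ← map_sub]; rfl
  have hnf : V (nrd (1 - e)) < 1 := by
    have : nrd (1 - e) = nrd e := by
      rw [sub_eq_add_neg, nrd_add, nrd_neg, map_one, star_neg, one_mul, trd_neg, trd_star, hθc]
      ring
    rwa [this]
  -- The rank-one rule applied to `1 - e`: the trace of `(1 - e) c θ` is `1` up to a non-unit.
  have h5 : (1 - q a * q k) * (q k * q a) * (1 - q a * q k) = 1 - q a * q k := by
    have hcθ : c * θ ∈ R := mul_mem hc hθ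
    have : q k * q a = q ⟨c * θ, hcθ⟩ := by rw [← map_mul]; rfl
    rw [this, ← hqf, mms hfR hcθ hnf]
    refine mk_eq_of_sub fun s hs => ?_
    have e1 : trd ((1 - e) * (c * θ)) - 1 = nrd θ * trd (c * c) - trd θ * trd (θ * (c * c)) := by
      have : trd (e * (c * θ)) = trd (θ * θ * (c * c)) := by
        rw [he, show θ * c * (c * θ) = θ * c * c * θ by simp only [mul_assoc], trd_mul_comm]
        simp only [mul_assoc]
      rw [sub_mul, one_mul, trd_sub, trd_mul_comm c, ← he, hθc, this, mul_self_eq, sub_mul, trd_sub,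
        smul_mul_assoc, trd_smul, ← Algebra.smul_def, trd_smul]
      ring
    have e2 : trd ((1 - e) * (c * θ)) • (1 - e) - (1 - e) =
        (nrd θ * trd (c * c) - trd θ * trd (θ * (c * c))) • (1 - e) := by
      rw [← e1, sub_smul, one_smul]
    simp only []
    rw [e2]
    exact small (V.map_sub_lt (val_mul_lt hn (hR.trd_le _ (mul_mem hc hc)))
      (val_mul_lt ht (hR.trd_le _ (mul_mem hθ (mul_mem hc hc))))) hfR hs
  set m := trd (e * θ') with hm
  have hmV : V m ≤ 1 := hR.trd_le _ (mul_mem heR hθ')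
  let μ : R := ⟨algebraMap A _ m, hR.scalar m hmV⟩
  have h6 : q a * q k * q a' * (q a * q k) = q μ * (q a * q k) := by
    rw [← hqe, mms heR hθ' hne, ← map_mul]
    congr 2
    rw [← hm, Algebra.smul_def]
  have hμ : ∀ x : R, q x * q μ = q μ * q x := fun x => by
    rw [← map_mul, ← map_mul]
    exact congrArg q (Subtype.ext (scalar_comm m (x : Quat A α β)).symm)
  have h7 : 1 - q a * q k = (1 - q a * q k) * q k * q a := by
    have : q a * (1 - q a * q k) = q a := by rw [mul_sub, ← mul_assoc, h1]; simp
    calc 1 - q a * q k = (1 - q a * q k) * (q k * q a) * (1 - q a * q k) := h5.symm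
      _ = (1 - q a * q k) * q k * (q a * (1 - q a * q k)) := by simp only [mul_assoc]
      _ = _ := by rw [this]
  -- By `h7` and `h4`, the part of `θ' θ c` in the image of `1 - e` vanishes, so `θ' e ≡ e θ' e`,
  -- which is a scalar multiple of `e`.
  have h8 : q a' * (q a * q k) = q μ * (q a * q k) := by
    have e1 : (1 - q a * q k) * (q a' * (q a * q k)) = 0 := by
      rw [h7]
      calc (1 - q a * q k) * q k * q a * (q a' * (q a * q k)) =
          (1 - q a * q k) * q k * (q a * q a' * q a) * q k := by simp only [mul_assoc]
        _ = 0 := by rw [h4]; simp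
    rw [sub_mul, one_mul, sub_eq_zero] at e1
    rw [e1, ← h6]
    simp only [mul_assoc]
  -- Applying `θ'` twice: `θ'² ≡ 0` forces the square of the scalar `m` to annihilate `e`, and as
  -- `trd e = 1` this makes `m` a non-unit.
  have h9 : q μ * q μ * (q a * q k) = 0 := by
    have : q a' * (q a' * (q a * q k)) = q μ * q μ * (q a * q k) := by
      rw [h8, ← mul_assoc, hμ, mul_assoc, h8, mul_assoc]
    rw [← this, ← mul_assoc, h2, zero_mul]
  have hm1 : V m < 1 := by
    have : q (μ * μ * (a * k)) = 0 := by simpa only [map_mul] using h9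
    have := (Ideal.Quotient.eq_zero_iff_mem.mp this) 1 (one_mem _)
    apply lt_one_of_sq
    have e1 : (((μ * μ * (a * k) : R) : Quat A α β)) * 1 = (m * m) • e := by
      rw [Algebra.smul_def, map_mul, mul_one]; rfl
    rw [e1, trd_smul, hθc, mul_one] at this
    exact this
  have h10 : q a' * q a = 0 := by
    have : q μ = 0 := by
      rw [← map_zero q]
      refine mk_eq_of_sub fun s hs => ?_
      have : ((μ : R) : Quat A α β) - (0 : R) = m • 1 := by
        rw [← Algebra.algebraMap_eq_smul_one]; simp [μ]
      rw [this]
      exact small hm1 (one_mem _) hs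
    rw [← h3, ← mul_assoc, h8, this]; simp
  rw [← map_mul] at h10
  exact Ideal.Quotient.eq_zero_iff_mem.mp h10

end Ramified

/-! ### Local conjugacy of embeddings and the local normalizer -/

section Admissible

variable {F : Type*} [Field F] {A : Type*} [Field A] [Algebra F A] {α β : F}
  {V : Valuation A ℤᵐ⁰} {R : Subring (Quat A α β)}

theorem commutes_of_conj_eq {θ θ' : Quat A α β} {x y : (Quat A α β)ˣ}
    (hx : (x : Quat A α β) * θ * ((x⁻¹ : (Quat A α β)ˣ) : Quat A α β) = θ')
    (hy : (y : Quat A α β) * θ = θ' * y) :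
    ((y⁻¹ * x : (Quat A α β)ˣ) : Quat A α β) * θ = θ * (y⁻¹ * x : (Quat A α β)ˣ) := by
  have h1 : (x : Quat A α β) * θ = θ' * x := by
    rw [← hx, mul_assoc _ _ (x : Quat A α β), Units.inv_mul, mul_one]
  have h2 : θ * ((y⁻¹ : (Quat A α β)ˣ) : Quat A α β) =
      ((y⁻¹ : (Quat A α β)ˣ) : Quat A α β) * θ' := by
    rw [Units.eq_inv_mul_iff_mul_eq, ← mul_assoc, hy, mul_assoc, Units.mul_inv, mul_one]
  rw [Units.val_mul, mul_assoc, h1, ← mul_assoc, ← h2, mul_assoc]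

/-- Each `a` gives an intertwiner `θ' a - a θ̄` of `θ` and `θ'`, of norm `2 nrd(θ) nrd(a) - trd(θ' a
θ ā)`, and it is enough to make this norm a unit. If `trd(θ θ')` is a unit, take `a = 1`. Otherwise
unimodularity gives a `c` for which `trd(θ c)` and `trd(θ' c)` are both units; by `trd_mul_mul_lt`
the product `θ' θ` is negligible, and for `a = c` the norm is `trd(θ' c) trd(θ c)` up to a non-unit.
-/
theorem exists_conj_of_ramified (hR : IsIntegralOrder V R) (hU : IsUnimodular V R)
    {θ θ' : Quat A α β} (hθ : θ ∈ R) (hd : Disc θ ≠ 0) (hm : IsMaximalAt V θ) (ht : V (trd θ) < 1)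
    (hn : V (nrd θ) < 1) (hθ' : θ' ∈ R) {x : (Quat A α β)ˣ}
    (hx : (x : Quat A α β) * θ * ((x⁻¹ : (Quat A α β)ˣ) : Quat A α β) = θ') :
    ∃ y ∈ unitsOf R, (y : Quat A α β) * θ = θ' * y := by
  have ht' : trd θ' = trd θ := by rw [← hx, trd_conj]
  have hn' : nrd θ' = nrd θ := by rw [← hx, nrd_conj]
  have key : ∀ a : Quat A α β, (θ' * a - a * star θ) * θ = θ' * (θ' * a - a * star θ) := fun a => by
    rw [sub_mul, mul_sub, mul_assoc a, star_mul_eq, ← mul_assoc θ' θ', mul_self_eq θ', ht', hn',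
      sub_mul, star_eq_sub, mul_sub a, mul_sub θ', ← scalar_comm _ a, ← Algebra.smul_def,
      ← scalar_comm, ← Algebra.smul_def, mul_smul_comm, smul_mul_assoc, mul_assoc]
    abel
  have hnrd : ∀ a : Quat A α β, nrd (θ' * a - a * star θ) =
      2 * nrd θ * nrd a - trd (θ' * a * θ * star a) := fun a => by
    rw [sub_eq_add_neg, nrd_add, nrd_neg, map_mul, map_mul, hn', nrd_star, star_neg, star_mul,
      star_star, mul_neg, trd_neg, ← mul_assoc]
    ring
  suffices h : ∃ a ∈ R, V (nrd (θ' * a - a * star θ)) = 1 by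
    obtain ⟨a, ha, h⟩ := h
    have h0 : nrd (θ' * a - a * star θ) ≠ 0 := fun h' => by simp [h'] at h
    exact ⟨unitOfNrd _ h0, hR.unit_mem
      (sub_mem (mul_mem hθ' ha) (mul_mem ha (hR.star_mem hθ))) h, key a⟩
  rcases (hR.trd_le _ (mul_mem hθ hθ')).lt_or_eq with h0 | h0
  · obtain ⟨c₁, hc₁, h₁⟩ : ∃ c ∈ R, V (trd (θ * c)) = 1 := by
      by_contra! h
      obtain ⟨c, hc, r, hr, h'⟩ := hU θ hθ fun s hs =>
        lt_of_le_of_ne (hR.trd_le _ (mul_mem hθ hs)) (h s hs)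
      exact hm.not_divisible (a := 0) (b := 1) hd hc (hR.trd_le r hr) (hR.nrd_le r hr)
        (Or.inr V.map_one) (by rw [map_zero, zero_add, one_smul, h'])
    obtain ⟨c₂, hc₂, h₂⟩ : ∃ c ∈ R, V (trd (θ' * c)) = 1 := by
      by_contra! h
      obtain ⟨c, hc, r, hr, h'⟩ := hU θ' hθ' fun s hs =>
        lt_of_le_of_ne (hR.trd_le _ (mul_mem hθ' hs)) (h s hs)
      -- If `θ'` were divisible by `c`, so would be its conjugate `θ`. The quotient need not lie in
      -- `R`, but its trace and norm are integral, which is all that `IsMaximalAt.not_divisible`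
      -- asks for.
      have e : θ = c • (((x⁻¹ : (Quat A α β)ˣ) : Quat A α β) * r *
          (((x⁻¹)⁻¹ : (Quat A α β)ˣ) : Quat A α β)) := by
        rw [inv_inv, ← smul_mul_assoc, ← mul_smul_comm, ← h', ← hx]
        simp [mul_assoc]
      refine hm.not_divisible (a := 0) (b := 1) hd hc (r := ((x⁻¹ : (Quat A α β)ˣ) : Quat A α β) *
        r * (((x⁻¹)⁻¹ : (Quat A α β)ˣ) : Quat A α β)) ?_ ?_ (Or.inr V.map_one)
        (by rw [map_zero, zero_add, one_smul, ← e])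
      · rw [trd_conj]; exact hR.trd_le r hr
      · rw [nrd_conj]; exact hR.nrd_le r hr
    -- Two proper subgroups do not cover a group: one of `c₁`, `c₂`, `c₁ + c₂` pairs to a unit with
    -- both elements.
    obtain ⟨c, hc, h1, h2⟩ : ∃ c ∈ R, V (trd (θ * c)) = 1 ∧ V (trd (θ' * c)) = 1 := by
      rcases (hR.trd_le _ (mul_mem hθ' hc₁)).lt_or_eq with h3 | h3
      · rcases (hR.trd_le _ (mul_mem hθ hc₂)).lt_or_eq with h4 | h4
        · refine ⟨c₁ + c₂, add_mem hc₁ hc₂, ?_, ?_⟩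
          · rw [mul_add, trd_add, V.map_add_eq_of_lt_left (by rwa [h₁]), h₁]
          · rw [mul_add, trd_add, V.map_add_eq_of_lt_right (by rwa [h₂]), h₂]
        · exact ⟨c₂, hc₂, h4, h₂⟩
      · exact ⟨c₁, hc₁, h₁, h3⟩
    refine ⟨c, hc, ?_⟩
    have h3 : ∀ s ∈ R, V (trd (θ' * θ * s)) < 1 := by
      have hne : trd (θ * c) ≠ 0 := fun h' => by simp [h'] at h1
      refine trd_mul_mul_lt hR (c := (trd (θ * c))⁻¹ • c) hθ hθ'
        (hR.smul_mem (val_inv_of_eq_one h1).le hc) ht hn (by rwa [ht']) (by rwa [hn']) ?_ h0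
      rw [mul_smul_comm, trd_smul, inv_mul_cancel₀ hne]
    -- Conjugating `θ' c` moves `θ'` to the right of `c̄`, where it meets `θ` in the product `θ' c θ
    -- c̄`.
    have e1 : θ' * c = algebraMap A _ (trd (θ' * c)) - trd θ • star c + star c * θ' := by
      have : star (θ' * c) = star c * star θ' := star_mul _ _
      rw [star_eq_sub, star_eq_sub θ', mul_sub, ht', ← scalar_comm, ← Algebra.smul_def] at this
      rw [sub_eq_iff_eq_add] at this
      rw [this]; abel
    have e2 : trd (θ' * c * θ * star c) = trd (θ' * c) * (trd c * trd θ - trd (θ * c)) -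
        trd θ * trd (star c * θ * star c) + trd (θ' * θ * (star c * star c)) := by
      have e3 : trd (θ * star c) = trd c * trd θ - trd (θ * c) := by
        rw [star_eq_sub, mul_sub, ← scalar_comm, ← Algebra.smul_def, trd_sub, trd_smul]
      rw [e1, add_mul, add_mul, sub_mul, sub_mul, trd_add, trd_sub, ← Algebra.smul_def,
        smul_mul_assoc, smul_mul_assoc, smul_mul_assoc, trd_smul, trd_smul, e3, ← e1,
        mul_assoc (star c) θ', mul_assoc (star c) (θ' * θ), trd_mul_comm (star c) (θ' * θ * star c),
        mul_assoc (θ' * θ)]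
    have hsc := hR.star_mem hc
    rw [hnrd, e2, show 2 * nrd θ * nrd c - (trd (θ' * c) * (trd c * trd θ - trd (θ * c)) -
        trd θ * trd (star c * θ * star c) + trd (θ' * θ * (star c * star c))) =
      trd (θ' * c) * trd (θ * c) + (nrd θ * (2 * nrd c) - trd θ * (trd (θ' * c) * trd c) +
        trd θ * trd (star c * θ * star c) - trd (θ' * θ * (star c * star c))) by ring]
    have h5 : V (trd (θ' * c) * trd (θ * c)) = 1 := by rw [map_mul, h1, h2, one_mul]
    rw [V.map_add_eq_of_lt_left, h5]
    rw [h5]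
    exact V.map_sub_lt (V.map_add_lt (V.map_sub_lt
      (val_mul_lt hn (val_mul_le (val_two_le V) (hR.nrd_le c hc)))
      (val_mul_lt ht (val_mul_le h2.le (hR.trd_le c hc))))
      (val_mul_lt ht (hR.trd_le _ (mul_mem (mul_mem hsc hθ) hsc)))) (h3 _ (mul_mem hsc hsc))
  · refine ⟨1, one_mem _, ?_⟩
    rw [hnrd, star_one, map_one, mul_one, mul_one, mul_one, trd_mul_comm,
      V.map_sub_eq_of_lt_right, h0]
    rw [h0, mul_comm]
    exact val_mul_lt hn (val_two_le V)

variable (V R) in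
/-- The local conditions under which the embeddings of the order generated by `θ` in `R` are
conjugate under the normalizer of `R`. -/
structure IsAdmissible (θ : Quat A α β) : Prop where
  order : IsIntegralOrder V R
  mem : θ ∈ R
  disc : Disc θ ≠ 0
  max : IsMaximalAt V θ
  anti : ∃ u ∈ R, nrd u ≠ 0 ∧ u * θ = star θ * u
  unit_or : V (Disc θ) = 1 ∨ IsUnimodular V R
  shift : V (Disc θ) < 1 →
    ∃ m, V m ≤ 1 ∧ V (trd θ - 2 * m) < 1 ∧ V (nrd θ - m * trd θ + m ^ 2) < 1

variable (R) in
/-- `z` is a scalar times a unit of `R`. -/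
def IsScalarMulUnit (z : (Quat A α β)ˣ) : Prop :=
  ∃ (c : Aˣ), ∃ s ∈ unitsOf R, z = scalarOf α β c * s

theorem IsScalarMulUnit.mul {y z : (Quat A α β)ˣ} (hy : IsScalarMulUnit R y)
    (hz : IsScalarMulUnit R z) : IsScalarMulUnit R (y * z) := by
  obtain ⟨c, s, hs, rfl⟩ := hy
  obtain ⟨c', s', hs', rfl⟩ := hz
  refine ⟨c * c', s * s', mul_mem hs hs', ?_⟩
  rw [mul_assoc, ← mul_assoc s, ← scalarOf_comm c' s, mul_assoc, ← mul_assoc]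
  simp only [scalarOf, map_mul]

theorem IsScalarMulUnit.inv {y : (Quat A α β)ˣ} (hy : IsScalarMulUnit R y) :
    IsScalarMulUnit R y⁻¹ := by
  obtain ⟨c, s, hs, rfl⟩ := hy
  refine ⟨c⁻¹, s⁻¹, inv_mem hs, ?_⟩
  rw [scalarOf_comm, mul_inv_rev, scalarOf, scalarOf, map_inv]

theorem isScalarMulUnit_of_mem {y : (Quat A α β)ˣ} (hy : y ∈ unitsOf R) : IsScalarMulUnit R y :=
  ⟨1, y, hy, by simp [scalarOf]⟩

theorem Normalizes.conj_unit {J s : (Quat A α β)ˣ} (hJ : Normalizes R J) (hs : s ∈ unitsOf R) :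
    J * s * J⁻¹ ∈ unitsOf R := by
  rw [mem_unitsOf] at hs ⊢
  refine ⟨?_, ?_⟩
  · exact hJ.conj_mem hs.1
  · have := hJ.conj_mem hs.2
    simpa [mul_assoc] using this

theorem conj_rearrange {G : Type*} [Group G] (c c' u u' J s s' : G) :
    c * (u * J * s) * (c' * (u' * J * s'))⁻¹ =
      c * (u * (J * (s * s'⁻¹) * J⁻¹) * u'⁻¹) * c'⁻¹ := by
  group

namespace IsAdmissible

variable {θ : Quat A α β}

theorem comm_shift {m : A} {k : Quat A α β} (hk : k * θ = θ * k) :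
    k * (θ + algebraMap A _ m) = (θ + algebraMap A _ m) * k := by
  rw [mul_add, add_mul, hk, scalar_comm]

theorem comm_of_shift {m : A} {k : Quat A α β}
    (hk : k * (θ + algebraMap A _ m) = (θ + algebraMap A _ m) * k) : k * θ = θ * k := by
  rw [mul_add, add_mul, scalar_comm] at hk
  exact add_right_cancel hk

variable (h : IsAdmissible V R θ)
include h

/-- In the ramified case, `θ` can be translated so that it becomes nilpotent modulo the maximal
ideal. -/
theorem exists_shift (hd : V (Disc θ) < 1) : ∃ m, V m ≤ 1 ∧
    IsMaximalAt V (θ + algebraMap A _ m) ∧ V (trd (θ + algebraMap A _ m)) < 1 ∧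
    V (nrd (θ + algebraMap A _ m)) < 1 := by
  obtain ⟨m, hm, h1, h2⟩ := h.shift hd
  refine ⟨-m, by rwa [Valuation.map_neg], fun k hk hk1 hk2 => ?_, ?_, ?_⟩
  · obtain ⟨a, b, ha, hb, e⟩ := h.max k (comm_of_shift hk) hk1 hk2
    refine ⟨a + b * m, b, V.map_add_le ha (val_mul_le hb hm), hb, ?_⟩
    rw [e, smul_add, map_add, Algebra.smul_def b (algebraMap A _ (-m)), ← map_mul, mul_neg, map_neg]
    abel
  · rw [trd_add, trd_algebraMap]; convert h1 using 2; ring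
  · rw [nrd_add, nrd_algebraMap, star_scalar, ← scalar_comm, ← Algebra.smul_def, trd_smul]
    convert h2 using 2; ring

/-- The elements `x` with `x θ x⁻¹ ∈ R`. -/
theorem exists_decomposition : ∃ J : (Quat A α β)ˣ, Normalizes R J ∧
    (IsUnimodular V R → J ∈ unitsOf R) ∧
    (∀ k : (Quat A α β)ˣ, (k : Quat A α β) * θ = θ * k → Normalizes R k → IsScalarMulUnit R k) ∧
    ∀ x : (Quat A α β)ˣ, (x : Quat A α β) * θ * ((x⁻¹ : (Quat A α β)ˣ) : Quat A α β) ∈ R →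
      ∃ y ∈ unitsOf R, ∃ k : (Quat A α β)ˣ, (k : Quat A α β) * θ = θ * k ∧
        (x = y * k ∨ x = y * J * k) := by
  rcases (h.order.Disc_le h.mem).lt_or_eq with hd | hd
  · have hU := h.unit_or.resolve_left hd.ne
    obtain ⟨m, hm, hmax, ht, hn⟩ := h.exists_shift hd
    have hmem := add_mem h.mem (h.order.scalar m hm)
    have hd' : Disc (θ + algebraMap A _ m) ≠ 0 := by rw [Disc_add_algebraMap]; exact h.disc
    -- In the ramified case conjugation by units of `R` is enough, so `J = 1`. In the unramified
    -- case below, `J` is the generator `j`.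
    refine ⟨1, normalizes_of_mem (one_mem _), fun _ => one_mem _, fun k hk hN =>
      exists_scalar_mul_unit_of_ramified h.order hU hmem hd' hmax ht hn (comm_shift hk) hN,
      fun x hx => ?_⟩
    have e : (x : Quat A α β) * (θ + algebraMap A _ m) * ((x⁻¹ : (Quat A α β)ˣ) : Quat A α β) =
        (x : Quat A α β) * θ * ((x⁻¹ : (Quat A α β)ˣ) : Quat A α β) + algebraMap A _ m := by
      rw [mul_add, add_mul, ← scalar_comm, mul_assoc _ (x : Quat A α β), Units.mul_inv, mul_one]
    obtain ⟨y, hy, hyθ⟩ := exists_conj_of_ramified h.order hU hmem hd' hmax ht hn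
      (add_mem hx (h.order.scalar m hm)) e
    exact ⟨y, hy, y⁻¹ * x, comm_of_shift (commutes_of_conj_eq e hyθ), Or.inl (by group)⟩
  · obtain ⟨u, hu, hu0, huθ⟩ := h.anti
    obtain ⟨j, hj, hjθ, hj'⟩ := exists_anticomm_generator h.order h.mem hd hu hu0 huθ
    refine ⟨j, normalizes_of_generator h.order h.mem hj hjθ hj',
      generator_mem_units h.order h.mem hd hj hjθ hj', fun k hk hN =>
      exists_scalar_mul_unit_of_unramified h.order h.mem hd hj hjθ hj' hk hN, fun x hx => ?_⟩
    obtain ⟨y, hy, hyθ⟩ := exists_conj_of_unramified h.order h.mem hd hjθ hx (trd_conj _ _)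
      (nrd_conj _ _)
    rcases hyθ with hyθ | hyθ
    · exact ⟨y, hy, y⁻¹ * x, commutes_of_conj_eq rfl hyθ, Or.inl (by group)⟩
    · exact ⟨y, hy, (y * j)⁻¹ * x, commutes_of_conj_eq rfl hyθ, Or.inr (by group)⟩

theorem exists_eq_mul {x : (Quat A α β)ˣ}
    (hx : (x : Quat A α β) * θ * ((x⁻¹ : (Quat A α β)ˣ) : Quat A α β) ∈ R) :
    ∃ z k : (Quat A α β)ˣ, Normalizes R z ∧ (k : Quat A α β) * θ = θ * k ∧ x = z * k := by
  obtain ⟨J, hJ, -, -, hx'⟩ := h.exists_decomposition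
  obtain ⟨y, hy, k, hk, rfl | rfl⟩ := hx' x hx
  · exact ⟨y, k, normalizes_of_mem hy, hk, rfl⟩
  · exact ⟨y * J, k, (normalizes_of_mem hy).mul hJ, hk, rfl⟩

theorem isScalarMulUnit_of_comm {k : (Quat A α β)ˣ} (hk : (k : Quat A α β) * θ = θ * k)
    (hN : Normalizes R k) : IsScalarMulUnit R k := by
  obtain ⟨J, -, -, hJ, -⟩ := h.exists_decomposition
  exact hJ k hk hN

/-- Modulo scalars and units of `R`, the normalizer has at most two classes, those of `1` and `J`.
Hence two elements that are both in the trivial class, or both outside it, differ by a scalar times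
a unit. This is what makes `Bil(R)` finite. -/
theorem isScalarMulUnit_mul_inv {y z : (Quat A α β)ˣ} (hy : Normalizes R y) (hz : Normalizes R z)
    (hiff : IsScalarMulUnit R y ↔ IsScalarMulUnit R z) : IsScalarMulUnit R (y * z⁻¹) := by
  obtain ⟨J, hJ, -, hk, hx⟩ := h.exists_decomposition
  have aux : ∀ x, Normalizes R x → IsScalarMulUnit R x ∨
      ∃ u ∈ unitsOf R, ∃ c : Aˣ, ∃ s ∈ unitsOf R, x = scalarOf α β c * (u * J * s) := by
    intro x hxN
    obtain ⟨u, hu, k, hkθ, rfl | rfl⟩ := hx x (hxN.conj_mem h.mem)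
    · have : Normalizes R k := by simpa using (normalizes_of_mem hu).inv.mul hxN
      exact Or.inl ((isScalarMulUnit_of_mem hu).mul (hk k hkθ this))
    · have : Normalizes R k := by simpa [mul_assoc] using ((normalizes_of_mem hu).mul hJ).inv.mul hxN
      obtain ⟨c, s, hs, rfl⟩ := hk k hkθ this
      exact Or.inr ⟨u, hu, c, s, hs, by
        rw [← mul_assoc (u * J), ← scalarOf_comm, mul_assoc]⟩
  by_cases hyS : IsScalarMulUnit R y
  · exact hyS.mul (hiff.mp hyS).inv
  · obtain ⟨u, hu, c, s, hs, rfl⟩ := (aux y hy).resolve_left hyS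
    obtain ⟨u', hu', c', s', hs', rfl⟩ := (aux z hz).resolve_left (fun h' => hyS (hiff.mpr h'))
    have hsc : ∀ c : Aˣ, IsScalarMulUnit R (scalarOf α β c) := fun c =>
      ⟨c, 1, one_mem _, (mul_one _).symm⟩
    have hm : u * (J * (s * s'⁻¹) * J⁻¹) * u'⁻¹ ∈ unitsOf R := by
      have := hJ.conj_unit (mul_mem hs (inv_mem hs'))
      exact mul_mem (mul_mem hu this) (inv_mem hu')
    have h1 := (hsc c).mul (isScalarMulUnit_of_mem hm)
    have h2 := h1.mul (hsc c').inv
    rw [conj_rearrange]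
    convert h2 using 1

/-- Here `J` itself is a unit, so the places prime to the discriminant contribute nothing to
`Bil(R)`. -/
theorem isScalarMulUnit_of_isUnimodular (hU : IsUnimodular V R) {z : (Quat A α β)ˣ}
    (hz : Normalizes R z) : IsScalarMulUnit R z := by
  obtain ⟨J, hJ, hJ', hk, hx⟩ := h.exists_decomposition
  obtain ⟨u, hu, k, hkθ, rfl | rfl⟩ := hx z (hz.conj_mem h.mem)
  · have : Normalizes R k := by simpa using (normalizes_of_mem hu).inv.mul hz
    exact (isScalarMulUnit_of_mem hu).mul (hk k hkθ this)
  · have hu' := mul_mem hu (hJ' hU)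
    have : Normalizes R k := by simpa [mul_assoc] using (normalizes_of_mem hu').inv.mul hz
    exact (isScalarMulUnit_of_mem hu').mul (hk k hkθ this)

end IsAdmissible

end Admissible

/-! ### Units missed by the norm form of an Eisenstein polynomial -/

section NormForm

variable {O : Type*} [CommRing O] [IsDomain O] [IsDiscreteValuationRing O]

/-- Modulo `π` the polynomial `ε x + η x²` vanishes at two different points, `0` and `-ε/η`. A
non-injective self-map of a finite field is not surjective. -/
theorem exists_not_dvd_quadratic [Finite (IsLocalRing.ResidueField O)] {π : O}
    (hπ : Irreducible π) {ε η : O} (hε : IsUnit ε) (hη : IsUnit η) :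
    ∃ c : O, ∀ x : O, ¬ π ∣ ε * x + η * x ^ 2 - c := by
  set r := IsLocalRing.residue O
  have hr : ∀ x, π ∣ x ↔ r x = 0 := fun x => by
    rw [IsLocalRing.residue_eq_zero_iff, hπ.maximalIdeal_eq, Ideal.mem_span_singleton]
  have hε0 : r ε ≠ 0 := (hε.map r).ne_zero
  have hη0 : r η ≠ 0 := (hη.map r).ne_zero
  let f : IsLocalRing.ResidueField O → IsLocalRing.ResidueField O := fun x => r ε * x + r η * x ^ 2
  have hf : ¬ Function.Injective f := fun h => by
    have : f 0 = f (-(r ε / r η)) := by simp only [f]; field_simp; ring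
    exact (neg_ne_zero.2 (div_ne_zero hε0 hη0)) (h this).symm
  rw [Finite.injective_iff_surjective, Function.Surjective] at hf
  push Not at hf
  obtain ⟨c, hc⟩ := hf
  obtain ⟨c, rfl⟩ := IsLocalRing.residue_surjective c
  refine ⟨c, fun x hx => hc (r x) ?_⟩
  rw [hr, map_sub, map_add, map_mul, map_mul, map_pow, sub_eq_zero] at hx
  exact hx

/-- Some unit is not represented by the norm form of an Eisenstein polynomial. -/
theorem exists_unit_not_norm [Finite (IsLocalRing.ResidueField O)] {π : O}
    (hπ : Irreducible π) (h2 : (2 : O) ≠ 0) {t n₀ : O} (ht : π ∣ t) (hn : IsUnit n₀) :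
    ∃ u : O, IsUnit u ∧ ∀ a b : O, a ^ 2 + a * b * t + b ^ 2 * (π * n₀) ≠ u := by
  have hp : Prime π := hπ.prime
  have hunit : ∀ x : O, ¬ π ∣ x → IsUnit x := fun x hx => by
    by_contra h
    rw [← mem_nonunits_iff, ← IsLocalRing.mem_maximalIdeal, hπ.maximalIdeal_eq,
      Ideal.mem_span_singleton] at h
    exact hx h
  have hn0 : ¬ π ∣ n₀ := fun h => hp.not_isUnit (isUnit_of_dvd_unit h hn)
  have hlt : ∀ x y : O, ¬ x ∣ y → x ≠ 0 → ∃ s, x = y * (π * s) := fun x y h _ => by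
    obtain ⟨s, hs⟩ := (ValuationRing.dvd_total x y).resolve_left h
    by_cases h' : π ∣ s
    · obtain ⟨s, rfl⟩ := h'
      exact ⟨s, hs⟩
    · obtain ⟨u, rfl⟩ := hunit s h'
      exact absurd ⟨((u⁻¹ : Oˣ) : O), by rw [hs, mul_assoc, Units.mul_inv, mul_one]⟩ h
  obtain ⟨t₁, rfl⟩ := ht
  -- Over a valuation ring a pair is a multiple of a pair in which one coordinate is `1`. It is
  -- applied to `(a - 1, b)`, since the unit to be avoided is close to `1`.
  have hgcd : ∀ x b : O, ∃ m x' b', x = m * x' ∧ b = m * b' ∧ (x' = 1 ∨ b' = 1) := fun x b => by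
    rcases ValuationRing.dvd_total x b with ⟨b', rfl⟩ | ⟨x', rfl⟩
    · exact ⟨x, 1, b', by simp⟩
    · exact ⟨b, x', 1, by simp⟩
  by_cases hcase : 2 * π ∣ π * t₁
  · -- the different of the polynomial is generated by `2`
    obtain ⟨s, hs⟩ := hcase
    have hs' : t₁ = 2 * s := mul_left_cancel₀ hp.ne_zero (by linear_combination hs)
    subst hs'
    -- The missed unit is `1 + 4c`, where `c` is not of the form `x + x²` modulo `π`.
    obtain ⟨c, hc⟩ := exists_not_dvd_quadratic hπ (isUnit_one (M := O)) isUnit_one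
    refine ⟨1 + 4 * c, hunit _ fun h => ?_, fun a b hab => ?_⟩
    · by_cases h2 : π ∣ 2
      · exact hp.not_dvd_one ((dvd_add_left (h2.trans ⟨2 * c, by ring⟩)).1 h)
      · obtain ⟨e, he⟩ := hunit 2 h2
        -- If `2` is a unit and `1 + 4c ≡ 0`, then `c ≡ x + x²` for `x = -1/2`.
        refine hc (-((e⁻¹ : Oˣ) : O)) ((hp.dvd_or_dvd (a := 4) ?_).resolve_left fun h4 => h2 ?_)
        · have : (2 : O) * ((e⁻¹ : Oˣ) : O) = 1 := by rw [← he, Units.mul_inv]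
          obtain ⟨y, hy⟩ := h
          refine ⟨-y, ?_⟩
          linear_combination -hy + (-1 + 2 * ((e⁻¹ : Oˣ) : O)) * this
        · exact (hp.dvd_or_dvd (a := 2) (b := 2) (by convert h4 using 1; norm_num)).elim id id
    · obtain ⟨m, x', b', hx, hb, h1⟩ := hgcd (a - 1) b
      have ha : a = 1 + m * x' := by linear_combination hx
      subst ha hb
      -- If `2` divides `m`, division of the equation by `4` represents `c` by `x + x²`. If not, `2
      -- = m π q`, and division by `m²` leaves an Eisenstein equation: `π` divides `x'`, so `b' =
      -- 1`, and then `π` divides the unit `n₀`.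
      by_cases hm : 2 ∣ m
      · obtain ⟨m, rfl⟩ := hm
        refine hc (m * x') ⟨-((1 + 2 * m * x') * (m * b') * s + (m * b') ^ 2 * n₀), ?_⟩
        refine mul_left_cancel₀ (mul_ne_zero h2 h2) ?_
        linear_combination hab
      · have hm0 : m ≠ 0 := by
          rintro rfl
          refine hc 0 ⟨0, ?_⟩
          refine mul_left_cancel₀ (mul_ne_zero h2 h2) ?_
          linear_combination hab
        obtain ⟨q, hq⟩ : ∃ q, 2 = m * (π * q) := hlt 2 m hm h2
        have e : x' ^ 2 + π * q * x' + (1 + m * x') * b' * π * (π * q) * s + b' ^ 2 * (π * n₀) =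
            π ^ 2 * q ^ 2 * c := by
          refine mul_left_cancel₀ (mul_ne_zero hm0 hm0) ?_
          linear_combination hab + (2 * c + c * m * π * q - m * x' -
            (1 + m * x') * m * b' * π * s) * hq
        have hx' : π ∣ x' := hp.dvd_of_dvd_pow (n := 2) ⟨π * q ^ 2 * c - q * x' -
          (1 + m * x') * b' * (π * q) * s - b' ^ 2 * n₀, by linear_combination e⟩
        have hb' : b' = 1 := h1.resolve_left fun h => hp.not_dvd_one (h ▸ hx')
        obtain ⟨y, rfl⟩ := hx'
        subst hb'
        refine hn0 ⟨q ^ 2 * c - y ^ 2 - q * y - (1 + m * (π * y)) * q * s, ?_⟩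
        refine mul_left_cancel₀ hp.ne_zero ?_
        linear_combination e
  · -- the different of the polynomial is generated by `t`
    obtain ⟨s, hs⟩ : ∃ s, 2 * π = (π * t₁) * (π * s) := hlt _ _ hcase (mul_ne_zero h2 hp.ne_zero)
    have hs : 2 = π * t₁ * s := mul_right_cancel₀ hp.ne_zero (by linear_combination hs)
    have ht0 : t₁ ≠ 0 := by rintro rfl; simp at hs; exact h2 hs
    -- The missed unit is now `1 + π t₁² c`, where `c` is not of the form `x + n₀ x²` modulo `π`.
    obtain ⟨c, hc⟩ := exists_not_dvd_quadratic hπ (isUnit_one (M := O)) hn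
    refine ⟨1 + π * t₁ ^ 2 * c, hunit _ fun h => hp.not_dvd_one
      ((dvd_add_left ⟨t₁ ^ 2 * c, by ring⟩).1 h), fun a b hab => ?_⟩
    obtain ⟨m, x', b', hx, hb, h1⟩ := hgcd (a - 1) b
    have ha : a = 1 + m * x' := by linear_combination hx
    subst ha hb
    -- The same alternative with `t₁` in place of `2`. If `t₁` divides `m`, division by `t₁²` gives
    -- first `π ∣ m x'` and then, after division by `π`, a representation of `c`.
    by_cases hm : t₁ ∣ m
    · obtain ⟨m, rfl⟩ := hm
      have e : (m * x') ^ 2 + π * s * (m * x') + (1 + t₁ * m * x') * (m * b') * π +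
          (m * b') ^ 2 * (π * n₀) = π * c := by
        refine mul_left_cancel₀ (mul_ne_zero ht0 ht0) ?_
        linear_combination hab - t₁ * m * x' * hs
      obtain ⟨y, hy⟩ : π ∣ m * x' := hp.dvd_of_dvd_pow (n := 2) ⟨c - s * (m * x') -
        (1 + t₁ * m * x') * (m * b') - (m * b') ^ 2 * n₀, by linear_combination e⟩
      refine hc (m * b') ⟨-(y ^ 2 + s * y + t₁ * y * (m * b')), ?_⟩
      refine mul_left_cancel₀ hp.ne_zero ?_
      linear_combination e - (m * x' + π * y + π * s + t₁ * m * b' * π) * hy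
    · have hm0 : m ≠ 0 := by
        rintro rfl
        refine hc 0 ⟨0, ?_⟩
        refine mul_left_cancel₀ (mul_ne_zero hp.ne_zero (mul_ne_zero ht0 ht0)) ?_
        linear_combination hab
      obtain ⟨q, hq⟩ : ∃ q, t₁ = m * (π * q) := hlt t₁ m hm ht0
      have e : x' ^ 2 + π ^ 2 * q * s * x' + (1 + m * x') * b' * π * (π * q) + b' ^ 2 * (π * n₀) =
          π * (π ^ 2 * q ^ 2 * c) := by
        refine mul_left_cancel₀ (mul_ne_zero hm0 hm0) ?_
        linear_combination hab - m * x' * hs + (π * c * t₁ + π * c * m * π * q - (1 + m * x') * m * b' * π - m * x' * π * s) * hq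
      have hx' : π ∣ x' := hp.dvd_of_dvd_pow (n := 2) ⟨π ^ 2 * q ^ 2 * c - π * q * s * x' -
        (1 + m * x') * b' * (π * q) - b' ^ 2 * n₀, by linear_combination e⟩
      have hb' : b' = 1 := h1.resolve_left fun h => hp.not_dvd_one (h ▸ hx')
      obtain ⟨y, rfl⟩ := hx'
      subst hb'
      refine hn0 ⟨π * q ^ 2 * c - y ^ 2 - π * q * s * y - (1 + m * (π * y)) * q, ?_⟩
      refine mul_left_cancel₀ hp.ne_zero ?_
      linear_combination e

end NormForm

/-! ### The completions of a number field -/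

section LocalField

variable {F : Type*} [Field F] [NumberField F] (v : FinPlace F)

theorem valued_algebraMap (t : F) :
    Valued.v (algebraMap F (v.adicCompletion F) t) = v.valuation F t :=
  v.valuedAdicCompletion_eq_valuation' t

theorem valued_algebraMap_int_le (t : 𝓞 F) :
    Valued.v (algebraMap F (v.adicCompletion F) t) ≤ 1 := by
  rw [valued_algebraMap]
  exact v.valuation_le_one t

theorem exists_algebraMap_sub_lt (x : v.adicCompletion F) {γ : ℤᵐ⁰} (hγ : γ ≠ 0) :
    ∃ t : F, Valued.v (algebraMap F (v.adicCompletion F) t - x) < γ := by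
  have h : {y : v.adicCompletion F | Valued.v (y - x) < γ} ∈ nhds x := by
    rw [Valued.mem_nhds]
    obtain ⟨z, hz⟩ := v.valuedAdicCompletion_surjective F γ
    have hz0 : z ≠ 0 := by rintro rfl; simp at hz; exact hγ hz.symm
    refine ⟨Units.mk0 (Valued.v.restrict z) ?_, ?_⟩
    · simpa using hz0
    · intro y hy
      simp only [Set.mem_ofPred_eq, Units.val_mk0] at hy ⊢
      rw [← hz]
      exact (Valuation.restrict_lt_iff (v := Valued.v)).1 hy
  obtain ⟨_, ⟨t, rfl⟩, ht⟩ := (HeightOneSpectrum.denseRange_algebraMap (K := F) v).inter_nhds_nonempty h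
  exact ⟨t, ‹_›⟩

theorem exists_int_sub_lt {x : v.adicCompletion F} (hx : Valued.v x ≤ 1) :
    ∃ r : 𝓞 F, Valued.v (algebraMap F (v.adicCompletion F) r - x) < 1 := by
  obtain ⟨t, ht⟩ := exists_algebraMap_sub_lt v x one_ne_zero
  have ht1 : v.valuation F t ≤ 1 := by
    rw [← valued_algebraMap, ← sub_add_cancel (algebraMap F (v.adicCompletion F) t) x]
    exact (Valued.v.map_add _ _).trans (max_le ht.le hx)
  obtain ⟨r, hr⟩ := v.exists_valuation_sub_lt_of_integer ht1 (γ := 1)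
  refine ⟨r, ?_⟩
  rw [← sub_add_sub_cancel _ (algebraMap F (v.adicCompletion F) t)]
  refine (Valued.v.map_add _ _).trans_lt (max_lt ?_ ht)
  rw [← map_sub, valued_algebraMap]
  exact hr

/-- By density `𝓞 F` surjects onto the residue field, and the map factors through the finite ring `𝓞
F ⧸ v`. -/
instance finite_residueField :
    Finite (IsLocalRing.ResidueField (v.adicCompletionIntegers F)) := by
  have : Finite (𝓞 F ⧸ v.asIdeal) := v.asIdeal.finiteQuotientOfFreeOfNeBot v.ne_bot
  let f : 𝓞 F →+* IsLocalRing.ResidueField (v.adicCompletionIntegers F) :=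
    (IsLocalRing.residue _).comp (algebraMap _ _)
  have hf : ∀ a ∈ v.asIdeal, f a = 0 := fun a ha => by
    refine (IsLocalRing.residue_eq_zero_iff _).2 ?_
    rw [IsLocalRing.mem_maximalIdeal, mem_nonunits_iff,
      HeightOneSpectrum.adicCompletionIntegers.isUnit_iff_valued_eq_one]
    refine ne_of_lt ?_
    have := (v.valuation_lt_one_iff_mem (K := F) a).2 ha
    rwa [← valued_algebraMap] at this
  refine Finite.of_surjective (Ideal.Quotient.lift _ f hf) fun y => ?_
  obtain ⟨y, rfl⟩ := IsLocalRing.residue_surjective y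
  obtain ⟨r, hr⟩ := exists_int_sub_lt v y.2
  refine ⟨Ideal.Quotient.mk _ r, ?_⟩
  rw [Ideal.Quotient.lift_mk]
  refine sub_eq_zero.1 ?_
  rw [RingHom.comp_apply, ← map_sub, IsLocalRing.residue_eq_zero_iff,
    IsLocalRing.mem_maximalIdeal, mem_nonunits_iff,
    HeightOneSpectrum.adicCompletionIntegers.isUnit_iff_valued_eq_one]
  exact ne_of_lt hr

instance charZero_adicCompletion : CharZero (v.adicCompletion F) :=
  charZero_of_injective_algebraMap (algebraMap F (v.adicCompletion F)).injective

/-- The map `y ↦ c - y²` is a contraction of the closed ball of radius `‖c‖ < 1`; its fixed point is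
the solution. -/
theorem exists_sq_add_self {c : v.adicCompletion F} (hc : Valued.v c < 1) :
    ∃ y : v.adicCompletion F, y ^ 2 + y = c := by
  have hc' : ‖c‖ < 1 := Valued.toNormedField.norm_lt_one_iff.2 hc
  let s : Set (v.adicCompletion F) := Metric.closedBall 0 ‖c‖
  let f : v.adicCompletion F → v.adicCompletion F := fun y => c - y ^ 2
  have hs : IsComplete s := Metric.isClosed_closedBall.isComplete
  have hu : ∀ x y : v.adicCompletion F, ‖x + y‖ ≤ max ‖x‖ ‖y‖ := fun x y =>
    IsUltrametricDist.norm_add_le_max x y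
  have hu' : ∀ x y : v.adicCompletion F, ‖x - y‖ ≤ max ‖x‖ ‖y‖ := fun x y =>
    by simpa [sub_eq_add_neg] using hu x (-y)
  have hmaps : Set.MapsTo f s s := fun y hy => by
    have hy : ‖y‖ ≤ ‖c‖ := by simpa [s] using hy
    have : ‖c - y ^ 2‖ ≤ ‖c‖ := by
      refine (hu' _ _).trans (max_le le_rfl ?_)
      rw [norm_pow]
      nlinarith [norm_nonneg y, norm_nonneg c]
    simpa [s, f] using this
  have hcontr : ContractingWith ‖c‖₊ (hmaps.restrict f s s) := by
    refine ⟨by exact_mod_cast hc', LipschitzWith.of_dist_le_mul fun x y => ?_⟩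
    have hx : ‖(x : v.adicCompletion F)‖ ≤ ‖c‖ := mem_closedBall_zero_iff.1 x.2
    have hy : ‖(y : v.adicCompletion F)‖ ≤ ‖c‖ := mem_closedBall_zero_iff.1 y.2
    rw [Subtype.dist_eq, Subtype.dist_eq, dist_eq_norm, dist_eq_norm]
    have e : ((hmaps.restrict f s s x : s) : v.adicCompletion F) -
        (hmaps.restrict f s s y : s) = -((x + y : v.adicCompletion F) * (x - y)) := by
      change (c - (x : v.adicCompletion F) ^ 2) - (c - (y : v.adicCompletion F) ^ 2) = _
      ring
    rw [e, norm_neg, norm_mul]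
    exact mul_le_mul_of_nonneg_right ((hu _ _).trans (max_le hx hy)) (norm_nonneg _)
  obtain ⟨y, -, hy, -⟩ := hcontr.exists_fixedPoint' hs hmaps (x := 0) (by simp [s])
    (edist_ne_top _ _)
  refine ⟨y, ?_⟩
  have : c - y ^ 2 = y := hy
  linear_combination -this

/-- With `y² + y = c`, this is `(2 y + 1)²`. The factor `4` makes the statement valid above `2` as
well. -/
theorem isSquare_one_add_four_mul {c : v.adicCompletion F} (hc : Valued.v c < 1) :
    IsSquare (1 + 4 * c) := by
  obtain ⟨y, rfl⟩ := exists_sq_add_self v hc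
  exact ⟨2 * y + 1, by ring⟩

end LocalField

/-! ### The conductor of a quadratic character -/

section Conductor

variable {F : Type*} [Field F] [NumberField F] (v : FinPlace F)

theorem mem_maximalIdeal_iff (x : v.adicCompletionIntegers F) :
    x ∈ IsLocalRing.maximalIdeal (v.adicCompletionIntegers F) ↔
      Valued.v (x : v.adicCompletion F) < 1 := by
  rw [IsLocalRing.mem_maximalIdeal, mem_nonunits_iff,
    HeightOneSpectrum.adicCompletionIntegers.isUnit_iff_valued_eq_one]
  exact ⟨fun h => lt_of_le_of_ne x.2 h, fun h => ne_of_lt h⟩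

theorem residue_eq_zero_iff_lt (x : v.adicCompletionIntegers F) :
    IsLocalRing.residue _ x = 0 ↔ Valued.v (x : v.adicCompletion F) < 1 := by
  rw [IsLocalRing.residue_eq_zero_iff, mem_maximalIdeal_iff]

theorem exists_uniformizer : ∃ π : v.adicCompletionIntegers F, Irreducible π ∧
    ∀ x : v.adicCompletion F, Valued.v x < 1 ↔
      ∃ y : v.adicCompletionIntegers F, x = π * y := by
  obtain ⟨π, hπ⟩ := IsDiscreteValuationRing.exists_irreducible (v.adicCompletionIntegers F)
  refine ⟨π, hπ, fun x => ⟨fun h => ?_, ?_⟩⟩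
  · have := (mem_maximalIdeal_iff v ⟨x, h.le⟩).2 h
    rw [hπ.maximalIdeal_eq, Ideal.mem_span_singleton] at this
    obtain ⟨y, hy⟩ := this
    exact ⟨y, congrArg Subtype.val hy⟩
  · rintro ⟨y, rfl⟩
    have : π * y ∈ IsLocalRing.maximalIdeal (v.adicCompletionIntegers F) := by
      rw [hπ.maximalIdeal_eq, Ideal.mem_span_singleton]
      exact dvd_mul_right π y
    exact (mem_maximalIdeal_iff v (π * y)).1 this

theorem coe_two : ((2 : v.adicCompletionIntegers F) : v.adicCompletion F) = 2 :=
  map_ofNat (v.adicCompletionIntegers F).subtype 2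

theorem coe_four : ((4 : v.adicCompletionIntegers F) : v.adicCompletion F) = 4 :=
  map_ofNat (v.adicCompletionIntegers F).subtype 4

theorem val_two_le_one : Valued.v (2 : v.adicCompletion F) ≤ 1 := by
  rw [← coe_two]
  exact (2 : v.adicCompletionIntegers F).2

theorem val_two_eq : Valued.v (2 : v.adicCompletion F) = v.valuation F 2 := by
  rw [← valued_algebraMap, map_ofNat (algebraMap F (v.adicCompletion F)) 2]

/-- Units congruent to `1` modulo `4π` are squares. Hence the infimum in `condExponent` is taken
over a nonempty set and is attained, so the value `0` is never an artefact of the empty set. -/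
theorem exists_isLocalNorm_of_near_one (ξ : F) :
    ∃ n : ℕ, ∀ u : (v.adicCompletionIntegers F)ˣ,
    (u : v.adicCompletionIntegers F) - 1 ∈
      IsLocalRing.maximalIdeal (v.adicCompletionIntegers F) ^ n →
    IsLocalNorm v ξ ((u : v.adicCompletionIntegers F) : v.adicCompletion F) := by
  obtain ⟨π, hπ, -⟩ := exists_uniformizer v
  have h4 : (4 : v.adicCompletionIntegers F) ≠ 0 := fun h => by
    have h : (4 : v.adicCompletion F) = 0 := by rw [← coe_four, h]; rfl
    norm_num at h
  obtain ⟨n, e, hn⟩ := IsDiscreteValuationRing.associated_pow_irreducible h4 hπ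
  refine ⟨n + 1, fun u hu => ?_⟩
  rw [hπ.maximalIdeal_eq, Ideal.span_singleton_pow, Ideal.mem_span_singleton] at hu
  obtain ⟨y, hy⟩ := hu
  have hlt : Valued.v ((π * e * y : v.adicCompletionIntegers F) : v.adicCompletion F) < 1 := by
    rw [← mem_maximalIdeal_iff, hπ.maximalIdeal_eq, Ideal.mem_span_singleton]
    exact ⟨e * y, by ring⟩
  obtain ⟨s, hs⟩ := isSquare_one_add_four_mul v hlt
  refine ⟨s, 0, ?_⟩
  rw [sq, ← hs]
  have : (u : v.adicCompletionIntegers F) = 1 + 4 * (π * e * y) := by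
    rw [← sub_eq_iff_eq_add', hy, pow_succ, ← hn]; ring
  rw [this, ← coe_four]
  push_cast
  ring

theorem isLocalNorm_of_mem_pow_condExponent (ξ : F) (u : (v.adicCompletionIntegers F)ˣ)
    (hu : (u : v.adicCompletionIntegers F) - 1 ∈
      IsLocalRing.maximalIdeal (v.adicCompletionIntegers F) ^ condExponent v ξ) :
    IsLocalNorm v ξ ((u : v.adicCompletionIntegers F) : v.adicCompletion F) :=
  Nat.sInf_mem (exists_isLocalNorm_of_near_one v ξ) u hu

theorem isLocalNorm_of_condExponent_eq_zero {ξ : F} (h : condExponent v ξ = 0)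
    {u : v.adicCompletion F} (hu : Valued.v u = 1) : IsLocalNorm v ξ u := by
  obtain ⟨w, hw⟩ : IsUnit (⟨u, hu.le⟩ : v.adicCompletionIntegers F) :=
    HeightOneSpectrum.adicCompletionIntegers.isUnit_iff_valued_eq_one.2 hu
  have := isLocalNorm_of_mem_pow_condExponent v ξ w (by simp [h])
  rwa [hw] at this

theorem condExponent_eq_zero_of_forall {ξ : F}
    (h : ∀ u : v.adicCompletion F, Valued.v u = 1 → IsLocalNorm v ξ u) :
    condExponent v ξ = 0 :=
  Nat.sInf_eq_zero.2 (Or.inl fun u _ => h _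
    (HeightOneSpectrum.adicCompletionIntegers.isUnit_iff_valued_eq_one.1 u.isUnit))

theorem val_four_inv_lt {c : v.adicCompletion F} (h2 : Valued.v (2 : v.adicCompletion F) = 1)
    {x : v.adicCompletion F} (hx : Valued.v x = 1) (hc : Valued.v c < 1) :
    Valued.v (c / (4 * x)) < 1 := by
  have h4 : (4 : v.adicCompletion F) = 2 * 2 := by norm_num
  rw [h4, map_div₀, map_mul, map_mul, h2, hx, one_mul, one_mul, div_one]
  exact hc

/-- In the finite residue field, of odd order, a count of values gives `u ≡ x² - ξ y²`. One of `x`,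
`y` is a unit, and the error can be absorbed in it, as `1 + 4c` is a square for small `c`. -/
theorem condExponent_eq_zero_of_unit {ξ : F} (h2 : v.valuation F 2 = 1)
    (hξ : v.valuation F ξ = 1) : condExponent v ξ = 0 := by
  refine condExponent_eq_zero_of_forall v fun u hu => ?_
  have h2' : Valued.v (2 : v.adicCompletion F) = 1 := by
    rw [val_two_eq, h2]
  set r := IsLocalRing.residue (v.adicCompletionIntegers F)
  set z := algebraMap F (v.adicCompletion F) ξ with hz
  have hz1 : Valued.v z = 1 := by rw [hz, valued_algebraMap, hξ]
  let u' : v.adicCompletionIntegers F := ⟨u, hu.le⟩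
  let z' : v.adicCompletionIntegers F := ⟨z, hz1.le⟩
  have hz0 : r z' ≠ 0 := fun h => by
    have := (residue_eq_zero_iff_lt v _).1 h
    simp [z', hz1] at this
  have := Fintype.ofFinite (IsLocalRing.ResidueField (v.adicCompletionIntegers F))
  have hodd : Fintype.card (IsLocalRing.ResidueField (v.adicCompletionIntegers F)) % 2 = 1 := by
    refine FiniteField.odd_card_of_char_ne_two fun h => ?_
    have h : r 2 = 0 := by
      rw [map_ofNat]
      have := CharP.cast_eq_zero (IsLocalRing.ResidueField (v.adicCompletionIntegers F))
        (ringChar (IsLocalRing.ResidueField (v.adicCompletionIntegers F)))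
      rw [h] at this
      exact_mod_cast this
    have := (residue_eq_zero_iff_lt v _).1 h
    rw [coe_two] at this
    exact absurd h2' (ne_of_lt this)
  obtain ⟨x, y, hxy⟩ := FiniteField.exists_root_sum_quadratic
    (f := Polynomial.X ^ 2 - Polynomial.C (r u')) (g := Polynomial.C (-r z') * Polynomial.X ^ 2)
    (Polynomial.degree_X_pow_sub_C two_pos _)
    (Polynomial.degree_C_mul_X_pow 2 (neg_ne_zero.2 hz0)) hodd
  obtain ⟨x, rfl⟩ := IsLocalRing.residue_surjective x
  obtain ⟨y, rfl⟩ := IsLocalRing.residue_surjective y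
  have he : Valued.v ((u + z * y ^ 2 - x ^ 2 : v.adicCompletion F)) < 1 := by
    have e : ((u' + z' * y ^ 2 - x ^ 2 : v.adicCompletionIntegers F) : v.adicCompletion F) =
        u + z * y ^ 2 - x ^ 2 := by push_cast; rfl
    rw [← e, ← residue_eq_zero_iff_lt]
    simp at hxy
    rw [map_sub, map_add, map_mul, map_pow, map_pow]
    linear_combination -hxy
  rcases (show Valued.v (x : v.adicCompletion F) ≤ 1 from x.2).lt_or_eq with hx | hx
  · rcases (show Valued.v (y : v.adicCompletion F) ≤ 1 from y.2).lt_or_eq with hy | hy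
    · exfalso
      have h : Valued.v u < 1 := by
        have e : u = (u + z * y ^ 2 - x ^ 2) - z * y ^ 2 + x ^ 2 := by ring
        rw [e]
        refine Valuation.map_add_lt _ (Valuation.map_sub_lt _ he ?_) ?_
        · rw [map_mul, hz1, one_mul, map_pow]; exact pow_lt_one₀ zero_le hy two_ne_zero
        · rw [map_pow]; exact pow_lt_one₀ zero_le hx two_ne_zero
      exact absurd hu h.ne
    · have hy0 : (y : v.adicCompletion F) ≠ 0 := fun h => by simp [h] at hy
      have hz0 : z ≠ 0 := fun h => by simp [h] at hz1
      obtain ⟨s, hs⟩ := isSquare_one_add_four_mul v (val_four_inv_lt v h2' (x := z * y ^ 2)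
        (c := - (u + z * y ^ 2 - x ^ 2)) (by rw [map_mul, map_pow, hy, hz1]; simp)
        (by rw [Valuation.map_neg]; exact he))
      refine ⟨x, y * s, ?_⟩
      rw [← hz, mul_pow, sq s, ← hs]
      field_simp
      ring
  · have hx0 : (x : v.adicCompletion F) ≠ 0 := fun h => by simp [h] at hx
    obtain ⟨s, hs⟩ := isSquare_one_add_four_mul v (val_four_inv_lt v h2' (x := x ^ 2)
      (c := (u + z * y ^ 2 - x ^ 2)) (by rw [map_pow, hx, one_pow]) he)
    refine ⟨x * s, y, ?_⟩
    rw [← hz, mul_pow, sq s, ← hs]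
    field_simp
    ring

theorem finite_valuation_ne_one {t : F} (ht : t ≠ 0) :
    {v : FinPlace F | v.valuation F t ≠ 1}.Finite := by
  have h1 := HeightOneSpectrum.Support.finite (R := 𝓞 F) (K := F) t
  have h2 := HeightOneSpectrum.Support.finite (R := 𝓞 F) (K := F) t⁻¹
  refine (h1.union h2).subset fun v hv => ?_
  rcases lt_or_gt_of_ne hv with h | h
  · right
    simp only [HeightOneSpectrum.Support, Set.mem_ofPred_eq, map_inv₀]
    exact (one_lt_inv₀ (by simpa [zero_lt_iff] using ht)).2 h
  · left
    exact h

theorem finite_condExponent_ne_zero {ξ : F} (hξ : ξ ≠ 0) :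
    {v : FinPlace F | condExponent v ξ ≠ 0}.Finite := by
  refine ((finite_valuation_ne_one (F := F) two_ne_zero).union
    (finite_valuation_ne_one hξ)).subset fun v hv => ?_
  by_contra h
  simp only [Set.mem_union, Set.mem_ofPred_eq, not_or, not_not] at h
  exact hv (condExponent_eq_zero_of_unit v h.1 h.2)

/-- For `ξ ≠ 0` only finitely many exponents are nonzero, so the `finprod` defining the conductor is
a genuine product and not the default value `1`. -/
theorem dvd_quadConductor_iff {ξ : F} (hξ : ξ ≠ 0) :
    v.asIdeal ∣ quadConductor ξ ↔ condExponent v ξ ≠ 0 := by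
  have hfin : (Function.mulSupport fun v : FinPlace F => v.asIdeal ^ condExponent v ξ).Finite :=
    (finite_condExponent_ne_zero hξ).subset fun v hv h => hv (by simp [h])
  rw [quadConductor, finprod_eq_prod _ hfin]
  constructor
  · intro h
    obtain ⟨w, -, hw⟩ := (v.prime.dvd_finsetProd_iff _).1 h
    have h0 : condExponent w ξ ≠ 0 := fun h0 => by
      rw [h0, pow_zero] at hw
      exact v.prime.not_isUnit (isUnit_of_dvd_one hw)
    have h1 := v.prime.dvd_of_dvd_pow hw
    have : v = w := HeightOneSpectrum.ext
      ((w.isMaximal.eq_of_le v.isPrime.ne_top (Ideal.dvd_iff_le.1 h1)).symm)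
    rwa [this]
  · intro h
    refine (dvd_pow_self _ h).trans (Finset.dvd_prod_of_mem _ ?_)
    rw [Set.Finite.mem_toFinset, Function.mem_mulSupport]
    intro h1
    exact v.prime.not_isUnit ((isUnit_pow_iff h).1 (h1 ▸ isUnit_one))

theorem not_dvd_of_isCoprime {I J : Ideal (𝓞 F)} (h : IsCoprime I J) (hI : v.asIdeal ∣ I) :
    ¬ v.asIdeal ∣ J := fun hJ =>
  v.prime.not_isUnit (h.isUnit_of_dvd' hI hJ)

/-- The residue field is perfect: a quadratic polynomial whose discriminant is not a unit has a
double root modulo the maximal ideal. -/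
theorem exists_double_root {t n : v.adicCompletion F} (ht : Valued.v t ≤ 1) (hn : Valued.v n ≤ 1)
    (hd : Valued.v (t ^ 2 - 4 * n) < 1) :
    ∃ m, Valued.v m ≤ 1 ∧ Valued.v (t - 2 * m) < 1 ∧ Valued.v (n - m * t + m ^ 2) < 1 := by
  have h2 := val_two_le_one v
  have h4 : (4 : v.adicCompletion F) = 2 ^ 2 := by norm_num
  rcases h2.lt_or_eq with h2 | h2
  · have ht1 : Valued.v t < 1 := by
      have : Valued.v (t ^ 2) < 1 := by
        rw [← sub_add_cancel (t ^ 2) (4 * n)]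
        refine Valuation.map_add_lt _ hd ?_
        rw [map_mul, h4, map_pow]
        exact mul_lt_one_of_lt_of_le (pow_lt_one₀ zero_le h2 two_ne_zero) hn
      rw [map_pow] at this
      exact lt_of_not_ge fun h => this.not_ge (one_le_pow₀ h)
    -- When `2` is not a unit, `t` is already small and every element of the residue field is a
    -- square; the double root is a square root of `-n`.
    have hchar : ringChar (IsLocalRing.ResidueField (v.adicCompletionIntegers F)) = 2 := by
      have : (2 : IsLocalRing.ResidueField (v.adicCompletionIntegers F)) = 0 := by
        rw [← coe_two] at h2
        have := (residue_eq_zero_iff_lt v 2).2 h2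
        rwa [map_ofNat] at this
      have hd := (ringChar.spec (IsLocalRing.ResidueField (v.adicCompletionIntegers F)) 2).1
        (by exact_mod_cast this)
      exact ((Nat.dvd_prime Nat.prime_two).1 hd).resolve_left CharP.ringChar_ne_one
    let n' : v.adicCompletionIntegers F := ⟨n, hn⟩
    obtain ⟨m, hm⟩ := FiniteField.isSquare_of_char_two hchar
      (IsLocalRing.residue (v.adicCompletionIntegers F) (-n'))
    obtain ⟨m, rfl⟩ := IsLocalRing.residue_surjective m
    have hm' : Valued.v (n + m ^ 2 : v.adicCompletion F) < 1 := by
      have e : ((n' + m ^ 2 : v.adicCompletionIntegers F) : v.adicCompletion F) =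
          n + m ^ 2 := by push_cast; rfl
      rw [← e, ← residue_eq_zero_iff_lt]
      rw [map_neg] at hm
      rw [map_add, map_pow]
      linear_combination -hm
    have hm1 : Valued.v (m : v.adicCompletion F) ≤ 1 := m.2
    refine ⟨m, hm1, Valuation.map_sub_lt _ ht1 ?_, ?_⟩
    · rw [map_mul]; exact mul_lt_one_of_lt_of_le h2 hm1
    · rw [show n - m * t + m ^ 2 = (n + m ^ 2) - m * t by ring]
      refine Valuation.map_sub_lt _ hm' ?_
      exact val_mul_lt' hm1 ht1
  -- When `2` is a unit, the double root is found by completing the square.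
  · refine ⟨t / 2, by rw [map_div₀, h2, div_one]; exact ht, ?_, ?_⟩
    · rw [mul_div_cancel₀ _ two_ne_zero]; simp
    · rw [show n - t / 2 * t + (t / 2) ^ 2 = -((t ^ 2 - 4 * n) / 2 ^ 2) by ring,
        Valuation.map_neg, map_div₀, map_pow, h2, one_pow, div_one]
      exact hd

end Conductor

/-! ### Local discriminants of quadratic maximal orders -/

section LocalDiscriminant

variable {F : Type*} [Field F] [NumberField F] (v : FinPlace F)

/-- `d` is the discriminant of the maximal order of a quadratic étale algebra over `F_v`. -/
structure IsLocalDisc (d : v.adicCompletion F) : Prop where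
  exists_eq : ∃ t n, Valued.v t ≤ 1 ∧ Valued.v n ≤ 1 ∧ d = t ^ 2 - 4 * n
  le_one : ∀ T G N, Valued.v T ≤ 1 → Valued.v N ≤ 1 → T ^ 2 - d * G ^ 2 = 4 * N → Valued.v G ≤ 1

variable {v}

/-- Write `d₁ = t₁² - 4 n₁`. A solution `(T, G, N)` for `d₁ d₂` gives the solution `(t₁ T, d₁ G, d₁
N + n₁ T²)` for `d₂`, so `d₁ G` is integral, and then so is `G` because `d₁` is a unit. -/
theorem IsLocalDisc.mul {d₁ d₂ : v.adicCompletion F} (h₁ : IsLocalDisc v d₁)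
    (h₂ : IsLocalDisc v d₂) (hd : Valued.v d₁ = 1) : IsLocalDisc v (d₁ * d₂) := by
  obtain ⟨t₁, n₁, ht₁, hn₁, e₁⟩ := h₁.exists_eq
  obtain ⟨t₂, n₂, ht₂, hn₂, e₂⟩ := h₂.exists_eq
  have h4 : Valued.v (4 : v.adicCompletion F) ≤ 1 := by rw [← coe_four]; exact (4 : v.adicCompletionIntegers F).2
  have hsq : ∀ {x : v.adicCompletion F}, Valued.v x ≤ 1 → Valued.v (x ^ 2) ≤ 1 := fun h => by
    rw [map_pow]; exact pow_le_one₀ zero_le h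
  refine ⟨⟨t₁ * t₂, t₁ ^ 2 * n₂ + (n₁ * t₂ ^ 2 - 4 * n₁ * n₂), val_mul_le ht₁ ht₂, ?_, ?_⟩, ?_⟩
  · exact Valuation.map_add_le _ (val_mul_le (hsq ht₁) hn₂) (Valuation.map_sub_le _
      (val_mul_le hn₁ (hsq ht₂)) (val_mul_le (val_mul_le h4 hn₁) hn₂))
  · rw [e₁, e₂]; ring
  · intro T G N hT hN h
    have := h₂.le_one (t₁ * T) (d₁ * G) (d₁ * N + n₁ * T ^ 2) (val_mul_le ht₁ hT)
      (Valuation.map_add_le _ (val_mul_le hd.le hN) (val_mul_le hn₁ (hsq hT))) (by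
        linear_combination d₁ * h - T ^ 2 * e₁)
    rwa [map_mul, hd, one_mul] at this

/-- A representation of an integer by the norm form of an Eisenstein polynomial is integral. -/
theorem integral_of_norm_integral {π : v.adicCompletionIntegers F} (hπ : ∀ x : v.adicCompletion F,
    Valued.v x < 1 ↔ ∃ y : v.adicCompletionIntegers F, x = π * y) (hπ0 : (π : v.adicCompletion F) ≠ 0)
    {t n a b u : v.adicCompletion F} (ht : Valued.v t < 1) (hn : Valued.v n = 1)
    (hu : Valued.v u ≤ 1) (h : a ^ 2 + a * b * t + b ^ 2 * (π * n) = u) :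
    Valued.v a ≤ 1 ∧ Valued.v b ≤ 1 := by
  have hπ1 : Valued.v (π : v.adicCompletion F) < 1 := (hπ _).2 ⟨1, by simp⟩
  have key : ∀ x y : v.adicCompletion F, 1 < Valued.v x → Valued.v y ≤ Valued.v x →
      1 < Valued.v (x ^ 2 + x * y * t) := fun x y hx hy => by
    have h0 : x ≠ 0 := by rintro rfl; simp at hx
    have e : x ^ 2 + x * y * t = x * x * (1 + (y / x) * t) := by field_simp
    have h1 : Valued.v (y / x * t) < 1 := val_mul_lt' (by
      rw [map_div₀]; exact div_le_one_of_le₀ hy zero_le) ht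
    rw [e, map_mul, map_mul, Valuation.map_one_add_of_lt _ h1, mul_one]
    exact one_lt_mul'' hx hx
  have hb : Valued.v b ≤ 1 := by
    -- Suppose `b⁻¹ = π c` and divide the equation by `b²`. The right side becomes `π` times a unit,
    -- so `a/b` is divisible by `π`; since `π` also divides `t`, the left side is divisible by `π²`.
    by_contra! hb
    have hb0 : b ≠ 0 := by rintro rfl; simp at hb
    have hb1 : Valued.v b⁻¹ < 1 := by rw [map_inv₀]; exact inv_lt_one_of_one_lt₀ hb
    obtain ⟨c, hc⟩ := (hπ _).1 hb1
    have e : (a / b) ^ 2 + (a / b) * 1 * t = π * (π * (c * c) * u - n) := by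
      have : b⁻¹ * b⁻¹ * b ^ 2 = 1 := by field_simp
      field_simp at h ⊢
      have h3 : (π * c * b : v.adicCompletion F) = 1 := by rw [← hc]; field_simp
      linear_combination h - (u * (π * c * b + 1)) * h3
    have hlt : Valued.v (π * (π * (c * c) * u - n) : v.adicCompletion F) < 1 :=
      val_mul_lt hπ1 (Valuation.map_sub_le _ (val_mul_le (val_mul_le hπ1.le
        (val_mul_le c.2 c.2)) hu) hn.le)
    have hn' : Valued.v (π * (c * c) * u - n : v.adicCompletion F) = 1 := by
      rw [Valuation.map_sub_eq_of_lt_right, hn]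
      rw [hn]
      exact val_mul_lt (val_mul_lt hπ1 (val_mul_le c.2 c.2)) hu
    have ha : Valued.v (a / b) < 1 := by
      by_contra! ha
      have e2 : (a / b) ^ 2 + (a / b) * 1 * t = (a / b) * (a / b) * (1 + (b / a) * t) := by
        have : a ≠ 0 := by rintro rfl; simp at ha
        field_simp
      have h1 : Valued.v (b / a * t) < 1 := val_mul_lt' (by
        rw [← inv_div, map_inv₀]; exact inv_le_one_of_one_le₀ ha) ht
      rw [← e, e2, map_mul, map_mul, Valuation.map_one_add_of_lt _ h1, mul_one] at hlt
      exact hlt.not_ge (one_le_mul ha ha)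
    obtain ⟨y, hy⟩ := (hπ _).1 ha
    obtain ⟨s, hs⟩ := (hπ _).1 ht
    have e3 : (π * (c * c) * u - n : v.adicCompletion F) = π * y * y + π * y * s := by
      refine mul_left_cancel₀ hπ0 ?_
      rw [← e, hy, hs]; ring
    rw [e3] at hn'
    refine absurd hn' (ne_of_lt (Valuation.map_add_lt _ ?_ ?_))
    · exact val_mul_lt (val_mul_lt hπ1 y.2) y.2
    · exact val_mul_lt (val_mul_lt hπ1 y.2) s.2
  refine ⟨?_, hb⟩
  by_contra! ha
  have h1 := key a b ha (hb.trans ha.le)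
  rw [eq_sub_of_add_eq h] at h1
  refine h1.not_ge (Valuation.map_sub_le _ hu (val_mul_le ?_ (val_mul_le hπ1.le hn.le)))
  rw [map_pow]; exact pow_le_one₀ zero_le hb

/-- The local discriminant is a unit at the places where the conductor is trivial. -/
theorem IsLocalDisc.eq_one {ξ α : F} (hα : α ≠ 0)
    (h : IsLocalDisc v (algebraMap F (v.adicCompletion F) (ξ * α ^ 2)))
    (hc : condExponent v ξ = 0) : Valued.v (algebraMap F (v.adicCompletion F) (ξ * α ^ 2)) = 1 := by
  set d := algebraMap F (v.adicCompletion F) (ξ * α ^ 2) with hd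
  obtain ⟨t, n, ht, hn, e⟩ := h.exists_eq
  have h4 : Valued.v (4 : v.adicCompletion F) ≤ 1 := by rw [← coe_four]; exact (4 : v.adicCompletionIntegers F).2
  have hd1 : Valued.v d ≤ 1 := by
    rw [e]
    refine Valuation.map_sub_le _ ?_ (val_mul_le h4 hn)
    rw [map_pow]; exact pow_le_one₀ zero_le ht
  by_contra hne
  have hlt := lt_of_le_of_ne hd1 hne
  rw [e] at hlt
  -- If `d` is not a unit, translating by a double root `m` gives a polynomial of discriminant `d`
  -- whose lower coefficients lie in the maximal ideal. By maximality of the order its constant term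
  -- is exactly a uniformizer, so it is Eisenstein and misses some unit, while the trivial conductor
  -- makes every unit a norm.
  obtain ⟨m, hm, htm, hnm⟩ := exists_double_root v ht hn hlt
  obtain ⟨π, hirr, hπ⟩ := exists_uniformizer v
  have hπ0 : (π : v.adicCompletion F) ≠ 0 := fun h0 => hirr.ne_zero (Subtype.ext h0)
  obtain ⟨t', ht'⟩ := (hπ _).1 htm
  obtain ⟨n', hn'⟩ := (hπ _).1 hnm
  have e' : d = (π * t') ^ 2 - 4 * (π * n') := by rw [e, ← ht', ← hn']; ring
  have hn1 : Valued.v (n' : v.adicCompletion F) = 1 := by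
    refine le_antisymm n'.2 (not_lt.1 fun hn1 => ?_)
    obtain ⟨n'', hn''⟩ := (hπ _).1 hn1
    -- If `π²` divided the constant term, half of `t' + π⁻¹ √d` would be integral with non-integral
    -- coefficient `π⁻¹`.
    have := h.le_one t' (π : v.adicCompletion F)⁻¹ n'' t'.2 n''.2 (by
      rw [e', hn'']; field_simp; ring)
    rw [map_inv₀] at this
    have hπ1 : Valued.v (π : v.adicCompletion F) < 1 := (hπ _).2 ⟨1, by simp⟩
    exact this.not_gt ((one_lt_inv₀ (by simpa [zero_lt_iff] using hπ0)).2 hπ1)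
  have h2 : (2 : v.adicCompletionIntegers F) ≠ 0 := fun h => by
    have h : (2 : v.adicCompletion F) = 0 := by rw [← coe_two, h]; rfl
    norm_num at h
  obtain ⟨u, hu, hnot⟩ := exists_unit_not_norm hirr h2 (dvd_mul_right π t')
    (HeightOneSpectrum.adicCompletionIntegers.isUnit_iff_valued_eq_one.2 hn1)
  have hu1 := HeightOneSpectrum.adicCompletionIntegers.isUnit_iff_valued_eq_one.1 hu
  obtain ⟨s, r, hsr⟩ := isLocalNorm_of_condExponent_eq_zero v hc hu1
  set z := algebraMap F (v.adicCompletion F) α with hz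
  have hz0 : z ≠ 0 := by simpa [hz] using hα
  -- The substitution `b = 2 r / α`, `a = s - b t / 2` with `t = π t'` turns `s² - ξ r²` into the
  -- norm form of the Eisenstein polynomial.
  have hr : (s - (2 * r / z) * (π * t') / 2) ^ 2 + (s - (2 * r / z) * (π * t') / 2) * (2 * r / z) *
      (π * t') + (2 * r / z) ^ 2 * (π * n') = (u : v.adicCompletion F) := by
    have e1 : algebraMap F (v.adicCompletion F) ξ = ((π * t') ^ 2 - 4 * (π * n')) / z ^ 2 := by
      rw [eq_div_iff (pow_ne_zero 2 hz0), ← e', hd, map_mul, map_pow]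
    rw [hsr, e1]
    field_simp
    ring
  obtain ⟨ha, hb⟩ := integral_of_norm_integral hπ hπ0 (ht' ▸ htm) hn1 hu1.le hr
  refine hnot ⟨_, ha⟩ ⟨_, hb⟩ (Subtype.ext ?_)
  push_cast
  exact hr

/-- By density of `F` in its completion. The approximation of `T² - ξ G²` is measured against `4`,
which need not be a unit, so that the quotient by `4` stays integral. -/
theorem exists_adicCompletion_approx {ξ : F} {T G N : v.adicCompletion F} (hT : Valued.v T ≤ 1)
    (hG : G ≠ 0) (hN : Valued.v N ≤ 1)
    (h : T ^ 2 - algebraMap F (v.adicCompletion F) ξ * G ^ 2 = 4 * N) :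
    ∃ t g n : F, v.valuation F t ≤ 1 ∧ v.valuation F n ≤ 1 ∧ v.valuation F g = Valued.v G ∧
      t ^ 2 - ξ * g ^ 2 = 4 * n := by
  set c := algebraMap F (v.adicCompletion F) ξ
  have h40 : Valued.v (4 : v.adicCompletion F) ≠ 0 := by simp
  let U : Set (v.adicCompletion F × v.adicCompletion F) :=
    {p | Valued.v (p.1 - T) < 1} ∩ {p | Valued.v (p.2 - G) < Valued.v G} ∩
      {p | Valued.v (p.1 ^ 2 - c * p.2 ^ 2 - 4 * N) < Valued.v (4 : v.adicCompletion F)}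
  have hopen : ∀ γ : ℤᵐ⁰, γ ≠ 0 → IsOpen {x : v.adicCompletion F | Valued.v x < γ} := fun γ hγ => by
    obtain ⟨z, hz⟩ := v.valuedAdicCompletion_surjective F γ
    rw [← hz]
    have := Valued.isOpen_ball (v.adicCompletion F) (Valued.v.restrict z)
    simpa [Valuation.restrict_lt_iff] using this
  have hU : IsOpen U := by
    refine (((hopen 1 one_ne_zero).preimage (f := fun p : _ × _ => p.1 - T) (by fun_prop)).inter
      ((hopen _ (by simpa using hG)).preimage (f := fun p : _ × _ => p.2 - G) (by fun_prop))).inter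
      ((hopen _ h40).preimage (f := fun p : _ × _ => p.1 ^ 2 - c * p.2 ^ 2 - 4 * N) (by fun_prop))
  have hne : U.Nonempty := ⟨(T, G), by
    refine ⟨⟨?_, ?_⟩, ?_⟩
    · simp
    · simpa [zero_lt_iff] using hG
    · simp [zero_lt_iff, h]⟩
  obtain ⟨⟨t, g⟩, ⟨h1, h2⟩, h3⟩ := ((HeightOneSpectrum.denseRange_algebraMap (K := F) v).prodMap
    (HeightOneSpectrum.denseRange_algebraMap (K := F) v)).exists_mem_open hU hne
  simp only [Prod.map_fst, Prod.map_snd, Set.mem_ofPred_eq] at h1 h2 h3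
  refine ⟨t, g, (t ^ 2 - ξ * g ^ 2) / 4, ?_, ?_, ?_, by ring⟩
  · rw [← valued_algebraMap, ← sub_add_cancel (algebraMap F (v.adicCompletion F) t) T]
    exact Valuation.map_add_le _ h1.le hT
  · rw [← valued_algebraMap]
    have e : algebraMap F (v.adicCompletion F) ((t ^ 2 - ξ * g ^ 2) / 4) =
        (algebraMap F (v.adicCompletion F) t ^ 2 - c * algebraMap F (v.adicCompletion F) g ^ 2 -
          4 * N) / 4 + N := by
      rw [map_div₀, map_sub, map_mul, map_pow, map_pow, map_ofNat]
      field_simp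
      ring
    rw [e]
    refine Valuation.map_add_le _ ?_ hN
    rw [map_div₀]
    exact div_le_one_of_le₀ h3.le zero_le
  · rw [← valued_algebraMap, ← sub_add_cancel (algebraMap F (v.adicCompletion F) g) G]
    exact Valuation.map_add_eq_of_lt_right _ h2

theorem exists_integral_multiple (x y : F) (hx : v.valuation F x ≤ 1) (hy : v.valuation F y ≤ 1) :
    ∃ d x' y' : 𝓞 F, v.valuation F d = 1 ∧ d * x = x' ∧ d * y = y' := by
  obtain ⟨n, d, h1⟩ := v.exists_primeCompl_mul_eq_of_integer x hx
  obtain ⟨m, e, h2⟩ := v.exists_primeCompl_mul_eq_of_integer y hy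
  refine ⟨d * e, n * e, d * m, ?_, ?_, ?_⟩
  · push_cast
    rw [map_mul, (v.valuation_eq_one_iff_notMem (K := F)).2 d.2,
      (v.valuation_eq_one_iff_notMem (K := F)).2 e.2, one_mul]
  · push_cast
    linear_combination ((e : 𝓞 F) : F) * h1
  · push_cast
    linear_combination ((d : 𝓞 F) : F) * h2

end LocalDiscriminant

/-! ### Fundamental discriminants are local discriminants at every place -/

section QuadraticField

variable {F : Type*} [Field F] [NumberField F] {ξ : F}

theorem quadExt_root (z : QuadExt ξ) :
    z ^ 2 - algebraMap F (QuadExt ξ) (2 * z.re) * z +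
      algebraMap F (QuadExt ξ) (z.re ^ 2 - ξ * z.im ^ 2) = 0 := by
  ext <;> simp [sq, QuadraticAlgebra.algebraMap_eq] <;> ring

theorem isIntegral_quadExt_of {z : QuadExt ξ} {t n : 𝓞 F} (ht : 2 * z.re = t)
    (hn : z.re ^ 2 - ξ * z.im ^ 2 = n) : IsIntegral (𝓞 F) z := by
  refine ⟨Polynomial.X ^ 2 - Polynomial.C t * Polynomial.X + Polynomial.C n, ?_, ?_⟩
  · monicity!
  · have := quadExt_root z
    rw [ht, hn] at this
    simpa [← IsScalarTower.algebraMap_apply, Polynomial.eval₂_add, Polynomial.eval₂_sub] using this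

/-- The conjugate of an integral element is integral, hence so are the sum and the product of the
two. -/
theorem isIntegral_trace {z : QuadExt ξ} (h : IsIntegral (𝓞 F) z) : IsIntegral (𝓞 F) (2 * z.re) ∧
    IsIntegral (𝓞 F) (z.re ^ 2 - ξ * z.im ^ 2) := by
  let σ : QuadExt ξ →ₐ[𝓞 F] QuadExt ξ :=
    { toFun := star
      map_one' := star_one _
      map_mul' := fun a b => by rw [star_mul, mul_comm]
      map_zero' := star_zero _
      map_add' := star_add
      commutes' := fun r => by
        rw [IsScalarTower.algebraMap_apply (𝓞 F) F (QuadExt ξ)]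
        ext <;> simp [QuadraticAlgebra.algebraMap_eq] }
  have hσ : IsIntegral (𝓞 F) (star z) := by
    obtain ⟨p, hm, hp⟩ := h
    refine ⟨p, hm, ?_⟩
    have := congrArg (σ : QuadExt ξ →+* QuadExt ξ) hp
    rw [Polynomial.hom_eval₂, map_zero, σ.comp_algebraMap] at this
    exact this
  have e1 : algebraMap F (QuadExt ξ) (2 * z.re) = z + star z := by
    ext <;> simp [QuadraticAlgebra.algebraMap_eq]; ring
  have e2 : algebraMap F (QuadExt ξ) (z.re ^ 2 - ξ * z.im ^ 2) = z * star z := by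
    ext <;> simp [QuadraticAlgebra.algebraMap_eq] <;> ring
  have hinj : Function.Injective (algebraMap F (QuadExt ξ)) := QuadraticAlgebra.algebraMap_injective
  exact ⟨(isIntegral_algebraMap_iff hinj).1 (e1 ▸ h.add hσ),
    (isIntegral_algebraMap_iff hinj).1 (e2 ▸ h.mul hσ)⟩

theorem exists_int_of_isIntegral {x : F} (h : IsIntegral (𝓞 F) x) : ∃ r : 𝓞 F, x = r := by
  obtain ⟨r, hr⟩ := IsIntegrallyClosed.isIntegral_iff.1 h
  exact ⟨r, hr.symm⟩

theorem im_of_sub_star_sq {ω : QuadExt ξ} (hξ : ξ ≠ 0)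
    (h : (ω - star ω) ^ 2 = algebraMap F (QuadExt ξ) ξ) : ω.im = 1 / 2 ∨ ω.im = -(1 / 2) := by
  have := congrArg QuadraticAlgebra.re h
  simp [sq, QuadraticAlgebra.algebraMap_eq] at this
  have h1 : (ω.im - 1 / 2) * (ω.im + 1 / 2) = 0 := by
    refine (mul_eq_zero.1 (?_ : ξ * _ = 0)).resolve_left hξ
    linear_combination this / 4
  rcases mul_eq_zero.1 h1 with h1 | h1
  · exact Or.inl (sub_eq_zero.1 h1)
  · exact Or.inr (eq_neg_of_add_eq_zero_left h1)

theorem im_sq_of_sub_star_sq {ω : QuadExt ξ} (hξ : ξ ≠ 0)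
    (h : (ω - star ω) ^ 2 = algebraMap F (QuadExt ξ) ξ) : ω.im ^ 2 = 1 / 4 := by
  rcases im_of_sub_star_sq hξ h with h | h <;> rw [h] <;> norm_num

/-- Here `α` generates `𝔞` at `v`. In the non-square case the integrality of `α ω` provides the
required trace and norm. For maximality, a local solution is approximated by one over `F`; a
multiple by a denominator prime to `v` is an integral element of `F(√ξ)`, hence lies in `𝓞 F + 𝔞 ω`,
and its coefficient is bounded by `α`. In the square case `ξ α²` is the square of a unit. -/
theorem IsFundamentalDiscriminant.isLocalDisc {𝔞 : FractionalIdeal (𝓞 F)⁰ F}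
    (h : IsFundamentalDiscriminant ξ 𝔞) (hξ : ξ ≠ 0) (v : FinPlace F) {α : F} (hα : α ∈ 𝔞)
    (hα0 : α ≠ 0) (hmax : ∀ a ∈ 𝔞, v.valuation F a ≤ v.valuation F α) :
    IsLocalDisc v (algebraMap F (v.adicCompletion F) (ξ * α ^ 2)) := by
  rcases h with ⟨hsq, ω, hω, hO⟩ | ⟨m, hm, rfl, rfl⟩
  · have him := im_sq_of_sub_star_sq hξ hω
    constructor
    · have hmem : (α • ω : QuadExt ξ) ∈ (integralClosure (𝓞 F) (QuadExt ξ) : Set (QuadExt ξ)) := by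
        rw [hO]
        exact ⟨0, α, hα, by simp⟩
      have hi := isIntegral_trace (z := α • ω) hmem
      obtain ⟨t, ht⟩ := exists_int_of_isIntegral hi.1
      obtain ⟨n, hn⟩ := exists_int_of_isIntegral hi.2
      refine ⟨algebraMap F _ t, algebraMap F _ n, valued_algebraMap_int_le v t,
        valued_algebraMap_int_le v n, ?_⟩
      rw [← ht, ← hn, ← map_pow, ← map_ofNat (algebraMap F (v.adicCompletion F)) 4, ← map_mul,
        ← map_sub]
      congr 1
      simp only [QuadraticAlgebra.re_smul, QuadraticAlgebra.im_smul, smul_eq_mul]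
      linear_combination (-4 * ξ * α ^ 2) * him
    · intro T G N hT hN hTG
      rcases eq_or_ne G 0 with rfl | hG
      · simp
      have hα' : algebraMap F (v.adicCompletion F) α ≠ 0 := by simpa using hα0
      obtain ⟨t, g, n, ht, hn, hg, e⟩ := exists_adicCompletion_approx (ξ := ξ) hT
        (mul_ne_zero hα' hG) hN (by
          rw [← hTG, map_mul, map_pow]; ring)
      obtain ⟨d, t', n', hd, htd, hnd⟩ := exists_integral_multiple t n ht hn
      have hmem : (⟨t' / 2, d * g / 2⟩ : QuadExt ξ) ∈
          (integralClosure (𝓞 F) (QuadExt ξ) : Set (QuadExt ξ)) := by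
        refine isIntegral_quadExt_of (t := t') (n := d * n') (by ring) ?_
        push_cast
        rw [← htd]
        linear_combination ((d : F) ^ 2 / 4) * e + (d : F) * hnd
      rw [hO] at hmem
      obtain ⟨s, a, ha, hs⟩ := hmem
      have hi := congrArg QuadraticAlgebra.im hs
      simp [IsScalarTower.algebraMap_apply (𝓞 F) F (QuadExt ξ), QuadraticAlgebra.algebraMap_eq]
        at hi
      have hda : v.valuation F (d * g) = v.valuation F a := by
        rcases im_of_sub_star_sq hξ hω with h | h
        · rw [h] at hi
          congr 1
          linear_combination 2 * hi
        · rw [h] at hi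
          rw [← Valuation.map_neg _ a]
          congr 1
          linear_combination 2 * hi
      have hle := hmax a ha
      rw [← hda, map_mul, hd, one_mul, hg, map_mul, ← valued_algebraMap] at hle
      have h0 : (0 : ℤᵐ⁰) < Valued.v (algebraMap F (v.adicCompletion F) α) := by
        simpa [zero_lt_iff] using hα0
      exact (mul_le_iff_le_one_right h0).1 hle
  · have hval : v.valuation F (m * α) = 1 := by
      rw [FractionalIdeal.mem_spanSingleton] at hα
      obtain ⟨r, rfl⟩ := hα
      refine le_antisymm ?_ ?_
      · rw [Algebra.smul_def, mul_left_comm, mul_inv_cancel₀ hm, mul_one]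
        exact v.valuation_le_one r
      · have := hmax m⁻¹ (FractionalIdeal.mem_spanSingleton_self _ _)
        rw [map_mul]
        calc (1 : ℤᵐ⁰) = v.valuation F m * v.valuation F m⁻¹ := by
              rw [← map_mul, mul_inv_cancel₀ hm, map_one]
          _ ≤ _ := mul_le_mul_right this _
    have hd : Valued.v (algebraMap F (v.adicCompletion F) (m ^ 2 * α ^ 2)) = 1 := by
      rw [← mul_pow, valued_algebraMap, map_pow, hval, one_pow]
    refine ⟨⟨algebraMap F _ (m * α), 0, by rw [valued_algebraMap, hval], by simp, by
      rw [← map_pow]; simp [mul_pow]⟩, fun T G N hT hN hTG => ?_⟩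
    have h4 : Valued.v (4 : v.adicCompletion F) ≤ 1 := by
      rw [← coe_four]; exact (4 : v.adicCompletionIntegers F).2
    have : Valued.v (algebraMap F (v.adicCompletion F) (m ^ 2 * α ^ 2) * G ^ 2) ≤ 1 := by
      rw [← sub_sub_cancel (T ^ 2) (algebraMap F (v.adicCompletion F) (m ^ 2 * α ^ 2) * G ^ 2), hTG]
      refine Valuation.map_sub_le _ ?_ (val_mul_le h4 hN)
      rw [map_pow]; exact pow_le_one₀ zero_le hT
    rw [map_mul, hd, one_mul, map_pow] at this
    exact (pow_le_one_iff two_ne_zero).1 this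

end QuadraticField

/-! ### Base change of quaternions -/

section BaseChange

variable {F : Type*} [Field F] {A A' : Type*} [CommRing A] [Algebra F A] [CommRing A']
  [Algebra F A'] {α β : F} (f : A →ₐ[F] A')

@[simp] theorem baseChange_re (x : Quat A α β) : (baseChange α β f x).re = f x.re := rfl
@[simp] theorem baseChange_imI (x : Quat A α β) : (baseChange α β f x).imI = f x.imI := rfl
@[simp] theorem baseChange_imJ (x : Quat A α β) : (baseChange α β f x).imJ = f x.imJ := rfl
@[simp] theorem baseChange_imK (x : Quat A α β) : (baseChange α β f x).imK = f x.imK := rfl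

theorem trd_baseChange (x : Quat A α β) : trd (baseChange α β f x) = f (trd x) := by simp [trd]

theorem nrd_baseChange (x : Quat A α β) : nrd (baseChange α β f x) = f (nrd x) := by simp [nrd]

theorem star_baseChange (x : Quat A α β) :
    star (baseChange α β f x) = baseChange α β f (star x) := by ext <;> simp

theorem Disc_baseChange (x : Quat A α β) : Disc (baseChange α β f x) = f (Disc x) := by
  simp only [Disc, trd_baseChange, nrd_baseChange, map_sub, map_mul, map_pow, map_ofNat]

theorem baseChange_smul (c : A) (x : Quat A α β) :
    baseChange α β f (c • x) = f c • baseChange α β f x := by ext <;> simp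

theorem baseChange_algebraMap (c : A) :
    baseChange α β f (algebraMap A _ c) = algebraMap A' _ (f c) := by
  have h : ∀ (B : Type _) [CommRing B] [Algebra F B] (b : B),
      algebraMap B (Quat B α β) b = b • (1 : Quat B α β) := fun B _ _ b =>
    Algebra.algebraMap_eq_smul_one b
  exact (congrArg _ (h A c)).trans ((baseChange_smul f c 1).trans
    ((congrArg _ (map_one (baseChange α β f))).trans (Algebra.algebraMap_eq_smul_one (f c)).symm))

theorem nrd_eq (x : Quat A α β) : nrd x = x.re ^ 2 - algebraMap F A α * x.imI ^ 2 -
    algebraMap F A β * x.imJ ^ 2 + algebraMap F A α * algebraMap F A β * x.imK ^ 2 := by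
  simp [nrd]; ring

theorem trd_eq (x : Quat A α β) : trd x = 2 * x.re := by simp [trd]; ring

theorem trd_mul_eq (x y : Quat A α β) : trd (x * y) = 2 * (x.re * y.re +
    algebraMap F A α * (x.imI * y.imI) + algebraMap F A β * (x.imJ * y.imJ) -
    algebraMap F A α * algebraMap F A β * (x.imK * y.imK)) := by
  simp [trd]; ring

end BaseChange

/-! ### Completions of a global order -/

section LocalOrder

variable {F : Type*} [Field F] [NumberField F] {α β : F} (v : FinPlace F)
  {R : Subalgebra (𝓞 F) (Quat F α β)}

/-- All the coordinates of `x` are at most `M`. -/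
def CoordsLE (M : ℤᵐ⁰) (x : Quat (v.adicCompletion F) α β) : Prop :=
  Valued.v x.re ≤ M ∧ Valued.v x.imI ≤ M ∧ Valued.v x.imJ ≤ M ∧ Valued.v x.imK ≤ M

variable {v}

theorem CoordsLE.add {M : ℤᵐ⁰} {x y : Quat (v.adicCompletion F) α β} (hx : CoordsLE v M x)
    (hy : CoordsLE v M y) : CoordsLE v M (x + y) :=
  ⟨Valuation.map_add_le _ hx.1 hy.1, Valuation.map_add_le _ hx.2.1 hy.2.1,
    Valuation.map_add_le _ hx.2.2.1 hy.2.2.1, Valuation.map_add_le _ hx.2.2.2 hy.2.2.2⟩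

theorem CoordsLE.smul {M : ℤᵐ⁰} {x : Quat (v.adicCompletion F) α β} (hx : CoordsLE v M x)
    {c : v.adicCompletion F} (hc : Valued.v c ≤ 1) : CoordsLE v M (c • x) := by
  have key : ∀ y : v.adicCompletion F, Valued.v y ≤ M → Valued.v (c • y) ≤ M := fun y hy => by
    rw [smul_eq_mul, map_mul]
    exact (mul_le_of_le_one_left zero_le hc).trans hy
  exact ⟨key _ hx.1, key _ hx.2.1, key _ hx.2.2.1, key _ hx.2.2.2⟩

theorem CoordsLE.zero (M : ℤᵐ⁰) : CoordsLE v M (0 : Quat (v.adicCompletion F) α β) := by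
  simp [CoordsLE]

theorem toLocal_smul_int (r : 𝓞 F) (x : Quat F α β) : toLocal v ((r : F) • x) =
    (algebraMap F (v.adicCompletion F) r) • toLocal v x :=
  baseChange_smul _ _ _

variable (v) in
/-- The completion of `R`, as a subring. -/
def localRing (R : Subalgebra (𝓞 F) (Quat F α β)) : Subring (Quat (v.adicCompletion F) α β) :=
  (localize v (R : Set (Quat F α β))).toSubring

theorem toLocal_mem {x : Quat F α β} (hx : x ∈ R) : toLocal v x ∈ localRing v R :=
  Algebra.subset_adjoin ⟨x, hx, rfl⟩

theorem algebraMap_mem_localize (S : Set (Quat F α β)) {c : v.adicCompletion F}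
    (hc : Valued.v c ≤ 1) : algebraMap _ (Quat (v.adicCompletion F) α β) c ∈ localize v S :=
  (localize v S).algebraMap_mem ⟨c, hc⟩

theorem smul_mem_localize {S : Set (Quat F α β)} {c : v.adicCompletion F}
    (hc : Valued.v c ≤ 1) {x : Quat (v.adicCompletion F) α β} (hx : x ∈ localize v S) :
    c • x ∈ localize v S := by
  rw [Algebra.smul_def]
  exact mul_mem (algebraMap_mem_localize S hc) hx

/-- As `R` is closed under products, the algebra generated by its image is already the `𝓞_v`-span,
so multiplication does not enter the induction. -/
theorem localRing_induction {p : Quat (v.adicCompletion F) α β → Prop}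
    (hR : ∀ x ∈ R, p (toLocal v x)) (h0 : p 0) (hadd : ∀ x y, p x → p y → p (x + y))
    (hsmul : ∀ (c : v.adicCompletion F) x, Valued.v c ≤ 1 → p x → p (c • x))
    {x : Quat (v.adicCompletion F) α β} (hx : x ∈ localRing v R) : p x := by
  have hcl : (Submonoid.closure (toLocal v '' (R : Set (Quat F α β))) : Set _) ⊆
      toLocal v '' (R : Set (Quat F α β)) := by
    intro y hy
    induction hy using Submonoid.closure_induction with
    | mem y hy => exact hy
    | one => exact ⟨1, R.one_mem, map_one _⟩
    | mul y z _ _ hy hz =>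
      obtain ⟨y, hy, rfl⟩ := hy
      obtain ⟨z, hz, rfl⟩ := hz
      exact ⟨y * z, R.mul_mem hy hz, map_mul _ _ _⟩
  have hx' : x ∈ Submodule.span (v.adicCompletionIntegers F)
      (toLocal v '' (R : Set (Quat F α β))) := by
    rw [← Algebra.adjoin_eq_span_of_subset _ (hcl.trans Submodule.subset_span)]
    exact hx
  clear hx
  induction hx' using Submodule.span_induction with
  | mem x hx => obtain ⟨y, hy, rfl⟩ := hx; exact hR y hy
  | zero => exact h0
  | add x y _ _ hx hy => exact hadd x y hx hy
  | smul c x _ hx => exact hsmul c x c.2 hx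

theorem int_smul_eq (c : 𝓞 F) (x : Quat F α β) : (c : F) • x = algebraMap (𝓞 F) (Quat F α β) c * x := by
  rw [Algebra.smul_def]
  rfl

theorem int_smul_mem {x : Quat F α β} (hx : x ∈ R) (c : 𝓞 F) : (c : F) • x ∈ R := by
  rw [int_smul_eq]
  exact mul_mem (R.algebraMap_mem c) hx

theorem IsOrder.exists_finset (hR : IsOrder R) : ∃ s : Finset (Quat F α β),
    ∀ p : Quat F α β → Prop, (∀ x ∈ s, p x) → p 0 → (∀ x y, p x → p y → p (x + y)) →
      (∀ (c : 𝓞 F) x, p x → p ((c : F) • x)) → ∀ x ∈ R, p x := by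
  obtain ⟨s, hs⟩ := hR.1
  refine ⟨s, fun p h1 h2 h3 h4 x hx => ?_⟩
  have hx' : x ∈ Subalgebra.toSubmodule R := hx
  rw [← hs] at hx'
  clear hx
  induction hx' using Submodule.span_induction with
  | mem x hx => exact h1 x hx
  | zero => exact h2
  | add x y _ _ hx hy => exact h3 x y hx hy
  | smul c x _ hx =>
    rw [Algebra.smul_def, ← int_smul_eq]
    exact h4 c x hx

theorem exists_coords_bound (hR : IsOrder R) (v : FinPlace F) :
    ∃ M, ∀ x ∈ localRing v R, CoordsLE v M x := by
  obtain ⟨s, hs⟩ := hR.exists_finset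
  classical
  obtain ⟨M, hM⟩ := Finset.exists_le (s.image fun x => max (max (Valued.v (toLocal v x).re)
    (Valued.v (toLocal v x).imI)) (max (Valued.v (toLocal v x).imJ) (Valued.v (toLocal v x).imK)))
  refine ⟨M, fun x hx => localRing_induction (p := CoordsLE v M) (fun y hy => ?_) (.zero M)
    (fun _ _ => .add) (fun _ _ hc hy => hy.smul hc) hx⟩
  refine hs (fun y => CoordsLE v M (toLocal v y)) ?_ ?_ ?_ ?_ y hy
  · intro y hy
    have := hM _ (Finset.mem_image_of_mem _ hy)
    simp only [max_le_iff] at this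
    exact ⟨this.1.1, this.1.2, this.2.1, this.2.2⟩
  · rw [map_zero]; exact .zero M
  · intro x y hx hy
    rw [map_add]
    exact hx.add hy
  · intro c x hx
    rw [toLocal_smul_int]
    exact hx.smul (valued_algebraMap_int_le v c)

theorem finite_not_coordsLE_one (hR : IsOrder R) :
    {v : FinPlace F | ¬ ∀ x ∈ localRing v R, CoordsLE v 1 x}.Finite := by
  obtain ⟨s, hs⟩ := hR.exists_finset
  have hfin : (⋃ x ∈ s, ⋃ t ∈ ({x.re, x.imI, x.imJ, x.imK} : Set F),
      {v : FinPlace F | 1 < v.valuation F t}).Finite := by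
    refine Set.Finite.biUnion s.finite_toSet fun x _ => Set.Finite.biUnion (by simp) fun t _ => ?_
    exact HeightOneSpectrum.Support.finite (R := 𝓞 F) (K := F) t
  refine hfin.subset fun v hv => ?_
  by_contra hv'
  simp only [Set.mem_iUnion, Set.mem_ofPred_eq, not_exists, not_lt] at hv'
  refine hv fun x hx => localRing_induction (p := CoordsLE v 1) (fun y hy => ?_) (.zero 1)
    (fun _ _ => .add) (fun _ _ hc hy => hy.smul hc) hx
  refine hs (fun y => CoordsLE v 1 (toLocal v y)) ?_ ?_ ?_ ?_ y hy
  · intro y hy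
    have key := hv' y hy
    refine ⟨?_, ?_, ?_, ?_⟩
    · exact (valued_algebraMap v _).trans_le (key y.re (by simp))
    · exact (valued_algebraMap v _).trans_le (key y.imI (by simp))
    · exact (valued_algebraMap v _).trans_le (key y.imJ (by simp))
    · exact (valued_algebraMap v _).trans_le (key y.imK (by simp))
  · rw [map_zero]; exact .zero 1
  · intro x y hx hy
    rw [map_add]
    exact hx.add hy
  · intro c x hx
    rw [toLocal_smul_int]
    exact hx.smul (valued_algebraMap_int_le v c)

theorem exists_smul_mem (hR : IsOrder R) (x : Quat F α β) : ∃ d : 𝓞 F, d ≠ 0 ∧ (d : F) • x ∈ R := by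
  have hx : x ∈ Submodule.span F (R : Set (Quat F α β)) := by rw [hR.2]; trivial
  induction hx using Submodule.span_induction with
  | mem x hx => exact ⟨1, one_ne_zero, by simpa using hx⟩
  | zero => exact ⟨1, one_ne_zero, by rw [smul_zero]; exact R.zero_mem⟩
  | add x y _ _ hx hy =>
    obtain ⟨d, hd, hx⟩ := hx
    obtain ⟨e, he, hy⟩ := hy
    refine ⟨d * e, mul_ne_zero hd he, ?_⟩
    have e1 : ((d * e : 𝓞 F) : F) • (x + y) = (e : F) • (d : F) • x + (d : F) • (e : F) • y := by
      rw [smul_add, smul_smul, smul_smul]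
      push_cast
      rw [mul_comm]
    rw [e1]
    exact add_mem (int_smul_mem hx e) (int_smul_mem hy d)
  | smul c x _ hx =>
    obtain ⟨d, hd, hx⟩ := hx
    obtain ⟨a, b, hb, rfl⟩ := IsFractionRing.div_surjective (A := 𝓞 F) c
    have hb0 : (algebraMap (𝓞 F) F b) ≠ 0 := by simpa using nonZeroDivisors.ne_zero hb
    refine ⟨d * b, mul_ne_zero hd (nonZeroDivisors.ne_zero hb), ?_⟩
    have : ((d * b : 𝓞 F) : F) • (algebraMap (𝓞 F) F a / algebraMap (𝓞 F) F b) • x =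
        (a : F) • (d : F) • x := by
      rw [smul_smul, smul_smul]
      congr 1
      push_cast
      field_simp
    rw [this]
    exact int_smul_mem hx a

/-- The powers of `x` remain in `R_v`, whose elements have bounded coordinates and hence bounded
norms. If `nrd x` had valuation above `1`, its powers would be unbounded. -/
theorem nrd_le_one (hR : IsOrder R) {x : Quat (v.adicCompletion F) α β} (hx : x ∈ localRing v R) :
    Valued.v (nrd x) ≤ 1 := by
  obtain ⟨M, hM⟩ := exists_coords_bound hR v
  set a := algebraMap F (v.adicCompletion F) α
  set b := algebraMap F (v.adicCompletion F) β
  set C := max (max 1 (Valued.v a)) (max (Valued.v b) (Valued.v (a * b)))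
  have hb : ∀ y ∈ localRing v R, Valued.v (nrd y) ≤ C * M ^ 2 := fun y hy => by
    obtain ⟨h1, h2, h3, h4⟩ := hM y hy
    have key : ∀ c z : v.adicCompletion F, Valued.v c ≤ C → Valued.v z ≤ M →
        Valued.v (c * z ^ 2) ≤ C * M ^ 2 := fun c z hc hz => by
      rw [map_mul, map_pow]
      exact mul_le_mul' hc (pow_le_pow_left₀ zero_le hz 2)
    rw [nrd_eq, ← one_mul (y.re ^ 2)]
    refine Valuation.map_add_le _ (Valuation.map_sub_le _ (Valuation.map_sub_le _ ?_ ?_) ?_) ?_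
    · exact key _ _ (by rw [map_one]; simp [C]) h1
    · exact key _ _ (by simp [C, a]) h2
    · exact key _ _ (by simp [C, b]) h3
    · exact key _ _ (by simp [C, a, b]) h4
  by_contra! h
  obtain ⟨n, hn⟩ := MulArchimedean.arch (C * M ^ 2 * Valued.v (nrd x)) h
  have h1 := hb _ (pow_mem hx n)
  rw [map_pow, map_pow] at h1
  have h2 := hn.trans h1
  have h0 : 0 < C * M ^ 2 := lt_of_lt_of_le (pow_pos (zero_lt_one.trans h) n) h1
  exact absurd h (not_lt.2 ((mul_le_iff_le_one_right h0).1 h2))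

theorem isIntegralOrder_localRing (hR : IsOrder R) (v : FinPlace F) :
    IsIntegralOrder (Valued.v : Valuation (v.adicCompletion F) ℤᵐ⁰) (localRing v R) where
  scalar c hc := algebraMap_mem_localize _ hc
  nrd_le r hr := nrd_le_one hR hr
  trd_le r hr := by
    -- Integrality of the trace follows from that of norms: `nrd (1 + r) = 1 + trd r + nrd r`.
    have h := nrd_add 1 (star r)
    rw [star_star, one_mul, map_one, nrd_star] at h
    have e : trd r = nrd (1 + star r) - 1 - nrd r := by rw [h]; ring
    have h1 : nrd (1 + star r) = nrd (1 + r) := by rw [← nrd_star, star_add, star_star, star_one]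
    rw [e, h1]
    exact Valuation.map_sub_le _ (Valuation.map_sub_le _ (nrd_le_one hR (add_mem (one_mem _) hr))
      (by rw [map_one])) (nrd_le_one hR hr)

end LocalOrder

/-! ### A unit Gram determinant implies unimodularity -/

section Unimodular

variable {F : Type*} [Field F] {A : Type*} [Field A] [Algebra F A] {α β : F}
  {V : Valuation A ℤᵐ⁰} {R : Subring (Quat A α β)}

theorem val_det_le_one {n : Type*} [Fintype n] [DecidableEq n] {M : Matrix n n A}
    (hM : ∀ i j, V (M i j) ≤ 1) : V M.det ≤ 1 := by
  rw [Matrix.det_apply]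
  refine V.map_sum_le fun σ _ => ?_
  rw [Units.smul_def, zsmul_eq_mul, map_mul, map_prod]
  have h : V ((Equiv.Perm.sign σ : ℤ) : A) = 1 := by
    rcases Int.units_eq_one_or (Equiv.Perm.sign σ) with h | h <;> simp [h]
  rw [h, one_mul]
  exact Finset.prod_le_one' fun i _ => hM _ _

/-- The coordinates of a quaternion. -/
def coords (x : Quat A α β) : Fin 4 → A := ![x.re, x.imI, x.imJ, x.imK]

theorem trd_mul_eq_dotProduct (x y : Quat A α β) : trd (x * y) =
    ∑ k, coords x k * ![2, 2 * algebraMap F A α, 2 * algebraMap F A β,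
      -2 * (algebraMap F A α * algebraMap F A β)] k * coords y k := by
  rw [trd_mul_eq, Fin.sum_univ_four]
  simp [coords]
  ring

/-- An order containing elements whose Gram determinant is a unit is unimodular. -/
theorem IsIntegralOrder.isUnimodular_of_det (hR : IsIntegralOrder V R) {π : A} (hπ : V π < 1)
    (hπ' : ∀ c, V c < 1 → ∃ y, V y ≤ 1 ∧ c = π * y) {x : Fin 4 → Quat A α β} (hx : ∀ i, x i ∈ R)
    (hd : V (Matrix.of fun i j => trd (x i * x j)).det = 1) : IsUnimodular V R := by
  intro r hr hlt
  set G : Matrix (Fin 4) (Fin 4) A := Matrix.of fun i j => trd (x i * x j) with hG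
  set X : Matrix (Fin 4) (Fin 4) A := Matrix.of fun i k => coords (x i) k with hX
  set T : Matrix (Fin 4) (Fin 4) A := Matrix.diagonal ![2, 2 * algebraMap F A α,
    2 * algebraMap F A β, -2 * (algebraMap F A α * algebraMap F A β)] with hT
  have hGX : G = X * T * X.transpose := by
    ext i j
    rw [Matrix.mul_apply, hG, Matrix.of_apply, trd_mul_eq_dotProduct]
    refine Finset.sum_congr rfl fun k _ => ?_
    rw [hT, Matrix.mul_diagonal, Matrix.transpose_apply]
    rfl
  have hd0 : G.det ≠ 0 := fun h => by simp [h] at hd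
  have hX0 : IsUnit X.det := by
    refine isUnit_iff_ne_zero.2 fun h => hd0 ?_
    rw [hGX, Matrix.det_mul, Matrix.det_mul, h, zero_mul, zero_mul]
  -- These are the coordinates of `r` with respect to the elements `x`. Multiplied by the Gram
  -- matrix they give the traces of `r x_j`, and the adjugate, which is integral, shows that they
  -- are non-units.
  set c := Matrix.vecMul (coords r) X⁻¹ with hc
  have hcX : Matrix.vecMul c X = coords r := by
    rw [hc, Matrix.vecMul_vecMul, Matrix.nonsing_inv_mul _ hX0, Matrix.vecMul_one]
  have hcG : Matrix.vecMul c G = fun j => trd (r * x j) := by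
    rw [hGX, ← Matrix.vecMul_vecMul, ← Matrix.vecMul_vecMul, hcX]
    ext j
    rw [trd_mul_eq_dotProduct, Matrix.vecMul, dotProduct]
    refine Finset.sum_congr rfl fun k _ => ?_
    rw [hT, Matrix.vecMul_diagonal, Matrix.transpose_apply]
    rfl
  have hclt : ∀ j, V (c j) < 1 := fun j => by
    have e : G.det * c j = ∑ i, trd (r * x i) * G.adjugate i j := by
      have := congrFun (congrArg (fun z => Matrix.vecMul z G.adjugate) hcG) j
      simp only [Matrix.vecMul_vecMul, Matrix.mul_adjugate, Matrix.vecMul_smul,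
        Matrix.vecMul_one, Pi.smul_apply, smul_eq_mul] at this
      rw [this, Matrix.vecMul, dotProduct]
    have h1 : V (G.det * c j) < 1 := by
      rw [e]
      refine V.map_sum_lt one_ne_zero fun i _ => val_mul_lt (hlt _ (hx i)) ?_
      rw [Matrix.adjugate_apply]
      refine val_det_le_one fun a b => ?_
      rw [Matrix.updateRow_apply]
      split_ifs
      · by_cases h : b = i
        · subst h; simp
        · simp [h]
      · exact hR.trd_le _ (mul_mem (hx a) (hx b))
    rwa [map_mul, hd, one_mul] at h1
  choose y hy hcy using fun j => hπ' (c j) (hclt j)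
  refine ⟨π, hπ, ∑ j, y j • x j, sum_mem fun j _ => hR.smul_mem (hy j) (hx j), ?_⟩
  have h := fun k => congrFun hcX k
  simp only [Matrix.vecMul, dotProduct, Fin.sum_univ_four, hcy] at h
  have h0 := h 0
  have h1 := h 1
  have h2 := h 2
  have h3 := h 3
  simp [hX, coords] at h0 h1 h2 h3
  rw [Fin.sum_univ_four]
  ext
  · simp only [QuaternionAlgebra.re_smul, QuaternionAlgebra.re_add, smul_eq_mul]
    rw [← h0]; ring
  · simp only [QuaternionAlgebra.imI_smul, QuaternionAlgebra.imI_add, smul_eq_mul]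
    rw [← h1]; ring
  · simp only [QuaternionAlgebra.imJ_smul, QuaternionAlgebra.imJ_add, smul_eq_mul]
    rw [← h2]; ring
  · simp only [QuaternionAlgebra.imK_smul, QuaternionAlgebra.imK_add, smul_eq_mul]
    rw [← h3]; ring

end Unimodular

/-! ### Unimodularity at the places prime to the discriminant -/

section Discriminant

variable {F : Type*} [Field F] [NumberField F] {α β : F} {R : Subalgebra (𝓞 F) (Quat F α β)}

/-- If `v` does not divide `N`, then one of the Gram determinants generating `N²` is a unit at `v`.
-/
theorem isUnimodular_localRing (hR : IsOrder R) {N : Ideal (𝓞 F)} (hN : N ^ 2 = discIdeal R)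
    {v : FinPlace F} (hv : ¬ v.asIdeal ∣ N) :
    IsUnimodular (Valued.v : Valuation (v.adicCompletion F) ℤᵐ⁰) (localRing v R) := by
  obtain ⟨d, ⟨x, hx, hd⟩, hdv⟩ : ∃ d ∈ {d : 𝓞 F | ∃ x : Fin 4 → Quat F α β, (∀ i, x i ∈ R) ∧
      (d : F) = (Matrix.of fun i j => trd (x i * x j)).det}, d ∉ v.asIdeal := by
    by_contra! h
    refine hv (v.prime.dvd_of_dvd_pow (n := 2) ?_)
    rw [hN, Ideal.dvd_iff_le, discIdeal, Ideal.span_le]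
    exact h
  obtain ⟨π, hirr, hπ⟩ := exists_uniformizer v
  refine (isIntegralOrder_localRing hR v).isUnimodular_of_det (π := π) ((hπ _).2 ⟨1, by simp⟩)
    (fun c hc => ?_) (x := fun i => toLocal v (x i)) (fun i => toLocal_mem (hx i)) ?_
  · obtain ⟨y, hy⟩ := (hπ c).1 hc
    exact ⟨y, y.2, hy⟩
  · have e : (Matrix.of fun i j => trd (toLocal v (x i) * toLocal v (x j))) =
        (algebraMap F (v.adicCompletion F)).mapMatrix (Matrix.of fun i j => trd (x i * x j)) := by
      refine Matrix.ext fun i j => ?_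
      simp only [Matrix.of_apply, RingHom.mapMatrix_apply, Matrix.map_apply, ← map_mul]
      exact trd_baseChange (Algebra.ofId F (v.adicCompletion F)) (x i * x j)
    rw [e, ← RingHom.map_det, ← hd, valued_algebraMap]
    exact (v.valuation_eq_one_iff_notMem (K := F)).2 hdv

theorem exists_int_of_valuation {t : F} (h : ∀ v : FinPlace F, v.valuation F t ≤ 1) :
    ∃ r : 𝓞 F, t = r := by
  obtain ⟨r, hr⟩ := HeightOneSpectrum.mem_integers_of_valuation_le_one F t h
  exact ⟨r, hr.symm⟩

theorem exists_int_trd (hR : IsOrder R) {x : Quat F α β} (hx : x ∈ R) : ∃ t : 𝓞 F, trd x = t := by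
  refine exists_int_of_valuation fun v => ?_
  have := (isIntegralOrder_localRing hR v).trd_le _ (toLocal_mem hx)
  rw [toLocal, trd_baseChange] at this
  exact (valued_algebraMap v _).symm.trans_le this

/-- Multiples of `1, i, j, k` lying in `R` have a diagonal Gram matrix of nonzero determinant.
Consequently only finitely many primes divide the discriminant. -/
theorem discIdeal_ne_bot (hR : IsOrder R) (hα : α ≠ 0) (hβ : β ≠ 0) : discIdeal R ≠ ⊥ := by
  let e : Fin 4 → Quat F α β := ![1, ⟨0, 1, 0, 0⟩, ⟨0, 0, 1, 0⟩, ⟨0, 0, 0, 1⟩]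
  choose d hd he using fun i => exists_smul_mem hR (e i)
  set x : Fin 4 → Quat F α β := fun i => (d i : F) • e i with hx
  have hmat : (Matrix.of fun i j => trd (x i * x j)) = Matrix.diagonal
      ![2 * (d 0 : F) ^ 2, 2 * α * (d 1 : F) ^ 2, 2 * β * (d 2 : F) ^ 2,
        -2 * (α * β) * (d 3 : F) ^ 2] := by
    ext i j
    rw [Matrix.of_apply, trd_mul_eq]
    fin_cases i <;> fin_cases j <;> simp [hx, e, Algebra.smul_def] <;> ring
  have hdet : (Matrix.of fun i j => trd (x i * x j)).det ≠ 0 := by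
    have hd' : ∀ i, (d i : F) ≠ 0 := fun i => by simpa using hd i
    rw [hmat, Matrix.det_diagonal, Fin.prod_univ_four]
    have h0 := hd' 0
    have h1 := hd' 1
    have h2 := hd' 2
    have h3 := hd' 3
    simp [h0, h1, h2, h3, hα, hβ]
  have hint : ∃ r : 𝓞 F, (r : F) = (Matrix.of fun i j => trd (x i * x j)).det := by
    choose t ht using fun i j => exists_int_trd hR (mul_mem (he i) (he j))
    refine ⟨(Matrix.of t).det, ?_⟩
    refine (RingHom.map_det (algebraMap (𝓞 F) F) _).trans (congrArg _ ?_)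
    ext i j
    exact (ht i j).symm
  obtain ⟨r, hr⟩ := hint
  intro h
  have : r ∈ discIdeal R := Ideal.subset_span ⟨x, he, hr⟩
  rw [h, Ideal.mem_bot] at this
  rw [← hr, this] at hdet
  exact hdet (map_zero _)

end Discriminant

/-! ### The centralizer of a trace zero element over a commutative ring -/

section Generator

variable {F : Type*} [Field F] {A : Type*} [CommRing A] [Algebra F A] {α β : F}

/-- An element commuting with a generator of trace zero is a combination of `1` and the
generator. -/
theorem eq_of_commute_of_trd_eq_zero [Invertible (2 : A)] {g x : Quat A α β} {Δ : Aˣ}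
    (ht : trd g = 0) (hn : nrd g = -(Δ : A)) (h : x * g = g * x) :
    x = algebraMap A _ (⅟2 * trd x) + (⅟2 * (↑Δ⁻¹ : A) * trd (x * g)) • g := by
  have hgg : g * g = algebraMap A _ (Δ : A) := by
    rw [mul_self_eq, ht, hn, zero_smul, map_neg, zero_sub, neg_neg]
  set y := x - algebraMap A _ (⅟2 * trd x) - (⅟2 * (↑Δ⁻¹ : A) * trd (x * g)) • g with hy
  have hyg : y * g = g * y := by
    rw [hy, sub_mul, sub_mul, mul_sub, mul_sub, h, scalar_comm, smul_mul_assoc, mul_smul_comm]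
  have hty : trd y = 0 := by
    rw [hy, trd_sub, trd_sub, trd_algebraMap, trd_smul, ht, mul_zero, sub_zero, ← mul_assoc,
      mul_invOf_self, one_mul, sub_self]
  have htyg : trd (y * g) = 0 := by
    rw [hy, sub_mul, sub_mul, trd_sub, trd_sub, ← Algebra.smul_def, trd_smul, ht, mul_zero,
      sub_zero, smul_mul_assoc, trd_smul, hgg, trd_algebraMap]
    linear_combination (-(trd (x * g)) * ⅟2 * 2) * Δ.inv_mul - trd (x * g) * invOf_mul_self (2 : A)
  have hsg : star g = -g := by rw [star_eq_sub, ht, map_zero, zero_sub]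
  have hsy : star y = -y := by rw [star_eq_sub, hty, map_zero, zero_sub]
  -- The conjugate of `y g` is `ḡ ȳ = g y = y g`, and it is also `-y g` as the trace vanishes.
  have h2 : y * g = -(y * g) := by
    have h3 := star_eq_sub (y * g)
    rw [htyg, map_zero, zero_sub, star_mul, hsg, hsy, neg_mul_neg, ← hyg] at h3
    exact h3
  have h4 : (2 : A) • (y * g) = 0 := by
    rw [two_smul]; nth_rewrite 1 [h2]; exact neg_add_cancel _
  have h5 : y * g = 0 := by
    have := congrArg ((⅟2 : A) • ·) h4
    simpa [smul_smul] using this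
  have h6 : y = 0 := by
    have h7 : y * g * g = 0 := by rw [h5, zero_mul]
    rw [mul_assoc, hgg, ← scalar_comm, ← Algebra.smul_def] at h7
    have := congrArg ((↑Δ⁻¹ : A) • ·) h7
    simpa [smul_smul] using this
  rw [hy, sub_sub, sub_eq_zero] at h6
  exact h6

end Generator

/-! ### Totally definite quaternion algebras -/

section Definite

variable {F : Type*} [Field F] [NumberField F] [IsTotallyReal F] {α β : F}

instance nonempty_realEmbedding : Nonempty (F →+* ℝ) :=
  ⟨InfinitePlace.embedding_of_isReal (IsTotallyReal.isReal (Classical.arbitrary (InfinitePlace F)))⟩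

theorem nrd_ne_zero_of_definite (hdef : ∀ τ : F →+* ℝ, τ α < 0 ∧ τ β < 0) {x : Quat F α β}
    (hx : x ≠ 0) : nrd x ≠ 0 := by
  obtain ⟨τ⟩ := nonempty_realEmbedding (F := F)
  obtain ⟨ha, hb⟩ := hdef τ
  intro h
  have h1 := congrArg τ h
  rw [nrd_eq] at h1
  simp only [map_add, map_sub, map_mul, map_pow, map_zero, Algebra.algebraMap_self, RingHom.id_apply] at h1
  have hab : 0 < τ α * τ β := mul_pos_of_neg_of_neg ha hb
  have key : ∀ c z : ℝ, 0 < c → c * z ^ 2 ≤ 0 → z = 0 := fun c z hc hz => by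
    have : z ^ 2 ≤ 0 := by
      by_contra! h'
      exact absurd hz (not_le.2 (mul_pos hc h'))
    exact pow_eq_zero_iff two_ne_zero |>.1 (le_antisymm this (sq_nonneg z))
  have p0 := sq_nonneg (τ x.re)
  have p1 := mul_nonneg (neg_pos.2 ha).le (sq_nonneg (τ x.imI))
  have p2 := mul_nonneg (neg_pos.2 hb).le (sq_nonneg (τ x.imJ))
  have p3 := mul_nonneg hab.le (sq_nonneg (τ x.imK))
  refine hx ?_
  ext
  · exact (map_eq_zero τ).1 (key 1 _ one_pos (by linarith))
  · exact (map_eq_zero τ).1 (key _ _ (neg_pos.2 ha) (by linarith))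
  · exact (map_eq_zero τ).1 (key _ _ (neg_pos.2 hb) (by linarith))
  · exact (map_eq_zero τ).1 (key _ _ hab (by linarith))

theorem nrd_pos_of_definite (hdef : ∀ τ : F →+* ℝ, τ α < 0 ∧ τ β < 0) {x : Quat F α β}
    (hx : x ≠ 0) (τ : F →+* ℝ) : 0 < τ (nrd x) := by
  refine lt_of_le_of_ne ?_ fun h => nrd_ne_zero_of_definite hdef hx ((map_eq_zero τ).1 h.symm)
  obtain ⟨ha, hb⟩ := hdef τ
  rw [nrd_eq]
  simp only [map_add, map_sub, map_mul, map_pow, Algebra.algebraMap_self, RingHom.id_apply]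
  have hab : 0 < τ α * τ β := mul_pos_of_neg_of_neg ha hb
  have p0 := sq_nonneg (τ x.re)
  have p1 := mul_nonneg (neg_pos.2 ha).le (sq_nonneg (τ x.imI))
  have p2 := mul_nonneg (neg_pos.2 hb).le (sq_nonneg (τ x.imJ))
  have p3 := mul_nonneg hab.le (sq_nonneg (τ x.imK))
  linarith

/-- With `g² = Δ`, the element `Δ x - g x g` anticommutes with `g`, and it is nonzero if `x` does
not commute with `g`. Definiteness makes its norm nonzero; a multiple lies in `R`. It provides the
element that exchanges `θ` and its conjugate. -/
theorem exists_anticommuting (hdef : ∀ τ : F →+* ℝ, τ α < 0 ∧ τ β < 0)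
    {R : Subalgebra (𝓞 F) (Quat F α β)} (hR : IsOrder R) {g : Quat F α β} (hg0 : g ≠ 0)
    (ht : trd g = 0) : ∃ u ∈ R, nrd u ≠ 0 ∧ u * g = -(g * u) := by
  set Δ := -nrd g with hΔ
  have hgg : g * g = algebraMap F _ Δ := by rw [mul_self_eq, ht, zero_smul, hΔ, map_neg, zero_sub]
  obtain ⟨τ⟩ := nonempty_realEmbedding (F := F)
  have hα : α ≠ 0 := fun h => by simpa [h] using (hdef τ).1
  have hβ : β ≠ 0 := fun h => by simpa [h] using (hdef τ).2
  obtain ⟨x, hx⟩ : ∃ x : Quat F α β, x * g ≠ g * x := by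
    by_contra! h
    have hre : g.re = 0 := by
      have : (2 : F) * g.re = 0 := by rw [← trd_eq, ht]
      simpa using this
    have h1 := h ⟨0, 1, 0, 0⟩
    have h2 := h ⟨0, 0, 1, 0⟩
    have e1 := congrArg QuaternionAlgebra.imK h1
    have e2 := congrArg QuaternionAlgebra.imJ h1
    have e3 := congrArg QuaternionAlgebra.imK h2
    simp [hre, eq_neg_iff_add_eq_zero, neg_eq_iff_add_eq_zero, ← two_mul, hα] at e1 e2 e3
    refine hg0 ?_
    ext <;> simp [hre, e1, e2, e3]
  set u := Δ • x - g * x * g with hu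
  have hug : u * g = -(g * u) := by
    have e1 : g * x * g * g = Δ • (g * x) := by
      rw [mul_assoc (g * x), hgg, ← scalar_comm, ← Algebra.smul_def]
    have e2 : g * (g * x * g) = Δ • (x * g) := by
      rw [← mul_assoc, ← mul_assoc, hgg, Algebra.smul_def, mul_assoc]
    rw [hu, sub_mul, mul_sub, e1, e2, smul_mul_assoc, mul_smul_comm]
    abel
  have hu0 : u ≠ 0 := fun h => by
    refine hx ?_
    have e : Δ • (g * x - x * g) = 0 := by
      have e2 : g * (g * x * g) = Δ • (x * g) := by
        rw [← mul_assoc, ← mul_assoc, hgg, Algebra.smul_def, mul_assoc]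
      have : g * u = 0 := by rw [h, mul_zero]
      rwa [hu, mul_sub, e2, mul_smul_comm, ← smul_sub] at this
    have hΔ0 : Δ ≠ 0 := neg_ne_zero.2 (nrd_ne_zero_of_definite hdef hg0)
    exact (sub_eq_zero.1 ((smul_eq_zero.1 e).resolve_left hΔ0)).symm
  obtain ⟨d, hd, hdu⟩ := exists_smul_mem hR u
  have hd' : (d : F) ≠ 0 := by simpa using hd
  refine ⟨_, hdu, nrd_ne_zero_of_definite hdef (smul_ne_zero hd' hu0), ?_⟩
  rw [smul_mul_assoc, mul_smul_comm, hug, smul_neg]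

end Definite

/-! ### From local discriminants to admissible generators -/

section Admissible

variable {F : Type*} [Field F] [NumberField F] {α β : F} {R : Subalgebra (𝓞 F) (Quat F α β)}

/-- For `k = a + b θ` one has `trd(k)² - Disc(θ) b² = 4 nrd(k)`, so `b` is integral. Then `a`
satisfies a monic quadratic equation with integral coefficients. -/
theorem isMaximalAt_of_isLocalDisc {v : FinPlace F} {θ : Quat (v.adicCompletion F) α β}
    (hd : Disc θ ≠ 0) (h : IsLocalDisc v (Disc θ)) (ht : Valued.v (trd θ) ≤ 1)
    (hn : Valued.v (nrd θ) ≤ 1) : IsMaximalAt Valued.v θ := by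
  intro k hk htk hnk
  obtain ⟨a, b, rfl⟩ : ∃ a b : v.adicCompletion F, k = algebraMap _ _ a + b • θ :=
    ⟨_, _, eq_of_commute hd hk⟩
  have e1 : nrd (algebraMap _ _ a + b • θ) = a * (a + b * trd θ) + b ^ 2 * nrd θ := by
    rw [nrd_add, nrd_algebraMap, nrd_smul, star_smul_eq, ← Algebra.smul_def, trd_smul, trd_smul,
      trd_star]
    ring
  have e2 : trd (algebraMap _ _ a + b • θ) = 2 * a + b * trd θ := by
    rw [trd_add, trd_algebraMap, trd_smul]
  have hb : Valued.v b ≤ 1 := h.le_one _ b _ htk hnk (by rw [e1, e2, Disc_eq]; ring)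
  have hb2 : Valued.v (b ^ 2 * nrd θ) ≤ 1 := val_mul_le (by
    rw [map_pow]; exact pow_le_one₀ zero_le hb) hn
  refine ⟨a, b, ?_, hb, rfl⟩
  by_contra! ha
  have h1 : Valued.v (a * (a + b * trd θ)) ≤ 1 := by
    rw [eq_sub_of_add_eq e1.symm]
    exact Valuation.map_sub_le _ hnk hb2
  rw [map_mul, Valuation.map_add_eq_of_lt_left _ ((val_mul_le hb ht).trans_lt ha)] at h1
  exact h1.not_gt (one_lt_mul'' ha ha)

/-- The local completions of a global generator of a quadratic order. -/
theorem isAdmissible_localRing (hR : IsOrder R) {N : Ideal (𝓞 F)} (hN : N ^ 2 = discIdeal R)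
    (v : FinPlace F) {θ u : Quat F α β} (hθ : θ ∈ R) (hd : Disc θ ≠ 0) (hu : u ∈ R)
    (hu0 : nrd u ≠ 0) (huθ : u * θ = star θ * u)
    (hdisc : IsLocalDisc v (algebraMap F (v.adicCompletion F) (Disc θ)))
    (hv : v.asIdeal ∣ N → Valued.v (algebraMap F (v.adicCompletion F) (Disc θ)) = 1) :
    IsAdmissible (Valued.v : Valuation (v.adicCompletion F) ℤᵐ⁰) (localRing v R) (toLocal v θ) := by
  have hO := isIntegralOrder_localRing hR v
  have hm := toLocal_mem (v := v) hθ
  have eD : Disc (toLocal v θ) = algebraMap F (v.adicCompletion F) (Disc θ) :=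
    Disc_baseChange (Algebra.ofId F (v.adicCompletion F)) θ
  have hd' : Disc (toLocal v θ) ≠ 0 := by rw [eD]; simpa using hd
  rw [← eD] at hdisc hv
  refine ⟨hO, hm, hd', isMaximalAt_of_isLocalDisc hd' hdisc (hO.trd_le _ hm) (hO.nrd_le _ hm),
    ⟨toLocal v u, toLocal_mem hu, ?_, ?_⟩, ?_, fun hlt => ?_⟩
  · rw [toLocal, nrd_baseChange]
    simpa [Algebra.ofId_apply] using hu0
  · rw [← map_mul, huθ, map_mul]
    congr 1
    exact (star_baseChange _ _).symm
  · by_cases h : v.asIdeal ∣ N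
    · exact Or.inl (hv h)
    · exact Or.inr (isUnimodular_localRing hR hN h)
  · exact exists_double_root v (hO.trd_le _ hm) (hO.nrd_le _ hm) hlt

end Admissible

/-! ### Local generators of fractional ideals -/

section Maximal

variable {F : Type*} [Field F] [NumberField F]

/-- A common denominator bounds the valuations on `𝔞`, and they are discrete. The element found
generates `𝔞` at `v`. -/
theorem exists_max_valuation {𝔞 : FractionalIdeal (𝓞 F)⁰ F} (h : 𝔞 ≠ 0) (v : FinPlace F) :
    ∃ α ∈ 𝔞, α ≠ 0 ∧ ∀ a ∈ 𝔞, v.valuation F a ≤ v.valuation F α := by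
  obtain ⟨d, hd, hint⟩ := 𝔞.isFractional
  have hd0 : (d : F) ≠ 0 := by simpa using nonZeroDivisors.ne_zero hd
  have key : ∀ a ∈ 𝔞, a ≠ 0 → ∃ n : ℕ, v.valuation F ((d : F) * a) = WithZero.exp (-(n : ℤ)) := by
    intro a ha ha0
    obtain ⟨r, hr⟩ := hint a ha
    have hr' : (d : F) * a = r := by rw [← Algebra.smul_def, ← hr]
    have hr0 : r ≠ 0 := by
      rintro rfl
      rw [show ((0 : 𝓞 F) : F) = 0 from map_zero _] at hr'
      exact mul_ne_zero hd0 ha0 hr'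
    refine ⟨multiplicity v.asIdeal (Ideal.span {r}), ?_⟩
    rw [hr', v.valuation_of_algebraMap r, v.intValuation_eq_exp_neg_multiplicity hr0]
  obtain ⟨a₀, ha₀, h0⟩ := FractionalIdeal.exists_ne_zero_mem_isInteger h
  have hne : ∃ n : ℕ, ∃ a ∈ 𝔞, a ≠ 0 ∧ v.valuation F ((d : F) * a) = WithZero.exp (-(n : ℤ)) := by
    have h1 : algebraMap (𝓞 F) F a₀ ≠ 0 := by simpa using ha₀
    obtain ⟨n, hn⟩ := key _ h0 h1
    exact ⟨n, _, h0, h1, hn⟩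
  classical
  obtain ⟨α, hα, hα0, hv⟩ := Nat.find_spec hne
  refine ⟨α, hα, hα0, fun a ha => ?_⟩
  rcases eq_or_ne a 0 with rfl | ha0
  · simp
  obtain ⟨n, hn⟩ := key a ha ha0
  have hle : Nat.find hne ≤ n := Nat.find_min' hne ⟨a, ha, ha0, hn⟩
  have h1 : v.valuation F ((d : F) * a) ≤ v.valuation F ((d : F) * α) := by
    rw [hn, hv, WithZero.exp_le_exp]
    omega
  rw [map_mul, map_mul] at h1
  exact (mul_le_mul_iff_right₀ (by simpa [zero_lt_iff] using hd0)).1 h1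

/-- If `𝔞 = 0`, the maximal order would be contained in `F`, but it contains `b √ξ`, where `b` is a
denominator of `ξ`. -/
theorem IsFundamentalDiscriminant.ne_zero {ξ : F} (hξ : ξ ≠ 0) {𝔞 : FractionalIdeal (𝓞 F)⁰ F}
    (h : IsFundamentalDiscriminant ξ 𝔞) : 𝔞 ≠ 0 := by
  rcases h with ⟨-, ω, -, hO⟩ | ⟨m, hm, -, rfl⟩
  · rintro rfl
    obtain ⟨a, b, hb, rfl⟩ := IsFractionRing.div_surjective (A := 𝓞 F) ξ
    have hb0 : (algebraMap (𝓞 F) F b) ≠ 0 := by simpa using nonZeroDivisors.ne_zero hb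
    have hmem : (⟨0, b⟩ : QuadExt (algebraMap (𝓞 F) F a / algebraMap (𝓞 F) F b)) ∈
        (integralClosure (𝓞 F) (QuadExt (algebraMap (𝓞 F) F a / algebraMap (𝓞 F) F b)) :
          Set (QuadExt (algebraMap (𝓞 F) F a / algebraMap (𝓞 F) F b))) := by
      refine isIntegral_quadExt_of (t := 0) (n := -(a * b)) (by simp) ?_
      push_cast
      field_simp
      ring
    rw [hO] at hmem
    obtain ⟨s, t, ht, hs⟩ := hmem
    rw [FractionalIdeal.mem_zero_iff] at ht
    have hi := congrArg QuadraticAlgebra.im hs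
    rw [ht] at hi
    simp [IsScalarTower.algebraMap_apply (𝓞 F) F (QuadExt _), QuadraticAlgebra.algebraMap_eq] at hi
    exact hb0 (by simp [hi])
  · exact FractionalIdeal.spanSingleton_ne_zero_iff.2 (inv_ne_zero hm)

end Maximal

/-! ### The embedded quadratic field and its admissible local generators -/

section Embedding

variable {F : Type*} [Field F] [NumberField F] {α β Δ : F} (ι : QuadExt Δ →ₐ[F] Quat F α β)

/-- The image of `√Δ` in the quaternion algebra. -/
def rootOf : Quat F α β := ι ⟨0, 1⟩

theorem apply_eq (z : QuadExt Δ) : ι z = algebraMap F _ z.re + z.im • rootOf ι := by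
  have : z = algebraMap F _ z.re + z.im • (⟨0, 1⟩ : QuadExt Δ) := by
    ext <;> simp [QuadraticAlgebra.algebraMap_eq]
  conv_lhs => rw [this]
  rw [map_add, AlgHom.commutes, map_smul, rootOf]

theorem rootOf_mul_self : rootOf ι * rootOf ι = algebraMap F _ Δ := by
  rw [rootOf, ← map_mul, ← AlgHom.commutes ι]
  congr 1
  ext <;> simp [QuadraticAlgebra.algebraMap_eq]

variable {ι}

/-- If the trace were nonzero, the quadratic equation of `√Δ` in `B` would make it a scalar, and `Δ`
a square in `F`. -/
theorem trd_rootOf (hΔ : ¬ IsSquare Δ) : trd (rootOf ι) = 0 := by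
  by_contra h
  have h1 := mul_self_eq (rootOf ι)
  rw [rootOf_mul_self] at h1
  have h2 : rootOf ι = algebraMap F _ ((Δ + nrd (rootOf ι)) / trd (rootOf ι)) := by
    have h3 : trd (rootOf ι) • rootOf ι = algebraMap F _ (Δ + nrd (rootOf ι)) := by
      rw [map_add, h1]; abel
    have := congrArg ((trd (rootOf ι))⁻¹ • ·) h3
    simp only [smul_smul, inv_mul_cancel₀ h, one_smul] at this
    rw [div_eq_inv_mul, map_mul, ← Algebra.smul_def]
    exact this
  have h3 := rootOf_mul_self ι
  rw [h2, ← map_mul] at h3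
  have h4 := congrArg QuaternionAlgebra.re h3
  simp at h4
  exact hΔ ⟨_, h4.symm⟩

theorem nrd_rootOf (hΔ : ¬ IsSquare Δ) : nrd (rootOf ι) = -Δ := by
  have h1 := mul_self_eq (rootOf ι)
  rw [rootOf_mul_self, trd_rootOf hΔ, zero_smul, zero_sub, ← map_neg] at h1
  have h4 := congrArg QuaternionAlgebra.re h1
  simp at h4
  linear_combination h4

theorem Disc_apply (hΔ : ¬ IsSquare Δ) (z : QuadExt Δ) : Disc (ι z) = 4 * z.im ^ 2 * Δ := by
  rw [apply_eq, add_comm, Disc_add_algebraMap, Disc_eq, trd_smul, nrd_smul, trd_rootOf hΔ,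
    nrd_rootOf hΔ]
  ring

theorem star_apply (hΔ : ¬ IsSquare Δ) (z : QuadExt Δ) :
    star (ι z) = algebraMap F _ z.re - z.im • rootOf ι := by
  rw [star_eq_sub, apply_eq, trd_add, trd_algebraMap, trd_smul, trd_rootOf hΔ, mul_zero, add_zero,
    two_mul, map_add]
  abel

theorem isIntegral_of_mem_lattice {B : Type*} [CommRing B] [Algebra F B] [Algebra (𝓞 F) B]
    [IsScalarTower (𝓞 F) F B] {𝔠 : FractionalIdeal (𝓞 F)⁰ F} {ω : B} {S : Subalgebra (𝓞 F) B}
    (hS : ∀ x, x ∈ S ↔ ∃ s : 𝓞 F, ∃ t ∈ 𝔠, x = algebraMap (𝓞 F) B s + algebraMap F B t * ω)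
    {z : B} (hz : z ∈ S) : IsIntegral (𝓞 F) z := by
  refine IsIntegral.of_mem_of_fg S ?_ z hz
  have h𝔠 : (𝔠 : Submodule (𝓞 F) F).FG := FractionalIdeal.fg_of_isNoetherianRing le_rfl 𝔠
  let f : F →ₗ[𝓞 F] B :=
    { toFun := fun t => algebraMap F B t * ω
      map_add' := fun a b => by rw [map_add, add_mul]
      map_smul' := fun c a => by
        rw [RingHom.id_apply, Algebra.smul_def, map_mul, ← IsScalarTower.algebraMap_apply,
          Algebra.smul_def, mul_assoc] }
  have e : Subalgebra.toSubmodule S = Submodule.span (𝓞 F) {1} ⊔ (𝔠 : Submodule (𝓞 F) F).map f := by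
    refine SetLike.ext fun x => ?_
    rw [Subalgebra.mem_toSubmodule, hS, Submodule.mem_sup]
    constructor
    · rintro ⟨s, t, ht, rfl⟩
      exact ⟨algebraMap _ _ s, Submodule.mem_span_singleton.2
        ⟨s, (Algebra.algebraMap_eq_smul_one s).symm⟩, _, ⟨t, ht, rfl⟩, rfl⟩
    · rintro ⟨y, hy, _, ⟨t, ht, rfl⟩, rfl⟩
      obtain ⟨s, rfl⟩ := Submodule.mem_span_singleton.1 hy
      exact ⟨s, t, ht, by rw [Algebra.algebraMap_eq_smul_one]; rfl⟩
  rw [e]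
  exact (Submodule.fg_span_singleton _).sup (h𝔠.map f)

theorem isIntegral_of_mem_quadLattice {𝔠 : FractionalIdeal (𝓞 F)⁰ F} {ω : QuadExt Δ}
    {S : Subalgebra (𝓞 F) (QuadExt Δ)} (hS : (S : Set (QuadExt Δ)) = quadLattice 𝔠 ω)
    {z : QuadExt Δ} (hz : z ∈ quadLattice 𝔠 ω) : z ∈ integralClosure (𝓞 F) (QuadExt Δ) := by
  have hz' : z ∈ S := by rw [← hS] at hz; exact hz
  refine isIntegral_of_mem_lattice (𝔠 := 𝔠) (ω := ω) (fun x => ?_) hz'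
  have : x ∈ S ↔ x ∈ quadLattice 𝔠 ω := by rw [← hS]; rfl
  rw [this]
  refine exists_congr fun s => exists_congr fun t => and_congr_right fun _ => ?_
  rw [← Algebra.smul_def]

theorem not_isSquare_of_neg [IsTotallyReal F] (h : ∀ τ : F →+* ℝ, τ Δ < 0) : ¬ IsSquare Δ := by
  rintro ⟨s, rfl⟩
  obtain ⟨τ⟩ := nonempty_realEmbedding (F := F)
  have := h τ
  rw [map_mul] at this
  exact this.not_ge (mul_self_nonneg _)

theorem isCoprime_dvd_condExponent {ξ : F} (hξ : ξ ≠ 0) {J : Ideal (𝓞 F)}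
    (h : IsCoprime (quadConductor ξ) J) {v : FinPlace F} (hv : v.asIdeal ∣ J) :
    condExponent v ξ = 0 := by
  by_contra h'
  exact not_dvd_of_isCoprime v h ((dvd_quadConductor_iff v hξ).2 h') hv

theorem condExponent_eq_zero_or {l D : F} (hl : l ≠ 0) (hD : D ≠ 0)
    (hlD : IsCoprime (quadConductor l) (quadConductor D)) (v : FinPlace F) :
    condExponent v l = 0 ∨ condExponent v D = 0 := by
  by_cases h : condExponent v D = 0
  · exact Or.inr h
  · exact Or.inl (isCoprime_dvd_condExponent hl hlD ((dvd_quadConductor_iff v hD).2 h))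

/-- At every finite place there is a local generator of the maximal order of the quadratic field
that belongs to the given global lattice. -/
theorem exists_isAdmissible [IsTotallyReal F] (hdef : ∀ τ : F →+* ℝ, τ α < 0 ∧ τ β < 0)
    {R : Subalgebra (𝓞 F) (Quat F α β)} (hR : IsOrder R) {N : Ideal (𝓞 F)}
    (hN : N ^ 2 = discIdeal R) {l D : F} (hl : l ≠ 0) (hD : ∀ τ : F →+* ℝ, τ (l * D) < 0)
    (hlD : IsCoprime (quadConductor l) (quadConductor D))
    (hΔN : IsCoprime (quadConductor (l * D)) N) {𝔞 𝔟 : FractionalIdeal (𝓞 F)⁰ F}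
    (h𝔟 : IsFundamentalDiscriminant l 𝔟) (h𝔞 : IsFundamentalDiscriminant D 𝔞)
    {ι : QuadExt (l * D) →ₐ[F] Quat F α β}
    (hι : ∀ x ∈ integralClosure (𝓞 F) (QuadExt (l * D)), ι x ∈ R)
    {ω : QuadExt (l * D)} (hω : GeneratesOrder (𝔞 * 𝔟) ω) (v : FinPlace F) :
    ∃ θ ∈ quadLattice (𝔞 * 𝔟) ω, θ.im ≠ 0 ∧ θ ∈ integralClosure (𝓞 F) (QuadExt (l * D)) ∧
      IsAdmissible (Valued.v : Valuation (v.adicCompletion F) ℤᵐ⁰) (localRing v R)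
        (toLocal v (ι θ)) := by
  have hΔ := not_isSquare_of_neg hD
  have hlD0 : l * D ≠ 0 := fun h => hΔ ⟨0, by rw [h]; simp⟩
  have hD0 : D ≠ 0 := right_ne_zero_of_mul hlD0
  obtain ⟨a, ha, ha0, hamax⟩ := exists_max_valuation (h𝔞.ne_zero hD0) v
  obtain ⟨b, hb, hb0, hbmax⟩ := exists_max_valuation (h𝔟.ne_zero hl) v
  have hda := h𝔞.isLocalDisc hD0 v ha ha0 hamax
  have hdb := h𝔟.isLocalDisc hl v hb hb0 hbmax
  have hdisc : IsLocalDisc v (algebraMap F (v.adicCompletion F) (l * D * (a * b) ^ 2)) := by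
    have e : l * D * (a * b) ^ 2 = (l * b ^ 2) * (D * a ^ 2) := by ring
    rw [e]
    -- The conductors of `l` and `D` are coprime, so one of the factors `l b²`, `D a²` is a unit at
    -- `v`, and `IsLocalDisc.mul` applies.
    rcases condExponent_eq_zero_or hl hD0 hlD v with h | h
    · rw [map_mul]
      exact hdb.mul hda (hdb.eq_one hb0 h)
    · rw [mul_comm, map_mul]
      exact hda.mul hdb (hda.eq_one ha0 h)
  obtain ⟨hω1, S, hS⟩ := hω
  have him := im_sq_of_sub_star_sq hlD0 hω1
  set θ : QuadExt (l * D) := (a * b) • ω with hθ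
  have hθmem : θ ∈ quadLattice (𝔞 * 𝔟) ω := ⟨0, a * b, FractionalIdeal.mul_mem_mul ha hb, by simp [hθ]⟩
  have hθim : θ.im ^ 2 = (a * b) ^ 2 / 4 := by
    rw [hθ, QuadraticAlgebra.im_smul, smul_eq_mul, mul_pow, him]; ring
  have hθ0 : θ.im ≠ 0 := fun h => by
    rw [h] at hθim
    have : (a * b) ^ 2 = 0 := by linear_combination -4 * hθim
    exact mul_ne_zero ha0 hb0 (pow_eq_zero_iff two_ne_zero |>.1 this)
  have hDisc : Disc (ι θ) = l * D * (a * b) ^ 2 := by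
    rw [Disc_apply hΔ, hθim]; ring
  have hθint : θ ∈ integralClosure (𝓞 F) (QuadExt (l * D)) := by
    refine isIntegral_of_mem_quadLattice hS ?_
    exact hθmem
  have hg0 : rootOf ι ≠ 0 := fun h => by
    have := nrd_rootOf (ι := ι) hΔ
    rw [h, nrd_zero] at this
    exact hlD0 (neg_eq_zero.1 this.symm)
  obtain ⟨u, hu, hu0, hug⟩ := exists_anticommuting hdef hR hg0 (trd_rootOf hΔ)
  refine ⟨θ, hθmem, hθ0, hθint, isAdmissible_localRing hR hN v (hι θ hθint) ?_ hu hu0 ?_ ?_ ?_⟩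
  · rw [hDisc]
    exact mul_ne_zero hlD0 (pow_ne_zero 2 (mul_ne_zero ha0 hb0))
  · rw [star_apply hΔ, apply_eq, mul_add, sub_mul, ← scalar_comm, mul_smul_comm, hug,
      smul_mul_assoc, smul_neg, sub_eq_add_neg]
  · rw [hDisc]; exact hdisc
  · intro hv
    rw [hDisc]
    -- At a place dividing `N` the conductor of `l D` is trivial, so such a place is always in the
    -- unramified case.
    exact hdisc.eq_one (mul_ne_zero ha0 hb0) (isCoprime_dvd_condExponent hlD0 hΔN hv)

end Embedding

/-! ### Adelic groups and their local components -/

section Adelic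

variable {F : Type*} [Field F] [NumberField F] {α β : F} {R : Subalgebra (𝓞 F) (Quat F α β)}

theorem mem_hat {S : Set (Quat F α β)} {x : Quat (FinAdele F) α β} :
    x ∈ hat S ↔ ∀ v, comp v x ∈ localize v S := by
  simp only [hat, Subring.mem_iInf, Subring.mem_comap]
  rfl

theorem nrd_comp (v : FinPlace F) (x : Quat (FinAdele F) α β) : nrd (comp v x) = nrd x v :=
  nrd_baseChange _ _

theorem quat_adele_ext {x y : Quat (FinAdele F) α β} (h : ∀ v, comp v x = comp v y) : x = y :=
  QuaternionAlgebra.ext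
    (FiniteAdeleRing.ext _ fun v => congrArg QuaternionAlgebra.re (h v))
    (FiniteAdeleRing.ext _ fun v => congrArg QuaternionAlgebra.imI (h v))
    (FiniteAdeleRing.ext _ fun v => congrArg QuaternionAlgebra.imJ (h v))
    (FiniteAdeleRing.ext _ fun v => congrArg QuaternionAlgebra.imK (h v))

/-- The component at `v` of a unit of `B ⊗ 𝔸_f`. -/
def compUnit (v : FinPlace F) : AdeleUnits α β →* (Quat (v.adicCompletion F) α β)ˣ :=
  Units.map (comp (α := α) (β := β) v).toMonoidHom

theorem mem_hatUnits {u : AdeleUnits α β} :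
    u ∈ hatUnits R ↔ ∀ v, compUnit v u ∈ unitsOf (localRing v R) := by
  rw [hatUnits, Submonoid.mem_units_iff]
  change (u : Quat (FinAdele F) α β) ∈ hat (R : Set (Quat F α β)) ∧
    ((u⁻¹ : AdeleUnits α β) : Quat (FinAdele F) α β) ∈ hat (R : Set (Quat F α β)) ↔ _
  simp only [mem_hat, mem_unitsOf, ← forall_and]
  rfl

/-- The finite idele which is `x` at `v` and `0` elsewhere. -/
def adeleSingle (v : FinPlace F) [DecidableEq (FinPlace F)] (x : v.adicCompletion F) : FinAdele F :=
  ⟨Pi.single v x, by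
    rw [Filter.eventually_cofinite]
    refine (Set.finite_singleton v).subset fun w hw => ?_
    by_contra h
    refine hw ?_
    rw [Pi.single_eq_of_ne h]
    exact zero_mem _⟩

theorem adeleSingle_same [DecidableEq (FinPlace F)] (v : FinPlace F) (x : v.adicCompletion F) :
    adeleSingle v x v = x := Pi.single_eq_same v x

theorem adeleSingle_ne [DecidableEq (FinPlace F)] {v w : FinPlace F} (h : w ≠ v)
    (x : v.adicCompletion F) : adeleSingle v x w = 0 := Pi.single_eq_of_ne h x

theorem exists_quat_single (v : FinPlace F) (x : Quat (v.adicCompletion F) α β) :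
    ∃ y : Quat (FinAdele F) α β, comp v y = x ∧ ∀ w, w ≠ v → comp w y = 0 := by
  classical
  refine ⟨⟨adeleSingle v x.re, adeleSingle v x.imI, adeleSingle v x.imJ, adeleSingle v x.imK⟩,
    ?_, fun w hw => ?_⟩
  · exact QuaternionAlgebra.ext (adeleSingle_same v _) (adeleSingle_same v _)
      (adeleSingle_same v _) (adeleSingle_same v _)
  · exact QuaternionAlgebra.ext (adeleSingle_ne hw _) (adeleSingle_ne hw _)
      (adeleSingle_ne hw _) (adeleSingle_ne hw _)

/-- The condition on `R̂` is tested on adeles supported at a single place. -/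
theorem mem_normalizer {z : AdeleUnits α β} :
    z ∈ normalizer R ↔ ∀ v, Normalizes (localRing v R) (compUnit v z) := by
  constructor
  · intro h v r
    obtain ⟨y, hy, hy'⟩ := exists_quat_single v r
    have h1 := h y
    rw [mem_hat, mem_hat] at h1
    have e : ∀ w, comp w (((z⁻¹ : AdeleUnits α β) : Quat (FinAdele F) α β) * y * (z : Quat (FinAdele F) α β)) =
        (((compUnit w z)⁻¹ : (Quat (w.adicCompletion F) α β)ˣ) : Quat (w.adicCompletion F) α β) *
          comp w y * (compUnit w z : Quat (w.adicCompletion F) α β) := fun w => by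
      rw [map_mul, map_mul]; rfl
    simp only [e] at h1
    constructor
    · intro hr
      have := h1.1 fun w => ?_
      · rw [← hy]; exact this v
      · by_cases hw : w = v
        · subst hw; rw [hy]; exact hr
        · rw [hy' w hw]; exact zero_mem _
    · intro hr
      have := h1.2 fun w => ?_
      · rw [← hy]; exact this v
      · by_cases hw : w = v
        · subst hw; rw [hy]; exact hr
        · rw [hy' w hw, mul_zero, zero_mul]; exact zero_mem _
  · intro h r
    rw [mem_hat, mem_hat]
    refine forall_congr' fun v => ?_
    rw [map_mul, map_mul]
    exact h v (comp v r)

/-- Together with `finite_not_coordsLE_one`, this shows that `R_v` is the standard lattice at almost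
all places. Thus the restricted product of the `B_v` may be formed with respect to the `R_v`. -/
theorem finite_not_standard (hR : IsOrder R) :
    {v : FinPlace F | ¬ ∀ x : Quat (v.adicCompletion F) α β, CoordsLE v 1 x →
      x ∈ localRing v R}.Finite := by
  let e : Fin 4 → Quat F α β := ![1, ⟨0, 1, 0, 0⟩, ⟨0, 0, 1, 0⟩, ⟨0, 0, 0, 1⟩]
  choose d hd he using fun i => exists_smul_mem hR (e i)
  have hd' : ∀ i, (d i : F) ≠ 0 := fun i => by simpa using hd i
  have hfin : (⋃ i, {v : FinPlace F | v.valuation F (d i : F) ≠ 1}).Finite :=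
    Set.finite_iUnion fun i => finite_valuation_ne_one (hd' i)
  refine hfin.subset fun v hv => ?_
  by_contra hv'
  simp only [Set.mem_iUnion, Set.mem_ofPred_eq, not_exists, not_not] at hv'
  have hmem : ∀ i, toLocal v (e i) ∈ localRing v R := fun i => by
    have h1 := toLocal_mem (v := v) (he i)
    rw [toLocal_smul_int] at h1
    have h2 : Valued.v (algebraMap F (v.adicCompletion F) (d i))⁻¹ = 1 := by
      rw [map_inv₀, valued_algebraMap, hv', inv_one]
    have h3 := (isIntegralOrder_localRing hR v).smul_mem h2.le h1
    rwa [smul_smul, inv_mul_cancel₀ (by simpa using hd' i), one_smul] at h3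
  refine hv fun x hx => ?_
  have e1 : x = x.re • toLocal v (e 0) + x.imI • toLocal v (e 1) + x.imJ • toLocal v (e 2) +
      x.imK • toLocal v (e 3) := by
    refine QuaternionAlgebra.ext ?_ ?_ ?_ ?_ <;> simp [e, toLocal]
  rw [e1]
  have hO := isIntegralOrder_localRing hR v
  exact add_mem (add_mem (add_mem (hO.smul_mem hx.1 (hmem 0)) (hO.smul_mem hx.2.1 (hmem 1)))
    (hO.smul_mem hx.2.2.1 (hmem 2))) (hO.smul_mem hx.2.2.2 (hmem 3))

theorem finite_not_mem_localRing (hR : IsOrder R) (x : Quat (FinAdele F) α β) :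
    {v : FinPlace F | comp v x ∉ localRing v R}.Finite := by
  have h : ∀ y : FinAdele F, {v : FinPlace F | ¬ Valued.v (y v) ≤ 1}.Finite := fun y => by
    have := y.2
    rw [Filter.eventually_cofinite] at this
    exact this
  refine ((finite_not_standard hR).union (((h x.re).union (h x.imI)).union
    ((h x.imJ).union (h x.imK)))).subset fun v hv => ?_
  by_contra hv'
  simp only [Set.mem_union, Set.mem_ofPred_eq, not_or, not_not] at hv'
  exact hv (hv'.1 _ ⟨hv'.2.1.1, hv'.2.1.2, hv'.2.2.1, hv'.2.2.2⟩)

theorem finite_not_mem_unitsOf (hR : IsOrder R) (x : AdeleUnits α β) :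
    {v : FinPlace F | compUnit v x ∉ unitsOf (localRing v R)}.Finite := by
  refine ((finite_not_mem_localRing hR x).union
    (finite_not_mem_localRing hR ((x⁻¹ : AdeleUnits α β) : Quat (FinAdele F) α β))).subset
    fun v hv => ?_
  by_contra hv'
  simp only [Set.mem_union, Set.mem_ofPred_eq, not_or, not_not] at hv'
  exact hv (mem_unitsOf.2 hv')

theorem exists_quat_of_local (hR : IsOrder R) (k : ∀ v : FinPlace F, Quat (v.adicCompletion F) α β)
    (hk : {v : FinPlace F | k v ∉ localRing v R}.Finite) :
    ∃ x : Quat (FinAdele F) α β, ∀ v, comp v x = k v := by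
  have h : {v : FinPlace F | ¬ CoordsLE v 1 (k v)}.Finite := by
    refine (hk.union (finite_not_coordsLE_one hR)).subset fun v hv => ?_
    by_contra hv'
    simp only [Set.mem_union, Set.mem_ofPred_eq, not_or, not_not] at hv'
    exact hv (hv'.2 _ hv'.1)
  have key : ∀ f : ∀ v : FinPlace F, v.adicCompletion F, (∀ v, CoordsLE v 1 (k v) →
      Valued.v (f v) ≤ 1) → ∀ᶠ v in Filter.cofinite, f v ∈ v.adicCompletionIntegers F := by
    intro f hf
    rw [Filter.eventually_cofinite]
    exact h.subset fun v hv hv' => hv (hf v hv')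
  exact ⟨⟨⟨fun v => (k v).re, key _ fun v h => h.1⟩, ⟨fun v => (k v).imI, key _ fun v h => h.2.1⟩,
    ⟨fun v => (k v).imJ, key _ fun v h => h.2.2.1⟩, ⟨fun v => (k v).imK, key _ fun v h => h.2.2.2⟩⟩,
    fun v => rfl⟩

theorem exists_unit_of_local (hR : IsOrder R) (k : ∀ v : FinPlace F, (Quat (v.adicCompletion F) α β)ˣ)
    (hk : {v : FinPlace F | k v ∉ unitsOf (localRing v R)}.Finite) :
    ∃ x : AdeleUnits α β, ∀ v, compUnit v x = k v := by
  obtain ⟨x, hx⟩ := exists_quat_of_local hR (fun v => (k v : Quat (v.adicCompletion F) α β))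
    (hk.subset fun v hv h => hv (mem_unitsOf.1 h).1)
  obtain ⟨y, hy⟩ := exists_quat_of_local hR
    (fun v => (((k v)⁻¹ : (Quat (v.adicCompletion F) α β)ˣ) : Quat (v.adicCompletion F) α β))
    (hk.subset fun v hv h => hv (mem_unitsOf.1 h).2)
  refine ⟨⟨x, y, quat_adele_ext fun v => ?_, quat_adele_ext fun v => ?_⟩, fun v => Units.ext (hx v)⟩
  · rw [map_mul, hx, hy, map_one, Units.mul_inv]
  · rw [map_mul, hx, hy, map_one, Units.inv_mul]

/-- The component at `v` of a finite idele. -/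
def ideleComp (v : FinPlace F) : (FinAdele F)ˣ →* (v.adicCompletion F)ˣ :=
  Units.map (adeleEval v).toRingHom.toMonoidHom

theorem idele_ext {x y : (FinAdele F)ˣ} (h : ∀ v, ideleComp v x = ideleComp v y) : x = y :=
  Units.ext (FiniteAdeleRing.ext _ fun v => congrArg Units.val (h v))

theorem compUnit_scalarUnit (v : FinPlace F) (ζ : (FinAdele F)ˣ) :
    compUnit v (scalarUnit (α := α) (β := β) ζ) = scalarOf α β (ideleComp v ζ) :=
  Units.ext (baseChange_algebraMap (adeleEval v) (ζ : FinAdele F))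

theorem exists_idele_of_local (c : ∀ v : FinPlace F, (v.adicCompletion F)ˣ)
    (hc : {v | c v ≠ 1}.Finite) : ∃ ζ : (FinAdele F)ˣ, ∀ v, ideleComp v ζ = c v := by
  have h1 : ∀ᶠ v in Filter.cofinite, (c v : v.adicCompletion F) ∈ v.adicCompletionIntegers F := by
    rw [Filter.eventually_cofinite]
    exact hc.subset fun v hv h => hv (by rw [h]; exact one_mem _)
  have h2 : ∀ᶠ v in Filter.cofinite, (((c v)⁻¹ : (v.adicCompletion F)ˣ) : v.adicCompletion F) ∈
      v.adicCompletionIntegers F := by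
    rw [Filter.eventually_cofinite]
    exact hc.subset fun v hv h => hv (by rw [h, inv_one]; exact one_mem _)
  exact ⟨⟨⟨_, h1⟩, ⟨_, h2⟩, FiniteAdeleRing.ext _ fun v => Units.mul_inv (c v),
    FiniteAdeleRing.ext _ fun v => Units.inv_mul (c v)⟩, fun v => Units.ext rfl⟩

theorem exists_scalarUnit_mul (hR : IsOrder R) {z : AdeleUnits α β}
    (h : ∀ v, IsScalarMulUnit (localRing v R) (compUnit v z)) :
    ∃ ζ : (FinAdele F)ˣ, ∃ u ∈ hatUnits R, z = scalarUnit ζ * u := by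
  classical
  choose c s hs hcs using h
  -- At the places where `z` is already a unit of `R_v` the scalar is taken to be `1`, so that the
  -- chosen scalars form an idele.
  obtain ⟨ζ, hζ⟩ := exists_idele_of_local
    (fun v => if compUnit v z ∈ unitsOf (localRing v R) then 1 else c v)
    ((finite_not_mem_unitsOf hR z).subset fun v hv h' => hv (if_pos h'))
  refine ⟨ζ, (scalarUnit ζ)⁻¹ * z, mem_hatUnits.2 fun v => ?_, (mul_inv_cancel_left _ _).symm⟩
  rw [map_mul, map_inv, compUnit_scalarUnit, hζ]
  split_ifs with h'
  · simpa [scalarOf] using h'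
  · have e : (scalarOf α β (c v))⁻¹ * compUnit v z = s v := by
      rw [hcs v, inv_mul_cancel_left]
    rw [e]
    exact hs v

/-- The normalizer of `R̂` as a subgroup. -/
def normalizerGroup (R : Subalgebra (𝓞 F) (Quat F α β)) : Subgroup (AdeleUnits α β) where
  carrier := normalizer R
  one_mem' := mem_normalizer.2 fun v r => by simp
  mul_mem' ha hb := mem_normalizer.2 fun v => by
    rw [map_mul]; exact (mem_normalizer.1 ha v).mul (mem_normalizer.1 hb v)
  inv_mem' ha := mem_normalizer.2 fun v => by
    rw [map_inv]; exact (mem_normalizer.1 ha v).inv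

theorem mem_normalizerGroup {z : AdeleUnits α β} :
    z ∈ normalizerGroup R ↔ ∀ v, Normalizes (localRing v R) (compUnit v z) := mem_normalizer

theorem hatUnits_le_normalizerGroup : hatUnits R ≤ normalizerGroup R := fun _ hu =>
  mem_normalizerGroup.2 fun v => normalizes_of_mem (mem_hatUnits.1 hu v)

theorem scalarUnit_mem_normalizerGroup (ζ : (FinAdele F)ˣ) :
    scalarUnit (α := α) (β := β) ζ ∈ normalizerGroup R :=
  mem_normalizerGroup.2 fun v => by rw [compUnit_scalarUnit]; exact normalizes_scalarOf _

theorem scalarUnit_comm (ζ : (FinAdele F)ˣ) (x : AdeleUnits α β) :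
    scalarUnit ζ * x = x * scalarUnit ζ := Units.ext (scalar_comm _ _)

end Adelic

/-! ### The torus `K̂^×` and the special points -/

section Torus

variable {F : Type*} [Field F] [NumberField F] {α β Δ : F} {R : Subalgebra (𝓞 F) (Quat F α β)}
  {ι : QuadExt Δ →ₐ[F] Quat F α β}

theorem exists_eq_of_commute_rootOf (hΔ : ¬ IsSquare Δ) {y : Quat (FinAdele F) α β}
    (hy : y * toAdele (rootOf ι) = toAdele (rootOf ι) * y) :
    ∃ a b : FinAdele F, y = algebraMap (FinAdele F) _ a + b • toAdele (rootOf ι) := by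
  have hΔ0 : Δ ≠ 0 := fun h => hΔ ⟨0, by rw [h, mul_zero]⟩
  let _ : Invertible (2 : FinAdele F) :=
    ((invertibleOfNonzero (two_ne_zero : (2 : F) ≠ 0)).map (algebraMap F (FinAdele F))).copy _
      (map_ofNat _ 2).symm
  exact ⟨_, _, eq_of_commute_of_trd_eq_zero
    (Δ := Units.map (algebraMap F (FinAdele F)).toMonoidHom (Units.mk0 Δ hΔ0))
    (((trd_baseChange _ _).trans (congrArg _ (trd_rootOf hΔ))).trans (map_zero _))
    (((nrd_baseChange _ _).trans (congrArg _ (nrd_rootOf hΔ))).trans (map_neg _ _)) hy⟩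

theorem toAdele_apply_eq (z : QuadExt Δ) : toAdele (ι z) =
    algebraMap (FinAdele F) _ (algebraMap F _ z.re) +
      (algebraMap F (FinAdele F) z.im) • toAdele (rootOf ι) := by
  rw [apply_eq, map_add]
  exact congrArg₂ (· + ·) (baseChange_algebraMap _ _) (baseChange_smul _ _ _)

/-- `K ⊗ 𝔸_f` is its own centralizer. In this form membership can be checked place by place. -/
theorem mem_hatK (hΔ : ¬ IsSquare Δ) {x : AdeleUnits α β} :
    x ∈ hatK ι ↔ (x : Quat (FinAdele F) α β) * toAdele (rootOf ι) = toAdele (rootOf ι) * x := by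
  have hle : (Algebra.adjoin (FinAdele F) (Set.range fun a => toAdele (ι a))) ≤
      Subalgebra.centralizer (FinAdele F) {toAdele (rootOf ι)} := by
    refine Algebra.adjoin_le ?_
    rintro _ ⟨a, rfl⟩
    rw [SetLike.mem_coe, Subalgebra.mem_centralizer_iff]
    rintro _ rfl
    change toAdele (rootOf ι) * toAdele (ι a) = toAdele (ι a) * toAdele (rootOf ι)
    rw [← map_mul, ← map_mul, rootOf, ← map_mul, ← map_mul, mul_comm]
  have key : ∀ y : Quat (FinAdele F) α β, y * toAdele (rootOf ι) = toAdele (rootOf ι) * y →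
      y ∈ Algebra.adjoin (FinAdele F) (Set.range fun a => toAdele (ι a)) := by
    intro y hy
    obtain ⟨a, b, rfl⟩ := exists_eq_of_commute_rootOf hΔ hy
    exact add_mem (Subalgebra.algebraMap_mem _ _)
      (Subalgebra.smul_mem _ (Algebra.subset_adjoin (Set.mem_range_self (⟨0, 1⟩ : QuadExt Δ))) _)
  rw [hatK, Submonoid.mem_units_iff]
  constructor
  · intro h
    exact ((Subalgebra.mem_centralizer_iff _).1 (hle h.1) _ rfl).symm
  · intro h
    refine ⟨key _ h, key _ ?_⟩
    have h' : Commute (x : Quat (FinAdele F) α β) (toAdele (rootOf ι)) := h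
    exact h'.units_inv_left

theorem commute_apply_iff {v : FinPlace F} {θ : QuadExt Δ} (hθ : θ.im ≠ 0)
    {y : Quat (v.adicCompletion F) α β} :
    y * toLocal v (ι θ) = toLocal v (ι θ) * y ↔
      y * toLocal v (rootOf ι) = toLocal v (rootOf ι) * y := by
  have e : toLocal v (ι θ) = algebraMap (v.adicCompletion F) _ (algebraMap F _ θ.re) +
      (algebraMap F (v.adicCompletion F) θ.im) • toLocal v (rootOf ι) := by
    rw [apply_eq, map_add]
    exact congrArg₂ (· + ·) (baseChange_algebraMap _ _) (baseChange_smul _ _ _)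
  rw [e, mul_add, add_mul, scalar_comm, add_right_inj, mul_smul_comm, smul_mul_assoc]
  refine ⟨fun h => ?_, fun h => by rw [h]⟩
  have h0 : algebraMap F (v.adicCompletion F) θ.im ≠ 0 := by simpa using hθ
  have := congrArg ((algebraMap F (v.adicCompletion F) θ.im)⁻¹ • ·) h
  beta_reduce at this
  rwa [smul_smul, smul_smul, inv_mul_cancel₀ h0, one_smul, one_smul] at this

theorem mem_hatK_iff_local (hΔ : ¬ IsSquare Δ) {x : AdeleUnits α β} :
    x ∈ hatK ι ↔ ∀ v, (compUnit v x : Quat (v.adicCompletion F) α β) * toLocal v (rootOf ι) =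
      toLocal v (rootOf ι) * compUnit v x := by
  rw [mem_hatK hΔ]
  constructor
  · intro h v
    have := congrArg (comp v) h
    rwa [map_mul, map_mul] at this
  · intro h
    refine quat_adele_ext fun v => ?_
    rw [map_mul, map_mul]
    exact h v

theorem scalarUnit_mem_hatK (hΔ : ¬ IsSquare Δ) (ζ : (FinAdele F)ˣ) :
    scalarUnit ζ ∈ hatK ι := (mem_hatK hΔ).2 (scalar_comm _ _)

theorem globalK_le_hatK (hΔ : ¬ IsSquare Δ) : globalK ι ≤ hatK ι := by
  rintro _ ⟨κ, rfl⟩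
  rw [mem_hatK hΔ]
  change toAdele (ι κ) * toAdele (ι _) = toAdele (ι _) * toAdele (ι κ)
  rw [← map_mul, ← map_mul, ← map_mul, ← map_mul, mul_comm]

variable (R ι) in
/-- For every finite place `v` some element of `S`, integral over `𝓞 F` and not in `F`, is
admissible for the completion of `R` at `v`. -/
def IsLocallyAdmissible (S : Set (QuadExt Δ)) : Prop :=
  ∀ v : FinPlace F, ∃ θ ∈ S, θ.im ≠ 0 ∧ θ ∈ integralClosure (𝓞 F) (QuadExt Δ) ∧
    IsAdmissible (Valued.v : Valuation (v.adicCompletion F) ℤᵐ⁰) (localRing v R)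
      (toLocal v (ι θ))

variable {S : Set (QuadExt Δ)}

/-- An element of `R_v` that commutes with `√Δ` has integral trace and norm, so it belongs to
`𝓞_v[θ]`, which lies in the completion of `𝓞_K` since `θ` is integral. -/
theorem hatOK_eq (hΔ : ¬ IsSquare Δ) (hι : ∀ x ∈ integralClosure (𝓞 F) (QuadExt Δ), ι x ∈ R)
    (hA : IsLocallyAdmissible R ι S) : hatOK ι = hatUnits R ⊓ hatK ι := by
  have h1 : ∀ x : Quat (FinAdele F) α β,
      x ∈ hat (ι '' (integralClosure (𝓞 F) (QuadExt Δ) : Set (QuadExt Δ))) ↔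
      x ∈ hat (R : Set (Quat F α β)) ∧ ∀ v, comp v x * toLocal v (rootOf ι) =
        toLocal v (rootOf ι) * comp v x := by
    intro x
    rw [mem_hat, mem_hat, ← forall_and]
    refine forall_congr' fun v => ?_
    constructor
    · intro h
      refine ⟨Algebra.adjoin_mono (Set.image_mono ?_) h, ?_⟩
      · rintro _ ⟨a, ha, rfl⟩
        exact hι a ha
      · have hle : localize v (ι '' (integralClosure (𝓞 F) (QuadExt Δ) : Set (QuadExt Δ))) ≤
            Subalgebra.centralizer (v.adicCompletionIntegers F) {toLocal v (rootOf ι)} := by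
          refine Algebra.adjoin_le ?_
          rintro _ ⟨_, ⟨a, -, rfl⟩, rfl⟩
          rw [SetLike.mem_coe, Subalgebra.mem_centralizer_iff]
          rintro _ rfl
          rw [← map_mul, ← map_mul, rootOf, ← map_mul, ← map_mul, mul_comm]
        exact ((Subalgebra.mem_centralizer_iff _).1 (hle h) _ rfl).symm
    · rintro ⟨hxR, hx⟩
      obtain ⟨θ, -, him, hint, hadm⟩ := hA v
      obtain ⟨a, b, ha, hb, hab⟩ := hadm.max (comp v x) ((commute_apply_iff him).2 hx)
        (hadm.order.trd_le _ hxR) (hadm.order.nrd_le _ hxR)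
      rw [hab]
      exact add_mem (algebraMap_mem_localize _ ha) (smul_mem_localize hb
        (Algebra.subset_adjoin ⟨_, ⟨θ, hint, rfl⟩, rfl⟩))
  ext x
  rw [Subgroup.mem_inf, mem_hatK_iff_local hΔ, hatOK, hatUnits, Submonoid.mem_units_iff,
    Submonoid.mem_units_iff]
  change _ ∈ hat (ι '' (integralClosure (𝓞 F) (QuadExt Δ) : Set (QuadExt Δ))) ∧
    _ ∈ hat (ι '' (integralClosure (𝓞 F) (QuadExt Δ) : Set (QuadExt Δ))) ↔
    (_ ∈ hat (R : Set (Quat F α β)) ∧ _ ∈ hat (R : Set (Quat F α β))) ∧ _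
  rw [h1, h1]
  refine ⟨fun h => ⟨⟨h.1.1, h.2.1⟩, h.1.2⟩, fun h => ⟨⟨h.1.1, h.2⟩, h.1.2, fun v => ?_⟩⟩
  have h' : Commute (compUnit v x : Quat (v.adicCompletion F) α β) (toLocal v (rootOf ι)) := h.2 v
  exact h'.units_inv_left

theorem apply_mem_conjOrder_iff {x : AdeleUnits α β} {y : QuadExt Δ} :
    ι y ∈ conjOrder R x ↔ ∀ v, (compUnit v x : Quat (v.adicCompletion F) α β) * toLocal v (ι y) *
      (((compUnit v x)⁻¹ : (Quat (v.adicCompletion F) α β)ˣ) : Quat (v.adicCompletion F) α β) ∈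
      localRing v R := by
  change (x : Quat (FinAdele F) α β) * toAdele (ι y) *
    ((x⁻¹ : AdeleUnits α β) : Quat (FinAdele F) α β) ∈ hat (R : Set (Quat F α β)) ↔ _
  rw [mem_hat]
  refine forall_congr' fun v => ?_
  rw [map_mul, map_mul]
  rfl

theorem conjOrder_mul {z : AdeleUnits α β} (hz : z ∈ normalizerGroup R) (x : AdeleUnits α β) :
    conjOrder R (z * x) = conjOrder R x := by
  ext b
  have hz' := inv_mem hz
  change _ ∈ hat (R : Set (Quat F α β)) ↔ _ ∈ hat (R : Set (Quat F α β))
  rw [hz' (x * toAdele b * ((x⁻¹ : AdeleUnits α β) : Quat (FinAdele F) α β))]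
  rw [inv_inv, mul_inv_rev, Units.val_mul, Units.val_mul]
  simp only [mul_assoc]

theorem conjOrder_mul_hatK (hΔ : ¬ IsSquare Δ) (x : AdeleUnits α β) {a : AdeleUnits α β}
    (ha : a ∈ hatK ι) (y : QuadExt Δ) : ι y ∈ conjOrder R (x * a) ↔ ι y ∈ conjOrder R x := by
  have hc : (a : Quat (FinAdele F) α β) * toAdele (ι y) *
      ((a⁻¹ : AdeleUnits α β) : Quat (FinAdele F) α β) = toAdele (ι y) := by
    rw [Units.mul_inv_eq_iff_eq_mul]
    rw [toAdele_apply_eq, mul_add, add_mul, scalar_comm, mul_smul_comm, smul_mul_assoc, (mem_hatK hΔ).1 ha]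
  change _ ∈ hat (R : Set (Quat F α β)) ↔ _ ∈ hat (R : Set (Quat F α β))
  have e : ((x * a : AdeleUnits α β) : Quat (FinAdele F) α β) * toAdele (ι y) *
      (((x * a)⁻¹ : AdeleUnits α β) : Quat (FinAdele F) α β) =
      x * (a * toAdele (ι y) * ((a⁻¹ : AdeleUnits α β) : Quat (FinAdele F) α β)) *
      ((x⁻¹ : AdeleUnits α β) : Quat (FinAdele F) α β) := by
    rw [mul_inv_rev, Units.val_mul, Units.val_mul]
    simp only [mul_assoc]
  rw [e, hc]

/-- Applied to the admissible generator at `v`, the condition on `x` gives a factorization `x_v =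
z_v k_v` with `z_v` in the local normalizer and `k_v` in the local torus. At almost all places `x_v`
is a unit of `R_v` and `k_v = 1` may be chosen, so the factors form adelic elements. Conversely, `z`
and `a` do not change which elements of `K` belong to the conjugate order. -/
theorem forall_mem_conjOrder_iff (hΔ : ¬ IsSquare Δ) (hR : IsOrder R)
    (hι : ∀ x ∈ integralClosure (𝓞 F) (QuadExt Δ), ι x ∈ R)
    (hS : ∀ y ∈ S, y ∈ integralClosure (𝓞 F) (QuadExt Δ))
    (hA : IsLocallyAdmissible R ι S) {x : AdeleUnits α β} :
    (∀ y ∈ S, ι y ∈ conjOrder R x) ↔ ∃ z ∈ normalizerGroup R, ∃ a ∈ hatK ι, x = z * a := by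
  classical
  constructor
  · intro h
    have hloc : ∀ v, ∃ z k : (Quat (v.adicCompletion F) α β)ˣ, compUnit v x = z * k ∧
        Normalizes (localRing v R) z ∧ (k : Quat (v.adicCompletion F) α β) * toLocal v (rootOf ι) =
          toLocal v (rootOf ι) * (k : Quat (v.adicCompletion F) α β) := by
      intro v
      obtain ⟨θ, hθ, him, hint, hadm⟩ := hA v
      obtain ⟨z, k, hz, hk, hxz⟩ := hadm.exists_eq_mul (apply_mem_conjOrder_iff.1 (h θ hθ) v)
      exact ⟨z, k, hxz, hz, (commute_apply_iff him).1 hk⟩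
    choose z k hxz hz hk using hloc
    obtain ⟨a, ha⟩ := exists_unit_of_local hR
      (fun v => if compUnit v x ∈ unitsOf (localRing v R) then 1 else k v)
      ((finite_not_mem_unitsOf hR x).subset fun v hv h' => hv (by
        rw [if_pos h']; exact one_mem _))
    refine ⟨x * a⁻¹, mem_normalizerGroup.2 fun v => ?_, a, (mem_hatK_iff_local hΔ).2 fun v => ?_,
      (inv_mul_cancel_right _ _).symm⟩
    · rw [map_mul, map_inv, ha]
      split_ifs with h'
      · rw [inv_one, mul_one]
        exact normalizes_of_mem h'
      · rw [hxz, mul_inv_cancel_right]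
        exact hz v
    · rw [ha]
      split_ifs
      · rw [Units.val_one, one_mul, mul_one]
      · exact hk v
  · rintro ⟨z, hz, a, ha, rfl⟩ y hy
    rw [conjOrder_mul_hatK hΔ _ ha]
    have := conjOrder_mul hz (1 : AdeleUnits α β)
    rw [mul_one] at this
    rw [this, apply_mem_conjOrder_iff]
    intro v
    rw [map_one, inv_one, Units.val_one, one_mul, mul_one]
    exact toLocal_mem (hι y (hS y hy))

theorem exists_scalarUnit_mul_of_mem_hatK (hΔ : ¬ IsSquare Δ) (hR : IsOrder R)
    (hA : IsLocallyAdmissible R ι S) {x : AdeleUnits α β} (hx : x ∈ normalizerGroup R)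
    (hx' : x ∈ hatK ι) : ∃ ζ : (FinAdele F)ˣ, ∃ u ∈ hatUnits R, x = scalarUnit ζ * u := by
  refine exists_scalarUnit_mul hR fun v => ?_
  obtain ⟨θ, hθ, him, hint, hadm⟩ := hA v
  exact hadm.isScalarMulUnit_of_comm ((commute_apply_iff him).2 ((mem_hatK_iff_local hΔ).1 hx' v))
    (mem_normalizerGroup.1 hx v)

end Torus

/-! ### Double cosets of a product of a normalizer and a torus -/

section DoubleCosets

/-- Subgroups `U` (normal in `N`), `T` and a central subgroup `Z` of `N ∩ T` such that
`N ∩ T ⊆ Z U`, together with `T₀ = U ∩ T` and a subgroup `K` of `T`. -/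
structure IsTorusConfiguration {G : Type*} [Group G] (U N T T₀ K Z : Subgroup G) : Prop where
  central : ∀ ζ ∈ Z, ∀ x : G, ζ * x = x * ζ
  Z_le_N : Z ≤ N
  Z_le_T : Z ≤ T
  U_le_N : U ≤ N
  conj_mem : ∀ n ∈ N, ∀ u ∈ U, n * u * n⁻¹ ∈ U
  K_le_T : K ≤ T
  T₀_eq : T₀ = U ⊓ T
  exists_eq : ∀ x ∈ N, x ∈ T → ∃ ζ ∈ Z, ∃ u ∈ U, x = ζ * u

variable {G : Type*} [Group G] {U N T T₀ K Z : Subgroup G}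

namespace IsTorusConfiguration

variable (h : IsTorusConfiguration U N T T₀ K Z)

/-- The classes of the elements `z * a` with `z ∈ N`, `a ∈ T`. -/
def points (U N T K : Subgroup G) : Set (DoubleCoset.Quotient (U : Set G) (K : Set G)) :=
  DoubleCoset.mk U K '' {x | ∃ z ∈ N, ∃ a ∈ T, x = z * a}

include h

theorem out_mem_N {q : DoubleCoset.Quotient (U : Set G) (Z : Set G)}
    (hq : q ∈ DoubleCoset.mk U Z '' (N : Set G)) : q.out ∈ N := by
  obtain ⟨n, hn, rfl⟩ := hq
  obtain ⟨a, b, ha, hb, e⟩ := DoubleCoset.mk_out_eq_mul U Z n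
  rw [e]
  exact mul_mem (mul_mem (h.U_le_N ha) hn) (h.Z_le_N hb)

theorem out_mem_T {p : DoubleCoset.Quotient (T₀ : Set G) (K : Set G)}
    (hp : p ∈ DoubleCoset.mk T₀ K '' (T : Set G)) : p.out ∈ T := by
  obtain ⟨n, hn, rfl⟩ := hp
  obtain ⟨a, b, ha, hb, e⟩ := DoubleCoset.mk_out_eq_mul T₀ K n
  rw [h.T₀_eq] at ha
  rw [e]
  exact mul_mem (mul_mem ha.2 hn) (h.K_le_T hb)

theorem mem_points_iff {x : G} :
    DoubleCoset.mk U K x ∈ points U N T K ↔ ∃ z ∈ N, ∃ a ∈ T, x = z * a := by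
  constructor
  · rintro ⟨_, ⟨z, hz, a, ha, rfl⟩, e⟩
    obtain ⟨u, hu, κ, hκ, e⟩ := (DoubleCoset.eq U K _ _).1 e
    exact ⟨u * z, mul_mem (h.U_le_N hu) hz, a * κ, mul_mem ha (h.K_le_T hκ), by
      rw [e]; simp only [mul_assoc]⟩
  · intro hx
    exact ⟨x, hx, rfl⟩

theorem out_points {q : DoubleCoset.Quotient (U : Set G) (K : Set G)} (hq : q ∈ points U N T K) :
    ∃ z ∈ N, ∃ a ∈ T, q.out = z * a := by
  rwa [← h.mem_points_iff, DoubleCoset.out_eq']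

/-- The inverse on the first factor is the one that occurs in `φ_{x,P} · z = φ_{z⁻¹ x, P}`. If two
pairs give the same class, an element of `N ∩ T` relates them; as `N ∩ T ⊆ Z U`, the first
components agree, and the relation between the second ones lies in `U ∩ T = T₀`. -/
theorem bijOn : Set.BijOn (fun s : DoubleCoset.Quotient (U : Set G) (Z : Set G) ×
      DoubleCoset.Quotient (T₀ : Set G) (K : Set G) => DoubleCoset.mk U K (s.1.out⁻¹ * s.2.out))
    ((DoubleCoset.mk U Z '' (N : Set G)) ×ˢ (DoubleCoset.mk T₀ K '' (T : Set G)))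
    (points U N T K) := by
  refine ⟨?_, ?_, ?_⟩
  · rintro ⟨q, p⟩ ⟨hq, hp⟩
    exact h.mem_points_iff.2 ⟨_, inv_mem (h.out_mem_N hq), _, h.out_mem_T hp, rfl⟩
  · rintro ⟨q, p⟩ ⟨hq, hp⟩ ⟨q', p'⟩ ⟨hq', hp'⟩ e
    have hz := h.out_mem_N hq
    have hz' := h.out_mem_N hq'
    have ha := h.out_mem_T hp
    have ha' := h.out_mem_T hp'
    obtain ⟨u, hu, κ, hκ, e⟩ := (DoubleCoset.eq U K _ _).1 e
    dsimp only at e hz hz' ha ha'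
    -- The left side is in `N` and the right side in `T`.
    have e1 : q'.out * u * q.out⁻¹ = p'.out * κ⁻¹ * p.out⁻¹ := by
      rw [eq_mul_inv_iff_mul_eq, eq_mul_inv_iff_mul_eq, mul_assoc, mul_assoc, mul_assoc,
        ← mul_assoc q.out⁻¹, ← mul_assoc u, ← e, mul_inv_cancel_left]
    have hm : p'.out * κ⁻¹ * p.out⁻¹ ∈ T :=
      mul_mem (mul_mem ha' (inv_mem (h.K_le_T hκ))) (inv_mem ha)
    have hq2 : q = q' := by
      obtain ⟨ζ, hζ, u', hu', e2⟩ := h.exists_eq (q'.out * u * q.out⁻¹)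
        (mul_mem (mul_mem hz' (h.U_le_N hu)) (inv_mem hz)) (by rw [e1]; exact hm)
      rw [← DoubleCoset.out_eq' U Z q, ← DoubleCoset.out_eq' U Z q', DoubleCoset.eq]
      have hu2 := h.conj_mem _ hz _ (inv_mem hu)
      refine ⟨u' * (q.out * u⁻¹ * q.out⁻¹), mul_mem hu' hu2, ζ, hζ, ?_⟩
      rw [← h.central ζ hζ]
      have : q'.out = (q'.out * u * q.out⁻¹) * (q.out * u⁻¹) := by group
      rw [this, e2]
      group
    subst hq2
    have hm2 : q.out * u * q.out⁻¹ ∈ T₀ := by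
      rw [h.T₀_eq]
      exact ⟨h.conj_mem _ hz _ hu, by rw [SetLike.mem_coe, e1]; exact hm⟩
    refine Prod.ext rfl ?_
    change p = p'
    rw [← DoubleCoset.out_eq' T₀ K p, ← DoubleCoset.out_eq' T₀ K p', DoubleCoset.eq]
    refine ⟨_, hm2, κ, hκ, ?_⟩
    rw [e1]
    group
  · rintro _ ⟨_, ⟨z, hz, a, ha, rfl⟩, rfl⟩
    -- The chosen representative of the class of `z⁻¹` is `u z⁻¹ ζ`, with a central factor `ζ` that
    -- is compensated on the torus side by taking the class of `ζ a`.
    have hq : DoubleCoset.mk U Z z⁻¹ ∈ DoubleCoset.mk U Z '' (N : Set G) := ⟨_, inv_mem hz, rfl⟩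
    obtain ⟨u, ζ, hu, hζ, e⟩ := DoubleCoset.mk_out_eq_mul U Z z⁻¹
    have hp : DoubleCoset.mk T₀ K (ζ * a) ∈ DoubleCoset.mk T₀ K '' (T : Set G) :=
      ⟨_, mul_mem (h.Z_le_T hζ) ha, rfl⟩
    obtain ⟨t, κ, ht, hκ, e'⟩ := DoubleCoset.mk_out_eq_mul T₀ K (ζ * a)
    have hn := h.out_mem_N hq
    rw [h.T₀_eq] at ht
    refine ⟨(DoubleCoset.mk U Z z⁻¹, DoubleCoset.mk T₀ K (ζ * a)), ⟨hq, hp⟩, ?_⟩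
    change DoubleCoset.mk U K _ = _
    rw [e', e]
    symm
    rw [DoubleCoset.eq]
    have h1 := h.conj_mem _ hz _ (mul_mem (inv_mem hu) ht.1)
    refine ⟨_, h1, κ, hκ, ?_⟩
    rw [← h.central ζ hζ (u * z⁻¹), ← mul_assoc t, ← h.central ζ hζ t]
    group

/-- Left multiplication by `n` respects the classes because `N` normalizes `U`; its inverse is
multiplication by `n⁻¹`. -/
theorem bijOn_mul {n : G} (hn : n ∈ N) :
    Set.BijOn (fun q : DoubleCoset.Quotient (U : Set G) (K : Set G) =>
      DoubleCoset.mk U K (n * q.out)) (points U N T K) (points U N T K) := by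
  refine ⟨?_, ?_, ?_⟩
  · intro q hq
    obtain ⟨z, hz, a, ha, e⟩ := h.out_points hq
    exact h.mem_points_iff.2 ⟨n * z, mul_mem hn hz, a, ha, by rw [e, mul_assoc]⟩
  · intro q hq q' hq' e
    obtain ⟨u, hu, κ, hκ, e⟩ := (DoubleCoset.eq U K _ _).1 e
    rw [← DoubleCoset.out_eq' U K q, ← DoubleCoset.out_eq' U K q', DoubleCoset.eq]
    have h1 := h.conj_mem _ (inv_mem hn) _ hu
    rw [inv_inv] at h1
    refine ⟨_, h1, κ, hκ, ?_⟩
    rw [← mul_right_inj n, e]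
    group
  · intro q hq
    obtain ⟨z, hz, a, ha, e⟩ := h.out_points hq
    have hm : DoubleCoset.mk U K (n⁻¹ * q.out) ∈ points U N T K :=
      h.mem_points_iff.2 ⟨n⁻¹ * z, mul_mem (inv_mem hn) hz, a, ha, by rw [e, mul_assoc]⟩
    refine ⟨_, hm, ?_⟩
    obtain ⟨u, κ, hu, hκ, e'⟩ := DoubleCoset.mk_out_eq_mul U K (n⁻¹ * q.out)
    change DoubleCoset.mk U K _ = _
    rw [e']
    conv_rhs => rw [← DoubleCoset.out_eq' U K q]
    symm
    rw [DoubleCoset.eq]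
    exact ⟨_, h.conj_mem _ hn _ hu, κ, hκ, by group⟩

theorem apply_out {M : Type*} {f : G → M}
    (hf : ∀ u ∈ U, ∀ κ ∈ K, ∀ x, f (u * x * κ) = f x) (x : G) :
    f (DoubleCoset.mk U K x : DoubleCoset.Quotient (U : Set G) (K : Set G)).out = f x := by
  obtain ⟨u, κ, hu, hκ, e⟩ := DoubleCoset.mk_out_eq_mul U K x
  rw [e, hf u hu κ hκ]

theorem finsum_points {M : Type*} [AddCommMonoid M] {f : G → M}
    (hf : ∀ u ∈ U, ∀ κ ∈ K, ∀ x, f (u * x * κ) = f x)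
    (hB : (DoubleCoset.mk U Z '' (N : Set G)).Finite)
    (hC : (DoubleCoset.mk T₀ K '' (T : Set G)).Finite) :
    ∑ᶠ q ∈ points U N T K, f q.out = ∑ᶠ q ∈ DoubleCoset.mk U Z '' (N : Set G),
      ∑ᶠ p ∈ DoubleCoset.mk T₀ K '' (T : Set G), f (q.out⁻¹ * p.out) := by
  rw [← finsum_mem_eq_of_bijOn _ h.bijOn (f := fun s => f (s.1.out⁻¹ * s.2.out))
    fun s _ => (h.apply_out hf _).symm]
  rw [← hB.coe_toFinset, ← hC.coe_toFinset, ← Finset.coe_product, finsum_mem_coe_finset,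
    Finset.sum_product, finsum_mem_coe_finset]
  refine Finset.sum_congr rfl fun _ _ => ?_
  rw [finsum_mem_coe_finset]

theorem finsum_points_mul {M : Type*} [AddCommMonoid M] {f : G → M}
    (hf : ∀ u ∈ U, ∀ κ ∈ K, ∀ x, f (u * x * κ) = f x) {n : G} (hn : n ∈ N) :
    ∑ᶠ q ∈ points U N T K, f (n * q.out) = ∑ᶠ q ∈ points U N T K, f q.out :=
  finsum_mem_eq_of_bijOn _ (h.bijOn_mul hn) fun _ _ => (h.apply_out hf _).symm

theorem finite_points (hB : (DoubleCoset.mk U Z '' (N : Set G)).Finite)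
    (hC : (DoubleCoset.mk T₀ K '' (T : Set G)).Finite) : (points U N T K).Finite := by
  rw [← h.bijOn.image_eq]
  exact (hB.prod hC).image _

end IsTorusConfiguration

end DoubleCosets

/-! ### Approximation at one place and common denominators -/

section Approximation

variable {F : Type*} [Field F] [NumberField F]

/-- Some power of a prime ideal is principal. -/
theorem exists_generator_pow (v : FinPlace F) : ∃ π : 𝓞 F, v.valuation F (π : F) < 1 ∧ π ≠ 0 ∧
    ∀ w : FinPlace F, w ≠ v → w.valuation F (π : F) = 1 := by
  have hv : v.asIdeal ∈ nonZeroDivisors (Ideal (𝓞 F)) := mem_nonZeroDivisors_of_ne_zero v.ne_bot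
  set n := Fintype.card (ClassGroup (𝓞 F)) with hn
  have hn0 : n ≠ 0 := Fintype.card_ne_zero
  have h1 : ClassGroup.mk0 ⟨v.asIdeal, hv⟩ ^ n = 1 := pow_card_eq_one
  rw [← map_pow] at h1
  have h2 := (ClassGroup.mk0_eq_one_iff (pow_mem hv n)).1 h1
  obtain ⟨π, hπ⟩ := h2
  have hπ' : v.asIdeal ^ n = Ideal.span {π} := hπ
  refine ⟨π, ?_, ?_, fun w hw => ?_⟩
  · refine (v.valuation_lt_one_iff_mem (K := F) π).2 (Ideal.pow_le_self hn0 ?_)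
    rw [hπ']
    exact Ideal.mem_span_singleton_self π
  · rintro rfl
    rw [Ideal.span_singleton_zero] at hπ'
    exact pow_ne_zero n v.ne_bot hπ'
  · refine le_antisymm (w.valuation_le_one π) (not_lt.1 fun h => hw ?_)
    have h3 := (w.valuation_lt_one_iff_mem (K := F) π).1 h
    have h4 : v.asIdeal ^ n ≤ w.asIdeal := by
      rw [hπ', Ideal.span_singleton_le_iff_mem]
      exact h3
    have h5 := w.isPrime.le_of_pow_le h4
    exact (HeightOneSpectrum.ext (v.isMaximal.eq_of_le w.isPrime.ne_top h5)).symm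

theorem exists_pow_mul_le {v : FinPlace F} {c π : v.adicCompletion F} (hπ : Valued.v π < 1)
    : ∃ n : ℕ, Valued.v (π ^ n * c) ≤ 1 := by
  rcases eq_or_ne c 0 with rfl | hc
  · exact ⟨0, by simp⟩
  have hc0 : Valued.v c ≠ 0 := by simpa using hc
  obtain ⟨n, hn⟩ := exists_pow_lt₀ hπ (Units.mk0 (Valued.v c) hc0)⁻¹
  refine ⟨n, ?_⟩
  rw [map_mul, map_pow]
  have := mul_le_mul_left hn.le (Valued.v c)
  rwa [Units.val_inv_eq_inv_val, Units.val_mk0, inv_mul_cancel₀ hc0] at this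

/-- Approximation of an element of `F_v` by an element of `F` that is integral away from `v`. -/
theorem exists_sub_le_and_forall_le (v : FinPlace F) (x : v.adicCompletion F) :
    ∃ m : F, Valued.v (algebraMap F (v.adicCompletion F) m - x) ≤ 1 ∧
      ∀ w : FinPlace F, w ≠ v → Valued.v (algebraMap F (w.adicCompletion F) m) ≤ 1 := by
  obtain ⟨π, hπ1, hπ0, hπ⟩ := exists_generator_pow v
  have hπF : (π : F) ≠ 0 := by simpa using hπ0
  obtain ⟨n, hn⟩ := exists_pow_mul_le (c := x) (π := algebraMap F (v.adicCompletion F) π)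
    (by rw [valued_algebraMap]; exact hπ1)
  set y := algebraMap F (v.adicCompletion F) ((π : F) ^ n) with hy
  have hy0 : Valued.v y ≠ 0 := by simpa [hy] using fun h => absurd h hπ0
  have hyx : Valued.v (y * x) ≤ 1 := by rw [hy, map_pow]; exact hn
  obtain ⟨t, ht⟩ := exists_algebraMap_sub_lt v (y * x) hy0
  have hy1 : Valued.v y ≤ 1 := by
    rw [hy, map_pow, map_pow]
    exact pow_le_one₀ zero_le (valued_algebraMap_int_le v π)
  have ht1 : v.valuation F t ≤ 1 := by
    rw [← valued_algebraMap, ← sub_add_cancel (algebraMap F (v.adicCompletion F) t) (y * x)]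
    exact (Valued.v.map_add _ _).trans (max_le (ht.le.trans hy1) hyx)
  -- Here `r` approximates `π^n x` at `v`. Dividing by `π^n` gives a close approximation of `x` and
  -- creates denominators at `v` only.
  obtain ⟨r, hr⟩ := v.exists_valuation_sub_lt_of_integer ht1 (γ := Units.mk0 _ hy0)
  refine ⟨r / π ^ n, ?_, fun w hw => ?_⟩
  · have h1 : Valued.v (algebraMap F (v.adicCompletion F) r - y * x) ≤ Valued.v y := by
      rw [← sub_add_sub_cancel _ (algebraMap F (v.adicCompletion F) t)]
      refine (Valued.v.map_add _ _).trans (max_le ?_ ht.le)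
      rw [← map_sub, valued_algebraMap]
      exact hr.le
    have hyn : y ≠ 0 := by simpa using hy0
    have e : algebraMap F (v.adicCompletion F) (r / π ^ n) - x =
        y⁻¹ * (algebraMap F (v.adicCompletion F) r - y * x) := by
      rw [map_div₀, ← hy]
      field_simp
    rw [e, map_mul, map_inv₀]
    refine (mul_le_mul_right h1 _).trans ?_
    rw [inv_mul_cancel₀ hy0]
  · rw [valued_algebraMap, map_div₀, map_pow, hπ w hw, one_pow, div_one]
    exact w.valuation_le_one r

variable {α β : F} {R : Subalgebra (𝓞 F) (Quat F α β)}

theorem exists_int_smul_mem_localRing (hR : IsOrder R) {v : FinPlace F}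
    (x : Quat (v.adicCompletion F) α β) :
    ∃ e : 𝓞 F, e ≠ 0 ∧ algebraMap F (v.adicCompletion F) e • x ∈ localRing v R := by
  let b : Fin 4 → Quat F α β := ![1, ⟨0, 1, 0, 0⟩, ⟨0, 0, 1, 0⟩, ⟨0, 0, 0, 1⟩]
  let c : Fin 4 → v.adicCompletion F := ![x.re, x.imI, x.imJ, x.imK]
  have hO := isIntegralOrder_localRing hR v
  obtain ⟨π, hπ⟩ := v.intValuation_exists_uniformizer
  have hπ0 : π ≠ 0 := by
    rintro rfl
    rw [map_zero] at hπ
    exact WithZero.exp_ne_zero hπ.symm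
  have key : ∀ i, ∃ e : 𝓞 F, e ≠ 0 ∧
      (algebraMap F (v.adicCompletion F) e * c i) • toLocal v (b i) ∈ localRing v R := by
    intro i
    obtain ⟨d, hd, hdb⟩ := exists_smul_mem hR (b i)
    obtain ⟨n, hn⟩ := exists_pow_mul_le (c := c i) (π := algebraMap F (v.adicCompletion F) π) (by
      rw [valued_algebraMap, v.valuation_of_algebraMap π, hπ]
      decide)
    refine ⟨π ^ n * d, mul_ne_zero (pow_ne_zero n hπ0) hd, ?_⟩
    have h1 := hO.smul_mem hn (toLocal_mem (v := v) hdb)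
    rw [toLocal_smul_int, smul_smul] at h1
    convert h1 using 2
    push_cast
    ring
  choose e he0 he using key
  refine ⟨∏ i, e i, Finset.prod_ne_zero_iff.2 fun i _ => he0 i, ?_⟩
  have e1 : x = ∑ i, c i • toLocal v (b i) := by
    rw [Fin.sum_univ_four]
    refine QuaternionAlgebra.ext ?_ ?_ ?_ ?_ <;> simp [b, c, toLocal]
  rw [e1, Finset.smul_sum]
  refine sum_mem fun i _ => ?_
  rw [smul_smul, ← Finset.mul_prod_erase _ _ (Finset.mem_univ i)]
  have h2 := hO.smul_mem (valued_algebraMap_int_le v (∏ j ∈ Finset.univ.erase i, e j)) (he i)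
  rw [smul_smul] at h2
  convert h2 using 2
  push_cast
  ring

theorem exists_int_smul_mem_hat (hR : IsOrder R) (x : Quat (FinAdele F) α β) :
    ∃ e : 𝓞 F, e ≠ 0 ∧ algebraMap F (FinAdele F) e • x ∈ hat (R : Set (Quat F α β)) := by
  choose e he0 he using fun v => exists_int_smul_mem_localRing hR (comp v x)
  have hfin := finite_not_mem_localRing hR x
  refine ⟨∏ v ∈ hfin.toFinset, e v, Finset.prod_ne_zero_iff.2 fun v _ => he0 v, mem_hat.2 fun v => ?_⟩
  have h1 : comp v (algebraMap F (FinAdele F) ((∏ v ∈ hfin.toFinset, e v : 𝓞 F) : F) • x) =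
      algebraMap F (v.adicCompletion F) ((∏ v ∈ hfin.toFinset, e v : 𝓞 F) : F) • comp v x :=
    baseChange_smul _ _ _
  rw [h1]
  have hO := isIntegralOrder_localRing hR v
  by_cases hv : comp v x ∈ localRing v R
  · exact hO.smul_mem (valued_algebraMap_int_le v _) hv
  · classical
    have hv' : v ∈ hfin.toFinset := hfin.mem_toFinset.2 hv
    rw [← Finset.prod_erase_mul _ _ hv']
    have h2 := hO.smul_mem (valued_algebraMap_int_le v (∏ j ∈ hfin.toFinset.erase v, e j)) (he v)
    rw [smul_smul, ← map_mul] at h2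
    have e2 : (((∏ j ∈ hfin.toFinset.erase v, e j) * e v : 𝓞 F) : F) =
      ((∏ j ∈ hfin.toFinset.erase v, e j : 𝓞 F) : F) * (e v : F) := map_mul (algebraMap (𝓞 F) F) _ _
    rw [e2]
    exact h2

end Approximation

/-! ### Classes of fractional ideals -/

section ClassGroup

theorem isIntegral_iff_exists_int {F K : Type*} [Field F] [NumberField F] [Field K] [NumberField K]
    [Algebra (𝓞 F) K] {z : K} : IsIntegral (𝓞 F) z ↔ ∃ r : 𝓞 K, (r : K) = z := by
  have : IsScalarTower ℤ (𝓞 F) K := IsScalarTower.of_algebraMap_eq' (RingHom.ext_int _ _)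
  constructor
  · intro h
    exact ⟨⟨z, isIntegral_trans (R := ℤ) (A := 𝓞 F) z h⟩, rfl⟩
  · rintro ⟨r, rfl⟩
    exact (RingOfIntegers.isIntegral_coe r).tower_top

open nonZeroDivisors in
/-- Nonzero fractional ideals of a number field fall into finitely many classes. -/
theorem exists_classGroup_map {K : Type*} [Field K] [NumberField K] {X : Type*}
    (P : X → Submodule (𝓞 K) K) (hP : ∀ x, P x ≠ ⊥) (hP' : ∀ x, ∃ d : K, d ≠ 0 ∧ ∀ k ∈ P x,
      ∃ r : 𝓞 K, (r : K) = d * k) :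
    ∃ f : X → ClassGroup (𝓞 K), ∀ x y, f x = f y → ∃ t : K, t ≠ 0 ∧ ∀ k, k ∈ P x ↔ t⁻¹ * k ∈ P y := by
  have hfrac : ∀ x, IsFractional (𝓞 K)⁰ (P x) := by
    intro x
    obtain ⟨d, hd, hk⟩ := hP' x
    obtain ⟨a, b, hb, rfl⟩ := IsFractionRing.div_surjective (A := 𝓞 K) d
    have hb0 : algebraMap (𝓞 K) K b ≠ 0 := by simpa using nonZeroDivisors.ne_zero hb
    have ha0 : a ≠ 0 := by
      rintro rfl
      simp at hd
    refine ⟨a, mem_nonZeroDivisors_of_ne_zero ha0, fun k hkP => ?_⟩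
    obtain ⟨r, hr⟩ := hk k hkP
    refine ⟨r * b, ?_⟩
    rw [map_mul, Algebra.smul_def]
    refine (congrArg (· * _) hr).trans ?_
    field_simp
  let I : X → FractionalIdeal (𝓞 K)⁰ K := fun x => ⟨P x, hfrac x⟩
  have hI : ∀ x, I x ≠ 0 := fun x h => hP x
    ((congrArg (fun J : FractionalIdeal (𝓞 K)⁰ K => (J : Submodule (𝓞 K) K)) h).trans
      FractionalIdeal.coe_zero)
  refine ⟨fun x => ClassGroup.mk K (Units.mk0 (I x) (hI x)), fun x y h => ?_⟩
  rw [← div_eq_one, ← map_div, ClassGroup.mk_eq_one_iff] at h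
  obtain ⟨t, ht⟩ := h
  rw [Units.val_div_eq_div_val, Units.val_mk0, Units.val_mk0] at ht
  have h1 : I x / I y = FractionalIdeal.spanSingleton (𝓞 K)⁰ t :=
    FractionalIdeal.coeToSubmodule_injective (ht.trans (FractionalIdeal.coe_spanSingleton _ _).symm)
  have h2 : I x = FractionalIdeal.spanSingleton (𝓞 K)⁰ t * I y := by
    rw [← h1, div_mul_cancel₀ _ (hI y)]
  have ht0 : t ≠ 0 := by
    rintro rfl
    rw [FractionalIdeal.spanSingleton_zero, zero_mul] at h2
    exact hI x h2
  refine ⟨t, ht0, fun k => ?_⟩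
  change k ∈ I x ↔ t⁻¹ * k ∈ I y
  rw [h2, FractionalIdeal.mem_singleton_mul]
  constructor
  · rintro ⟨y', hy', rfl⟩
    rwa [inv_mul_cancel_left₀ ht0]
  · intro hk
    exact ⟨_, hk, by rw [mul_inv_cancel_left₀ ht0]⟩

end ClassGroup

/-! ### Finiteness of `Bil(R)` and `Cl(K)` -/

section Finiteness

variable {F : Type*} [Field F] [NumberField F] {α β Δ : F} {R : Subalgebra (𝓞 F) (Quat F α β)}
  {ι : QuadExt Δ →ₐ[F] Quat F α β} {S : Set (QuadExt Δ)}

/-- Send a class to the set of places where it is not a scalar times a unit. These places divide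
`N`, so there are finitely many such sets, and the map is injective because the local normalizers
have at most two classes modulo scalars and units. -/
theorem finite_Bil (hR : IsOrder R) (hα : α ≠ 0) (hβ : β ≠ 0) {N : Ideal (𝓞 F)}
    (hN : N ^ 2 = discIdeal R) (hA : IsLocallyAdmissible R ι S) : (Bil R).Finite := by
  have hN0 : N ≠ 0 := by
    rintro rfl
    rw [zero_pow two_ne_zero] at hN
    exact discIdeal_ne_bot hR hα hβ hN.symm
  let f : DoubleCoset.Quotient (hatUnits R : Set (AdeleUnits α β))
      ((scalarUnit (α := α) (β := β)).range : Set (AdeleUnits α β)) → Set (FinPlace F) :=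
    fun q => {v | ¬ IsScalarMulUnit (localRing v R) (compUnit v q.out)}
  have hnorm : ∀ q ∈ Bil R, q.out ∈ normalizerGroup R := by
    rintro _ ⟨z, hz, rfl⟩
    obtain ⟨u, ζ, hu, ⟨ζ, rfl⟩, e⟩ :=
      DoubleCoset.mk_out_eq_mul (hatUnits R) (scalarUnit (α := α) (β := β)).range z
    rw [e]
    exact mul_mem (mul_mem (hatUnits_le_normalizerGroup hu) hz) (scalarUnit_mem_normalizerGroup ζ)
  refine Set.Finite.of_finite_image (f := f) ?_ ?_
  · refine (Ideal.finite_factors hN0).finite_subsets.subset ?_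
    rintro _ ⟨q, hq, rfl⟩ v hv
    by_contra h
    obtain ⟨θ, -, -, -, hadm⟩ := hA v
    exact hv (hadm.isScalarMulUnit_of_isUnimodular (isUnimodular_localRing hR hN h)
      (mem_normalizerGroup.1 (hnorm q hq) v))
  · intro q hq q' hq' e
    have key : ∀ v, IsScalarMulUnit (localRing v R) (compUnit v (q'.out * q.out⁻¹)) := by
      intro v
      obtain ⟨θ, -, -, -, hadm⟩ := hA v
      rw [map_mul, map_inv]
      refine hadm.isScalarMulUnit_mul_inv (mem_normalizerGroup.1 (hnorm q' hq') v)
        (mem_normalizerGroup.1 (hnorm q hq) v) ?_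
      have := Set.ext_iff.1 e v
      exact (not_iff_not.1 this).symm
    obtain ⟨ζ, u, hu, e1⟩ := exists_scalarUnit_mul hR key
    rw [← DoubleCoset.out_eq' _ _ q, ← DoubleCoset.out_eq' _ _ q', DoubleCoset.eq]
    refine ⟨u, hu, scalarUnit ζ, ⟨ζ, rfl⟩, ?_⟩
    rw [← scalarUnit_comm, ← mul_assoc, ← e1, inv_mul_cancel_right]

theorem toAdele_mem_hat {x : Quat F α β} (hx : x ∈ R) : toAdele x ∈ hat (R : Set (Quat F α β)) :=
  mem_hat.2 fun _ => toLocal_mem hx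

theorem trd_apply (hΔ : ¬ IsSquare Δ) (z : QuadExt Δ) : trd (ι z) = 2 * z.re := by
  rw [apply_eq, trd_add, trd_algebraMap, trd_smul, trd_rootOf hΔ, mul_zero, add_zero]

theorem nrd_apply (hΔ : ¬ IsSquare Δ) (z : QuadExt Δ) : nrd (ι z) = z.re ^ 2 - Δ * z.im ^ 2 := by
  have h := Disc_apply (ι := ι) hΔ z
  rw [Disc_eq, trd_apply hΔ] at h
  have h4 : (4 : F) ≠ 0 := by norm_num
  apply mul_left_cancel₀ h4
  linear_combination -h

/-- The trace and the norm of `z` are integral at every place, hence belong to `𝓞 F`. -/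
theorem isIntegral_of_toAdele_mem_hat (hR : IsOrder R) (hΔ : ¬ IsSquare Δ) {z : QuadExt Δ}
    (hz : toAdele (ι z) ∈ hat (R : Set (Quat F α β))) : IsIntegral (𝓞 F) z := by
  have hz' : ∀ v, toLocal v (ι z) ∈ localRing v R := mem_hat.1 hz
  obtain ⟨t, ht⟩ := exists_int_of_valuation (t := trd (ι z)) fun v => by
    have := (isIntegralOrder_localRing hR v).trd_le _ (hz' v)
    rw [toLocal, trd_baseChange] at this
    exact (valued_algebraMap v _).symm.trans_le this
  obtain ⟨n, hn⟩ := exists_int_of_valuation (t := nrd (ι z)) fun v => by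
    have := (isIntegralOrder_localRing hR v).nrd_le _ (hz' v)
    rw [toLocal, nrd_baseChange] at this
    exact (valued_algebraMap v _).symm.trans_le this
  rw [trd_apply hΔ] at ht
  rw [nrd_apply hΔ] at hn
  exact isIntegral_quadExt_of ht hn

theorem toAdele_algebraMap (c : F) : toAdele (algebraMap F (Quat F α β) c) =
    algebraMap (FinAdele F) _ (algebraMap F _ c) := baseChange_algebraMap _ _

theorem hatK_comm (hΔ : ¬ IsSquare Δ) {a b : AdeleUnits α β} (ha : a ∈ hatK ι) (hb : b ∈ hatK ι) :
    a * b = b * a := by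
  obtain ⟨s, t, e⟩ := exists_eq_of_commute_rootOf hΔ ((mem_hatK hΔ).1 ha)
  refine Units.ext ?_
  rw [Units.val_mul, Units.val_mul, e, add_mul, mul_add, scalar_comm, smul_mul_assoc,
    mul_smul_comm, (mem_hatK hΔ).1 hb]

/-- An element of `K̂^×` can be approximated at one place by an element of `K` that generates a
sublattice at all other places. -/
theorem exists_approx (hR : IsOrder R) (hΔ : ¬ IsSquare Δ) {a : AdeleUnits α β} (ha : a ∈ hatK ι)
    (c : AdeleUnits α β) (v : FinPlace F) : ∃ k : QuadExt Δ,
      ((a⁻¹ : AdeleUnits α β) : Quat (FinAdele F) α β) * toAdele (ι k) ∈ hat (R : Set (Quat F α β)) ∧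
      comp v (((c⁻¹ : AdeleUnits α β) : Quat (FinAdele F) α β) * (toAdele (ι k) - (a : Quat (FinAdele F) α β))) ∈
        localRing v R := by
  obtain ⟨s, t, hst⟩ := exists_eq_of_commute_rootOf hΔ ((mem_hatK hΔ).1 ha)
  have aux : ∀ y : Quat (FinAdele F) α β, ∃ e : 𝓞 F, e ≠ 0 ∧ ∀ w,
      algebraMap F (w.adicCompletion F) e • comp w y ∈ localRing w R ∧
      algebraMap F (w.adicCompletion F) e • comp w (y * toAdele (rootOf ι)) ∈ localRing w R := by
    intro y
    obtain ⟨e₁, he₁, h₁⟩ := exists_int_smul_mem_hat hR y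
    obtain ⟨e₂, he₂, h₂⟩ := exists_int_smul_mem_hat hR (y * toAdele (rootOf ι))
    refine ⟨e₁ * e₂, mul_ne_zero he₁ he₂, fun w => ?_⟩
    have hO := isIntegralOrder_localRing hR w
    have h₁' : algebraMap F (w.adicCompletion F) e₁ • comp w y ∈ localRing w R := by
      have := mem_hat.1 h₁ w
      rwa [show comp w (algebraMap F (FinAdele F) e₁ • y) =
        algebraMap F (w.adicCompletion F) e₁ • comp w y from baseChange_smul _ _ _] at this
    have h₂' : algebraMap F (w.adicCompletion F) e₂ • comp w (y * toAdele (rootOf ι)) ∈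
        localRing w R := by
      have := mem_hat.1 h₂ w
      rwa [show comp w (algebraMap F (FinAdele F) e₂ • (y * toAdele (rootOf ι))) =
        algebraMap F (w.adicCompletion F) e₂ • comp w (y * toAdele (rootOf ι)) from
          baseChange_smul _ _ _] at this
    have e : algebraMap F (w.adicCompletion F) ((e₁ * e₂ : 𝓞 F) : F) =
        algebraMap F (w.adicCompletion F) e₁ * algebraMap F (w.adicCompletion F) e₂ := by
      rw [← map_mul]; rfl
    rw [e]
    constructor
    · rw [mul_comm, ← smul_smul]
      exact hO.smul_mem (valued_algebraMap_int_le w e₂) h₁'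
    · rw [← smul_smul]
      exact hO.smul_mem (valued_algebraMap_int_le w e₁) h₂'
  obtain ⟨e₁, he₁, h₁⟩ := aux ((a⁻¹ : AdeleUnits α β) : Quat (FinAdele F) α β)
  obtain ⟨e₂, he₂, h₂⟩ := aux ((c⁻¹ : AdeleUnits α β) : Quat (FinAdele F) α β)
  -- The factor `e₁` carries `a⁻¹` and `a⁻¹ √Δ` into the order at every place, and `e₂` does the
  -- same for `c`. With `a = s + t √Δ`, take `k = e (m + n √Δ)`, where `m` and `n` approximate `s/e`
  -- and `t/e` up to integral errors at `v` and are integral elsewhere.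
  set e : F := (e₁ : F) * (e₂ : F) with he
  have he0 : e ≠ 0 := mul_ne_zero (by simpa using he₁) (by simpa using he₂)
  have hev : ∀ w : FinPlace F, algebraMap F (w.adicCompletion F) e ≠ 0 := fun w => by simpa using he0
  obtain ⟨m, hm, hm'⟩ := exists_sub_le_and_forall_le v (s v / algebraMap F (v.adicCompletion F) e)
  obtain ⟨n, hn, hn'⟩ := exists_sub_le_and_forall_le v (t v / algebraMap F (v.adicCompletion F) e)
  have hk : ∀ w : FinPlace F, comp w (toAdele (ι (⟨e * m, e * n⟩ : QuadExt Δ))) =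
      algebraMap (w.adicCompletion F) _ (algebraMap F (w.adicCompletion F) (e * m)) +
      (algebraMap F (w.adicCompletion F) (e * n)) • comp w (toAdele (rootOf ι)) := by
    intro w
    rw [toAdele_apply_eq, map_add]
    exact congrArg₂ (· + ·) (baseChange_algebraMap _ _) (baseChange_smul _ _ _)
  have hcomb : ∀ (w : FinPlace F) (y : Quat (FinAdele F) α β) (p q : w.adicCompletion F),
      Valued.v p ≤ 1 → Valued.v q ≤ 1 →
      (algebraMap F (w.adicCompletion F) e₁ • comp w y ∈ localRing w R ∧
      algebraMap F (w.adicCompletion F) e₁ • comp w (y * toAdele (rootOf ι)) ∈ localRing w R ∨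
      algebraMap F (w.adicCompletion F) e₂ • comp w y ∈ localRing w R ∧
      algebraMap F (w.adicCompletion F) e₂ • comp w (y * toAdele (rootOf ι)) ∈ localRing w R) →
      comp w y * (algebraMap (w.adicCompletion F) _ (algebraMap F (w.adicCompletion F) e * p) +
      (algebraMap F (w.adicCompletion F) e * q) • comp w (toAdele (rootOf ι))) ∈ localRing w R := by
    intro w y p q hp hq h
    have hO := isIntegralOrder_localRing hR w
    rw [mul_add, ← scalar_comm, ← Algebra.smul_def, mul_smul_comm, ← map_mul, he, map_mul]
    have key : ∀ (a b c : w.adicCompletion F) (z : Quat (w.adicCompletion F) α β), Valued.v b ≤ 1 →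
        Valued.v c ≤ 1 → a • z ∈ localRing w R → (a * b * c) • z ∈ localRing w R := by
      intro a b c z hb hc hz
      rw [mul_assoc, mul_comm, ← smul_smul]
      exact hO.smul_mem (by rw [map_mul]; exact mul_le_one' hb hc) hz
    have h1 := valued_algebraMap_int_le w e₁
    have h2 := valued_algebraMap_int_le w e₂
    rcases h with h | h
    · exact add_mem (key _ _ _ _ h2 hp h.1) (key _ _ _ _ h2 hq h.2)
    · rw [mul_comm (algebraMap F (w.adicCompletion F) e₁)]
      exact add_mem (key _ _ _ _ h1 hp h.1) (key _ _ _ _ h1 hq h.2)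
  have hdiff : comp v (toAdele (ι (⟨e * m, e * n⟩ : QuadExt Δ)) - (a : Quat (FinAdele F) α β)) =
      algebraMap (v.adicCompletion F) _ (algebraMap F (v.adicCompletion F) e *
        (algebraMap F (v.adicCompletion F) m - s v / algebraMap F (v.adicCompletion F) e)) +
      (algebraMap F (v.adicCompletion F) e *
        (algebraMap F (v.adicCompletion F) n - t v / algebraMap F (v.adicCompletion F) e)) •
          comp v (toAdele (rootOf ι)) := by
    have e2 : comp v (a : Quat (FinAdele F) α β) =
        algebraMap (v.adicCompletion F) _ (s v) + (t v) • comp v (toAdele (rootOf ι)) := by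
      rw [hst, map_add]
      exact congrArg₂ (· + ·) (baseChange_algebraMap _ _) (baseChange_smul _ _ _)
    rw [map_sub, hk, e2, mul_sub, mul_sub, mul_div_cancel₀ _ (hev v), mul_div_cancel₀ _ (hev v),
      map_sub, sub_smul, map_mul, map_mul (algebraMap F (v.adicCompletion F)) e n]
    abel
  refine ⟨⟨e * m, e * n⟩, mem_hat.2 fun w => ?_, ?_⟩
  · change _ ∈ localRing w R
    by_cases hw : w = v
    · subst hw
      rw [← sub_add_cancel (toAdele (ι _)) (a : Quat (FinAdele F) α β), mul_add, Units.inv_mul,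
        map_add, map_one, map_mul, hdiff]
      exact add_mem (hcomb w _ _ _ hm hn (Or.inl (h₁ w))) (one_mem _)
    · rw [map_mul, hk, map_mul (algebraMap F (w.adicCompletion F)) e m,
        map_mul (algebraMap F (w.adicCompletion F)) e n]
      exact hcomb w _ _ _ (hm' w hw) (hn' w hw) (Or.inl (h₁ w))
  · rw [map_mul, hdiff]
    exact hcomb v _ _ _ hm hn (Or.inr (h₂ v))

variable (R ι) in
/-- The fractional ideal of `K` attached to an element of `K̂^×`. -/
def adelicIdeal (a : AdeleUnits α β) : Set (QuadExt Δ) :=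
  {k | ((a⁻¹ : AdeleUnits α β) : Quat (FinAdele F) α β) * toAdele (ι k) ∈ hat (R : Set (Quat F α β))}

theorem mem_adelicIdeal {a : AdeleUnits α β} {k : QuadExt Δ} : k ∈ adelicIdeal R ι a ↔
    ((a⁻¹ : AdeleUnits α β) : Quat (FinAdele F) α β) * toAdele (ι k) ∈ hat (R : Set (Quat F α β)) :=
  Iff.rfl

-- To `a ∈ K̂^×` attach the fractional ideal of all `k` in `K` with `a⁻¹ k ∈ R̂`. By approximation
-- it determines `a` up to `Ô_K^×`, and elements of `K^×` scale it, so the finiteness of the ideal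
-- class group of `K` gives that of `Cl(K)`.
open Classical in
theorem finite_ClK (hR : IsOrder R) (hΔ : ¬ IsSquare Δ)
    (hι : ∀ x ∈ integralClosure (𝓞 F) (QuadExt Δ), ι x ∈ R)
    (hA : IsLocallyAdmissible R ι S) : (ClK ι).Finite := by
  have hfact : Fact (∀ r : F, r ^ 2 ≠ Δ + 0 * r) :=
    ⟨fun r h => hΔ ⟨r, by rw [← sq, h, zero_mul, add_zero]⟩⟩
  have hNF : NumberField (QuadExt Δ) :=
    { to_charZero := inferInstance
      to_finiteDimensional := Module.Finite.trans F _ }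
  have hint : ∀ z : 𝓞 (QuadExt Δ), toAdele (ι z) ∈ hat (R : Set (Quat F α β)) := fun z =>
    toAdele_mem_hat (hι _ (isIntegral_iff_exists_int.2 ⟨z, rfl⟩))
  let P : hatK ι → Submodule (𝓞 (QuadExt Δ)) (QuadExt Δ) := fun a =>
    { carrier := adelicIdeal R ι a
      zero_mem' := by
        rw [mem_adelicIdeal, map_zero, map_zero, mul_zero]
        exact zero_mem _
      add_mem' := fun {x y} hx hy => by
        rw [mem_adelicIdeal, map_add, map_add, mul_add]
        exact add_mem hx hy
      smul_mem' := fun z x hx => by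
        rw [show z • x = x * (z : QuadExt Δ) from mul_comm _ _, mem_adelicIdeal, map_mul, map_mul, ← mul_assoc]
        exact mul_mem hx (hint z) }
  have hP : ∀ a, P a ≠ ⊥ := by
    intro a h
    obtain ⟨e, he, hmem⟩ := exists_int_smul_mem_hat hR
      ((((a : AdeleUnits α β)⁻¹ : AdeleUnits α β) : Quat (FinAdele F) α β))
    have h1 : algebraMap F (QuadExt Δ) e ∈ P a := by
      refine mem_adelicIdeal.2 ?_
      rwa [AlgHom.commutes, toAdele_algebraMap, ← scalar_comm, ← Algebra.smul_def]
    rw [h, Submodule.mem_bot] at h1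
    have h2 := QuadraticAlgebra.algebraMap_injective (h1.trans (map_zero _).symm)
    exact he (by simpa using h2)
  have hP' : ∀ a, ∃ d : QuadExt Δ, d ≠ 0 ∧ ∀ k ∈ P a,
      ∃ r : 𝓞 (QuadExt Δ), (r : QuadExt Δ) = d * k := by
    intro a
    obtain ⟨e, he, hmem⟩ := exists_int_smul_mem_hat hR
      (((a : AdeleUnits α β) : Quat (FinAdele F) α β))
    refine ⟨algebraMap F (QuadExt Δ) e, fun h => he ?_, fun k hk => ?_⟩
    · have h2 := QuadraticAlgebra.algebraMap_injective (h.trans (map_zero _).symm)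
      simpa using h2
    · have h1 : toAdele (ι (algebraMap F (QuadExt Δ) e * k)) ∈ hat (R : Set (Quat F α β)) := by
        have := mul_mem hmem hk
        rwa [smul_mul_assoc, Units.mul_inv_cancel_left, Algebra.smul_def, ← toAdele_algebraMap,
          ← AlgHom.commutes ι, ← map_mul, ← map_mul] at this
      exact isIntegral_iff_exists_int.1 (isIntegral_of_toAdele_mem_hat hR hΔ h1)
  obtain ⟨f, hf⟩ := exists_classGroup_map P hP hP'
  -- At each place `a` is approximated by an element `k` of its own ideal. That `k` also lies in the
  -- ideal of `c`, and both `c⁻¹ k` and `c⁻¹ (k - a)` are integral there.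
  have hsub : ∀ a c : hatK ι, P a ≤ P c →
      (((c : AdeleUnits α β)⁻¹ * a : AdeleUnits α β) : Quat (FinAdele F) α β) ∈
        hat (R : Set (Quat F α β)) := by
    intro a c hac
    refine mem_hat.2 fun v => ?_
    obtain ⟨k, hk, hk'⟩ := exists_approx hR hΔ a.2 c v
    have h1 : comp v ((((c : AdeleUnits α β)⁻¹ : AdeleUnits α β) : Quat (FinAdele F) α β) *
      toAdele (ι k)) ∈ localRing v R := mem_hat.1 (hac hk) v
    have h2 := sub_mem h1 hk'
    rw [← map_sub, ← mul_sub, sub_sub_cancel] at h2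
    exact h2
  let q : ClassGroup (𝓞 (QuadExt Δ)) → DoubleCoset.Quotient (hatOK ι : Set (AdeleUnits α β))
      (globalK ι : Set (AdeleUnits α β)) := fun C =>
    if h : ∃ a, f a = C then DoubleCoset.mk _ _ (h.choose : AdeleUnits α β) else default
  refine (Set.finite_range q).subset ?_
  rintro _ ⟨b, hb, rfl⟩
  have hex : ∃ a, f a = f ⟨b, hb⟩ := ⟨_, rfl⟩
  refine ⟨f ⟨b, hb⟩, ?_⟩
  change (dite _ _ _) = _
  rw [dif_pos hex]
  set a := hex.choose with ha
  obtain ⟨t, ht, hab⟩ := hf a ⟨b, hb⟩ hex.choose_spec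
  let κ : AdeleUnits α β := globalUnit (Units.map ι.toRingHom.toMonoidHom (Units.mk0 t ht))
  have hκ : κ ∈ globalK ι := ⟨Units.mk0 t ht, rfl⟩
  have hκ' := globalK_le_hatK hΔ hκ
  let c : hatK ι := ⟨b * κ, mul_mem hb hκ'⟩
  have hκinv : ((κ⁻¹ : AdeleUnits α β) : Quat (FinAdele F) α β) = toAdele (ι t⁻¹) := rfl
  have hac : P a = P c := by
    ext k
    rw [hab]
    change t⁻¹ * k ∈ adelicIdeal R ι b ↔ k ∈ adelicIdeal R ι c
    rw [mem_adelicIdeal, mem_adelicIdeal, map_mul, map_mul, ← hκinv, ← mul_assoc, ← Units.val_mul]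
    have e : (b⁻¹ * κ⁻¹ : AdeleUnits α β) = ((c : AdeleUnits α β))⁻¹ := by
      change _ = (b * κ)⁻¹
      rw [hatK_comm hΔ hb hκ', mul_inv_rev]
    rw [← e]
  have h1 := hsub a c hac.le
  have h2 := hsub c a hac.ge
  symm
  rw [DoubleCoset.eq]
  have h3 : (a : AdeleUnits α β) * (c : AdeleUnits α β)⁻¹ ∈ hatOK ι := by
    rw [hatK_comm hΔ a.2 (inv_mem c.2), hatOK_eq hΔ hι hA]
    refine ⟨?_, (hatK ι).mul_mem ((hatK ι).inv_mem c.2) a.2⟩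
    have h4 : (((c : AdeleUnits α β)⁻¹ * a)⁻¹ : AdeleUnits α β) = (a : AdeleUnits α β)⁻¹ * c := by
      rw [mul_inv_rev, inv_inv]
    exact (Submonoid.mem_units_iff _ _).2 ⟨h1, by rw [h4]; exact h2⟩
  refine ⟨_, h3, κ, hκ, ?_⟩
  change _ = _ * (b * κ)⁻¹ * b * κ
  group

end Finiteness

/-! ### The quadratic Hecke character on unit ideles and totally positive elements -/

section Hecke

variable {F : Type*} [Field F] [NumberField F]

open Filter Topology

theorem continuous_finiteToAdele : Continuous (finiteToAdele : FinAdele F → AdeleRing (𝓞 F) F) :=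
  (continuous_const.prodMk continuous_id : Continuous fun x : FinAdele F =>
    ((1 : InfiniteAdeleRing F), x))

-- The truncations converge coordinatewise in the product of the local integer rings, and the map
-- from this product to the restricted product is continuous.
open Classical in
theorem tendsto_finAdele {x : FinAdele F} (hx : ∀ v, x v ∈ v.adicCompletionIntegers F)
    {y : Finset (FinPlace F) → FinAdele F} (hy : ∀ S v, y S v = if v ∈ S then x v else 1) :
    Tendsto y atTop (𝓝 x) := by
  have hc : Continuous (RestrictedProduct.structureMap (fun v : FinPlace F => v.adicCompletion F)
      (fun v => v.adicCompletionIntegers F) cofinite) :=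
    RestrictedProduct.isEmbedding_structureMap.continuous
  have ht : Tendsto (fun (S : Finset (FinPlace F)) (v : FinPlace F) =>
      if v ∈ S then (⟨x v, hx v⟩ : v.adicCompletionIntegers F) else 1) atTop
      (𝓝 fun v => ⟨x v, hx v⟩) := by
    rw [tendsto_pi_nhds]
    intro v
    refine tendsto_const_nhds.congr' ?_
    filter_upwards [eventually_ge_atTop ({v} : Finset (FinPlace F))] with S hS
    rw [if_pos (hS (Finset.mem_singleton_self v))]
  have h := (hc.tendsto _).comp ht
  have e : (RestrictedProduct.structureMap (fun v : FinPlace F => v.adicCompletion F)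
      (fun v => v.adicCompletionIntegers F) cofinite) ∘ (fun (S : Finset (FinPlace F)) (v : FinPlace F) =>
      if v ∈ S then (⟨x v, hx v⟩ : v.adicCompletionIntegers F) else 1) = y := by
    funext S
    refine FiniteAdeleRing.ext _ fun v => ?_
    rw [hy]
    change ((if v ∈ S then (⟨x v, hx v⟩ : v.adicCompletionIntegers F) else 1 :
      v.adicCompletionIntegers F) : v.adicCompletion F) = _
    split_ifs <;> rfl
  rw [e] at h
  exact h

theorem ideleComp_localIdele_same (v : FinPlace F) (x : (v.adicCompletion F)ˣ) :
    ideleComp v (localIdele v x) = x := by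
  classical
  refine Units.ext ?_
  exact Pi.mulSingle_eq_same v _

theorem ideleComp_localIdele_ne {v w : FinPlace F} (h : w ≠ v) (x : (v.adicCompletion F)ˣ) :
    ideleComp w (localIdele v x) = 1 := by
  classical
  refine Units.ext ?_
  exact Pi.mulSingle_eq_of_ne h _

open Classical in
theorem ideleComp_prod_localIdele (x : (FinAdele F)ˣ) (S : Finset (FinPlace F)) (w : FinPlace F) :
    ideleComp w (∏ v ∈ S, localIdele v (ideleComp v x)) = if w ∈ S then ideleComp w x else 1 := by
  rw [map_prod]
  split_ifs with h
  · rw [Finset.prod_eq_single_of_mem w h fun v _ hv => ideleComp_localIdele_ne hv.symm _,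
      ideleComp_localIdele_same]
  · refine Finset.prod_eq_one fun v hv => ideleComp_localIdele_ne ?_ _
    rintro rfl
    exact h hv

theorem ideleComp_val (v : FinPlace F) (x : (FinAdele F)ˣ) :
    (ideleComp v x : v.adicCompletion F) = (x : FinAdele F) v := rfl

/-- The quadratic character is trivial on unit ideles whose components at the places dividing the
conductor are `1`. -/
theorem quadChar_eq_one {l : F} (hl : l ≠ 0) {x : (FinAdele F)ˣ}
    (h1 : ∀ v, Valued.v (ideleComp v x : v.adicCompletion F) = 1)
    (h2 : ∀ v : FinPlace F, v.asIdeal ∣ quadConductor l → ideleComp v x = 1) :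
    quadChar l x = 1 := by
  classical
  rw [quadChar, MonoidHom.comp_apply, heckeChar]
  -- In the default branch `heckeChar` is the trivial character and the claim is immediate.
  split_ifs with h
  swap
  · rfl
  obtain ⟨hc, -, hn⟩ := h.choose_spec
  set χ := h.choose
  -- The truncations of `x` are finite products of local ideles, each of which is a local norm: a
  -- unit where the conductor is trivial, and `1` elsewhere. They converge to `x`, and the character
  -- is continuous.
  let P : Finset (FinPlace F) → (FinAdele F)ˣ := fun S => ∏ v ∈ S, localIdele v (ideleComp v x)
  have hP : ∀ S, χ (Units.map finiteToAdele (P S)) = 1 := by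
    intro S
    rw [map_prod, map_prod]
    refine Finset.prod_eq_one fun v _ => (hn v _).2 ?_
    by_cases hv : v.asIdeal ∣ quadConductor l
    · rw [h2 v hv]
      exact ⟨1, 0, by simp⟩
    · rw [dvd_quadConductor_iff v hl, not_not] at hv
      exact isLocalNorm_of_condExponent_eq_zero v hv (h1 v)
  have hval : ∀ S v, (P S : FinAdele F) v = if v ∈ S then (x : FinAdele F) v else 1 := by
    intro S v
    have := congrArg Units.val (ideleComp_prod_localIdele x S v)
    rw [ideleComp_val] at this
    rw [this]
    split_ifs <;> rfl
  have hinv : ∀ S v, (((P S)⁻¹ : (FinAdele F)ˣ) : FinAdele F) v =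
      if v ∈ S then ((x⁻¹ : (FinAdele F)ˣ) : FinAdele F) v else 1 := by
    intro S v
    have := congrArg (fun u => ((u⁻¹ : (v.adicCompletion F)ˣ) : v.adicCompletion F))
      (ideleComp_prod_localIdele x S v)
    rw [← map_inv, ideleComp_val] at this
    rw [this]
    split_ifs
    · rw [← map_inv]; rfl
    · simp
  have ht : Tendsto (fun S => Units.map (finiteToAdele (F := F)) (P S)) atTop
      (𝓝 (Units.map finiteToAdele x)) := by
    rw [Units.isInducing_embedProduct.tendsto_nhds_iff]
    refine Tendsto.prodMk_nhds ?_ ?_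
    · refine (continuous_finiteToAdele.tendsto _).comp (tendsto_finAdele (fun v => ?_) hval)
      exact (h1 v).le
    · refine (MulOpposite.continuous_op.tendsto _).comp
        ((continuous_finiteToAdele.tendsto _).comp (tendsto_finAdele (fun v => ?_) hinv))
      have : Valued.v (((ideleComp v x)⁻¹ : (v.adicCompletion F)ˣ) : v.adicCompletion F) = 1 := by
        rw [Units.val_inv_eq_inv_val, map_inv₀, h1, inv_one]
      rw [← map_inv] at this
      exact this.le
  have h3 := (hc.tendsto _).comp ht
  have h4 : Tendsto (χ ∘ fun S => Units.map (finiteToAdele (F := F)) (P S)) atTop (𝓝 1) := by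
    refine tendsto_const_nhds.congr fun S => ?_
    exact (hP S).symm
  exact tendsto_nhds_unique h3 h4

theorem intUnits_mul_self (u : ℤˣ) : u * u = 1 := Int.units_mul_self u

/-- The quadratic character is trivial on totally positive elements of `F`. -/
theorem quadChar_algebraMap [IsTotallyReal F] (l : F) (c : Fˣ) (hc : ∀ τ : F →+* ℝ, 0 < τ c) :
    quadChar l (Units.map (algebraMap F (FinAdele F)).toMonoidHom c) = 1 := by
  rw [quadChar, MonoidHom.comp_apply, heckeChar]
  split_ifs with h
  swap
  · rfl
  obtain ⟨-, ht, -⟩ := h.choose_spec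
  set χ := h.choose
  -- A positive real number is a square, so the infinite component of `c` is a square of ideles and
  -- a character with values `±1` is trivial on it. The principal idele then leaves only its finite
  -- component.
  have hsq : ∀ w : InfinitePlace F, ∃ s : w.Completion, s * s = algebraMap F (InfiniteAdeleRing F) c w := by
    intro w
    have hw : w.IsReal := IsTotallyReal.isReal w
    let e := InfinitePlace.Completion.ringEquivRealOfIsReal hw
    let τ : F →+* ℝ := (e : w.Completion →+* ℝ).comp
      ((Pi.evalRingHom (fun w : InfinitePlace F => w.Completion) w).comp
        (algebraMap F (InfiniteAdeleRing F)))
    refine ⟨e.symm (Real.sqrt (τ c)), e.injective ?_⟩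
    rw [map_mul, e.apply_symm_apply, Real.mul_self_sqrt (hc τ).le]
    rfl
  choose s hs using hsq
  let s' : InfiniteAdeleRing F := s
  have hs' : s' * s' = algebraMap F (InfiniteAdeleRing F) c := funext hs
  let t : AdeleRing (𝓞 F) F := (s', 1)
  let t' : AdeleRing (𝓞 F) F := (s' * algebraMap F (InfiniteAdeleRing F) (c⁻¹ : Fˣ), 1)
  have hcc : algebraMap F (InfiniteAdeleRing F) c * algebraMap F (InfiniteAdeleRing F) (c⁻¹ : Fˣ) = 1 := by
    rw [← map_mul, Units.mul_inv, map_one]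
  have htt : t * t' = 1 := by
    refine Prod.ext ?_ (mul_one (1 : FinAdele F))
    change s' * (s' * _) = 1
    rw [← mul_assoc, hs', hcc]
  let u : (AdeleRing (𝓞 F) F)ˣ := ⟨t, t', htt, by rw [mul_comm, htt]⟩
  have e : Units.map (algebraMap F (AdeleRing (𝓞 F) F)).toMonoidHom c =
      u * u * Units.map finiteToAdele (Units.map (algebraMap F (FinAdele F)).toMonoidHom c) := by
    refine Units.ext (Prod.ext ?_ ?_)
    · change algebraMap F (InfiniteAdeleRing F) c = s' * s' * 1
      rw [mul_one, hs']
    · change algebraMap F (FinAdele F) c = 1 * 1 * algebraMap F (FinAdele F) c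
      rw [one_mul, one_mul]
  have h1 := ht c
  rw [e, map_mul, map_mul, intUnits_mul_self, one_mul] at h1
  exact h1

end Hecke

/-! ### Transformation of the weights under the normalizer and the torus -/

section Weights

variable {F : Type*} [Field F] [NumberField F] {α β Δ : F} {R : Subalgebra (𝓞 F) (Quat F α β)}
  {ι : QuadExt Δ →ₐ[F] Quat F α β} {l : F}

open Classical in
theorem ideleComp_awayIdele (f : Ideal (𝓞 F)) (x : (FinAdele F)ˣ) (v : FinPlace F) :
    ideleComp v (awayIdele f x) = if v.asIdeal ∣ f then 1 else ideleComp v x := by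
  refine Units.ext ?_
  change (if v.asIdeal ∣ f then 1 else (x : FinAdele F) v) = _
  split_ifs <;> rfl

theorem awayIdele_mul (f : Ideal (𝓞 F)) (x y : (FinAdele F)ˣ) :
    awayIdele f (x * y) = awayIdele f x * awayIdele f y := by
  refine idele_ext fun v => ?_
  rw [map_mul, ideleComp_awayIdele, ideleComp_awayIdele, ideleComp_awayIdele]
  split_ifs
  · rw [one_mul]
  · rw [map_mul]

theorem delta_mul (y z : AdeleUnits α β) : delta l (y * z) = delta l y * delta l z := by
  rw [delta, map_mul, awayIdele_mul, map_mul]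
  rfl

theorem delta_mul_self (z : AdeleUnits α β) : delta l z * delta l z = 1 := Int.units_mul_self _

theorem delta_inv (z : AdeleUnits α β) : delta l z⁻¹ = delta l z := by
  have h : delta l z * delta l z⁻¹ * delta l z = delta l z := by
    rw [← delta_mul, ← delta_mul, mul_inv_cancel, one_mul]
  rw [mul_comm, ← mul_assoc, delta_mul_self, one_mul] at h
  exact h

theorem ideleComp_nrd (v : FinPlace F) (z : AdeleUnits α β) :
    ideleComp v (Units.map nrd z) = Units.map nrd (compUnit v z) :=
  Units.ext (nrd_comp v _).symm

theorem delta_scalarUnit (ζ : (FinAdele F)ˣ) : delta l (scalarUnit (α := α) (β := β) ζ) = 1 := by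
  have h : Units.map nrd (scalarUnit (α := α) (β := β) ζ) = ζ * ζ :=
    Units.ext ((nrd_algebraMap _).trans (sq _))
  rw [delta, h, awayIdele_mul, map_mul, Int.units_mul_self]

theorem valued_nrd_eq_one (hR : IsOrder R) {v : FinPlace F} {u : (Quat (v.adicCompletion F) α β)ˣ}
    (hu : u ∈ unitsOf (localRing v R)) :
    Valued.v ((Units.map nrd u : (v.adicCompletion F)ˣ) : v.adicCompletion F) = 1 := by
  have hO := isIntegralOrder_localRing hR v
  have h1 := hO.nrd_le _ (mem_unitsOf.1 hu).1
  have h2 := hO.nrd_le _ (mem_unitsOf.1 hu).2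
  have h3 : Valued.v (nrd (u : Quat (v.adicCompletion F) α β)) *
      Valued.v (nrd ((u⁻¹ : (Quat (v.adicCompletion F) α β)ˣ) : Quat (v.adicCompletion F) α β)) = 1 := by
    rw [← map_mul, ← map_mul, Units.mul_inv, map_one, map_one]
  change Valued.v (nrd (u : Quat (v.adicCompletion F) α β)) = 1
  refine le_antisymm h1 ?_
  rw [← h3]
  exact mul_le_of_le_one_right zero_le h2

theorem delta_hatUnits (hR : IsOrder R) (hl : l ≠ 0) {u : AdeleUnits α β} (hu : u ∈ hatUnits R) :
    delta l u = 1 := by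
  rw [delta]
  refine quadChar_eq_one hl (fun v => ?_) fun v hv => ?_
  · rw [ideleComp_awayIdele]
    split_ifs
    · rw [Units.val_one, map_one]
    · rw [ideleComp_nrd]
      exact valued_nrd_eq_one hR (mem_hatUnits.1 hu v)
  · rw [ideleComp_awayIdele, if_pos hv]

theorem finite_dvd_quadConductor (hl : l ≠ 0) :
    {v : FinPlace F | v.asIdeal ∣ quadConductor l}.Finite :=
  (finite_condExponent_ne_zero hl).subset fun v hv => (dvd_quadConductor_iff v hl).1 hv

theorem quadChar_eq_away_mul_prod (hl : l ≠ 0) (x : (FinAdele F)ˣ) :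
    quadChar l x = quadChar l (awayIdele (quadConductor l) x) *
      ∏ v ∈ (finite_dvd_quadConductor hl).toFinset, quadCharAt v l (ideleComp v x) := by
  classical
  simp only [quadCharAt]
  rw [← map_prod, ← map_mul]
  congr 1
  refine idele_ext fun v => ?_
  rw [map_mul, ideleComp_awayIdele, ideleComp_prod_localIdele]
  simp only [Set.Finite.mem_toFinset, Set.mem_ofPred_eq]
  split_ifs
  · rw [one_mul]
  · rw [mul_one]

theorem conj_mem_localLattice_iff {v : FinPlace F} {y : (Quat (v.adicCompletion F) α β)ˣ}
    (hy : Normalizes (localRing v R) y) (t : Quat (v.adicCompletion F) α β) :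
    t ∈ localLattice v R ↔
      ((y⁻¹ : (Quat (v.adicCompletion F) α β)ˣ) : Quat (v.adicCompletion F) α β) * t * y ∈
        localLattice v R := by
  have hc : ∀ c : v.adicCompletion F,
      ((y⁻¹ : (Quat (v.adicCompletion F) α β)ˣ) : Quat (v.adicCompletion F) α β) *
        algebraMap _ _ c * y = algebraMap _ _ c := fun c => by
    rw [← scalar_comm, mul_assoc, Units.inv_mul, mul_one]
  constructor
  · rintro ⟨r, hr, c, rfl⟩
    exact ⟨_, (hy r).1 hr, c, by rw [mul_add, add_mul, hc]⟩
  · rintro ⟨r, hr, c, h⟩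
    refine ⟨t - algebraMap _ _ c, (hy _).2 ?_, c, (sub_add_cancel _ _).symm⟩
    rw [mul_sub, sub_mul, hc, h, add_sub_cancel_right]
    exact hr

theorem conj_mem_adelicLattice_iff {y : AdeleUnits α β} (hy : y ∈ normalizerGroup R)
    (t : Quat (FinAdele F) α β) :
    ((y⁻¹ : AdeleUnits α β) : Quat (FinAdele F) α β) * t * y ∈ adelicLattice R ↔
      t ∈ adelicLattice R := by
  have hc : ∀ c : FinAdele F, ((y⁻¹ : AdeleUnits α β) : Quat (FinAdele F) α β) *
        algebraMap _ _ c * y = algebraMap _ _ c := fun c => by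
    rw [← scalar_comm, mul_assoc, Units.inv_mul, mul_one]
  constructor
  · rintro ⟨r, hr, c, h⟩
    refine ⟨t - algebraMap _ _ c, (hy _).2 ?_, c, (sub_add_cancel _ _).symm⟩
    rw [mul_sub, sub_mul, hc, h, add_sub_cancel_right]
    exact hr
  · rintro ⟨r, hr, c, rfl⟩
    exact ⟨_, (hy r).1 hr, c, by rw [mul_add, add_mul, hc]⟩

theorem comp_mem_localLattice {t : Quat (FinAdele F) α β} (ht : t ∈ adelicLattice R)
    (v : FinPlace F) : comp v t ∈ localLattice v R := by
  obtain ⟨r, hr, c, rfl⟩ := ht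
  refine ⟨comp v r, mem_hat.1 hr v, c v, ?_⟩
  rw [map_add]
  exact congrArg _ (baseChange_algebraMap _ _)

variable {w : ∀ v : FinPlace F, Quat (v.adicCompletion F) α β → ℤ}

theorem adelicWeight_of_mem (hl : l ≠ 0) {t : Quat (FinAdele F) α β} (ht : t ∈ adelicLattice R) :
    adelicWeight R l w t = ∏ v ∈ (finite_dvd_quadConductor hl).toFinset, w v (comp v t) := by
  rw [adelicWeight, if_pos ht, ← finprod_mem_coe_finset]
  refine finprod_congr fun v => ?_
  simp only [Finset.mem_coe, Set.Finite.mem_toFinset, Set.mem_ofPred_eq]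

theorem adelicWeight_conj (hl : l ≠ 0)
    (hw : ∀ v : FinPlace F, v.asIdeal ∣ quadConductor l → IsLocalWeight v R l (w v))
    {z : AdeleUnits α β} (hz : z ∈ normalizerGroup R) (t : Quat (FinAdele F) α β) :
    adelicWeight R l w (((z⁻¹ : AdeleUnits α β) : Quat (FinAdele F) α β) * t * z) =
      ((∏ v ∈ (finite_dvd_quadConductor hl).toFinset,
        quadCharAt v l (ideleComp v (Units.map nrd z)) : ℤˣ) : ℤ) * adelicWeight R l w t := by
  by_cases ht : t ∈ adelicLattice R
  · rw [adelicWeight_of_mem hl ht, adelicWeight_of_mem hl ((conj_mem_adelicLattice_iff hz t).2 ht),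
      Units.coe_prod, ← Finset.prod_mul_distrib]
    refine Finset.prod_congr rfl fun v hv => ?_
    rw [Set.Finite.mem_toFinset] at hv
    rw [ideleComp_nrd, ← (hw v hv).transp (comp v t) (comp_mem_localLattice ht v) (compUnit v z)
      (conj_mem_localLattice_iff (mem_normalizerGroup.1 hz v)), map_mul, map_mul]
    rfl
  · rw [adelicWeight, if_neg (mt (conj_mem_adelicLattice_iff hz t).1 ht), adelicWeight, if_neg ht,
      mul_zero]

/-- The prefactor contributes `χ^l(nrd z)`, and the local weights contribute the components of this
value at the places dividing the conductor of `l`. These cancel because they are signs, and what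
remains is the value away from the conductor, `δ^l(z)`. -/
theorem conjWeight_inv_mul (hl : l ≠ 0)
    (hw : ∀ v : FinPlace F, v.asIdeal ∣ quadConductor l → IsLocalWeight v R l (w v))
    {z : AdeleUnits α β} (hz : z ∈ normalizerGroup R) (x : AdeleUnits α β)
    (y : Quat (FinAdele F) α β) :
    conjWeight R l w (z⁻¹ * x) y = (delta l z : ℤ) * conjWeight R l w x y := by
  have e : ((z⁻¹ * x : AdeleUnits α β) : Quat (FinAdele F) α β) * y *
      (((z⁻¹ * x)⁻¹ : AdeleUnits α β) : Quat (FinAdele F) α β) =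
      ((z⁻¹ : AdeleUnits α β) : Quat (FinAdele F) α β) *
        (x * y * ((x⁻¹ : AdeleUnits α β) : Quat (FinAdele F) α β)) * z := by
    rw [mul_inv_rev, inv_inv, Units.val_mul, Units.val_mul]
    simp only [mul_assoc]
  rw [conjWeight, conjWeight, e, adelicWeight_conj hl hw hz, map_mul, map_mul, map_inv, map_inv,
    Int.units_inv_eq_self, delta]
  have h := quadChar_eq_away_mul_prod hl (Units.map nrd z)
  set p := ∏ v ∈ (finite_dvd_quadConductor hl).toFinset,
        quadCharAt v l (ideleComp v (Units.map nrd z))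
  rw [h]
  have hp : (p : ℤ) * (p : ℤ) = 1 := by rw [← Units.val_mul, Int.units_mul_self, Units.val_one]
  push_cast
  linear_combination ((quadChar l (awayIdele (quadConductor l) (Units.map nrd z)) : ℤˣ) : ℤ) *
    ((quadChar l (Units.map nrd x) : ℤˣ) : ℤ) *
    adelicWeight R l w (x * y * ((x⁻¹ : AdeleUnits α β) : Quat (FinAdele F) α β)) * hp

/-- Conjugation by `a` does not move `y`, so only the prefactor changes. -/
theorem conjWeight_mul_of_commute (x : AdeleUnits α β) {a : AdeleUnits α β}
    {y : Quat (FinAdele F) α β} (h : (a : Quat (FinAdele F) α β) * y = y * a) :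
    conjWeight R l w (x * a) y = (quadChar l (Units.map nrd a) : ℤ) * conjWeight R l w x y := by
  have e : ((x * a : AdeleUnits α β) : Quat (FinAdele F) α β) * y *
      (((x * a)⁻¹ : AdeleUnits α β) : Quat (FinAdele F) α β) =
      x * y * ((x⁻¹ : AdeleUnits α β) : Quat (FinAdele F) α β) := by
    rw [mul_inv_rev, Units.val_mul, Units.val_mul, mul_assoc (x : Quat (FinAdele F) α β), h,
      mul_assoc, mul_assoc, mul_assoc, Units.mul_inv_cancel_left]
  rw [conjWeight, conjWeight, e, map_mul, map_mul, Units.val_mul]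
  ring

theorem commute_toAdele_apply (hΔ : ¬ IsSquare Δ) {a : AdeleUnits α β} (ha : a ∈ hatK ι)
    (y : QuadExt Δ) :
    (a : Quat (FinAdele F) α β) * toAdele (ι y) = toAdele (ι y) * a := by
  rw [toAdele_apply_eq, mul_add, add_mul, scalar_comm, mul_smul_comm, smul_mul_assoc,
    (mem_hatK hΔ).1 ha]

variable {ξ : (FinAdele F)ˣ}

theorem idealWeight_inv_mul (hl : l ≠ 0)
    (hw : ∀ v : FinPlace F, v.asIdeal ∣ quadConductor l → IsLocalWeight v R l (w v))
    {z : AdeleUnits α β} (hz : z ∈ normalizerGroup R) (x : AdeleUnits α β)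
    (y : Quat (FinAdele F) α β) :
    idealWeight R l w ξ (z⁻¹ * x) y = (delta l z : ℤ) * idealWeight R l w ξ x y := by
  rw [idealWeight, idealWeight, conjWeight_inv_mul hl hw hz]
  ring

theorem idealWeight_mul_hatK (hΔ : ¬ IsSquare Δ) (x : AdeleUnits α β) {a : AdeleUnits α β}
    (ha : a ∈ hatK ι) (y : QuadExt Δ) :
    idealWeight R l w ξ (x * a) (toAdele (ι y)) =
      (quadChar l (Units.map nrd a) : ℤ) * idealWeight R l w ξ x (toAdele (ι y)) := by
  rw [idealWeight, idealWeight, conjWeight_mul_of_commute x (a := a)]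
  · ring
  · rw [mul_smul_comm, smul_mul_assoc, commute_toAdele_apply hΔ ha]

/-- Norms from a totally definite algebra are totally positive. -/
theorem quadChar_nrd_globalUnit [IsTotallyReal F] (hdef : ∀ τ : F →+* ℝ, τ α < 0 ∧ τ β < 0)
    (γ : (Quat F α β)ˣ) : quadChar l (Units.map nrd (globalUnit γ)) = 1 := by
  have e : Units.map nrd (globalUnit γ) =
      Units.map (algebraMap F (FinAdele F)).toMonoidHom (Units.map nrd γ) :=
    Units.ext (nrd_baseChange _ _)
  rw [e]
  exact quadChar_algebraMap l _ fun τ => nrd_pos_of_definite hdef γ.ne_zero τ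

theorem idealWeight_mul_globalK [IsTotallyReal F] (hdef : ∀ τ : F →+* ℝ, τ α < 0 ∧ τ β < 0)
    (hΔ : ¬ IsSquare Δ) (x : AdeleUnits α β) {κ : AdeleUnits α β}
    (hκ : κ ∈ globalK ι) (y : QuadExt Δ) :
    idealWeight R l w ξ (x * κ) (toAdele (ι y)) = idealWeight R l w ξ x (toAdele (ι y)) := by
  rw [idealWeight_mul_hatK hΔ x (globalK_le_hatK hΔ hκ)]
  obtain ⟨κ, rfl⟩ := hκ
  rw [MonoidHom.comp_apply, quadChar_nrd_globalUnit hdef, Units.val_one, one_mul]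

theorem idealWeight_hatUnits_mul (hR : IsOrder R) (hl : l ≠ 0)
    (hw : ∀ v : FinPlace F, v.asIdeal ∣ quadConductor l → IsLocalWeight v R l (w v))
    {u : AdeleUnits α β} (hu : u ∈ hatUnits R) (x : AdeleUnits α β)
    (y : Quat (FinAdele F) α β) :
    idealWeight R l w ξ (u * x) y = idealWeight R l w ξ x y := by
  have h := idealWeight_inv_mul (ξ := ξ) hl hw (inv_mem (hatUnits_le_normalizerGroup hu)) x y
  rw [inv_inv, delta_inv, delta_hatUnits hR hl hu, Units.val_one, one_mul] at h
  exact h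

end Weights

/-! ### Conjugation as an orthogonal transformation -/

section Conjugation

variable {F : Type*} [Field F] {α β : F}

/-- The basis `i, j, k` of the space of quaternions of trace zero. -/
def pureBasis (α β : F) : Fin 3 → Quat F α β := ![⟨0, 1, 0, 0⟩, ⟨0, 0, 1, 0⟩, ⟨0, 0, 0, 1⟩]

/-- The matrix of conjugation by `γ` on the space of quaternions of trace zero. -/
def conjMatrix (γ : (Quat F α β)ˣ) : Matrix (Fin 3) (Fin 3) F :=
  Matrix.of fun i j => coord ((γ : Quat F α β) * pureBasis α β j * ((γ⁻¹ : (Quat F α β)ˣ) : Quat F α β)) i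

theorem coord_add (x y : Quat F α β) : coord (x + y) = coord x + coord y := by
  funext i; fin_cases i <;> rfl

theorem coord_smul (c : F) (x : Quat F α β) : coord (c • x) = c • coord x := by
  funext i; fin_cases i <;> rfl

theorem coord_algebraMap (c : F) : coord (algebraMap F (Quat F α β) c) = 0 := by
  funext i; fin_cases i <;> rfl

theorem eq_add_sum_coord (y : Quat F α β) :
    y = algebraMap F _ y.re + ∑ j, coord y j • pureBasis α β j := by
  rw [Fin.sum_univ_three]
  refine QuaternionAlgebra.ext ?_ ?_ ?_ ?_ <;>
    simp [coord, pureBasis, QuaternionAlgebra.algebraMap_eq]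

theorem coord_sum {s : Finset (Fin 3)} (f : Fin 3 → Quat F α β) :
    coord (∑ j ∈ s, f j) = ∑ j ∈ s, coord (f j) := by
  classical
  induction s using Finset.induction_on with
  | empty => funext i; fin_cases i <;> rfl
  | insert a s ha ih => rw [Finset.sum_insert ha, Finset.sum_insert ha, coord_add, ih]

theorem coord_conj (γ : (Quat F α β)ˣ) (y : Quat F α β) (i : Fin 3) :
    coord ((γ : Quat F α β) * y * ((γ⁻¹ : (Quat F α β)ˣ) : Quat F α β)) i =
      ∑ j, conjMatrix γ i j * coord y j := by
  have e : (γ : Quat F α β) * y * ((γ⁻¹ : (Quat F α β)ˣ) : Quat F α β) = algebraMap F _ y.re +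
      ∑ j, coord y j • (γ * pureBasis α β j * ((γ⁻¹ : (Quat F α β)ˣ) : Quat F α β)) := by
    conv_lhs => rw [eq_add_sum_coord y]
    rw [mul_add, add_mul, ← scalar_comm, mul_assoc, Units.mul_inv, mul_one, Finset.mul_sum,
      Finset.sum_mul]
    simp only [mul_smul_comm, smul_mul_assoc]
  rw [e, coord_add, coord_algebraMap, zero_add, coord_sum, Finset.sum_apply]
  refine Finset.sum_congr rfl fun j _ => ?_
  rw [coord_smul, Pi.smul_apply, smul_eq_mul, mul_comm]
  rfl

/-- The coefficients of the form `trd(x²) / 2` on the space of quaternions of trace zero. -/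
def formCoeff (α β : F) : Fin 3 → F := ![α, β, -(α * β)]

theorem trd_mul_of_trd_eq_zero [CharZero F] {x y : Quat F α β} (hx : trd x = 0) :
    trd (x * y) = 2 * ∑ k, coord x k * (formCoeff α β k * coord y k) := by
  have hre : x.re = 0 := by
    have h : trd x = 2 * x.re := by simp [trd]; ring
    rw [h] at hx
    simpa using hx
  rw [trd_mul_eq, hre, Fin.sum_univ_three]
  simp [coord, formCoeff]
  ring

theorem trd_pureBasis (j : Fin 3) : trd (pureBasis α β j) = 0 := by
  fin_cases j <;> simp [pureBasis, trd]

theorem coord_pureBasis (i j : Fin 3) : coord (pureBasis α β j) i = if i = j then 1 else 0 := by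
  fin_cases i <;> fin_cases j <;> rfl

/-- Conjugation preserves the trace form on pure quaternions. -/
theorem conjMatrix_transpose_mul [CharZero F] (γ : (Quat F α β)ˣ) :
    (conjMatrix γ).transpose * (Matrix.diagonal (formCoeff α β) * conjMatrix γ) =
      Matrix.diagonal (formCoeff α β) := by
  refine Matrix.ext fun i j => ?_
  have h1 := trd_mul_of_trd_eq_zero
    (x := (γ : Quat F α β) * pureBasis α β i * ((γ⁻¹ : (Quat F α β)ˣ) : Quat F α β))
    (y := (γ : Quat F α β) * pureBasis α β j * ((γ⁻¹ : (Quat F α β)ˣ) : Quat F α β))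
    (by rw [trd_conj, trd_pureBasis])
  have h2 : (γ : Quat F α β) * pureBasis α β i * ((γ⁻¹ : (Quat F α β)ˣ) : Quat F α β) *
      (γ * pureBasis α β j * ((γ⁻¹ : (Quat F α β)ˣ) : Quat F α β)) =
      γ * (pureBasis α β i * pureBasis α β j) * ((γ⁻¹ : (Quat F α β)ˣ) : Quat F α β) := by
    simp only [mul_assoc, Units.inv_mul_cancel_left]
  rw [h2, trd_conj, trd_mul_of_trd_eq_zero (trd_pureBasis i)] at h1
  have h3 := mul_left_cancel₀ two_ne_zero h1
  rw [Matrix.mul_apply]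
  simp only [Matrix.diagonal_mul, Matrix.transpose_apply]
  refine h3.symm.trans ?_
  simp only [coord_pureBasis, Matrix.diagonal_apply]
  rcases eq_or_ne i j with rfl | h <;> simp_all [eq_comm]

/-- The orthogonality relation for the dual form, obtained by passing to the two-sided inverse. The
Laplacian has the coefficients of the dual form. -/
theorem conjMatrix_mul_transpose [CharZero F] (hα : α ≠ 0) (hβ : β ≠ 0) (γ : (Quat F α β)ˣ) (i j : Fin 3) :
    ∑ k, (formCoeff α β k)⁻¹ * (conjMatrix γ i k * conjMatrix γ j k) =
      if i = j then (formCoeff α β i)⁻¹ else 0 := by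
  have hd : ∀ k, formCoeff α β k ≠ 0 := by
    intro k
    fin_cases k
    · exact hα
    · exact hβ
    · exact neg_ne_zero.2 (mul_ne_zero hα hβ)
  have hdd : Matrix.diagonal (fun k => (formCoeff α β k)⁻¹) * Matrix.diagonal (formCoeff α β) = 1 := by
    rw [Matrix.diagonal_mul_diagonal, ← Matrix.diagonal_one]
    congr 1
    funext k
    exact inv_mul_cancel₀ (hd k)
  have h1 : (Matrix.diagonal (fun k => (formCoeff α β k)⁻¹) * (conjMatrix γ).transpose *
      Matrix.diagonal (formCoeff α β)) * conjMatrix γ = 1 := by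
    rw [Matrix.mul_assoc, Matrix.mul_assoc, conjMatrix_transpose_mul, hdd]
  have h2 := mul_eq_one_comm.1 h1
  have h3 : conjMatrix γ * (Matrix.diagonal (fun k => (formCoeff α β k)⁻¹) *
      (conjMatrix γ).transpose) = Matrix.diagonal (fun k => (formCoeff α β k)⁻¹) := by
    have h4 := congrArg (· * Matrix.diagonal (fun k => (formCoeff α β k)⁻¹)) h2
    have hdd' : Matrix.diagonal (formCoeff α β) * Matrix.diagonal (fun k => (formCoeff α β k)⁻¹) = 1 :=
      mul_eq_one_comm.1 hdd
    simpa only [Matrix.mul_assoc, hdd', Matrix.mul_one, Matrix.one_mul] using h4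
  have h5 := congrFun (congrFun h3 i) j
  rw [Matrix.mul_apply] at h5
  simp only [Matrix.diagonal_mul, Matrix.transpose_apply, Matrix.diagonal_apply] at h5
  rw [← h5]
  exact Finset.sum_congr rfl fun k _ => by ring

end Conjugation

/-! ### Invariance of the harmonic polynomials -/

section Substitution

variable {F : Type*} [Field F] {α β : F}

open MvPolynomial

/-- The substitution of the linear forms given by the rows of `M` for the variables. -/
def linSubst (M : Matrix (Fin 3) (Fin 3) F) :
    MvPolynomial ((F →+* ℝ) × Fin 3) ℂ →ₐ[ℂ] MvPolynomial ((F →+* ℝ) × Fin 3) ℂ :=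
  aeval fun s => ∑ j, C ((s.1 (M s.2 j) : ℝ) : ℂ) * X (s.1, j)

theorem linSubst_X (M : Matrix (Fin 3) (Fin 3) F) (s : (F →+* ℝ) × Fin 3) :
    linSubst M (X s) = ∑ j, C ((s.1 (M s.2 j) : ℝ) : ℂ) * X (s.1, j) := aeval_X _ _

theorem linSubst_C (M : Matrix (Fin 3) (Fin 3) F) (c : ℂ) : linSubst M (C c) = C c :=
  (linSubst M).commutes c

-- The chain rule, proved by induction on the polynomial.
open Classical in
theorem pderiv_linSubst (M : Matrix (Fin 3) (Fin 3) F) (τ : F →+* ℝ) (j : Fin 3)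
    (p : MvPolynomial ((F →+* ℝ) × Fin 3) ℂ) :
    pderiv (τ, j) (linSubst M p) = ∑ i, C ((τ (M i j) : ℝ) : ℂ) * linSubst M (pderiv (τ, i) p) := by
  induction p using MvPolynomial.induction_on with
  | C a => simp
  | add p q hp hq => simp only [map_add, hp, hq, mul_add, Finset.sum_add_distrib]
  | mul_X p s hp =>
    have h1 : pderiv (τ, j) (linSubst M (X s)) =
        if s.1 = τ then C ((τ (M s.2 j) : ℝ) : ℂ) else 0 := by
      rw [linSubst_X, map_sum]
      simp only [pderiv_C_mul, pderiv_X, Pi.single_apply, Prod.mk.injEq]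
      split_ifs with h
      · subst h
        simp
      · simp [Ne.symm h, eq_comm]
    have h2 : ∀ i, pderiv (τ, i) (X s : MvPolynomial ((F →+* ℝ) × Fin 3) ℂ) =
        if s.1 = τ then (if s.2 = i then 1 else 0) else 0 := by
      intro i
      rw [pderiv_X, Pi.single_apply]
      obtain ⟨σ, k⟩ := s
      simp only [Prod.mk.injEq]
      split_ifs <;> simp_all
    rw [map_mul, pderiv_mul, hp, h1]
    simp only [pderiv_mul, h2, map_add, map_mul, mul_add, Finset.sum_add_distrib, Finset.sum_mul]
    refine congrArg₂ (· + ·) (Finset.sum_congr rfl fun i _ => by ring) ?_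
    · split_ifs with h
      · simp only [apply_ite (linSubst M), map_one, map_zero, mul_ite, mul_one, mul_zero,
          Finset.sum_ite_eq, Finset.mem_univ, if_true]
        ring
      · simp

theorem laplacian_eq_sum (τ : F →+* ℝ) (p : MvPolynomial ((F →+* ℝ) × Fin 3) ℂ) :
    laplacian α β τ p = ∑ k, C ((τ (formCoeff α β k)⁻¹ : ℝ) : ℂ) * pderiv (τ, k) (pderiv (τ, k) p) := by
  rw [laplacian, Fin.sum_univ_three]
  simp only [formCoeff, C_mul', sub_eq_add_neg]
  congr 1
  · congr 1 <;> simp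
  · simp

/-- Two applications of the chain rule produce the sums evaluated in `conjMatrix_mul_transpose`; the
mixed derivatives drop out. -/
theorem laplacian_linSubst [CharZero F] (hα : α ≠ 0) (hβ : β ≠ 0) (γ : (Quat F α β)ˣ) (τ : F →+* ℝ)
    (p : MvPolynomial ((F →+* ℝ) × Fin 3) ℂ) :
    laplacian α β τ (linSubst (conjMatrix γ) p) = linSubst (conjMatrix γ) (laplacian α β τ p) := by
  rw [laplacian_eq_sum, laplacian_eq_sum, map_sum]
  simp only [pderiv_linSubst, map_sum, pderiv_C_mul, map_mul, linSubst_C]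
  have hrel : ∀ i j : Fin 3, ∑ k, (((τ (formCoeff α β k)⁻¹ : ℝ) : ℂ) *
      (((τ (conjMatrix γ i k) : ℝ) : ℂ) * ((τ (conjMatrix γ j k) : ℝ) : ℂ))) =
      if i = j then ((τ (formCoeff α β i)⁻¹ : ℝ) : ℂ) else 0 := by
    intro i j
    have h := congrArg (fun x : F => ((τ x : ℝ) : ℂ)) (conjMatrix_mul_transpose hα hβ γ i j)
    simp only [map_sum, map_mul, Complex.ofReal_sum, Complex.ofReal_mul] at h
    rw [h]
    split_ifs <;> simp
  have e1 : ∀ k, C ((τ (formCoeff α β k)⁻¹ : ℝ) : ℂ) * ∑ i, C ((τ (conjMatrix γ i k) : ℝ) : ℂ) *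
      ∑ j, C ((τ (conjMatrix γ j k) : ℝ) : ℂ) *
        linSubst (conjMatrix γ) (pderiv (τ, j) (pderiv (τ, i) p)) =
      ∑ i, ∑ j, C (((τ (formCoeff α β k)⁻¹ : ℝ) : ℂ) *
      (((τ (conjMatrix γ i k) : ℝ) : ℂ) * ((τ (conjMatrix γ j k) : ℝ) : ℂ))) *
        linSubst (conjMatrix γ) (pderiv (τ, j) (pderiv (τ, i) p)) := by
    intro k
    rw [Finset.mul_sum]
    refine Finset.sum_congr rfl fun i _ => ?_
    rw [Finset.mul_sum, Finset.mul_sum]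
    refine Finset.sum_congr rfl fun j _ => ?_
    rw [C_mul, C_mul]
    ring
  rw [Finset.sum_congr rfl fun k _ => e1 k, Finset.sum_comm]
  refine Finset.sum_congr rfl fun i _ => ?_
  rw [Finset.sum_comm]
  simp only [← Finset.sum_mul, ← map_sum, hrel]
  simp [apply_ite C, ite_mul]

open Classical in
theorem isWeightedHomogeneous_linSubst (M : Matrix (Fin 3) (Fin 3) F) {k : (F →+* ℝ) → ℕ}
    {p : MvPolynomial ((F →+* ℝ) × Fin 3) ℂ}
    (hp : IsWeightedHomogeneous
      (fun s : (F →+* ℝ) × Fin 3 => (Pi.single s.1 1 : (F →+* ℝ) → ℕ)) p k) :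
    IsWeightedHomogeneous
      (fun s : (F →+* ℝ) × Fin 3 => (Pi.single s.1 1 : (F →+* ℝ) → ℕ)) (linSubst M p) k := by
  set wt : (F →+* ℝ) × Fin 3 → ((F →+* ℝ) → ℕ) := fun s => Pi.single s.1 1
  have hX : ∀ s, IsWeightedHomogeneous wt (linSubst M (X s)) (wt s) := by
    intro s
    rw [linSubst_X]
    refine IsWeightedHomogeneous.sum _ _ _ fun j _ => ?_
    have := (isWeightedHomogeneous_C wt ((s.1 (M s.2 j) : ℝ) : ℂ)).mul
      (isWeightedHomogeneous_X ℂ wt (s.1, j))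
    rwa [zero_add] at this
  rw [linSubst, aeval_def, eval₂_eq]
  refine IsWeightedHomogeneous.sum _ _ _ fun d hd => ?_
  have h1 := IsWeightedHomogeneous.prod d.support
    (fun s => (linSubst M (X s)) ^ d s) (fun s => d s • wt s) fun s _ => (hX s).pow (d s)
  have h2 : ∑ s ∈ d.support, d s • wt s = k := by
    have := hp (mem_support_iff.1 hd)
    rwa [Finsupp.weight_apply, Finsupp.sum] at this
  rw [h2] at h1
  have h3 := (isWeightedHomogeneous_C wt (coeff d p)).mul h1
  rw [zero_add] at h3
  simp only [linSubst_X] at h3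
  exact h3

theorem evalPoly_linSubst (γ : (Quat F α β)ˣ) (p : MvPolynomial ((F →+* ℝ) × Fin 3) ℂ) :
    evalPoly α β (linSubst (conjMatrix γ) p) = act (evalPoly α β p) γ := by
  funext y
  change aeval (fun s : (F →+* ℝ) × Fin 3 => ((s.1 (coord y s.2) : ℝ) : ℂ))
    (linSubst (conjMatrix γ) p) = aeval (fun s : (F →+* ℝ) × Fin 3 =>
      ((s.1 (coord ((γ : Quat F α β) * y * ((γ⁻¹ : (Quat F α β)ˣ) : Quat F α β)) s.2) : ℝ) : ℂ)) p
  rw [← AlgHom.comp_apply]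
  congr 1
  refine MvPolynomial.algHom_ext fun s => ?_
  rw [AlgHom.comp_apply, linSubst_X, aeval_X, map_sum, coord_conj, map_sum, Complex.ofReal_sum]
  refine Finset.sum_congr rfl fun j _ => ?_
  rw [map_mul, aeval_X, map_mul, Complex.ofReal_mul]
  congr 1
  exact aeval_C _ _

theorem act_mem_harmonicForms [CharZero F] (hα : α ≠ 0) (hβ : β ≠ 0) {k : (F →+* ℝ) → ℕ}
    {P : Quat F α β → ℂ} (hP : P ∈ harmonicForms α β k) (γ : (Quat F α β)ˣ) :
    act P γ ∈ harmonicForms α β k := by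
  obtain ⟨p, hp, rfl⟩ := hP
  refine ⟨linSubst (conjMatrix γ) p, ⟨isWeightedHomogeneous_linSubst _ hp.1, fun τ => ?_⟩,
    evalPoly_linSubst γ p⟩
  rw [laplacian_linSubst hα hβ, hp.2 τ, map_zero]

end Substitution

/-! ### The action of `B^×` and the polynomial representing evaluation -/

section Action

variable {F : Type*} [Field F] [NumberField F] {α β : F}

theorem act_mul (P : Quat F α β → ℂ) (γ γ' : (Quat F α β)ˣ) :
    act P (γ * γ') = act (act P γ) γ' := by
  funext y
  simp only [act, mul_inv_rev, Units.val_mul, mul_assoc]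

theorem act_one (P : Quat F α β → ℂ) : act P 1 = P := by
  funext y
  simp [act]

/-- The action of `γ` as an automorphism of the additive group of functions. -/
def actEquiv (γ : (Quat F α β)ˣ) : (Quat F α β → ℂ) ≃+ (Quat F α β → ℂ) where
  toFun P := act P γ
  invFun P := act P γ⁻¹
  left_inv P := by beta_reduce; rw [← act_mul, mul_inv_cancel, act_one]
  right_inv P := by beta_reduce; rw [← act_mul, inv_mul_cancel, act_one]
  map_add' P Q := rfl

/-- Evaluation at `y` is invariant under `γ`, and so is the inner product. Hence the translate
represents the same functional, and the representing vector is unique. -/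
theorem act_eq_self_of_commute {k : (F →+* ℝ) → ℕ} (hα : α ≠ 0) (hβ : β ≠ 0)
    {ip : InnerProductSpace.Core ℂ (harmonicForms α β k)} (hip : IsInvariantInner ip) (c : ℂ)
    {y : Quat F α β} {γ : (Quat F α β)ˣ} (hγ : (γ : Quat F α β) * y = y * γ) :
    act (rieszPoly ip c y) γ = rieszPoly ip c y := by
  rw [rieszPoly]
  split_ifs with h
  swap
  · rfl
  set Q := h.choose
  have hQ : ∀ P : harmonicForms α β k, ip.inner Q P = c * (P : Quat F α β → ℂ) y := h.choose_spec
  let Q' : harmonicForms α β k := ⟨act Q γ, act_mem_harmonicForms hα hβ Q.2 γ⟩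
  have hQ' : ∀ P : harmonicForms α β k, ip.inner Q' P = c * (P : Quat F α β → ℂ) y := by
    intro P
    let P' : harmonicForms α β k := ⟨act P γ⁻¹, act_mem_harmonicForms hα hβ P.2 γ⁻¹⟩
    rw [hip γ Q P' Q' P rfl (by
      change _ = act (act _ _) _
      rw [← act_mul, inv_mul_cancel, act_one]), hQ]
    change c * (P : Quat F α β → ℂ) _ = _
    congr 2
    rw [inv_inv, mul_assoc, ← hγ, Units.inv_mul_cancel_left]
  have h0 : Q' + (-1 : ℂ) • Q = 0 := by
    refine ip.definite _ ?_
    rw [ip.add_left, ip.smul_left, hQ, hQ']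
    simp
  have h1 : Q' = Q := by
    have h2 : Q' + -Q = 0 := by rwa [← neg_one_smul ℂ Q]
    exact add_neg_eq_zero.1 h2
  exact congrArg Subtype.val h1

theorem rieszPoly_mem {k : (F →+* ℝ) → ℕ} (ip : InnerProductSpace.Core ℂ (harmonicForms α β k))
    (c : ℂ) (y : Quat F α β) : rieszPoly ip c y ∈ harmonicForms α β k := by
  rw [rieszPoly]
  split_ifs with h
  · exact h.choose.2
  · exact zero_mem _

theorem rieszPoly_zero {k : (F →+* ℝ) → ℕ} (ip : InnerProductSpace.Core ℂ (harmonicForms α β k))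
    (y : Quat F α β) : rieszPoly ip 0 y = 0 := by
  rw [rieszPoly]
  split_ifs with h
  · have h1 := h.choose_spec h.choose
    rw [zero_mul] at h1
    exact congrArg Subtype.val (ip.definite _ h1)
  · rfl

end Action

/-! ### The forms `φ_{x,P}` -/

section MinimalForm

variable {F : Type*} [Field F] [NumberField F] {α β : F} {R : Subalgebra (𝓞 F) (Quat F α β)}

theorem baseUnits_comm {b : (Quat F α β)ˣ} (hb : b ∈ baseUnits α β) (γ : (Quat F α β)ˣ) :
    b * γ = γ * b := by
  obtain ⟨u, rfl⟩ := hb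
  exact Units.ext (Algebra.commutes (u : 𝓞 F) (γ : Quat F α β))

theorem act_baseUnits (P : Quat F α β → ℂ) {b : (Quat F α β)ˣ} (hb : b ∈ baseUnits α β) :
    act P b = P := by
  funext y
  obtain ⟨u, rfl⟩ := hb
  have h : algebraMap (𝓞 F) (Quat F α β) u * y = y * algebraMap (𝓞 F) (Quat F α β) u :=
    Algebra.commutes _ _
  change P (algebraMap (𝓞 F) (Quat F α β) u * y * _) = P y
  congr 1
  rw [h, mul_assoc]
  exact (congrArg (y * ·) (Units.mul_inv (Units.map (algebraMap (𝓞 F) (Quat F α β)).toMonoidHom u))).trans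
    (mul_one y)

/-- Units of `𝓞 F` are central and act trivially, so the summands of `minimalForm` do not depend on
the representatives of the cosets. -/
theorem act_out (P : Quat F α β → ℂ) (γ : (Quat F α β)ˣ) :
    act P (QuotientGroup.mk γ : (Quat F α β)ˣ ⧸ baseUnits α β).out = act P γ := by
  obtain ⟨b, hb⟩ := QuotientGroup.mk_out_eq_mul (baseUnits α β) γ
  rw [hb, act_mul, act_baseUnits _ b.2]

theorem globalUnit_mem_hatUnits {b : (Quat F α β)ˣ} (hb : b ∈ baseUnits α β) :
    globalUnit b ∈ hatUnits R := by
  obtain ⟨u, rfl⟩ := hb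
  refine (Submonoid.mem_units_iff _ _).2 ⟨toAdele_mem_hat (R.algebraMap_mem _), ?_⟩
  exact toAdele_mem_hat (x := algebraMap (𝓞 F) (Quat F α β) ((u⁻¹ : (𝓞 F)ˣ) : 𝓞 F))
    (R.algebraMap_mem _)

theorem globalUnit_baseUnits_comm {b : (Quat F α β)ˣ} (hb : b ∈ baseUnits α β)
    (x : AdeleUnits α β) : globalUnit b * x = x * globalUnit b := by
  obtain ⟨u, rfl⟩ := hb
  refine Units.ext ?_
  have e : toAdele (algebraMap (𝓞 F) (Quat F α β) u) =
      algebraMap (FinAdele F) (Quat (FinAdele F) α β) (algebraMap F _ ((u : 𝓞 F) : F)) :=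
    baseChange_algebraMap _ _
  change toAdele (algebraMap (𝓞 F) (Quat F α β) u) * (x : Quat (FinAdele F) α β) =
    (x : Quat (FinAdele F) α β) * toAdele (algebraMap (𝓞 F) (Quat F α β) u)
  rw [e, scalar_comm]

theorem mk_mem_Gam {x y : AdeleUnits α β} {γ : (Quat F α β)ˣ} :
    (QuotientGroup.mk γ : (Quat F α β)ˣ ⧸ baseUnits α β) ∈ Gam R x y ↔
      x * globalUnit γ * y⁻¹ ∈ hatUnits R := by
  constructor
  · rintro ⟨γ', hγ', e⟩
    have hb := QuotientGroup.eq.1 e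
    have e1 : γ = γ' * (γ'⁻¹ * γ) := by group
    rw [e1, map_mul, ← globalUnit_baseUnits_comm hb, ← mul_assoc, ← globalUnit_baseUnits_comm hb,
      mul_assoc, mul_assoc, ← mul_assoc x]
    exact mul_mem (globalUnit_mem_hatUnits hb) hγ'
  · intro h
    exact ⟨γ, h, rfl⟩

theorem out_mem_Gam {x y : AdeleUnits α β} {q : (Quat F α β)ˣ ⧸ baseUnits α β} :
    q ∈ Gam R x y ↔ x * globalUnit q.out * y⁻¹ ∈ hatUnits R := by
  rw [← mk_mem_Gam, QuotientGroup.out_eq']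

theorem conj_mem_hatUnits {z : AdeleUnits α β} (hz : z ∈ normalizerGroup R) {u : AdeleUnits α β} :
    z * u * z⁻¹ ∈ hatUnits R ↔ u ∈ hatUnits R := by
  have key : ∀ z ∈ normalizerGroup R, ∀ u ∈ hatUnits R, z * u * z⁻¹ ∈ hatUnits R := by
    intro z hz u hu
    rw [mem_hatUnits] at hu ⊢
    intro v
    rw [map_mul, map_mul, map_inv]
    have h := mem_normalizerGroup.1 (inv_mem hz) v
    have h1 := mem_unitsOf.1 (hu v)
    rw [mem_unitsOf]
    have ha := (h _).1 h1.1
    have hb := (h _).1 h1.2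
    rw [map_inv, inv_inv] at ha hb
    refine ⟨ha, ?_⟩
    rw [mul_inv_rev, mul_inv_rev, inv_inv, ← mul_assoc]
    exact hb
  refine ⟨fun h => ?_, key z hz u⟩
  have := key _ (inv_mem hz) _ h
  rwa [inv_inv, show z⁻¹ * (z * u * z⁻¹) * z = u by group] at this

/-- Conjugation by `z⁻¹` preserves `R̂^×` and turns `x γ (z y)⁻¹` into `z⁻¹ x γ y⁻¹`. -/
theorem translateForm_minimalForm {z : AdeleUnits α β} (hz : z ∈ normalizerGroup R)
    (x : AdeleUnits α β) (P : Quat F α β → ℂ) :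
    translateForm (minimalForm R x P) z = minimalForm R (z⁻¹ * x) P := by
  funext y
  change minimalForm R x P (z * y) = _
  have e : Gam R x (z * y) = Gam R (z⁻¹ * x) y := by
    ext q
    rw [out_mem_Gam, out_mem_Gam, ← conj_mem_hatUnits (inv_mem hz)]
    rw [show z⁻¹ * (x * globalUnit q.out * (z * y)⁻¹) * z⁻¹⁻¹ =
      z⁻¹ * x * globalUnit q.out * y⁻¹ by group]
  rw [minimalForm, minimalForm, e]

theorem minimalForm_hatUnits_mul {u : AdeleUnits α β} (hu : u ∈ hatUnits R) (x : AdeleUnits α β)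
    (P : Quat F α β → ℂ) : minimalForm R (u * x) P = minimalForm R x P := by
  funext y
  have e : Gam R (u * x) y = Gam R x y := by
    ext q
    rw [out_mem_Gam, out_mem_Gam, mul_assoc, mul_assoc, ← mul_assoc x]
    exact Subgroup.mul_mem_cancel_left _ hu
  rw [minimalForm, minimalForm, e]

theorem minimalForm_apply_hatUnits_mul {u : AdeleUnits α β} (hu : u ∈ hatUnits R)
    (x : AdeleUnits α β) (P : Quat F α β → ℂ) (y : AdeleUnits α β) :
    minimalForm R x P (u * y) = minimalForm R x P y := by
  have e : Gam R x (u * y) = Gam R x y := by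
    ext q
    rw [out_mem_Gam, out_mem_Gam, mul_inv_rev, ← mul_assoc]
    exact Subgroup.mul_mem_cancel_right _ (inv_mem hu)
  rw [minimalForm, minimalForm, e]

/-- Reindexing the sum by `γ ↦ κ γ`. For `κ` in `K^×` this makes the form attached to a special
point well defined on its class. -/
theorem minimalForm_mul_globalUnit (x : AdeleUnits α β) {κ : (Quat F α β)ˣ} {P : Quat F α β → ℂ}
    (hP : act P κ = P) : minimalForm R (x * globalUnit κ) P = minimalForm R x P := by
  funext y
  rw [minimalForm, minimalForm]
  refine finsum_mem_eq_of_bijOn (fun q => κ • q) ⟨?_, (MulAction.injective κ).injOn, ?_⟩ ?_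
  · intro q hq
    obtain ⟨γ, rfl⟩ := QuotientGroup.mk_surjective q
    change (QuotientGroup.mk (κ * γ) : (Quat F α β)ˣ ⧸ baseUnits α β) ∈ _
    rw [mk_mem_Gam] at hq ⊢
    rwa [map_mul, ← mul_assoc]
  · intro q hq
    obtain ⟨γ, rfl⟩ := QuotientGroup.mk_surjective q
    refine ⟨QuotientGroup.mk (κ⁻¹ * γ), ?_, ?_⟩
    · rw [mk_mem_Gam] at hq ⊢
      rwa [mul_assoc x, ← map_mul, mul_inv_cancel_left]
    · change (QuotientGroup.mk (κ * (κ⁻¹ * γ)) : (Quat F α β)ˣ ⧸ baseUnits α β) = _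
      rw [mul_inv_cancel_left]
  · intro q _
    obtain ⟨γ, rfl⟩ := QuotientGroup.mk_surjective q
    change act P _ = act P (QuotientGroup.mk (κ * γ) : (Quat F α β)ˣ ⧸ baseUnits α β).out
    rw [act_out, act_out, act_mul, hP]

/-- Reindexing by `γ ↦ γ γ₀`, which passes to cosets because the units of `𝓞 F` are central. -/
theorem minimalForm_apply_mul_globalUnit (x : AdeleUnits α β) (P : Quat F α β → ℂ)
    (y : AdeleUnits α β) (γ₀ : (Quat F α β)ˣ) :
    minimalForm R x P (y * globalUnit γ₀) = act (minimalForm R x P y) γ₀ := by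
  rw [minimalForm, minimalForm]
  have h1 : act (∑ᶠ q ∈ Gam R x y, act P q.out) γ₀ =
      ∑ᶠ q ∈ Gam R x y, act (act P q.out) γ₀ := by
    change (actEquiv γ₀) _ = _
    rw [AddEquiv.map_finsum]
    refine finsum_congr fun q => ?_
    rw [AddEquiv.map_finsum]
    rfl
  rw [h1]
  have hmk : ∀ γ δ : (Quat F α β)ˣ,
      (QuotientGroup.mk ((QuotientGroup.mk γ : (Quat F α β)ˣ ⧸ baseUnits α β).out * δ) :
        (Quat F α β)ˣ ⧸ baseUnits α β) = QuotientGroup.mk (γ * δ) := by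
    intro γ δ
    obtain ⟨b, hb⟩ := QuotientGroup.mk_out_eq_mul (baseUnits α β) γ
    rw [hb, mul_assoc, baseUnits_comm b.2, ← mul_assoc]
    exact QuotientGroup.mk_mul_of_mem _ b.2
  symm
  refine finsum_mem_eq_of_bijOn (fun q => QuotientGroup.mk (q.out * γ₀)) ⟨?_, ?_, ?_⟩ ?_
  · intro q hq
    rw [out_mem_Gam] at hq
    beta_reduce
    rw [mk_mem_Gam, map_mul]
    rwa [show x * (globalUnit q.out * globalUnit γ₀) * (y * globalUnit γ₀)⁻¹ =
      x * globalUnit q.out * y⁻¹ by group]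
  · refine Function.Injective.injOn (Function.LeftInverse.injective
      (g := fun q => QuotientGroup.mk (q.out * γ₀⁻¹)) fun q => ?_)
    beta_reduce
    rw [hmk, mul_inv_cancel_right, QuotientGroup.out_eq']
  · intro q hq
    obtain ⟨γ, rfl⟩ := QuotientGroup.mk_surjective q
    refine ⟨QuotientGroup.mk (γ * γ₀⁻¹), ?_, ?_⟩
    · rw [mk_mem_Gam] at hq ⊢
      rw [map_mul, map_inv]
      rwa [show x * (globalUnit γ * (globalUnit γ₀)⁻¹) * y⁻¹ =
        x * globalUnit γ * (y * globalUnit γ₀)⁻¹ by group]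
    · beta_reduce
      rw [hmk, inv_mul_cancel_right]
  · intro q _
    rw [act_out, act_mul]

theorem minimalForm_apply_mem (hα : α ≠ 0) (hβ : β ≠ 0) {k : (F →+* ℝ) → ℕ}
    {P : Quat F α β → ℂ} (hP : P ∈ harmonicForms α β k) (x y : AdeleUnits α β) :
    minimalForm R x P y ∈ harmonicForms α β k :=
  finsum_mem_induction (· ∈ harmonicForms α β k) (zero_mem _) (fun _ _ => add_mem)
    fun q _ => act_mem_harmonicForms hα hβ hP q.out

theorem minimalForm_mem_modularForms (hα : α ≠ 0) (hβ : β ≠ 0) {k : (F →+* ℝ) → ℕ}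
    {P : Quat F α β → ℂ} (hP : P ∈ harmonicForms α β k) (x : AdeleUnits α β) :
    minimalForm R x P ∈ modularForms R k :=
  ⟨minimalForm_apply_mem hα hβ hP x, fun u hu y γ => by
    rw [mul_assoc, minimalForm_apply_hatUnits_mul hu, minimalForm_apply_mul_globalUnit]⟩

theorem minimalForm_zero (x : AdeleUnits α β) : minimalForm R x 0 = 0 := by
  funext y
  rw [minimalForm]
  exact finsum_mem_eq_zero_of_forall_eq_zero fun q _ => rfl

end MinimalForm

/-! ### The terms of `η` along the parametrization of the special points -/

section Forms

variable {F : Type*} [Field F] [NumberField F] {α β Δ : F} {R : Subalgebra (𝓞 F) (Quat F α β)}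
  {ι : QuadExt Δ →ₐ[F] Quat F α β} {S : Set (QuadExt Δ)}

theorem isTorusConfiguration (hR : IsOrder R) (hΔ : ¬ IsSquare Δ)
    (hι : ∀ x ∈ integralClosure (𝓞 F) (QuadExt Δ), ι x ∈ R) (hA : IsLocallyAdmissible R ι S) :
    IsTorusConfiguration (hatUnits R) (normalizerGroup R) (hatK ι) (hatOK ι) (globalK ι)
      (scalarUnit (α := α) (β := β)).range where
  central := by
    rintro _ ⟨ζ, rfl⟩ x
    exact scalarUnit_comm ζ x
  Z_le_N := by
    rintro _ ⟨ζ, rfl⟩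
    exact scalarUnit_mem_normalizerGroup ζ
  Z_le_T := by
    rintro _ ⟨ζ, rfl⟩
    exact scalarUnit_mem_hatK hΔ ζ
  U_le_N := hatUnits_le_normalizerGroup
  conj_mem _ hn _ hu := (conj_mem_hatUnits hn).2 hu
  K_le_T := globalK_le_hatK hΔ
  T₀_eq := hatOK_eq hΔ hι hA
  exists_eq x hx hx' := by
    obtain ⟨ζ, u, hu, e⟩ := exists_scalarUnit_mul_of_mem_hatK hΔ hR hA hx hx'
    exact ⟨_, ⟨ζ, rfl⟩, u, hu, e⟩

theorem specialPoints_eq (hΔ : ¬ IsSquare Δ) (hR : IsOrder R)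
    (hι : ∀ x ∈ integralClosure (𝓞 F) (QuadExt Δ), ι x ∈ R)
    {𝔠 : FractionalIdeal (𝓞 F)⁰ F} {ω : QuadExt Δ}
    (hS : ∀ y ∈ quadLattice 𝔠 ω, y ∈ integralClosure (𝓞 F) (QuadExt Δ))
    (hA : IsLocallyAdmissible R ι (quadLattice 𝔠 ω)) :
    specialPoints R ι 𝔠 ω = IsTorusConfiguration.points (hatUnits R) (normalizerGroup R) (hatK ι)
      (globalK ι) := by
  have e : {x | ∀ y ∈ quadLattice 𝔠 ω, ι y ∈ conjOrder R x} =
      {x | ∃ z ∈ normalizerGroup R, ∃ a ∈ hatK ι, x = z * a} :=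
    Set.ext fun x => forall_mem_conjOrder_iff hΔ hR hι hS hA
  rw [specialPoints, e]
  rfl

theorem comap_conjOrder_mul (hΔ : ¬ IsSquare Δ) {z : AdeleUnits α β} (hz : z ∈ normalizerGroup R)
    (x : AdeleUnits α β) {a : AdeleUnits α β} (ha : a ∈ hatK ι) :
    (conjOrder R (z * x * a)).comap ι.toRingHom = (conjOrder R x).comap ι.toRingHom := by
  ext y
  change ι y ∈ conjOrder R (z * x * a) ↔ ι y ∈ conjOrder R x
  rw [conjOrder_mul_hatK hΔ _ ha, conjOrder_mul hz]

theorem unitIndex_mul (hΔ : ¬ IsSquare Δ) {z : AdeleUnits α β} (hz : z ∈ normalizerGroup R)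
    (x : AdeleUnits α β) {a : AdeleUnits α β} (ha : a ∈ hatK ι) :
    unitIndex R ι (z * x * a) = unitIndex R ι x := by
  rw [unitIndex, unitIndex, comap_conjOrder_mul hΔ hz x ha]

/-- The order `R ∩ K` is the maximal order. With `unitIndex_mul` it follows that all special points
have the same unit index `t_K`. -/
theorem unitIndex_one (hR : IsOrder R) (hΔ : ¬ IsSquare Δ)
    (hι : ∀ x ∈ integralClosure (𝓞 F) (QuadExt Δ), ι x ∈ R) : unitIndex R ι 1 = tK Δ := by
  let O := integralClosure (𝓞 F) (QuadExt Δ)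
  have hmem : ∀ y : QuadExt Δ, y ∈ (conjOrder R (1 : AdeleUnits α β)).comap ι.toRingHom ↔ y ∈ O := by
    intro y
    have h1 : y ∈ (conjOrder R (1 : AdeleUnits α β)).comap ι.toRingHom ↔
        toAdele (ι y) ∈ hat (R : Set (Quat F α β)) := by
      change (1 : Quat (FinAdele F) α β) * toAdele (ι y) * ((1⁻¹ : AdeleUnits α β) :
        Quat (FinAdele F) α β) ∈ hat (R : Set (Quat F α β)) ↔ _
      rw [inv_one, Units.val_one, one_mul, mul_one]
    rw [h1]
    exact ⟨fun h => isIntegral_of_toAdele_mem_hat hR hΔ h, fun h => toAdele_mem_hat (hι y h)⟩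
  let f : Oˣ →* (QuadExt Δ)ˣ := Units.map (O.val : O →+* QuadExt Δ).toMonoidHom
  have hf : Function.Injective f := Units.map_injective Subtype.val_injective
  have e1 : ((conjOrder R (1 : AdeleUnits α β)).comap ι.toRingHom).toSubmonoid.units =
      (⊤ : Subgroup Oˣ).map f := by
    ext u
    rw [Submonoid.mem_units_iff]
    constructor
    · rintro ⟨h1, h2⟩
      exact ⟨⟨⟨u, (hmem _).1 h1⟩, ⟨((u⁻¹ : (QuadExt Δ)ˣ) : QuadExt Δ), (hmem _).1 h2⟩,
        Subtype.ext (Units.mul_inv u), Subtype.ext (Units.inv_mul u)⟩, trivial, Units.ext rfl⟩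
    · rintro ⟨u, -, rfl⟩
      exact ⟨(hmem _).2 (u : O).2, (hmem _).2 ((u⁻¹ : Oˣ) : O).2⟩
  have e2 : (Units.map (algebraMap (𝓞 F) (QuadExt Δ)).toMonoidHom).range =
      (Units.map (algebraMap (𝓞 F) O).toMonoidHom).range.map f := by
    rw [MonoidHom.map_range]
    rfl
  rw [unitIndex, e1, e2, Subgroup.relIndex_map_map_of_injective _ _ hf, Subgroup.relIndex_top_right]
  rfl

theorem translateForm_smul (c : ℂ) (φ : AdeleUnits α β → Quat F α β → ℂ) (z : AdeleUnits α β) :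
    translateForm (c • φ) z = c • translateForm φ z := rfl

theorem translateForm_finsum_mem {T : Type*} {s : Set T} (hs : s.Finite)
    (f : T → AdeleUnits α β → Quat F α β → ℂ) (z : AdeleUnits α β) :
    translateForm (∑ᶠ i ∈ s, f i) z = ∑ᶠ i ∈ s, translateForm (f i) z :=
  AddMonoidHom.map_finsum_mem (f := f)
    (LinearMap.funLeft ℂ (Quat F α β → ℂ) (fun x => z * x)).toAddMonoidHom hs

variable [IsTotallyReal F] (hdef : ∀ τ : F →+* ℝ, τ α < 0 ∧ τ β < 0) {l : F} (hl : l ≠ 0)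
  (hR : IsOrder R) (hΔ : ¬ IsSquare Δ)
  (hι : ∀ x ∈ integralClosure (𝓞 F) (QuadExt Δ), ι x ∈ R)
  {w : ∀ v : FinPlace F, Quat (v.adicCompletion F) α β → ℤ}
  (hw : ∀ v : FinPlace F, v.asIdeal ∣ quadConductor l → IsLocalWeight v R l (w v))
  {ξ : (FinAdele F)ˣ} {ω : QuadExt Δ} {P : Quat F α β → ℂ}
  (hP : ∀ κ : (Quat F α β)ˣ, (κ : Quat F α β) * ι ω = ι ω * κ → act P κ = P)

variable (R ι l w ξ ω P) in
/-- The term of the form `eta` attached to `x`. -/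
def etaTerm (x : AdeleUnits α β) : AdeleUnits α β → Quat F α β → ℂ :=
  ((idealWeight R l w ξ x (toAdele (ι ω)) : ℂ) / (unitIndex R ι x : ℂ)) • minimalForm R x P

include hdef hl hR hΔ hw hP in
theorem etaTerm_mul_mul {u : AdeleUnits α β} (hu : u ∈ hatUnits R) {κ : AdeleUnits α β}
    (hκ : κ ∈ globalK ι) (x : AdeleUnits α β) :
    etaTerm R ι l w ξ ω P (u * x * κ) = etaTerm R ι l w ξ ω P x := by
  rw [etaTerm, etaTerm, idealWeight_mul_globalK hdef hΔ _ hκ, idealWeight_hatUnits_mul hR hl hw hu,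
    unitIndex_mul hΔ (hatUnits_le_normalizerGroup hu) x (globalK_le_hatK hΔ hκ)]
  obtain ⟨κ, rfl⟩ := hκ
  rw [MonoidHom.comp_apply, minimalForm_mul_globalUnit, minimalForm_hatUnits_mul hu]
  refine hP _ ?_
  change ι κ * ι ω = ι ω * ι κ
  rw [← map_mul, ← map_mul, mul_comm]

include hl hw in
theorem translateForm_etaTerm (hΔ : ¬ IsSquare Δ) {z : AdeleUnits α β} (hz : z ∈ normalizerGroup R)
    (x : AdeleUnits α β) : translateForm (etaTerm R ι l w ξ ω P x) z =
      ((delta l z : ℤ) : ℂ) • etaTerm R ι l w ξ ω P (z⁻¹ * x) := by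
  have h1 := unitIndex_mul (ι := ι) hΔ (inv_mem hz) x (hatK ι).one_mem
  rw [mul_one] at h1
  have h2 : ((delta l z : ℤ) : ℂ) * ((delta l z : ℤ) : ℂ) = 1 := by
    rw [← Int.cast_mul, ← Units.val_mul, delta_mul_self, Units.val_one, Int.cast_one]
  rw [etaTerm, etaTerm, translateForm_smul, translateForm_minimalForm hz, h1, smul_smul,
    idealWeight_inv_mul hl hw hz, Int.cast_mul, mul_div_assoc, ← mul_assoc, h2, one_mul]

-- The weight at `z⁻¹ a` is the weight at `1` times `δ(z)` and the genus character of `a`; the unit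
-- index is `t_K`, and the form is the translate by `z` of the one attached to `a`.
include hl hR hΔ hι hw in
theorem etaTerm_inv_mul {z a : AdeleUnits α β} (hz : z ∈ normalizerGroup R) (ha : a ∈ hatK ι) :
    etaTerm R ι l w ξ ω P (z⁻¹ * a) = (idealWeight R l w ξ 1 (toAdele (ι ω)) : ℂ) •
      (((delta l z : ℤ) : ℂ) • (tK Δ : ℂ)⁻¹ •
        translateForm (((quadChar l (Units.map nrd a) : ℤ) : ℂ) • minimalForm R a P) z) := by
  have h1 := unitIndex_mul (ι := ι) hΔ (inv_mem hz) 1 ha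
  rw [mul_one, unitIndex_one hR hΔ hι] at h1
  have h2 := idealWeight_mul_hatK (R := R) (l := l) (w := w) (ξ := ξ) hΔ 1 ha ω
  rw [one_mul] at h2
  rw [etaTerm, idealWeight_inv_mul hl hw hz, h1, h2, translateForm_smul,
    translateForm_minimalForm hz, smul_smul, smul_smul, smul_smul]
  congr 1
  push_cast
  ring

end Forms

/-! ### Sums over the points of a torus configuration -/

section TorusSums

variable {G : Type*} [Group G] {U N T T₀ K Z : Subgroup G}
  (h : IsTorusConfiguration U N T T₀ K Z) {M : Type*} [AddCommGroup M] [Module ℂ M] {f : G → M}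
  (hf : ∀ u ∈ U, ∀ κ ∈ K, ∀ x, f (u * x * κ) = f x)
  (hB : (DoubleCoset.mk U Z '' (N : Set G)).Finite)
  (hC : (DoubleCoset.mk T₀ K '' (T : Set G)).Finite)

include h hf hB hC in
theorem IsTorusConfiguration.smul_finsum_points {c : ℂ} {r : G → M}
    (hr : ∀ z ∈ N, c • ∑ᶠ p ∈ DoubleCoset.mk T₀ K '' (T : Set G), f (z⁻¹ * p.out) = r z) :
    c • ∑ᶠ q ∈ IsTorusConfiguration.points U N T K, f q.out =
      ∑ᶠ q ∈ DoubleCoset.mk U Z '' (N : Set G), r q.out := by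
  rw [h.finsum_points hf hB hC]
  refine (smul_finsum_mem hB).trans (finsum_mem_congr rfl fun q hq => ?_)
  exact hr _ (h.out_mem_N hq)

-- Termwise, `φ` multiplies by `d` and replaces `x` by `n⁻¹ x`; left multiplication by `n⁻¹`
-- permutes the points.
include h hf hB hC in
theorem IsTorusConfiguration.map_finsum_points (φ : M →ₗ[ℂ] M) {d : ℂ} {n : G} (hn : n ∈ N)
    (hφ : ∀ x, φ (f x) = d • f (n⁻¹ * x)) :
    φ (∑ᶠ q ∈ IsTorusConfiguration.points U N T K, f q.out) =
      d • ∑ᶠ q ∈ IsTorusConfiguration.points U N T K, f q.out := by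
  have hX := h.finite_points hB hC
  rw [← h.finsum_points_mul hf (inv_mem hn)]
  refine Eq.trans ?_ (smul_finsum_mem hX).symm
  rw [h.finsum_points_mul hf (inv_mem hn)]
  exact (AddMonoidHom.map_finsum_mem _ φ.toAddMonoidHom hX).trans
    (finsum_mem_congr rfl fun q _ => hφ _)

end TorusSums

/-! ### The inner sum over `Cl(K)` -/

section TorusForms

variable {F : Type*} [Field F] [NumberField F] [IsTotallyReal F] {α β Δ : F}
  {R : Subalgebra (𝓞 F) (Quat F α β)} {ι : QuadExt Δ →ₐ[F] Quat F α β}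
  (hR : IsOrder R) (hΔ : ¬ IsSquare Δ) {l : F} (hl : l ≠ 0)
  (hι : ∀ x ∈ integralClosure (𝓞 F) (QuadExt Δ), ι x ∈ R)
  {w : ∀ v : FinPlace F, Quat (v.adicCompletion F) α β → ℤ}
  (hw : ∀ v : FinPlace F, v.asIdeal ∣ quadConductor l → IsLocalWeight v R l (w v))
  {ξ : (FinAdele F)ˣ} {ω : QuadExt Δ} {P : Quat F α β → ℂ}

include hR hΔ hl hι hw in
theorem smul_finsum_etaTerm (hC : (ClK ι).Finite)
    (hconf : IsTorusConfiguration (hatUnits R) (normalizerGroup R) (hatK ι) (hatOK ι) (globalK ι)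
      (scalarUnit (α := α) (β := β)).range)
    (hw0 : (idealWeight R l w ξ 1 (toAdele (ι ω)) : ℂ) ≠ 0)
    {z : AdeleUnits α β} (hz : z ∈ normalizerGroup R) :
    (idealWeight R l w ξ 1 (toAdele (ι ω)) : ℂ)⁻¹ •
        ∑ᶠ p ∈ ClK ι, etaTerm R ι l w ξ ω P (z⁻¹ * p.out) =
      ((delta l z : ℤ) : ℂ) • translateForm (psi R ι l P) z := by
  have h1 : ∀ p ∈ ClK ι, etaTerm R ι l w ξ ω P (z⁻¹ * p.out) = _ := fun p hp =>
    etaTerm_inv_mul (P := P) (ξ := ξ) (ω := ω) hl hR hΔ hι hw hz (hconf.out_mem_T hp)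
  rw [finsum_mem_congr rfl h1, ← smul_finsum_mem hC, inv_smul_smul₀ hw0, ← smul_finsum_mem hC,
    ← smul_finsum_mem hC, ← translateForm_finsum_mem hC]
  rfl

end TorusForms

end QForms

end

theorem proposition5p3 {F : Type*} [Field F] [NumberField F] [IsTotallyReal F]
    (α β : F) (hdef : ∀ τ : F →+* ℝ, τ α < 0 ∧ τ β < 0)
    (R : Subalgebra (𝓞 F) (Quat F α β)) (hR : IsOrder R)
    (N : Ideal (𝓞 F)) (hN : N ^ 2 = discIdeal R)
    (hE : ∀ v : FinPlace F, v.asIdeal ∣ N → EichlerInvariantNeZero v R)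
    (l D : F) (hl : l ≠ 0) (hD : ∀ τ : F →+* ℝ, τ (l * D) < 0)
    (hcl : IsCoprime (quadConductor l) (Ideal.span {2} * differentIdeal ℤ (𝓞 F) * N))
    (hlD : IsCoprime (quadConductor l) (quadConductor D))
    (hΔN : IsCoprime (quadConductor (l * D)) N)
    (𝔞 𝔟 : FractionalIdeal (𝓞 F)⁰ F)
    (h𝔟 : IsFundamentalDiscriminant l 𝔟) (h𝔞 : IsFundamentalDiscriminant D 𝔞)
    (ι : QuadExt (l * D) →ₐ[F] Quat F α β)
    (hι : ∀ x ∈ integralClosure (𝓞 F) (QuadExt (l * D)), ι x ∈ R)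
    (ω : QuadExt (l * D)) (hω : GeneratesOrder (𝔞 * 𝔟) ω)
    (ξ : (FinAdele F)ˣ) (hξ : IdeleGenerates ξ (𝔞 * 𝔟))
    (w : ∀ v : FinPlace F, Quat (v.adicCompletion F) α β → ℤ)
    (hw : ∀ v : FinPlace F, v.asIdeal ∣ quadConductor l → IsLocalWeight v R l (w v))
    (k : (F →+* ℝ) → ℕ) (ip : InnerProductSpace.Core ℂ (harmonicForms α β k))
    (hip : IsInvariantInner ip) :
    (Bil R).Finite ∧ (ClK ι).Finite ∧ (specialPoints R ι (𝔞 * 𝔟) ω).Finite ∧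
    eta R ι l w (𝔞 * 𝔟) ξ ip ω =
      ∑ᶠ z ∈ Bil R, ((delta l z.out : ℤ) : ℂ) •
        translateForm (psi R ι l (PDelta R ι l w ξ ip ω)) z.out ∧
    eta R ι l w (𝔞 * 𝔟) ξ ip ω ∈ eigenForms R k (delta l) := by
  have hΔ := not_isSquare_of_neg hD
  obtain ⟨τ⟩ := nonempty_realEmbedding (F := F)
  have hα : α ≠ 0 := by
    rintro rfl
    simpa using (hdef τ).1
  have hβ : β ≠ 0 := by
    rintro rfl
    simpa using (hdef τ).2
  have hA : IsLocallyAdmissible R ι (quadLattice (𝔞 * 𝔟) ω) := fun v =>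
    exists_isAdmissible hdef hR hN hl hD hlD hΔN h𝔟 h𝔞 hι hω v
  obtain ⟨S, hS⟩ := hω.2
  have hS' : ∀ y ∈ quadLattice (𝔞 * 𝔟) ω, y ∈ integralClosure (𝓞 F) (QuadExt (l * D)) :=
    fun y hy => isIntegral_of_mem_quadLattice hS hy
  have hconf := isTorusConfiguration hR hΔ hι hA
  have hB : (Bil R).Finite := finite_Bil hR hα hβ hN hA
  have hC : (ClK ι).Finite := finite_ClK hR hΔ hι hA
  have hX := specialPoints_eq hΔ hR hι hS' hA
  have hXfin : (specialPoints R ι (𝔞 * 𝔟) ω).Finite := by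
    rw [hX]
    exact hconf.finite_points hB hC
  set P := PDelta R ι l w ξ ip ω with hPdef
  have hPV : P ∈ harmonicForms α β k := rieszPoly_mem ip _ _
  have hP : ∀ κ : (Quat F α β)ˣ, (κ : Quat F α β) * ι ω = ι ω * κ → act P κ = P :=
    fun κ hκ => act_eq_self_of_commute hα hβ hip _ hκ
  have heta : eta R ι l w (𝔞 * 𝔟) ξ ip ω = (idealWeight R l w ξ 1 (toAdele (ι ω)) : ℂ)⁻¹ •
      ∑ᶠ q ∈ IsTorusConfiguration.points (hatUnits R) (normalizerGroup R) (hatK ι) (globalK ι),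
        etaTerm R ι l w ξ ω P q.out := by
    rw [← hX]
    rfl
  have hinv : ∀ u ∈ hatUnits R, ∀ κ ∈ globalK ι, ∀ x,
      etaTerm R ι l w ξ ω P (u * x * κ) = etaTerm R ι l w ξ ω P x :=
    fun u hu κ hκ x => etaTerm_mul_mul hdef hl hR hΔ hw hP hu hκ x
  refine ⟨hB, hC, hXfin, ?_, ?_⟩
  -- If the weight at `ω` vanishes, its inverse is `0` by convention and `P` represents the zero
  -- functional, so both sides are zero. Otherwise the division is a true one.
  · by_cases hw0 : idealWeight R l w ξ 1 (toAdele (ι ω)) = 0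
    · have hP0 : P = 0 := by
        rw [hPdef, PDelta, hw0, Int.cast_zero, rieszPoly_zero]
      have hpsi : psi R ι l P = 0 := by
        rw [psi, hP0]
        simp only [minimalForm_zero, smul_zero, finsum_zero]
      rw [heta, hw0, Int.cast_zero, inv_zero, zero_smul, hpsi]
      symm
      refine finsum_mem_eq_zero_of_forall_eq_zero fun z _ => ?_
      exact smul_zero _
    · have hw0' : (idealWeight R l w ξ 1 (toAdele (ι ω)) : ℂ) ≠ 0 := by exact_mod_cast hw0
      rw [heta]
      exact hconf.smul_finsum_points hinv hB hC
        (r := fun z => ((delta l z : ℤ) : ℂ) • translateForm (psi R ι l P) z)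
        fun z hz => smul_finsum_etaTerm hR hΔ hl hι hw hC hconf hw0' hz
  · have hmod : eta R ι l w (𝔞 * 𝔟) ξ ip ω ∈ modularForms R k := by
      rw [heta]
      refine Submodule.smul_mem _ _ ?_
      exact finsum_mem_induction (· ∈ modularForms R k) (zero_mem _) (fun _ _ => add_mem)
        fun q _ => Submodule.smul_mem _ _ (minimalForm_mem_modularForms hα hβ hPV q.out)
    have heig : ∀ z ∈ normalizerGroup R, translateForm (eta R ι l w (𝔞 * 𝔟) ξ ip ω) z =
        ((delta l z : ℤ) : ℂ) • eta R ι l w (𝔞 * 𝔟) ξ ip ω := by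
      intro z hz
      rw [heta, translateForm_smul, smul_comm]
      congr 1
      exact hconf.map_finsum_points hinv hB hC
        (LinearMap.funLeft ℂ (Quat F α β → ℂ) (fun x => z * x)) hz
        (translateForm_etaTerm hl hw hΔ hz)
    refine ⟨⟨hmod, fun ζ => ?_⟩, heig⟩
    -- Invariance under scalars is a case of the eigenvalue property: the norm of `ζ` is `ζ²`, so
    -- `δ` is `1` there.
    rw [heig _ (scalarUnit_mem_normalizerGroup ζ), delta_scalarUnit, Units.val_one, Int.cast_one,
      one_smul]
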